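/- **Conventions.** Let $A=(a_{ij})_{i,j\in I}$ be a simply-laced generalized Cartan matrix: $a_{ii}=2$, $a_{ij}=a_{ji}\in\{0,-1\}$ for $i\neq j$. Let $\hbar$ be a formal variable and $q=e^{\hbar}$. A $\mathbb C[[\hbar]]$-module is topologically free if it has the form $V_0[[\hbar]]$ (equivalently, if it is torsion-free, separated and $\hbar$-adically complete). For a topologically free $W$, $\mathcal E_\hbar(W)$ is the set of $\sum_{n}a_nx^{n}\in(\mathrm{End}_{\mathbb C[[\hbar]]}W)[[x,x^{-1}]]$ with $\lim_{n\to\infty}a_{-n}w=0$ $\hbar$-adically for all $w\in W$. A rational function of $z-w$, $\hbar$ and a central $\kappa$ is expanded in nonnegative powers of $\hbar$ and of $w$, one of $w-z$ in nonnegative powers of $\hbar$ and of $z$; $z^{-1}\delta\!\left(\frac{w+c\hbar}{z}\right)=\sum_{n\in\mathbb Z}z^{-n-1}(w+c\hbar)^n$, expanded in nonnegative powers of $\hbar$. Put $[c]_{q^{t}}=\frac{q^{ct}-q^{-ct}}{q^{t}-q^{-t}}$, $G(t)=\frac{q^{t}-q^{-t}}{t}$, $F(t)=\frac{t}{q^{t}-q^{-t}}$,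 understood as power series in $t$. Let $\widetilde{\mathcal A}$ be the associative unital $\mathbb C$-algebra generated by $\tilde\kappa,\tilde H_{i,n},\tilde X^{\pm}_{i,n}$ ($i\in I$, $n\in\mathbb Z$), subject only to the relation that $\tilde\kappa$ is central. A restricted $\widetilde{\mathcal A}[[\hbar]]$-module is an $\widetilde{\mathcal A}[[\hbar]]$-module $W$ that is topologically free over $\mathbb C[[\hbar]]$ and satisfies $\lim_{n\to\infty}\tilde H_{i,n}w=0=\lim_{n\to\infty}\tilde X^{\pm}_{i,n}w$ for all $i\in I$, $w\in W$. Let $\widehat{\mathcal{DY}}(A)$ be the topological (complete, torsion-free) associative unital $\mathbb C[[\hbar]]$-algebra generated by $\kappa,H_{i,n},X^{\pm}_{i,n}$ with $\kappa$ central, subject to the following relations, where $H_i^+(z)=1+2\hbar\sum_{n\ge0}H_{i,n}z^{-n-1}$, $H_i^-(z)=1+2\hbar\sum_{n\ge1}H_{i,-n}z^{n-1}$, $X_i^\pm(z)=\sum_{n\in\mathbb Z}X^\pm_{i,n}z^{-n-1}$ and $i,j\in I$: \begin{align*} &[H_i^\pm(z),H_j^\pm(w)]=0,\\ &H_i^+(z)H_j^-(w)=H_j^-(w)H_i^+(z)\tfrac{(z-w-a_{ij}\hbar-\kappa\hbar)(z-w+a_{ij}\hbar+\kappa\hbar)}{(z-w+a_{ij}\hbar-\kappa\hbar)(z-w-a_{ij}\hbar+\kappa\hbar)},\\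 &H_i^+(z)X_j^\pm(w)=X_j^\pm(w)H_i^+(z)\left(\tfrac{z-w+a_{ij}\hbar\pm\frac12\kappa\hbar}{z-w-a_{ij}\hbar\pm\frac12\kappa\hbar}\right)^{\pm1},\\ &H_i^-(z)X_j^\pm(w)=X_j^\pm(w)H_i^-(z)\left(\tfrac{w-z-a_{ji}\hbar\pm\frac12\kappa\hbar}{w-z+a_{ji}\hbar\pm\frac12\kappa\hbar}\right)^{\pm1},\\ &[X_i^+(z),X_j^-(w)]=\tfrac{\delta_{ij}}{2\hbar}\Big(H_i^+(w+\tfrac12\kappa\hbar)z^{-1}\delta\big(\tfrac{w+\kappa\hbar}{z}\big)-H_i^-(w-\tfrac12\kappa\hbar)z^{-1}\delta\big(\tfrac{w-\kappa\hbar}{z}\big)\Big),\\ &(z-w\mp a_{ij}\hbar)X_i^\pm(z)X_j^\pm(w)=(z-w\pm a_{ij}\hbar)X_j^\pm(w)X_i^\pm(z),\\ &X_i^\pm(z)X_j^\pm(w)=X_j^\pm(w)X_i^\pm(z)\quad\text{if }a_{ij}=0, \end{align*} and the order-$2$ Serre relation for $(X_i^\pm(z_1),X_i^\pm(z_2),X_j^\pm(w))$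 if $a_{ij}=-1$; here the order-$2$ Serre relation for $(a(z_1),a(z_2),b(w))$ is $$\sum_{\sigma\in S_2}\big(a(z_{\sigma(1)})a(z_{\sigma(2)})b(w)-2a(z_{\sigma(1)})b(w)a(z_{\sigma(2)})+b(w)a(z_{\sigma(1)})a(z_{\sigma(2)})\big)=0 .$$ A restricted $\widehat{\mathcal{DY}}(A)$-module is a $\widehat{\mathcal{DY}}(A)$-module that is topologically free over $\mathbb C[[\hbar]]$ with $\lim_{n\to\infty}H_{i,n}w=0=\lim_{n\to\infty}X^\pm_{i,n}w$ for all $i\in I$, $w\in W$. **Theorem.** Let $W$ be a restricted $\widetilde{\mathcal A}[[\hbar]]$-module, and let $\tilde H_i^\pm(z),\tilde X_i^\pm(z)$ be defined like $H_i^\pm(z),X_i^\pm(z)$. Write $\kappa=\tilde\kappa$ and, for $i\in I$, set \begin{align*} &h_{i,\mathcal Y}^\pm(z)=\pm F(\partial_z)\log\tilde H_i^\pm\big(z\pm\tfrac12\kappa\hbar\big),\qquad h_{i,\mathcal Y}(z)=h^+_{i,\mathcal Y}(z)+h^-_{i,\mathcal Y}(z),\\ &x_{i,\mathcal Y}^+(z)=\tilde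 X_i^+(z),\qquad x_{i,\mathcal Y}^-(z)=\tilde X_i^-(z-\kappa\hbar)\,\tilde H_i^+\big(z-\tfrac12\kappa\hbar\big)^{-1},\\ &C_i(x)=\tilde H_i^-\big(x-\tfrac32\kappa\hbar\big)\tilde H_i^+\big(x-\tfrac12\kappa\hbar\big)^{-1}. \end{align*} Then $C_i(x)=\exp\!\big(-G(\partial_x)q^{-\kappa\partial_x}h_{i,\mathcal Y}^-(x)\big)\exp\!\big(-G(\partial_x)q^{-\kappa\partial_x}h_{i,\mathcal Y}^+(x)\big)$ and $C_i(x)\in\mathcal E_\hbar(W)$. Moreover, $W$ is a restricted $\widehat{\mathcal{DY}}(A)$-module with $\kappa=\tilde\kappa$, $H_{i,n}=\tilde H_{i,n}$, $X^\pm_{i,n}=\tilde X^\pm_{i,n}$ for all $i\in I$, $n\in\mathbb Z$ if and only if the following relations hold for all $i,j\in I$: \begin{align*} &[h_{i,\mathcal Y}(z),h_{j,\mathcal Y}(w)]=[a_{ij}]_{q^{\partial_w}}[\kappa]_{q^{\partial_w}}\big((z-w+\kappa\hbar)^{-2}-(w-z+\kappa\hbar)^{-2}\big),\\ &[h_{i,\mathcal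 Y}(z),x^\pm_{j,\mathcal Y}(w)]=\pm x^\pm_{j,\mathcal Y}(w)\,[a_{ij}]_{q^{\partial_w}}\big((z-w+\kappa\hbar)^{-1}+(w-z+\kappa\hbar)^{-1}\big),\\ &(z-w-a_{ij}\hbar)x^\pm_{i,\mathcal Y}(z)x^\pm_{j,\mathcal Y}(w)=(z-w+a_{ij}\hbar)x^\pm_{j,\mathcal Y}(w)x^\pm_{i,\mathcal Y}(z),\\ &x^\pm_{i,\mathcal Y}(z)x^\pm_{j,\mathcal Y}(w)=x^\pm_{j,\mathcal Y}(w)x^\pm_{i,\mathcal Y}(z)\quad\text{if }a_{ij}=0,\\ &x^+_{i,\mathcal Y}(z)x^-_{j,\mathcal Y}(w)-\Big(\tfrac{w-z+a_{ij}\hbar}{w-z-a_{ij}\hbar}\Big)x^-_{j,\mathcal Y}(w)x^+_{i,\mathcal Y}(z)=\tfrac{\delta_{ij}}{2\hbar}\Big(z^{-1}\delta\big(\tfrac wz\big)-C_i(w)\,z^{-1}\delta\big(\tfrac{w-2\kappa\hbar}{z}\big)\Big), \end{align*} together with the order-$2$ Serre relations for $(x^\pm_{i,\mathcal Y}(z_1),x^\pm_{i,\mathcal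 Y}(z_2),x^\pm_{j,\mathcal Y}(w))$ whenever $a_{ij}=-1$. -/

import Mathlib

open scoped PowerSeries

noncomputable section

namespace DoubleYangian

/-! ## Simply-laced generalized Cartan matrices -/

/-- A simply-laced generalized Cartan matrix: `2` on the diagonal, `0` or `-1` off the diagonal,
with symmetric zero pattern (hence symmetric). -/
structure IsSimplyLacedGCM {I : Type*} (A : Matrix I I ℤ) : Prop where
  diag : ∀ i, A i i = 2
  simplyLaced : A.IsSimplyLaced
  zero_symm : ∀ i j, A i j = 0 → A j i = 0

/-! ## The `ħ`-adic topology

The formal variable `ħ` is `PowerSeries.X : ℂ⟦X⟧`. -/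

/-- The scalar `c ħ ∈ ℂ[[ħ]]`. -/
def ch (c : ℂ) : ℂ⟦X⟧ := PowerSeries.C c * PowerSeries.X

/-- Topologically free `ℂ[[ħ]]`-modules, i.e. those of the form `V₀[[ħ]]`: they are the
torsion-free, separated and `ħ`-adically complete modules (`IsAdicComplete` means separated and
complete). -/
def IsTopFree (M : Type*) [AddCommGroup M] [Module ℂ⟦X⟧ M] : Prop :=
  (∀ v : M, (PowerSeries.X : ℂ⟦X⟧) • v = 0 → v = 0) ∧
    IsAdicComplete (Ideal.span {(PowerSeries.X : ℂ⟦X⟧)}) M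

/-- The `ħ`-adic topology of a `ℂ[[ħ]]`-module. -/
@[reducible]
def hTop (M : Type*) [AddCommGroup M] [Module ℂ⟦X⟧ M] : TopologicalSpace M :=
  (Ideal.span {(PowerSeries.X : ℂ⟦X⟧)}).adicModuleTopology M

/-- `lim_{n → ∞} f n = 0` in the `ħ`-adic sense. -/
def HTendsZero {M : Type*} [AddCommGroup M] [Module ℂ⟦X⟧ M] (f : ℕ → M) : Prop :=
  ∀ r : ℕ, ∃ N : ℕ, ∀ n ≥ N, ∃ u : M, f n = (PowerSeries.X : ℂ⟦X⟧) ^ r • u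

/-- `End W` carries the topology of pointwise `ħ`-adic convergence; infinite sums of operators
are taken with respect to it. -/
instance endTopology (W : Type*) [AddCommGroup W] [Module ℂ⟦X⟧ W] :
    TopologicalSpace (Module.End ℂ⟦X⟧ W) :=
  letI : TopologicalSpace W := hTop W
  TopologicalSpace.induced (fun (T : Module.End ℂ⟦X⟧ W) (w : W) => T w) inferInstance

/-- The space `ℰ_ħ(W) = Hom (W, W_ħ((x)))` of fields on `W`; here `a n` is the coefficient
of `x ^ n`. -/
def IsField {W : Type*} [AddCommGroup W] [Module ℂ⟦X⟧ W] (a : ℤ → Module.End ℂ⟦X⟧ W) : Prop :=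
  ∀ w : W, HTendsZero fun n : ℕ => a (-(n : ℤ)) w

/-! ## Formal calculus

`R` is a `ℂ[[ħ]]`-algebra with a topology in which infinite sums are taken. A formal distribution
`a(z) ∈ R[[z, z⁻¹]]` is a function `ℤ → R`, with `a n` the coefficient of `z ^ n`; likewise
`D(z, w) ∈ R[[z^{±1}, w^{±1}]]` is a function `ℤ → ℤ → R`, with `D m n` the coefficient of
`z ^ m w ^ n`. -/

section Calculus

variable {R : Type*} [Ring R] [Algebra ℂ⟦X⟧ R] [TopologicalSpace R]

/-- The constant distribution `1`. -/
def fone : ℤ → R := fun n => if n = 0 then 1 else 0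

/-- The product `a(z) b(z)` in one and the same variable. -/
def fmul (a b : ℤ → R) : ℤ → R := fun n => ∑' k : ℤ, a (n - k) * b k

/-- The power `a(z) ^ k`. -/
def fpow (a : ℤ → R) : ℕ → ℤ → R
  | 0 => fone
  | k + 1 => fmul a (fpow a k)

/-- The derivative `∂_z a(z)`. -/
def fderiv (a : ℤ → R) : ℤ → R := fun n => (n + 1) • a (n + 1)

/-- `P(ħ ∂_z) a(z)` for `P ∈ ℂ[[t]]`. -/
def fdiffop (P : ℂ⟦X⟧) (a : ℤ → R) : ℤ → R := fun n =>
  ∑' k : ℕ, (PowerSeries.C (PowerSeries.coeff k P) * PowerSeries.X ^ k : ℂ⟦X⟧) • (fderiv^[k] a) n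

/-- The substitution `a(z + μ) = ∑_{k ≥ 0} (μ ^ k / k!) ∂_z ^ k a(z)`, for `μ ∈ ħ R`. -/
def fshift (μ : R) (a : ℤ → R) : ℤ → R := fun n =>
  ∑' k : ℕ, Ring.choose (n + (k : ℤ)) k • (μ ^ k * a (n + k))

/-- `(2ħ)⁻¹ log (1 + 2ħ a(z)) = ∑_{k ≥ 1} (-1)^{k-1} (2ħ)^{k-1} a(z)^k / k`. -/
def flog (a : ℤ → R) : ℤ → R := fun n =>
  ∑' k : ℕ, (ch (-2) ^ k * PowerSeries.C ((1 : ℂ) / ((k : ℂ) + 1)) : ℂ⟦X⟧) • fpow a (k + 1) n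

/-- `(1 + 2ħ a(z))⁻¹ = ∑_{k ≥ 0} (-2ħ)^k a(z)^k`. -/
def finv (a : ℤ → R) : ℤ → R := fun n => ∑' k : ℕ, (ch (-2) ^ k) • fpow a k n

/-- `exp (a(z))`. -/
def fexp (a : ℤ → R) : ℤ → R := fun n =>
  ∑' k : ℕ, (PowerSeries.C ((1 : ℂ) / (k.factorial : ℂ)) : ℂ⟦X⟧) • fpow a k n

/-- `a(z) b(w)`. -/
def zw (a b : ℤ → R) : ℤ → ℤ → R := fun m n => a m * b n

/-- `b(w) a(z)`. -/
def wz (b a : ℤ → R) : ℤ → ℤ → R := fun m n => b n * a m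

/-- `(z - w - c) D(z, w)`. -/
def mulSub (c : R) (D : ℤ → ℤ → R) : ℤ → ℤ → R := fun m n =>
  D (m - 1) n - D m (n - 1) - c * D m n

/-- The product `D(z, w) K(z, w)`. -/
def dmul (D K : ℤ → ℤ → R) : ℤ → ℤ → R := fun m n =>
  ∑' p : ℤ × ℤ, D (m - p.1) (n - p.2) * K p.1 p.2

/-- The product `a(w) K(z, w)`. -/
def wmul (a : ℤ → R) (K : ℤ → ℤ → R) : ℤ → ℤ → R := fun m n => ∑' k : ℤ, a (n - k) * K m k

/-- The derivative `∂_w D(z, w)`. -/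
def wderiv (D : ℤ → ℤ → R) : ℤ → ℤ → R := fun m n => (n + 1) • D m (n + 1)

/-- `P(∂_w) D(z, w)` for `P ∈ R[[t]]`. -/
def wdiffop (P : R⟦X⟧) (D : ℤ → ℤ → R) : ℤ → ℤ → R := fun m n =>
  ∑' k : ℕ, PowerSeries.coeff k P * (wderiv^[k] D) m n

/-- `f(z - w)`, for `f(x) = ∑_{m ≥ 0} f_m x^{-m}` given as the power series `∑ f_m u^m` in
`u = x⁻¹`, where `(z - w)^{-m} = ∑_{q ≥ 0} (-1)^q binom(-m, q) z^{-m-q} w^q`. -/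
def expandZW (f : R⟦X⟧) : ℤ → ℤ → R := fun p q =>
  if 0 ≤ q ∧ p + q ≤ 0 then
    ((-1) ^ q.toNat * Ring.choose (p + q) q.toNat : ℤ) • PowerSeries.coeff (-(p + q)).toNat f
  else 0

/-- `f(w - z)`, expanded in nonnegative powers of `z`. -/
def expandWZ (f : R⟦X⟧) : ℤ → ℤ → R := fun p q => expandZW f q p

/-- `(x + c)⁻¹` as a power series in `x⁻¹`. -/
def inv1 (c : R) : R⟦X⟧ := PowerSeries.X * PowerSeries.mk fun n => (-c) ^ n

/-- `(x + μ) / (x + ν)` as a power series in `x⁻¹`. -/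
def ratio (μ ν : R) : R⟦X⟧ :=
  (1 + PowerSeries.C μ * PowerSeries.X) * PowerSeries.mk fun n => (-ν) ^ n

/-- `z⁻¹ δ((w + c) / z) = ∑_{n ∈ ℤ} z^{-n-1} (w + c)^n`, with `(w + c)^n` expanded in
nonnegative powers of `c`. -/
def delta (c : R) : ℤ → ℤ → R := fun p q =>
  if p + q + 1 ≤ 0 then
    Ring.choose (-p - 1) (-p - 1 - q).toNat • c ^ (-p - 1 - q).toNat
  else 0

/-- The series `S(t) = sinh t / t = ∑_{n ≥ 0} t^{2n} / (2n+1)!`. -/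
def S : ℂ⟦X⟧ := PowerSeries.mk fun n => if Even n then (1 : ℂ) / ((n + 1).factorial : ℂ) else 0

/-- The `q`-number `[c]_{q^t} = (q^{ct} - q^{-ct}) / (q^t - q^{-t})`, `q = e^ħ`, as a power series
in `t`, i.e. `c S(c ħ t) S(ħ t)⁻¹`. -/
def qnum (c : R) : R⟦X⟧ :=
  PowerSeries.C c *
    (PowerSeries.mk fun n =>
      (PowerSeries.C (PowerSeries.coeff n S) * PowerSeries.X ^ n : ℂ⟦X⟧) • c ^ n) *
    (PowerSeries.mk fun n =>
      algebraMap ℂ⟦X⟧ R (PowerSeries.C (PowerSeries.coeff n S⁻¹) * PowerSeries.X ^ n))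

/-- The left-hand side of the order-`2` Serre relation for `(a(z₁), a(z₂), b(w))`: the coefficient
of `z₁ ^ m₁ z₂ ^ m₂ w ^ n`. -/
def serre (a b : ℤ → R) (m₁ m₂ n : ℤ) : R :=
  (a m₁ * a m₂ * b n - 2 * (a m₁ * b n * a m₂) + b n * a m₁ * a m₂) +
    (a m₂ * a m₁ * b n - 2 * (a m₂ * b n * a m₁) + b n * a m₂ * a m₁)

end Calculus

/-! ## Generating currents -/

/-- A choice of elements `κ`, `H_{i,n}`, `X^±_{i,n}`; the sign is `1` or `-1` in `ℤˣ`. -/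
@[ext]
structure Gens (I : Type*) (R : Type*) where
  kappa : R
  H : I → ℤ → R
  X : ℤˣ → I → ℤ → R

namespace Gens

variable {I : Type*} {R : Type*}

/-- The images of the elements under a map. -/
def map {T : Type*} (f : R → T) (g : Gens I R) : Gens I T where
  kappa := f g.kappa
  H i n := f (g.H i n)
  X s i n := f (g.X s i n)

variable [Ring R] [Algebra ℂ⟦X⟧ R] [TopologicalSpace R]

/-- The element `c ħ` of `R`. -/
def hb (R : Type*) [Ring R] [Algebra ℂ⟦X⟧ R] (c : ℂ) : R := algebraMap ℂ⟦X⟧ R (ch c)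

/-- The element `c κ ħ` of `R`. -/
def kh (g : Gens I R) (c : ℂ) : R := ch c • g.kappa

/-- `∑_{n ≥ 0} H_{i,n} z^{-n-1}` for the sign `+`, and `∑_{n ≥ 1} H_{i,-n} z^{n-1}` for the
sign `-`. -/
def A (g : Gens I R) (s : ℤˣ) (i : I) : ℤ → R := fun e =>
  if (s = 1 ∧ e < 0) ∨ (s = -1 ∧ 0 ≤ e) then g.H i (-e - 1) else 0

/-- The current `H_i^±(z) = 1 + 2ħ A_i^±(z)`. -/
def Hc (g : Gens I R) (s : ℤˣ) (i : I) : ℤ → R := fun e => fone e + ch 2 • g.A s i e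

/-- The current `X_i^±(z) = ∑_n X^±_{i,n} z^{-n-1}`. -/
def Xc (g : Gens I R) (s : ℤˣ) (i : I) : ℤ → R := fun e => g.X s i (-e - 1)

/-! ### The defining relations of the double Yangian

Each of the following is the difference of the two sides of a relation. -/

/-- `H_i^±(z) H_j^±(w) - H_j^±(w) H_i^±(z)`. -/
def dy1 (g : Gens I R) (s : ℤˣ) (i j : I) : ℤ → ℤ → R :=
  zw (g.Hc s i) (g.Hc s j) - wz (g.Hc s j) (g.Hc s i)

/-- `H_i^+(z) H_j^-(w)` minus
`H_j^-(w) H_i^+(z) (x-aħ-κħ)(x+aħ+κħ) / ((x+aħ-κħ)(x-aħ+κħ))`, where `x = z - w`. -/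
def dy2 (g : Gens I R) (a : ℂ) (i j : I) : ℤ → ℤ → R :=
  zw (g.Hc 1 i) (g.Hc (-1) j) -
    dmul (wz (g.Hc (-1) j) (g.Hc 1 i))
      (expandZW (ratio (-hb R a - g.kh 1) (hb R a - g.kh 1) *
        ratio (hb R a + g.kh 1) (-hb R a + g.kh 1)))

/-- `H_i^+(z) X_j^±(w)` minus
`X_j^±(w) H_i^+(z) ((x + aħ ± κħ/2) / (x - aħ ± κħ/2))^{±1}`, where `x = z - w`. -/
def dy3 (g : Gens I R) (a : ℂ) (s : ℤˣ) (i j : I) : ℤ → ℤ → R :=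
  zw (g.Hc 1 i) (g.Xc s j) -
    dmul (wz (g.Xc s j) (g.Hc 1 i))
      (expandZW (if s = 1 then
        ratio (hb R a + g.kh (1 / 2)) (-hb R a + g.kh (1 / 2))
      else
        ratio (-hb R a - g.kh (1 / 2)) (hb R a - g.kh (1 / 2))))

/-- `H_i^-(z) X_j^±(w)` minus
`X_j^±(w) H_i^-(z) ((y - aħ ± κħ/2) / (y + aħ ± κħ/2))^{±1}`, where `y = w - z`. -/
def dy4 (g : Gens I R) (a : ℂ) (s : ℤˣ) (i j : I) : ℤ → ℤ → R :=
  zw (g.Hc (-1) i) (g.Xc s j) -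
    dmul (wz (g.Xc s j) (g.Hc (-1) i))
      (expandWZ (if s = 1 then
        ratio (-hb R a + g.kh (1 / 2)) (hb R a + g.kh (1 / 2))
      else
        ratio (hb R a - g.kh (1 / 2)) (-hb R a - g.kh (1 / 2))))

/-- `2ħ [X_i^+(z), X_j^-(w)]` minus
`δ_{ij} (H_i^+(w + κħ/2) z⁻¹δ((w + κħ)/z) - H_i^-(w - κħ/2) z⁻¹δ((w - κħ)/z))`. -/
def dy5 [DecidableEq I] (g : Gens I R) (i j : I) : ℤ → ℤ → R :=
  ch 2 • (zw (g.Xc 1 i) (g.Xc (-1) j) - wz (g.Xc (-1) j) (g.Xc 1 i)) -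
    if i = j then
      wmul (fshift (g.kh (1 / 2)) (g.Hc 1 i)) (delta (g.kh 1)) -
        wmul (fshift (g.kh (-1 / 2)) (g.Hc (-1) i)) (delta (g.kh (-1)))
    else 0

/-- `(z - w ∓ aħ) X_i^±(z) X_j^±(w) - (z - w ± aħ) X_j^±(w) X_i^±(z)`. -/
def dy6 (g : Gens I R) (a : ℂ) (s : ℤˣ) (i j : I) : ℤ → ℤ → R :=
  mulSub (hb R (((s : ℤ) : ℂ) * a)) (zw (g.Xc s i) (g.Xc s j)) -
    mulSub (hb R (-((s : ℤ) : ℂ) * a)) (wz (g.Xc s j) (g.Xc s i))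

/-- `X_i^±(z) X_j^±(w) - X_j^±(w) X_i^±(z)`. -/
def dy7 (g : Gens I R) (s : ℤˣ) (i j : I) : ℤ → ℤ → R :=
  zw (g.Xc s i) (g.Xc s j) - wz (g.Xc s j) (g.Xc s i)

/-- The set of all coefficients of the defining relations (the centrality of `κ` is built into the
algebra `Atilde` below). -/
inductive Relator [DecidableEq I] (A : Matrix I I ℤ) (g : Gens I R) : R → Prop
  | dy1 (s : ℤˣ) (i j : I) (m n : ℤ) : Relator A g (g.dy1 s i j m n)
  | dy2 (i j : I) (m n : ℤ) : Relator A g (g.dy2 (A i j) i j m n)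
  | dy3 (s : ℤˣ) (i j : I) (m n : ℤ) : Relator A g (g.dy3 (A i j) s i j m n)
  | dy4 (s : ℤˣ) (i j : I) (m n : ℤ) : Relator A g (g.dy4 (A j i) s i j m n)
  | dy5 (i j : I) (m n : ℤ) : Relator A g (g.dy5 i j m n)
  | dy6 (s : ℤˣ) (i j : I) (m n : ℤ) : Relator A g (g.dy6 (A i j) s i j m n)
  | dy7 (s : ℤˣ) (i j : I) (m n : ℤ) (h : A i j = 0) : Relator A g (g.dy7 s i j m n)
  | dy8 (s : ℤˣ) (i j : I) (m₁ m₂ n : ℤ) (h : A i j = -1) :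
      Relator A g (serre (g.Xc s i) (g.Xc s j) m₁ m₂ n)

/-! ### The modified currents -/

/-- `h^±_{i,𝒴}(z) = ± F(∂_z) log H_i^±(z ± κħ/2)`, where `F(x) = (2ħ)⁻¹ S(ħx)⁻¹`. -/
def hpm (g : Gens I R) (s : ℤˣ) (i : I) : ℤ → R :=
  (s : ℤ) • fdiffop S⁻¹ (flog (fshift (g.kh (((s : ℤ) : ℂ) / 2)) (g.A s i)))

/-- `h_{i,𝒴}(z) = h^+_{i,𝒴}(z) + h^-_{i,𝒴}(z)`. -/
def hY (g : Gens I R) (i : I) : ℤ → R := g.hpm 1 i + g.hpm (-1) i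

/-- `H_i^+(z - κħ/2)⁻¹`. -/
def Hinv (g : Gens I R) (i : I) : ℤ → R := finv (fshift (g.kh (-1 / 2)) (g.A 1 i))

/-- `x^+_{i,𝒴}(z) = X_i^+(z)` and `x^-_{i,𝒴}(z) = X_i^-(z - κħ) H_i^+(z - κħ/2)⁻¹`. -/
def xY (g : Gens I R) (s : ℤˣ) (i : I) : ℤ → R :=
  if s = 1 then g.Xc 1 i else fmul (fshift (g.kh (-1)) (g.Xc (-1) i)) (g.Hinv i)

/-- `C_i(x) = H_i^-(x - 3κħ/2) H_i^+(x - κħ/2)⁻¹`. -/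
def Cc (g : Gens I R) (i : I) : ℤ → R :=
  fmul (fshift (g.kh (-3 / 2)) (g.Hc (-1) i)) (g.Hinv i)

/-- `exp (-G(∂_x) q^{-κ∂_x} h^±_{i,𝒴}(x))`, where `G(x) = 2ħ S(ħx)`, `q = e^ħ`; thus
`q^{-κ∂_x} a(x) = a(x - κħ)`. -/
def expG (g : Gens I R) (s : ℤˣ) (i : I) : ℤ → R :=
  fexp (ch (-2) • fdiffop S (fshift (g.kh (-1)) (g.hpm s i)))

/-- The relations satisfied by the modified currents. -/
structure CurrentRelations [DecidableEq I] (A : Matrix I I ℤ) (g : Gens I R) : Prop where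
  /-- `[h_i(z), h_j(w)] = [a]_{q^∂_w} [κ]_{q^∂_w} ((z-w+κħ)^{-2} - (w-z+κħ)^{-2})` -/
  h_h : ∀ i j, zw (g.hY i) (g.hY j) - wz (g.hY j) (g.hY i) =
    wdiffop (qnum (A i j : R)) (wdiffop (qnum g.kappa)
      (expandZW (inv1 (g.kh 1) ^ 2) - expandWZ (inv1 (g.kh 1) ^ 2)))
  /-- `[h_i(z), x_j^±(w)] = ± x_j^±(w) [a]_{q^∂_w} ((z-w+κħ)⁻¹ + (w-z+κħ)⁻¹)` -/
  h_x : ∀ (s : ℤˣ) i j, zw (g.hY i) (g.xY s j) - wz (g.xY s j) (g.hY i) =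
    (s : ℤ) • wmul (g.xY s j) (wdiffop (qnum (A i j : R))
      (expandZW (inv1 (g.kh 1)) + expandWZ (inv1 (g.kh 1))))
  /-- `(z-w-aħ) x_i^±(z) x_j^±(w) = (z-w+aħ) x_j^±(w) x_i^±(z)` -/
  x_x : ∀ (s : ℤˣ) i j, mulSub (hb R (A i j)) (zw (g.xY s i) (g.xY s j)) =
    mulSub (hb R (-(A i j : ℂ))) (wz (g.xY s j) (g.xY s i))
  /-- `x_i^±(z) x_j^±(w) = x_j^±(w) x_i^±(z)` if `a = 0` -/
  x_x_zero : ∀ (s : ℤˣ) i j, A i j = 0 →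
    zw (g.xY s i) (g.xY s j) = wz (g.xY s j) (g.xY s i)
  /-- `x_i^+(z) x_j^-(w) - ((w-z+aħ)/(w-z-aħ)) x_j^-(w) x_i^+(z)
  = δ_{ij} (2ħ)⁻¹ (z⁻¹δ(w/z) - C_i(w) z⁻¹δ((w-2κħ)/z))`, multiplied by `2ħ` -/
  x_x_pm : ∀ i j,
    ch 2 • (zw (g.xY 1 i) (g.xY (-1) j) -
        dmul (wz (g.xY (-1) j) (g.xY 1 i)) (expandWZ (ratio (hb R (A i j)) (-hb R (A i j))))) =
      if i = j then delta 0 - wmul (g.Cc i) (delta (g.kh (-2))) else 0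
  /-- the order-`2` Serre relations for `(x_i^±(z₁), x_i^±(z₂), x_j^±(w))` if `a = -1` -/
  serre : ∀ (s : ℤˣ) i j, A i j = -1 → ∀ m₁ m₂ n, serre (g.xY s i) (g.xY s j) m₁ m₂ n = 0

end Gens

/-! ## The algebras -/

/-- Labels of the generators `κ̃`, `H̃_{i,n}`, `X̃^±_{i,n}`. -/
inductive Gen (I : Type*)
  | kappa : Gen I
  | H : I → ℤ → Gen I
  | X : ℤˣ → I → ℤ → Gen I

/-- The relation that `κ̃` is central. -/
inductive AtildeRel (I : Type*) : FreeAlgebra ℂ (Gen I) → FreeAlgebra ℂ (Gen I) → Prop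
  | comm (x : Gen I) : AtildeRel I (FreeAlgebra.ι ℂ Gen.kappa * FreeAlgebra.ι ℂ x)
      (FreeAlgebra.ι ℂ x * FreeAlgebra.ι ℂ Gen.kappa)

/-- The associative `ℂ`-algebra generated by `κ̃`, `H̃_{i,n}`, `X̃^±_{i,n}` subject only to the
relation that `κ̃` is central.

The elements `H̃_{i,0}` are *not* required to be central: the coefficient of `z⁻¹` in
`H_i^+(z) X_j^±(w) = X_j^±(w) H_i^+(z) (⋯)^{±1}` reads `[H_{i,0}, X_j^±(w)] = ± a_{ij} X_j^±(w)`,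
so that this requirement would force `X_j^± = 0` on every torsion-free module. Modules on which
`H̃_{i,0}` acts centrally are particular modules of the algebra considered here. -/
def Atilde (I : Type*) : Type _ := RingQuot (AtildeRel I)

instance (I : Type*) : Ring (Atilde I) := inferInstanceAs (Ring (RingQuot (AtildeRel I)))

instance (I : Type*) : Algebra ℂ (Atilde I) :=
  inferInstanceAs (Algebra ℂ (RingQuot (AtildeRel I)))

/-- The class of a generator. -/
def Atilde.gen {I : Type*} (x : Gen I) : Atilde I :=
  RingQuot.mkAlgHom ℂ (AtildeRel I) (FreeAlgebra.ι ℂ x)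

/-- The `ℂ[[ħ]]`-algebra structure of `Ã[[ħ]]`. -/
instance (I : Type*) : Algebra ℂ⟦X⟧ (Atilde I)⟦X⟧ :=
  (PowerSeries.map (algebraMap ℂ (Atilde I))).toAlgebra' (by
    intro c x
    ext n
    rw [PowerSeries.coeff_mul, PowerSeries.coeff_mul,
      ← Finset.Nat.sum_antidiagonal_swap]
    refine Finset.sum_congr rfl fun p _ => ?_
    simp only [PowerSeries.coeff_map, Prod.fst_swap, Prod.snd_swap]
    exact Algebra.commutes _ _)

/-- `Ã[[ħ]]` carries the `ħ`-adic topology. -/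
instance (I : Type*) : TopologicalSpace (Atilde I)⟦X⟧ := hTop (Atilde I)⟦X⟧

/-- The generators in `Ã[[ħ]]`. -/
def Atilde.gens (I : Type*) : Gens I (Atilde I)⟦X⟧ where
  kappa := PowerSeries.C (Atilde.gen Gen.kappa)
  H i n := PowerSeries.C (Atilde.gen (Gen.H i n))
  X s i n := PowerSeries.C (Atilde.gen (Gen.X s i n))

/-- The defining ideal of the double Yangian: the smallest two-sided ideal of `Ã[[ħ]]` which
contains all the coefficients of the defining relations, is `ħ`-adically closed, and is
`ħ`-saturated (so that relations may be divided by `ħ`, as in the relation for `[X^+, X^-]`). -/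
def dyIdeal {I : Type*} [DecidableEq I] (A : Matrix I I ℤ) : TwoSidedIdeal (Atilde I)⟦X⟧ :=
  sInf {J | (∀ x, (Atilde.gens I).Relator A x → x ∈ J) ∧ IsClosed (J : Set (Atilde I)⟦X⟧) ∧
    ∀ x : (Atilde I)⟦X⟧, (PowerSeries.X : ℂ⟦X⟧) • x ∈ J → x ∈ J}

/-- The topological `ℂ[[ħ]]`-algebra `DY^(A)`, given by generators and relations. -/
def DY {I : Type*} [DecidableEq I] (A : Matrix I I ℤ) : Type _ := (dyIdeal A).ringCon.Quotient

instance {I : Type*} [DecidableEq I] (A : Matrix I I ℤ) : Ring (DY A) :=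
  inferInstanceAs (Ring (dyIdeal A).ringCon.Quotient)

instance {I : Type*} [DecidableEq I] (A : Matrix I I ℤ) : Algebra ℂ⟦X⟧ (DY A) :=
  inferInstanceAs (Algebra ℂ⟦X⟧ (dyIdeal A).ringCon.Quotient)

/-- The generators `κ`, `H_{i,n}`, `X^±_{i,n}` of `DY^(A)`. -/
def DY.gens {I : Type*} [DecidableEq I] (A : Matrix I I ℤ) : Gens I (DY A) :=
  (Atilde.gens I).map fun x => ((dyIdeal A).ringCon.mk' x : (dyIdeal A).ringCon.Quotient)

/-! ## Restricted modules

A module over a `ℂ[[ħ]]`-algebra `B` is a `ℂ[[ħ]]`-module `W` with a homomorphism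
`B → End W` of `ℂ[[ħ]]`-algebras. -/

/-- The condition defining restricted modules, for the operators by which the generators act:
`W` is topologically free and `H_{i,n} w → 0`, `X^±_{i,n} w → 0` as `n → ∞`. -/
def IsRestricted {I W : Type*} [AddCommGroup W] [Module ℂ⟦X⟧ W]
    (g : Gens I (Module.End ℂ⟦X⟧ W)) : Prop :=
  IsTopFree W ∧
    (∀ (i : I) (w : W), HTendsZero fun n : ℕ => g.H i n w) ∧
    (∀ (s : ℤˣ) (i : I) (w : W), HTendsZero fun n : ℕ => g.X s i n w)

/-- `W` is a restricted `DY^(A)`-module on which `κ`, `H_{i,n}`, `X^±_{i,n}` act by the given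
operators. -/
def IsRestrictedDYModule {I W : Type*} [DecidableEq I] [AddCommGroup W] [Module ℂ⟦X⟧ W]
    (A : Matrix I I ℤ) (g : Gens I (Module.End ℂ⟦X⟧ W)) : Prop :=
  ∃ ρ : DY A →ₐ[ℂ⟦X⟧] Module.End ℂ⟦X⟧ W,
    (DY.gens A).map ρ = g ∧ IsRestricted ((DY.gens A).map ρ)

end DoubleYangian

end

open scoped PowerSeries

noncomputable section

set_option linter.style.haveILetI false
set_option linter.unusedSectionVars false

namespace DoubleYangian

section
/-! ## Topologically free modules -/

/-! The proof takes place among operators on `W`. Since `W` is torsion-free and separated, the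
kernel of `π` is `ħ`-saturated and closed, so a double Yangian structure with the given generators
exists exactly when all relators act by zero (`isRestrictedDYModule_iff`). What remains is to
translate the relations for `H_i^±`, `X_i^±` into those for the modified currents, and each
translation has to be reversible.

Logarithms. The currents `H_i^±(z)` are one-sided, hence elements of a power series ring over `End
W`, in which `EXP y = exp (2ħ y)` and `Flog b = (2ħ)⁻¹ log (1 + 2ħ b)` make sense. As `F G = 1`, the
exponents in the formula for `C_i` are logarithms of shifted currents, and the formula follows
(`IsGood.Cc_eq_expG`). An exchange relation between `H(z) = 1 + 2ħ b(z)` and a current `d(w)` says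
that two products of commuting operators take the same value at `d`; the operators are left and
right multiplication by `H` and multiplication by `1 + r ħ x⁻¹` with `x = ±(z - w)`. Exponentials of
commuting operators agree on a vector exactly when the exponents do (`EXP_apply_eq_iff`). Therefore
the relation is equivalent to a formula for the commutator of `log H(z)` with `d(w)`
(`exchange_iff`), whose kernel `psi` is the logarithm of a quotient of linear factors.

The relations of `h`. The operator `F(∂)` is invertible up to the factor `2ħ`, and the logarithms of
`H^+` and `H^-` involve disjoint powers of `z`, so the two commutator formulas can be added to one
formula for `h_{i,𝒴}` without losing information (`hY_relation_iff`). Quantum numbers enter through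
the identities `ev_S_qker_inv1` and `ev_S_S_qker_inv1`, which turn them into the kernels `psi`. For
`[h, h]` the logarithm is taken in the second current as well (`commutator_Flog_iff`), and powers of
`w` are separated too (`h_h_iff`).

The current `x^-`. Up to a shift it is `X^-` multiplied on the right by the invertible series `b(w)
= H^+(w - κħ/2)⁻¹`. The commutator of `b` with `log H^-` moves the kernel of `[log H^-, X^-]` to the
position required in `[h, x^-]` (`HRel.lH_neg_xY_iff`). The exchange of `b(z)` with `X^-(w)`
interchanges the factors `z - w - aħ` and `z - w + aħ` in the quadratic relation
(`HRel.x_x_iff_dy`). The exchange of `b(w)` with `X^+(z)` is precisely the rational factor of the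
mixed relation, and `b` cancels `H^+` in one delta term while completing `H^-` to `C_i` in the other
(`IsGood.x_x_pm_iff_dy`).

The Serre relations for `x^-`. Put `u = z₁ - w`, `v = z₂ - w`. If `N₁, N₂, N₃` are the words `x x
x'`, `x x' x`, `x' x x`, then the quadratic relations suggest `N₁ = (u-ħ)(v-ħ)E`, `N₂ =
(u-ħ)(v+ħ)E`, `N₃ = (u+ħ)(v+ħ)E` with a common `E`. The corresponding words `M_k` in `X^-`,
multiplied by the three series, arise by changing the sign of `ħ` in the two linear factors and
multiplying by `(u-v-2ħ)/(u-v+2ħ)`. Then `N₁ - 2N₂ + N₃` and `M₁ - 2M₂ + M₃` differ by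
`-4ħ(u-v-2ħ)E`, which is antisymmetric in `z₁, z₂` by the quadratic relation and disappears on
symmetrizing. The three words live in different expansion regions, so there is no common `E`;
`serre_comparison` carries out the argument with one quotient for each region, and `serreHalf_rho`
supplies them. -/

/-- The formal variable `ħ`. -/
abbrev hv : ℂ⟦X⟧ := PowerSeries.X

/-- A convenient reformulation of `IsTopFree`. -/
class TopFree (M : Type*) [AddCommGroup M] [Module ℂ⟦X⟧ M] : Prop where
  tf : ∀ v : M, hv • v = 0 → v = 0
  sep : ∀ v : M, (∀ r : ℕ, ∃ u : M, hv ^ r • u = v) → v = 0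
  compl : ∀ a : ℕ → M, ∃ m : M, ∀ r : ℕ, ∃ u : M,
    hv ^ r • u = m - ∑ k ∈ Finset.range r, hv ^ k • a k

section Module

variable {M N : Type*} [AddCommGroup M] [Module ℂ⟦X⟧ M] [AddCommGroup N] [Module ℂ⟦X⟧ N]

/-- The submodule `ħ ^ r M`. -/
def hsub (M : Type*) [AddCommGroup M] [Module ℂ⟦X⟧ M] (r : ℕ) : Submodule ℂ⟦X⟧ M :=
  LinearMap.range ((hv ^ r) • (LinearMap.id : M →ₗ[ℂ⟦X⟧] M))

theorem mem_hsub {r : ℕ} {v : M} : v ∈ hsub M r ↔ ∃ u : M, hv ^ r • u = v := by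
  simp [hsub, LinearMap.mem_range]

theorem smul_mem_hsub (r : ℕ) (v : M) : hv ^ r • v ∈ hsub M r := mem_hsub.2 ⟨v, rfl⟩

theorem hsub_zero (v : M) : v ∈ hsub M 0 := mem_hsub.2 ⟨v, by simp⟩

theorem hsub_anti {r s : ℕ} (h : r ≤ s) {v : M} (hv' : v ∈ hsub M s) : v ∈ hsub M r := by
  obtain ⟨u, rfl⟩ := mem_hsub.1 hv'
  refine mem_hsub.2 ⟨hv ^ (s - r) • u, ?_⟩
  rw [smul_smul, ← pow_add]; congr 2; omega

theorem map_mem_hsub (f : M →ₗ[ℂ⟦X⟧] N) {r : ℕ} {v : M} (h : v ∈ hsub M r) :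
    f v ∈ hsub N r := by
  obtain ⟨u, rfl⟩ := mem_hsub.1 h
  exact mem_hsub.2 ⟨f u, by simp⟩

theorem smul_mem_hsub_add {r s : ℕ} {v : M} (h : v ∈ hsub M s) : hv ^ r • v ∈ hsub M (r + s) := by
  obtain ⟨u, rfl⟩ := mem_hsub.1 h
  exact mem_hsub.2 ⟨u, by rw [pow_add, mul_smul]⟩

variable [TopFree M] [TopFree N]

theorem eq_of_hsub {v w : M} (h : ∀ r, v - w ∈ hsub M r) : v = w :=
  sub_eq_zero.1 (TopFree.sep _ fun r => mem_hsub.1 (h r))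

theorem hpow_inj (r : ℕ) {v : M} (h : hv ^ r • v = 0) : v = 0 := by
  induction r with
  | zero => simpa using h
  | succ r ih => exact ih (TopFree.tf _ (by rw [smul_smul, ← pow_succ']; exact h))

theorem hv_inj {v w : M} (h : hv • v = hv • w) : v = w :=
  sub_eq_zero.1 (TopFree.tf _ (by rw [smul_sub, h, sub_self]))

theorem hpow_inj' (r : ℕ) {v w : M} (h : hv ^ r • v = hv ^ r • w) : v = w :=
  sub_eq_zero.1 (hpow_inj r (by rw [smul_sub, h, sub_self]))

/-- The sum `∑ ħ ^ k a_k`. -/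
def hsum (a : ℕ → M) : M := (TopFree.compl a).choose

theorem hsum_spec (a : ℕ → M) (r : ℕ) :
    hsum a - ∑ k ∈ Finset.range r, hv ^ k • a k ∈ hsub M r :=
  mem_hsub.2 ((TopFree.compl a).choose_spec r)

/-- By separatedness, congruences modulo every `ħ ^ r` pin the sum down, so an identity between
infinite sums becomes a statement about finite partial sums. -/
theorem hsum_unique {a : ℕ → M} {m : M}
    (h : ∀ r, m - ∑ k ∈ Finset.range r, hv ^ k • a k ∈ hsub M r) : m = hsum a :=
  eq_of_hsub fun r => by
    have := (hsub M r).sub_mem (h r) (hsum_spec a r)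
    simpa using this

theorem map_hsum (f : M →ₗ[ℂ⟦X⟧] N) (a : ℕ → M) : f (hsum a) = hsum fun k => f (a k) :=
  hsum_unique fun r => by
    have := map_mem_hsub f (hsum_spec a r)
    simpa using this

theorem hsum_add (a b : ℕ → M) : hsum (fun k => a k + b k) = hsum a + hsum b :=
  (hsum_unique fun r => by
    have := (hsub M r).add_mem (hsum_spec a r) (hsum_spec b r)
    simp only [smul_add, Finset.sum_add_distrib]
    convert this using 1; abel).symm

theorem hsum_smul (c : ℂ⟦X⟧) (a : ℕ → M) : hsum (fun k => c • a k) = c • hsum a := by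
  have := map_hsum (c • (LinearMap.id : M →ₗ[ℂ⟦X⟧] M)) a
  simpa using this.symm

theorem hsum_zero : hsum (fun _ => (0 : M)) = 0 :=
  (hsum_unique fun r => by simp).symm

theorem hsum_neg (a : ℕ → M) : hsum (fun k => - a k) = - hsum a := by
  have := map_hsum (-(LinearMap.id : M →ₗ[ℂ⟦X⟧] M)) a
  simpa using this.symm

theorem hsum_sub (a b : ℕ → M) : hsum (fun k => a k - b k) = hsum a - hsum b := by
  simp only [sub_eq_add_neg, hsum_add, hsum_neg]

theorem hsum_succ (a : ℕ → M) : hsum a = a 0 + hv • hsum (fun k => a (k + 1)) :=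
  (hsum_unique fun r => by
    cases r with
    | zero => exact hsub_zero _
    | succ r =>
      have := smul_mem_hsub_add (r := 1) (hsum_spec (fun k => a (k + 1)) r)
      rw [add_comm 1 r] at this
      rw [Finset.sum_range_succ']
      convert this using 1
      simp only [pow_one, smul_sub, Finset.smul_sum, smul_smul, ← pow_succ', pow_zero, one_smul]
      abel).symm

theorem hsum_single (a : M) : hsum (fun k => if k = 0 then a else 0) = a := by
  rw [hsum_succ]; simp [hsum_zero]

/-- Sums of sums: `∑ ħ^i ∑ ħ^j a_{ij}` is the sum over the antidiagonals. -/
theorem hsum_hsum (a : ℕ → ℕ → M) :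
    hsum (fun i => hsum (a i)) = hsum fun n => ∑ p ∈ Finset.HasAntidiagonal.antidiagonal n, a p.1 p.2 := by
  refine hsum_unique fun r => ?_
  have h1 : ∀ r, ∑ n ∈ Finset.range r, hv ^ n • ∑ p ∈ Finset.HasAntidiagonal.antidiagonal n, a p.1 p.2 =
      ∑ i ∈ Finset.range r, hv ^ i • ∑ j ∈ Finset.range (r - i), hv ^ j • a i j := by
    intro r
    simp only [Finset.smul_sum, smul_smul, ← pow_add]
    rw [Finset.sum_sigma', Finset.sum_sigma']
    refine Finset.sum_bij' (fun x _ => ⟨x.2.1, x.2.2⟩) (fun x _ => ⟨x.1 + x.2, (x.1, x.2)⟩)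
      ?_ ?_ ?_ ?_ ?_
    · rintro ⟨n, p⟩ h; simp at h ⊢; omega
    · rintro ⟨n, p⟩ h; simp at h ⊢; omega
    · rintro ⟨n, p⟩ h; simp at h ⊢; rcases h with ⟨h, rfl⟩; simp
    · rintro ⟨n, p⟩ h; simp
    · rintro ⟨n, p⟩ h; simp at h ⊢; rw [h.2]
  rw [h1]
  have h2 : hsum (fun i => hsum (a i)) -
      ∑ i ∈ Finset.range r, hv ^ i • ∑ j ∈ Finset.range (r - i), hv ^ j • a i j =
      (hsum (fun i => hsum (a i)) - ∑ i ∈ Finset.range r, hv ^ i • hsum (a i)) +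
      ∑ i ∈ Finset.range r, hv ^ i • (hsum (a i) -
        ∑ j ∈ Finset.range (r - i), hv ^ j • a i j) := by
    simp only [smul_sub, Finset.sum_sub_distrib]; abel
  rw [h2]
  refine (hsub M r).add_mem (hsum_spec _ _) (Submodule.sum_mem _ fun i hi => ?_)
  have := smul_mem_hsub_add (r := i) (hsum_spec (a i) (r - i))
  rwa [Nat.add_sub_cancel' (Finset.mem_range.1 hi).le] at this

theorem hsum_comm (a : ℕ → ℕ → M) :
    hsum (fun i => hsum (a i)) = hsum fun j => hsum fun i => a i j := by
  rw [hsum_hsum, hsum_hsum]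
  congr 1; funext n
  rw [← Finset.Nat.sum_antidiagonal_swap]; rfl

variable {L : Type*} [AddCommGroup L] [Module ℂ⟦X⟧ L] [TopFree L]

/-- Linear maps pass through `hsum`, so bilinearity yields a double sum, which is regrouped by total
degree as in a Cauchy product. -/
theorem hsum_bilin (β : M →ₗ[ℂ⟦X⟧] N →ₗ[ℂ⟦X⟧] L) (a : ℕ → M) (b : ℕ → N) :
    β (hsum a) (hsum b) = hsum fun n => ∑ p ∈ Finset.HasAntidiagonal.antidiagonal n, β (a p.1) (b p.2) := by
  rw [← hsum_hsum (fun i j => β (a i) (b j)), map_hsum]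
  have : ∀ i, β (hsum a) (b i) = hsum fun j => β (a j) (b i) := fun i =>
    map_hsum (β.flip (b i)) a
  simp only [this]
  rw [hsum_comm]

end Module

/-! ### Instances -/

section Instances

variable {M N : Type*} [AddCommGroup M] [Module ℂ⟦X⟧ M] [AddCommGroup N] [Module ℂ⟦X⟧ N]

instance topFree_pi {ι : Type*} {M : ι → Type*} [∀ i, AddCommGroup (M i)]
    [∀ i, Module ℂ⟦X⟧ (M i)] [∀ i, TopFree (M i)] : TopFree (∀ i, M i) where
  tf v h := funext fun i => TopFree.tf _ (congrFun h i)
  sep v h := funext fun i => TopFree.sep _ fun r => by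
    obtain ⟨u, hu⟩ := h r
    exact ⟨u i, congrFun hu i⟩
  compl a := by
    refine ⟨fun i => hsum fun k => a k i, fun r => ?_⟩
    choose u hu using fun i => mem_hsub.1 (hsum_spec (fun k => a k i) r)
    refine ⟨u, funext fun i => ?_⟩
    simp [hu]

theorem hsum_apply {ι : Type*} {M : ι → Type*} [∀ i, AddCommGroup (M i)]
    [∀ i, Module ℂ⟦X⟧ (M i)] [∀ i, TopFree (M i)] (a : ℕ → ∀ i, M i) (i : ι) :
    hsum a i = hsum fun k => a k i :=
  map_hsum (LinearMap.proj (R := ℂ⟦X⟧) (φ := M) i) a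

theorem mem_hsub_pi {ι : Type*} {M : ι → Type*} [∀ i, AddCommGroup (M i)]
    [∀ i, Module ℂ⟦X⟧ (M i)] {r : ℕ} {v : ∀ i, M i} :
    v ∈ hsub (∀ i, M i) r ↔ ∀ i, v i ∈ hsub (M i) r := by
  simp only [mem_hsub]
  constructor
  · rintro ⟨u, rfl⟩ i; exact ⟨u i, rfl⟩
  · intro h; choose u hu using h; exact ⟨u, funext hu⟩

/-- Limits are formed pointwise. The quotient of a remainder by `ħ ^ r` is at first only a choice
for every vector; torsion-freeness of `M` makes it unique and therefore linear. -/
instance topFree_hom [TopFree M] : TopFree (N →ₗ[ℂ⟦X⟧] M) where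
  tf v h := LinearMap.ext fun i => TopFree.tf _ (LinearMap.congr_fun h i)
  sep v h := LinearMap.ext fun i => TopFree.sep _ fun r => by
    obtain ⟨u, hu⟩ := h r
    exact ⟨u i, LinearMap.congr_fun hu i⟩
  compl a := by
    let T : N →ₗ[ℂ⟦X⟧] M :=
      { toFun := fun x => hsum fun k => a k x
        map_add' := fun x y => by simp only [map_add, hsum_add]
        map_smul' := fun c x => by simp only [map_smul, hsum_smul]; rfl }
    refine ⟨T, fun r => ?_⟩
    choose u hu using fun x => mem_hsub.1 (hsum_spec (fun k => a k x) r)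
    refine ⟨{ toFun := u, map_add' := fun x y => ?_, map_smul' := fun c x => ?_ },
      LinearMap.ext fun x => ?_⟩
    · apply hpow_inj' r
      rw [smul_add, hu, hu, hu]
      simp only [map_add, hsum_add, smul_add, Finset.sum_add_distrib]; abel
    · apply hpow_inj' r
      rw [smul_comm, RingHom.id_apply, hu, hu]
      simp only [map_smul, hsum_smul, smul_sub, Finset.smul_sum, smul_comm c]
    · simp [hu, T]

/-- Pointwise quotients by `ħ ^ r` are unique, so they assemble to a linear map. Estimates for
operators may thus be made vector by vector. -/
theorem mem_hsub_hom [TopFree M] {r : ℕ} {T : N →ₗ[ℂ⟦X⟧] M} :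
    T ∈ hsub (N →ₗ[ℂ⟦X⟧] M) r ↔ ∀ x, T x ∈ hsub M r := by
  simp only [mem_hsub]
  constructor
  · rintro ⟨u, rfl⟩ i; exact ⟨u i, rfl⟩
  · intro h; choose u hu using h
    refine ⟨{ toFun := u, map_add' := fun x y => ?_, map_smul' := fun c x => ?_ },
      LinearMap.ext fun x => ?_⟩
    · apply hpow_inj' r
      rw [smul_add, hu, hu, hu, map_add]
    · apply hpow_inj' r
      rw [smul_comm, RingHom.id_apply, hu, hu, map_smul]
    · simp [hu]

theorem hsum_hom_apply [TopFree M] (a : ℕ → N →ₗ[ℂ⟦X⟧] M) (x : N) :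
    hsum a x = hsum fun k => a k x :=
  map_hsum (LinearMap.applyₗ x) a

instance topFree_end [TopFree M] : TopFree (Module.End ℂ⟦X⟧ M) := topFree_hom

instance topFree_powerSeries {R : Type*} [Ring R] [Algebra ℂ⟦X⟧ R] [TopFree R] :
    TopFree R⟦X⟧ where
  tf v h := PowerSeries.ext fun i => by
    simpa using TopFree.tf (PowerSeries.coeff i v) (by simpa using congrArg (PowerSeries.coeff i) h)
  sep v h := PowerSeries.ext fun i => TopFree.sep _ fun r => by
    obtain ⟨u, hu⟩ := h r
    exact ⟨PowerSeries.coeff i u, by simpa using congrArg (PowerSeries.coeff i) hu⟩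
  compl a := by
    refine ⟨PowerSeries.mk fun i => hsum fun k => PowerSeries.coeff i (a k), fun r => ?_⟩
    choose u hu using fun i => mem_hsub.1 (hsum_spec (fun k => PowerSeries.coeff i (a k)) r)
    refine ⟨PowerSeries.mk u, PowerSeries.ext fun i => ?_⟩
    simp [hu]

/-- The coefficient map as a `ℂ[[ħ]]`-linear map. -/
def coeffL (R : Type*) [Ring R] [Algebra ℂ⟦X⟧ R] (n : ℕ) : R⟦X⟧ →ₗ[ℂ⟦X⟧] R where
  toFun := PowerSeries.coeff n
  map_add' := by simp
  map_smul' := by simp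

theorem smul_eq_hv_pow (M : Type*) [AddCommGroup M] [Module ℂ⟦X⟧ M] (v : M) (r : ℕ) :
    v ∈ ((Ideal.span {hv}) ^ r • ⊤ : Submodule ℂ⟦X⟧ M) ↔ v ∈ hsub M r := by
  rw [Ideal.span_singleton_pow, Submodule.ideal_span_singleton_smul, mem_hsub]
  constructor
  · rintro ⟨u, -, rfl⟩; exact ⟨u, rfl⟩
  · rintro ⟨u, rfl⟩; exact ⟨u, trivial, rfl⟩

theorem IsTopFree.topFree (h : IsTopFree M) : TopFree M where
  tf := h.1
  sep v hv' := h.2.toIsHausdorff.haus' v fun r => by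
    rw [SModEq.zero, smul_eq_hv_pow, mem_hsub]; exact hv' r
  compl a := by
    obtain ⟨m, hm⟩ := h.2.toIsPrecomplete.prec'
      (fun r => ∑ k ∈ Finset.range r, hv ^ k • a k) (by
        intro r s hrs
        rw [SModEq.comm, SModEq.sub_mem, smul_eq_hv_pow, ← Finset.sum_Ico_eq_sub _ hrs]
        refine Submodule.sum_mem _ fun k hk => ?_
        exact hsub_anti (Finset.mem_Ico.1 hk).1 (smul_mem_hsub _ _))
    refine ⟨m, fun r => mem_hsub.1 ?_⟩
    have := hm r
    rwa [SModEq.comm, SModEq.sub_mem, smul_eq_hv_pow] at this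

end Instances

end

section
/-! ## Power series in `ħ y` -/

section Ev

variable {R : Type*} [Ring R] [Algebra ℂ⟦X⟧ R] [TopFree R]

theorem hsum_mul (a b : ℕ → R) :
    hsum a * hsum b =
      hsum fun n => ∑ p ∈ Finset.HasAntidiagonal.antidiagonal n, a p.1 * b p.2 :=
  hsum_bilin (LinearMap.mul ℂ⟦X⟧ R) a b

theorem mul_hsum (x : R) (a : ℕ → R) : x * hsum a = hsum fun n => x * a n :=
  map_hsum (LinearMap.mulLeft ℂ⟦X⟧ x) a

theorem hsum_mul_right (x : R) (a : ℕ → R) : hsum a * x = hsum fun n => a n * x :=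
  map_hsum (LinearMap.mulRight ℂ⟦X⟧ x) a

/-- `P(ħ y)` for `P ∈ ℂ[[t]]`. -/
def ev (y : R) : ℂ⟦X⟧ →+* R where
  toFun P := hsum fun k => (PowerSeries.C (PowerSeries.coeff k P) : ℂ⟦X⟧) • y ^ k
  map_one' := by
    rw [← hsum_single (1 : R)]
    congr 1; funext k
    rw [PowerSeries.coeff_one]
    split_ifs with h <;> simp [h]
  map_mul' P Q := by
    rw [hsum_mul]
    congr 1; funext n
    rw [PowerSeries.coeff_mul, map_sum, Finset.sum_smul]
    refine Finset.sum_congr rfl fun p hp => ?_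
    rw [smul_mul_smul_comm, ← pow_add, Finset.HasAntidiagonal.mem_antidiagonal.1 hp, map_mul]
  map_zero' := by simp [hsum_zero]
  map_add' P Q := by simp [add_smul, hsum_add]

theorem ev_def (y : R) (P : ℂ⟦X⟧) :
    ev y P = hsum fun k => (PowerSeries.C (PowerSeries.coeff k P) : ℂ⟦X⟧) • y ^ k := rfl

theorem ev_X (y : R) : ev y PowerSeries.X = hv • y := by
  rw [ev_def, hsum_succ, hsum_succ]
  simp [PowerSeries.coeff_X, hsum_zero]

theorem ev_C (y : R) (c : ℂ) : ev y (PowerSeries.C c) = (PowerSeries.C c : ℂ⟦X⟧) • (1 : R) := by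
  rw [ev_def, hsum_succ]
  simp [PowerSeries.coeff_C, hsum_zero]

theorem ev_X_pow_mul (y : R) (r : ℕ) (P : ℂ⟦X⟧) :
    ev y (PowerSeries.X ^ r * P) ∈ hsub R r := by
  rw [map_mul, map_pow, ev_X, smul_pow, smul_mul_assoc]
  exact smul_mem_hsub _ _

theorem commute_hsum {x : R} {a : ℕ → R} (h : ∀ n, Commute x (a n)) : Commute x (hsum a) := by
  rw [Commute, SemiconjBy, mul_hsum, hsum_mul_right]
  exact congrArg hsum (funext fun n => h n)

theorem commute_ev {x y : R} (h : Commute x y) (P : ℂ⟦X⟧) : Commute x (ev y P) :=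
  commute_hsum fun n => (h.pow_right n).smul_right _

theorem map_ev {M : Type*} [AddCommGroup M] [Module ℂ⟦X⟧ M] [TopFree M] (f : R →ₗ[ℂ⟦X⟧] M)
    (y : R) (P : ℂ⟦X⟧) :
    f (ev y P) = hsum fun k => (PowerSeries.C (PowerSeries.coeff k P) : ℂ⟦X⟧) • f (y ^ k) := by
  rw [ev_def, map_hsum]; simp

theorem map_ev_eq {R' : Type*} [Ring R'] [Algebra ℂ⟦X⟧ R'] [TopFree R'] (f : R →ₗ[ℂ⟦X⟧] R')
    {y : R} {y' : R'} (h : ∀ k, f (y ^ k) = y' ^ k) (P : ℂ⟦X⟧) : f (ev y P) = ev y' P := by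
  rw [map_ev, ev_def]; simp only [h]

variable {M N : Type*} [AddCommGroup M] [Module ℂ⟦X⟧ M] [AddCommGroup N] [Module ℂ⟦X⟧ N]
  [TopFree M] [TopFree N]

theorem ev_apply (D : Module.End ℂ⟦X⟧ M) (P : ℂ⟦X⟧) (m : M) :
    ev D P m = hsum fun k => (PowerSeries.C (PowerSeries.coeff k P) : ℂ⟦X⟧) • (D ^ k) m := by
  rw [ev_def, hsum_hom_apply]; rfl

theorem pow_intertwine (f : M →ₗ[ℂ⟦X⟧] N) {D : Module.End ℂ⟦X⟧ M} {D' : Module.End ℂ⟦X⟧ N}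
    {S : Set M} (hS : ∀ m ∈ S, D m ∈ S) (h : ∀ m ∈ S, f (D m) = D' (f m)) (k : ℕ) :
    ∀ m ∈ S, f ((D ^ k) m) = (D' ^ k) (f m) := by
  induction k with
  | zero => simp
  | succ k ih =>
    intro m hm
    rw [pow_succ, pow_succ, Module.End.mul_apply, Module.End.mul_apply, ih _ (hS m hm), h m hm]

theorem ev_intertwine_on (f : M →ₗ[ℂ⟦X⟧] N) {D : Module.End ℂ⟦X⟧ M} {D' : Module.End ℂ⟦X⟧ N}
    {S : Set M} (hS : ∀ m ∈ S, D m ∈ S) (h : ∀ m ∈ S, f (D m) = D' (f m)) (P : ℂ⟦X⟧)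
    {m : M} (hm : m ∈ S) : f (ev D P m) = ev D' P (f m) := by
  rw [ev_apply, ev_apply, map_hsum]
  simp only [map_smul, pow_intertwine f hS h _ m hm]

/-- This is how shifts and the operators `S(ħ∂)`, `S⁻¹(ħ∂)` are carried from one space of series to
another: only the underlying derivation has to be compared. -/
theorem ev_intertwine (f : M →ₗ[ℂ⟦X⟧] N) {D : Module.End ℂ⟦X⟧ M} {D' : Module.End ℂ⟦X⟧ N}
    (h : ∀ m, f (D m) = D' (f m)) (P : ℂ⟦X⟧) (m : M) : f (ev D P m) = ev D' P (f m) :=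
  ev_intertwine_on (S := Set.univ) f (fun _ _ => trivial) (fun m _ => h m) P trivial

/-! ### Exponential and logarithm -/

/-- The series `exp (c t)`. -/
def expS (c : ℂ) : ℂ⟦X⟧ := PowerSeries.rescale c (PowerSeries.exp ℂ)

theorem coeff_expS (c : ℂ) (k : ℕ) : PowerSeries.coeff k (expS c) = c ^ k / k.factorial := by
  simp [expS, PowerSeries.coeff_rescale, PowerSeries.coeff_exp, div_eq_mul_inv]

theorem expS_add (c d : ℂ) : expS (c + d) = expS c * expS d :=
  (PowerSeries.exp_mul_exp_eq_exp_add c d).symm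

theorem expS_zero : expS 0 = 1 := by
  ext k; rw [coeff_expS, PowerSeries.coeff_one]
  rcases k with _ | k <;> simp

/-- The series `log (1 + 2 t) / (2 t)`. -/
def logS : ℂ⟦X⟧ := PowerSeries.mk fun k => (-2) ^ k * (1 / ((k : ℂ) + 1))

/-- `exp (2ħ y)`. -/
def EXP (y : R) : R := ev y (expS 2)

/-- `(2ħ)⁻¹ log (1 + 2ħ b)`. -/
def Flog (b : R) : R := b * ev b logS

theorem geom_two_mul : (PowerSeries.mk fun k => (-2 : ℂ) ^ k) * (1 + 2 * PowerSeries.X) = 1 := by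
  have h2 : (2 : ℂ⟦X⟧) = PowerSeries.C 2 := (map_ofNat PowerSeries.C 2).symm
  ext n
  rw [mul_add, mul_one, h2, ← mul_assoc, mul_comm _ (PowerSeries.C 2), mul_assoc]
  rcases n with _ | n
  · simp
  · simp [PowerSeries.coeff_succ_mul_X, PowerSeries.coeff_one, pow_succ]; ring

theorem deriv_logS : PowerSeries.derivative ℂ (PowerSeries.X * logS) =
    PowerSeries.mk fun k => (-2) ^ k := by
  ext n
  rw [PowerSeries.coeff_derivative, PowerSeries.coeff_succ_X_mul, logS, PowerSeries.coeff_mk,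
    PowerSeries.coeff_mk]
  have : (n : ℂ) + 1 ≠ 0 := Nat.cast_add_one_ne_zero n
  field_simp

theorem hasSubst_X_mul (G : ℂ⟦X⟧) : PowerSeries.HasSubst (PowerSeries.X * G) :=
  PowerSeries.HasSubst.of_constantCoeff_zero' (by simp)

theorem deriv_expS (c : ℂ) :
    PowerSeries.derivative ℂ (expS c) = PowerSeries.C c * expS c := by
  ext n
  rw [PowerSeries.coeff_derivative, PowerSeries.coeff_C_mul, coeff_expS, coeff_expS,
    Nat.factorial_succ, pow_succ]
  have : (n : ℂ) + 1 ≠ 0 := Nat.cast_add_one_ne_zero n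
  have : (n.factorial : ℂ) ≠ 0 := by exact_mod_cast n.factorial_ne_zero
  push_cast
  field_simp

/-- With `g = (1 + 2t)⁻¹`, the composite `E` satisfies `E' = 2 E g`, while `g' = -2 g²`. Hence `E g`
has derivative zero, and its constant term is `1`. -/
theorem expS_subst_log :
    (expS 2).subst (PowerSeries.X * logS) = 1 + 2 * (PowerSeries.X : ℂ⟦X⟧) := by
  set E := (expS 2).subst (PowerSeries.X * logS) with hE
  set g : ℂ⟦X⟧ := PowerSeries.mk fun k => (-2) ^ k with hg
  have h2 : (2 : ℂ⟦X⟧) = PowerSeries.C 2 := (map_ofNat PowerSeries.C 2).symm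
  have hdE : PowerSeries.derivative ℂ E = 2 * E * g := by
    rw [hE, PowerSeries.derivative_subst (hasSubst_X_mul _), deriv_logS, deriv_expS,
      PowerSeries.subst_mul (hasSubst_X_mul _), PowerSeries.subst_C, h2]
    rfl
  have hone : E * g = 1 := by
    apply PowerSeries.derivative.ext
    · have hdg : PowerSeries.derivative ℂ g * (1 + 2 * PowerSeries.X) = - 2 * g := by
        have := congrArg (PowerSeries.derivative ℂ) geom_two_mul
        rw [Derivation.leibniz, ← hg] at this
        have h3 : PowerSeries.derivative ℂ (1 + 2 * (PowerSeries.X : ℂ⟦X⟧)) = 2 := by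
          rw [map_add, Derivation.leibniz, PowerSeries.derivative_X, h2, PowerSeries.derivative_C]
          simp
        rw [h3] at this
        simp only [smul_eq_mul, Derivation.map_one_eq_zero] at this
        linear_combination this
      have hdg' : PowerSeries.derivative ℂ g = -2 * g * g := by
        linear_combination g * hdg - PowerSeries.derivative ℂ g * geom_two_mul
      rw [Derivation.leibniz, hdE, hdg']
      simp only [smul_eq_mul, Derivation.map_one_eq_zero]
      ring
    · rw [map_mul, hE, ← PowerSeries.coeff_zero_eq_constantCoeff_apply,
        PowerSeries.coeff_subst' (hasSubst_X_mul _), finsum_eq_single _ 0]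
      · simp [coeff_expS, hg]
      · intro k hk
        simp [hk, mul_pow]
  linear_combination (1 + 2 * PowerSeries.X) * hone - E * geom_two_mul

/-- Composition: `P(ħ (b G(ħ b))) = (P ∘ (t G))(ħ b)`. -/
theorem ev_subst (b : R) (P G : ℂ⟦X⟧) :
    ev (b * ev b G) P = ev b (P.subst (PowerSeries.X * G)) := by
  symm
  rw [ev_def (b * ev b G)]
  refine hsum_unique fun r => ?_
  have h1 : ∀ k, hv ^ k • (PowerSeries.C (PowerSeries.coeff k P) : ℂ⟦X⟧) • (b * ev b G) ^ k =
      ev b (PowerSeries.C (PowerSeries.coeff k P) * (PowerSeries.X * G) ^ k) := by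
    intro k
    rw [map_mul, ev_C, map_pow, map_mul, ev_X, smul_mul_assoc, one_mul, smul_mul_assoc, smul_pow,
      smul_comm]
  simp only [h1]
  rw [← map_sum, ← map_sub]
  -- The terms of the substitution with index at least `r` contain `X ^ r`, so truncating the outer
  -- series costs only a multiple of `X ^ r`, which `ev` sends into `ħ ^ r R`.
  have h2 : (PowerSeries.X : ℂ⟦X⟧) ^ r ∣ P.subst (PowerSeries.X * G) -
      ∑ k ∈ Finset.range r, PowerSeries.C (PowerSeries.coeff k P) * (PowerSeries.X * G) ^ k := by
    rw [PowerSeries.X_pow_dvd_iff]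
    intro m hm
    rw [map_sub, PowerSeries.coeff_subst' (hasSubst_X_mul _), map_sum, sub_eq_zero]
    rw [finsum_eq_sum_of_support_subset (s := Finset.range r)]
    · simp
    · intro k hk
      by_contra hkr
      simp only [Finset.coe_range, Set.mem_Iio, not_lt] at hkr
      apply hk
      beta_reduce
      rw [mul_pow, PowerSeries.coeff_X_pow_mul', if_neg (by omega), smul_zero]
  obtain ⟨Q, hQ⟩ := h2
  rw [hQ]
  exact ev_X_pow_mul _ _ _

theorem two_smul_hv : (ch 2) = 2 * hv := by rw [ch, map_ofNat]

theorem EXP_Flog (b : R) : EXP (Flog b) = 1 + ch 2 • b := by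
  rw [EXP, Flog, ev_subst, expS_subst_log, map_add, map_one, map_mul, ev_X, map_ofNat,
    two_smul_hv, mul_smul, two_mul, two_smul]

theorem EXP_add {y z : R} (h : Commute y z) : EXP (y + z) = EXP y * EXP z := by
  rw [EXP, EXP, EXP, ev_def, ev_def, ev_def, hsum_mul]
  congr 1; funext n
  rw [h.add_pow', Finset.smul_sum]
  refine Finset.sum_congr rfl fun p hp => ?_
  rw [smul_mul_smul_comm, ← Nat.cast_smul_eq_nsmul ℂ⟦X⟧, smul_smul, ← map_mul, coeff_expS,
    coeff_expS, coeff_expS]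
  obtain rfl := Finset.HasAntidiagonal.mem_antidiagonal.1 hp
  congr 1
  rw [show (((p.1 + p.2).choose p.1 : ℕ) : ℂ⟦X⟧) =
    PowerSeries.C (((p.1 + p.2).choose p.1 : ℕ) : ℂ) by simp, ← map_mul]
  congr 1
  have h1 : (p.1.factorial : ℂ) ≠ 0 := by exact_mod_cast p.1.factorial_ne_zero
  have h2 : (p.2.factorial : ℂ) ≠ 0 := by exact_mod_cast p.2.factorial_ne_zero
  have h3 : ((p.1 + p.2).factorial : ℂ) ≠ 0 := by exact_mod_cast (p.1 + p.2).factorial_ne_zero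
  have h4 : (((p.1 + p.2).choose p.1 : ℕ) : ℂ) * p.1.factorial * p.2.factorial =
      (p.1 + p.2).factorial := by
    have := Nat.add_choose_mul_factorial_mul_factorial p.1 p.2
    rw [← this, Nat.choose_symm_add]; push_cast
    ring
  field_simp
  rw [pow_add, ← h4]; ring

theorem EXP_zero : EXP (0 : R) = 1 := by
  rw [EXP, ev_def, hsum_succ]
  simp [coeff_expS, hsum_zero]

theorem EXP_neg_mul (y : R) : EXP (-y) * EXP y = 1 := by
  rw [← EXP_add (Commute.neg_left (Commute.refl y)), neg_add_cancel, EXP_zero]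

theorem EXP_mul_neg (y : R) : EXP y * EXP (-y) = 1 := by
  rw [← EXP_add (Commute.neg_right (Commute.refl y)), add_neg_cancel, EXP_zero]

theorem commute_Flog {x b : R} (h : Commute x b) : Commute x (Flog b) :=
  h.mul_right (commute_ev h _)

/-- If `y c = 0`, then `exp (2ħ y) m = m + 2ħ c` if and only if `y m = c`. -/
theorem EXP_apply_iff (y : Module.End ℂ⟦X⟧ M) (m c : M) (hc : y c = 0) :
    EXP y m = m + ch 2 • c ↔ y m = c := by
  -- Factor `exp (2t) - 1 = 2t U(t)` with `U(0) = 1`. Then `U(ħy)` is invertible, and since `y c =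
  -- 0` both it and its inverse fix `c`.
  obtain ⟨Q, hQ⟩ : ∃ Q : ℂ⟦X⟧, expS 2 = 1 + PowerSeries.C 2 * PowerSeries.X * (1 + PowerSeries.X * Q) := by
    refine ⟨PowerSeries.mk fun k => PowerSeries.coeff (k + 2) (expS 2) / 2, ?_⟩
    ext n
    rw [mul_assoc]
    rcases n with _ | _ | n
    · simp [coeff_expS]
    · simp [coeff_expS, PowerSeries.coeff_succ_X_mul, PowerSeries.coeff_one]
    · simp [PowerSeries.coeff_succ_X_mul, PowerSeries.coeff_one]; ring
  set U : ℂ⟦X⟧ := 1 + PowerSeries.X * Q with hU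
  have hUunit : U * U⁻¹ = 1 := PowerSeries.mul_inv_cancel _ (by simp [hU])
  have hfix : ∀ P : ℂ⟦X⟧, ev y P c = (PowerSeries.C (PowerSeries.coeff 0 P) : ℂ⟦X⟧) • c := by
    intro P
    rw [ev_apply, hsum_succ]
    simp [pow_succ, hc, hsum_zero]
  have hE : EXP y m = m + ch 2 • ev y U (y m) := by
    rw [EXP, hQ, map_add, map_one, map_mul, map_mul, ev_C, ev_X]
    simp only [LinearMap.add_apply, Module.End.mul_apply, Module.End.one_apply,
      LinearMap.smul_apply]
    rw [ch, mul_smul]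
    congr 3
    have := congrArg (fun T : Module.End ℂ⟦X⟧ M => T m) (commute_ev (Commute.refl y) U).eq
    simpa using this
  have hcancel : ∀ v w : M, ch 2 • v = ch 2 • w → v = w := by
    intro v w h
    rw [ch, mul_smul, mul_smul] at h
    have := congrArg (fun v => (PowerSeries.C (1/2 : ℂ) : ℂ⟦X⟧) • v) h
    simp only [smul_smul, ← mul_assoc, ← map_mul] at this
    norm_num at this
    exact hv_inj this
  rw [hE]
  constructor
  · intro h
    have h1 : ev y U (y m) = c := hcancel _ _ (add_left_cancel h)
    have h2 := congrArg (ev y U⁻¹) h1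
    rw [← Module.End.mul_apply, ← map_mul, mul_comm, hUunit, map_one, hfix] at h2
    simpa [hU] using h2
  · intro h
    rw [h, hfix]
    simp [hU]

end Ev

end

section
/-! ## Convergence -/

section Topology

open Filter Topology

section hTop

variable {M : Type*} [AddCommGroup M] [Module ℂ⟦X⟧ M]

theorem hTop_hasBasis :
    letI := hTop M
    (𝓝 (0 : M)).HasBasis (fun _ : ℕ => True) (fun r => (hsub M r : Set M)) := by
  letI := hTop M
  letI : TopologicalSpace ℂ⟦X⟧ := (Ideal.span {hv}).adicTopology
  have h := ((Ideal.span {hv}).ringFilterBasis.moduleFilterBasis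
    ((Ideal.span {hv}).adic_module_basis M)).toAddGroupFilterBasis.nhds_zero_hasBasis
  refine h.to_hasBasis ?_ ?_
  · rintro V ⟨n, rfl⟩
    exact ⟨n, trivial, fun x hx => (smul_eq_hv_pow M x n).2 hx⟩
  · intro r _
    refine ⟨_, ⟨r, rfl⟩, fun x hx => (smul_eq_hv_pow M x r).1 hx⟩

theorem hTop_isTopologicalAddGroup :
    letI := hTop M
    IsTopologicalAddGroup M :=
  letI : TopologicalSpace ℂ⟦X⟧ := (Ideal.span {hv}).adicTopology
  ((Ideal.span {hv}).ringFilterBasis.moduleFilterBasis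
    ((Ideal.span {hv}).adic_module_basis M)).toAddGroupFilterBasis.isTopologicalAddGroup

theorem hasSum_hTop {ι : Type*} {f : ι → M} {m : M} :
    letI := hTop M
    HasSum f m ↔ ∀ r, ∃ s : Finset ι, ∀ t, s ⊆ t → ∑ i ∈ t, f i - m ∈ hsub M r := by
  letI := hTop M
  haveI := hTop_isTopologicalAddGroup (M := M)
  rw [HasSum, SummationFilter.unconditional_filter, ← tendsto_sub_nhds_zero_iff,
    hTop_hasBasis.tendsto_right_iff]
  simp only [eventually_atTop, true_implies]
  rfl

theorem hTop_t2 [TopFree M] :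
    letI := hTop M
    T2Space M := by
  letI := hTop M
  haveI := hTop_isTopologicalAddGroup (M := M)
  haveI : T1Space M := by
    refine IsTopologicalAddGroup.t1Space M ?_
    rw [← isOpen_compl_iff, isOpen_iff_mem_nhds]
    intro x hx
    have : ∃ r, x ∉ hsub M r := by
      by_contra h
      push Not at h
      exact hx (eq_of_hsub fun r => by simpa using h r)
    obtain ⟨r, hr⟩ := this
    rw [← map_add_left_nhds_zero x, mem_map]
    refine hTop_hasBasis.mem_of_superset (i := r) trivial ?_ 
    intro y hy h0
    apply hr
    have : x = -y := eq_neg_of_add_eq_zero_left h0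
    rw [this]; exact (hsub M r).neg_mem hy
  infer_instance

/-- A family whose terms tend to zero. -/
def UFin {ι : Type*} (f : ι → M) : Prop := ∀ r, {i | f i ∉ hsub M r}.Finite

/-- Let `B r` be the finite set of indices whose terms are not divisible by `ħ ^ r`. The sums over
`B (r + 1)` and `B r` differ by a multiple of `ħ ^ r`, so the total is a telescoping `hsum`. -/
theorem exists_fsum [TopFree M] {ι : Type*} {f : ι → M} (hf : UFin f) :
    ∃ m : M, ∀ r (s : Finset ι), (∀ i ∉ s, f i ∈ hsub M r) → m - ∑ i ∈ s, f i ∈ hsub M r := by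
  classical
  set B : ℕ → Finset ι := fun r => (hf r).toFinset with hB
  have hBm : ∀ r, ∀ i ∉ B r, f i ∈ hsub M r := fun r i hi => by
    by_contra h; exact hi (by simpa [hB] using h)
  have hBs : ∀ r s : ℕ, r ≤ s → B r ⊆ B s := fun r s hrs i hi => by
    simp only [hB, Set.Finite.mem_toFinset, Set.mem_ofPred_eq] at hi ⊢
    exact fun h => hi (hsub_anti hrs h)
  have hcomp : ∀ r (s : Finset ι), (∀ i ∉ s, f i ∈ hsub M r) →
      ∑ i ∈ s, f i - ∑ i ∈ B r, f i ∈ hsub M r := by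
    intro r s hs
    have hsub' : B r ⊆ s := fun i hi => by
      by_contra h
      simp only [hB, Set.Finite.mem_toFinset, Set.mem_ofPred_eq] at hi
      exact hi (hs i h)
    rw [← Finset.sum_sdiff hsub', add_sub_cancel_right]
    exact Submodule.sum_mem _ fun i hi => hBm r i (Finset.mem_sdiff.1 hi).2
  have hdiff : ∀ r, ∃ u : M, hv ^ r • u = ∑ i ∈ B (r + 1), f i - ∑ i ∈ B r, f i := fun r =>
    mem_hsub.1 (hcomp r _ fun i hi => hsub_anti (Nat.le_succ r) (hBm _ i hi))
  choose a ha using hdiff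
  have hB0 : B 0 = ∅ := by
    ext i; simp [hB, hsub_zero]
  refine ⟨hsum a, fun r s hs => ?_⟩
  have h1 : ∑ k ∈ Finset.range r, hv ^ k • a k = ∑ i ∈ B r, f i := by
    simp only [ha]
    rw [Finset.sum_range_sub (fun k => ∑ i ∈ B k, f i), hB0]; simp
  have h2 := (hsub M r).sub_mem (hsum_spec a r) (hcomp r s hs)
  rw [h1] at h2
  simpa using h2

theorem hasSum_of_spec {ι : Type*} {f : ι → M} (hf : UFin f) {m : M}
    (h : ∀ r (s : Finset ι), (∀ i ∉ s, f i ∈ hsub M r) → m - ∑ i ∈ s, f i ∈ hsub M r) :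
    letI := hTop M
    HasSum f m := by
  rw [hasSum_hTop]
  intro r
  refine ⟨(hf r).toFinset, fun t ht => ?_⟩
  rw [← neg_sub]
  refine (hsub M r).neg_mem (h r t fun i hi => ?_)
  by_contra h'
  exact hi (ht (by simpa using h'))

theorem UFin.summable [TopFree M] {ι : Type*} {f : ι → M} (hf : UFin f) :
    letI := hTop M
    Summable f := by
  obtain ⟨m, hm⟩ := exists_fsum hf
  exact ⟨m, hasSum_of_spec hf hm⟩

theorem UFin.map {N : Type*} [AddCommGroup N] [Module ℂ⟦X⟧ N] {ι : Type*} {f : ι → M}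
    (hf : UFin f) (T : M →ₗ[ℂ⟦X⟧] N) : UFin fun i => T (f i) := fun r =>
  (hf r).subset fun _ hi h => hi (map_mem_hsub T h)

theorem UFin.of_finite {ι : Type*} {f : ι → M} (hf : {i | f i ≠ 0}.Finite) : UFin f := fun r =>
  hf.subset fun _ hi h => hi (h ▸ (hsub M r).zero_mem)

end hTop

section End

variable {W : Type*} [AddCommGroup W] [Module ℂ⟦X⟧ W]

theorem hasSum_end {ι : Type*} {f : ι → Module.End ℂ⟦X⟧ W} {T : Module.End ℂ⟦X⟧ W} :
    HasSum f T ↔ ∀ w, letI := hTop W; HasSum (fun i => f i w) (T w) := by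
  letI : TopologicalSpace W := hTop W
  let φ : Module.End ℂ⟦X⟧ W →+ (W → W) :=
    { toFun := fun T w => T w, map_zero' := rfl, map_add' := fun _ _ => rfl }
  have hφ : Topology.IsInducing φ := ⟨rfl⟩
  rw [← hφ.hasSum_iff, Pi.hasSum]
  rfl

instance end_isTopologicalAddGroup : IsTopologicalAddGroup (Module.End ℂ⟦X⟧ W) := by
  letI : TopologicalSpace W := hTop W
  haveI := hTop_isTopologicalAddGroup (M := W)
  let φ : Module.End ℂ⟦X⟧ W →+ (W → W) :=
    { toFun := fun T w => T w, map_zero' := rfl, map_add' := fun _ _ => rfl }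
  exact topologicalAddGroup_induced φ

instance end_t2 [TopFree W] : T2Space (Module.End ℂ⟦X⟧ W) := by
  letI : TopologicalSpace W := hTop W
  haveI := hTop_t2 (M := W)
  have hcont : Continuous (fun (T : Module.End ℂ⟦X⟧ W) (w : W) => T w) := continuous_induced_dom
  exact T2Space.of_injective_continuous (fun S T h => LinearMap.ext fun w => congrFun h w) hcont

/-- A family of operators which tends pointwise to zero. -/
def PFin {ι : Type*} (f : ι → Module.End ℂ⟦X⟧ W) : Prop := ∀ w, UFin fun i => f i w

theorem UFin.pFin {ι : Type*} {f : ι → Module.End ℂ⟦X⟧ W} (hf : UFin f) : PFin f := fun w =>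
  hf.map (LinearMap.applyₗ w)

variable [TopFree W] {ι : Type*} {f g : ι → Module.End ℂ⟦X⟧ W}

/-- The values are summed vector by vector; linearity of the result is uniqueness of limits in the
Hausdorff space `W`. The second component keeps the error estimate that a bare `HasSum` would hide.
-/
theorem PFin.exists_hasSum (hf : PFin f) : ∃ T : Module.End ℂ⟦X⟧ W, HasSum f T ∧
    ∀ w r (s : Finset ι), (∀ i ∉ s, f i w ∈ hsub W r) → T w - ∑ i ∈ s, f i w ∈ hsub W r := by
  choose T hT using fun w => exists_fsum (hf w)
  have hsum : ∀ w, letI := hTop W; HasSum (fun i => f i w) (T w) := fun w =>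
    hasSum_of_spec (hf w) (hT w)
  letI : TopologicalSpace W := hTop W
  haveI := hTop_isTopologicalAddGroup (M := W)
  haveI := hTop_t2 (M := W)
  let T' : Module.End ℂ⟦X⟧ W :=
    { toFun := T
      map_add' := fun x y => (hsum (x + y)).unique (by simpa using (hsum x).add (hsum y))
      map_smul' := fun c x => by
        refine (hsum (c • x)).unique ?_
        have := hsum x
        rw [hasSum_hTop] at this ⊢
        intro r
        obtain ⟨s, hs⟩ := this r
        refine ⟨s, fun t ht => ?_⟩
        have := (hsub W r).smul_mem c (hs t ht)
        simpa [smul_sub, Finset.smul_sum] using this }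
  exact ⟨T', hasSum_end.2 hsum, hT⟩

theorem PFin.summable (hf : PFin f) : Summable f :=
  let ⟨T, hT, _⟩ := hf.exists_hasSum; ⟨T, hT⟩

theorem PFin.tsum_sub_mem (hf : PFin f) (w : W) (r : ℕ) (s : Finset ι)
    (h : ∀ i ∉ s, f i w ∈ hsub W r) : (∑' i, f i) w - ∑ i ∈ s, f i w ∈ hsub W r := by
  obtain ⟨T, hT, hT'⟩ := hf.exists_hasSum
  rw [hT.tsum_eq]; exact hT' w r s h

theorem PFin.tsum_mem (hf : PFin f) (w : W) (r : ℕ)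
    (h : ∀ i, f i w ∈ hsub W r) : (∑' i, f i) w ∈ hsub W r := by
  simpa using hf.tsum_sub_mem w r ∅ fun i _ => h i

theorem hasSum_mul_left {T : Module.End ℂ⟦X⟧ W} (hf : HasSum f T) (S : Module.End ℂ⟦X⟧ W) :
    HasSum (fun i => S * f i) (S * T) := by
  rw [hasSum_end] at hf ⊢
  intro w
  have := hf w
  rw [hasSum_hTop] at this ⊢
  intro r
  obtain ⟨s, hs⟩ := this r
  refine ⟨s, fun t ht => ?_⟩
  have := map_mem_hsub S (hs t ht)
  simpa using this

theorem hasSum_mul_right {T : Module.End ℂ⟦X⟧ W} (hf : HasSum f T) (S : Module.End ℂ⟦X⟧ W) :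
    HasSum (fun i => f i * S) (T * S) := by
  rw [hasSum_end] at hf ⊢
  exact fun w => hf (S w)

theorem PFin.tsum_mul_left (hf : PFin f) (S : Module.End ℂ⟦X⟧ W) :
    ∑' i, S * f i = S * ∑' i, f i :=
  (hasSum_mul_left hf.summable.hasSum S).tsum_eq

theorem PFin.tsum_mul_right (hf : PFin f) (S : Module.End ℂ⟦X⟧ W) :
    ∑' i, f i * S = (∑' i, f i) * S :=
  (hasSum_mul_right hf.summable.hasSum S).tsum_eq

theorem PFin.mul_left (hf : PFin f) (S : Module.End ℂ⟦X⟧ W) : PFin fun i => S * f i :=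
  fun w => (hf w).map S

theorem PFin.mul_right (hf : PFin f) (S : Module.End ℂ⟦X⟧ W) : PFin fun i => f i * S :=
  fun w => hf (S w)

theorem UFin.comp {M : Type*} [AddCommGroup M] [Module ℂ⟦X⟧ M] {κ : Type*} {f : ι → M}
    (hf : UFin f) {e : κ → ι} (he : Function.Injective e) : UFin fun i => f (e i) := fun r =>
  (hf r).preimage he.injOn

theorem PFin.comp {κ : Type*} (hf : PFin f) {e : κ → ι} (he : Function.Injective e) :
    PFin fun i => f (e i) := fun w => (hf w).comp he

theorem tsum_hpow (a : ℕ → Module.End ℂ⟦X⟧ W) : ∑' k, hv ^ k • a k = hsum a := by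
  refine (hasSum_end.2 fun w => ?_).tsum_eq
  rw [hasSum_hTop]
  intro r
  refine ⟨Finset.range r, fun t ht => ?_⟩
  rw [← Finset.sum_sdiff ht, add_sub_assoc]
  refine (hsub W r).add_mem (Submodule.sum_mem _ fun i hi => ?_) ?_
  · have : r ≤ i := by simpa using (Finset.mem_sdiff.1 hi).2
    exact hsub_anti this (smul_mem_hsub i _)
  · rw [← neg_sub]
    have := mem_hsub_hom.1 (hsum_spec a r) w
    simpa using (hsub W r).neg_mem this

/-- A linear map preserves divisibility by `ħ ^ r`, hence limits of partial sums. Uniform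
convergence is demanded in the source because its topology is `ħ`-adic; the target has only the
pointwise topology. -/
theorem map_tsum_of_uFin {M : Type*} [AddCommGroup M] [Module ℂ⟦X⟧ M] [TopFree M]
    {f : ι → M} (hf : UFin f) (π : M →ₗ[ℂ⟦X⟧] Module.End ℂ⟦X⟧ W) :
    π (letI := hTop M; ∑' i, f i) = ∑' i, π (f i) := by
  letI := hTop M
  haveI := hTop_t2 (M := M)
  obtain ⟨m, hm⟩ := hf.summable
  rw [hm.tsum_eq]
  refine ((hasSum_end.2 fun w => ?_).tsum_eq).symm
  rw [hasSum_hTop] at hm ⊢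
  intro r
  obtain ⟨s, hs⟩ := hm r
  refine ⟨s, fun t ht => ?_⟩
  have := map_mem_hsub ((LinearMap.applyₗ w).comp π) (hs t ht)
  simpa using this

end End

end Topology

end

section
/-! ## Double Yangian modules in terms of relations between operators -/

section Small

variable {R : Type*} [Ring R] [Algebra ℂ⟦X⟧ R]

theorem mul_mem_hsub_left {r : ℕ} {x : R} (y : R) (h : x ∈ hsub R r) : y * x ∈ hsub R r :=
  map_mem_hsub (LinearMap.mulLeft ℂ⟦X⟧ y) h

theorem mul_mem_hsub_right {r : ℕ} {x : R} (y : R) (h : x ∈ hsub R r) : x * y ∈ hsub R r :=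
  map_mem_hsub (LinearMap.mulRight ℂ⟦X⟧ y) h

theorem mul_mem_hsub {r s : ℕ} {x y : R} (h : x ∈ hsub R r) (h' : y ∈ hsub R s) :
    x * y ∈ hsub R (r + s) := by
  obtain ⟨u, rfl⟩ := mem_hsub.1 h
  obtain ⟨v, rfl⟩ := mem_hsub.1 h'
  exact mem_hsub.2 ⟨u * v, by rw [smul_mul_smul_comm, pow_add]⟩

theorem pow_mem_hsub {x : R} (h : x ∈ hsub R 1) (n : ℕ) : x ^ n ∈ hsub R n := by
  induction n with
  | zero => exact hsub_zero _
  | succ n ih => rw [pow_succ]; exact mul_mem_hsub ih h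

theorem zsmul_mem_hsub {M : Type*} [AddCommGroup M] [Module ℂ⟦X⟧ M] {r : ℕ} {x : M} (n : ℤ)
    (h : x ∈ hsub M r) : n • x ∈ hsub M r :=
  (hsub M r).toAddSubgroup.zsmul_mem h n

theorem ch_smul_mem (c : ℂ) (x : R) : ch c • x ∈ hsub R 1 := by
  rw [ch, mul_smul]
  have := (hsub R 1).smul_mem (PowerSeries.C c) (smul_mem_hsub 1 x)
  simpa using this

theorem hb_mem (c : ℂ) : Gens.hb R c ∈ hsub R 1 := by
  rw [Gens.hb, Algebra.algebraMap_eq_smul_one]; exact ch_smul_mem c 1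

theorem kh_mem {I : Type*} (g : Gens I R) (c : ℂ) : g.kh c ∈ hsub R 1 := ch_smul_mem c _

/-- The coefficient of `u ^ m` is divisible by `ħ ^ m`. -/
def HSer (f : R⟦X⟧) : Prop := ∀ m, PowerSeries.coeff m f ∈ hsub R m

theorem HSer.mul {f f' : R⟦X⟧} (h : HSer f) (h' : HSer f') : HSer (f * f') := fun m => by
  rw [PowerSeries.coeff_mul]
  refine Submodule.sum_mem _ fun p hp => ?_
  rw [← Finset.HasAntidiagonal.mem_antidiagonal.1 hp]
  exact mul_mem_hsub (h _) (h' _)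

theorem hser_ratio {μ ν : R} (hμ : μ ∈ hsub R 1) (hν : ν ∈ hsub R 1) : HSer (ratio μ ν) := by
  refine HSer.mul (fun m => ?_) fun m => ?_
  · rcases m with _ | _ | m
    · exact hsub_zero _
    · simpa [PowerSeries.coeff_succ_mul_X, PowerSeries.coeff_one] using hμ
    · simp [PowerSeries.coeff_succ_mul_X, PowerSeries.coeff_one]
  · rw [PowerSeries.coeff_mk]
    exact pow_mem_hsub ((hsub R 1).neg_mem hν) m

theorem expandZW_mem {f : R⟦X⟧} (hf : HSer f) (p q : ℤ) :
    expandZW f p q ∈ hsub R (-(p + q)).toNat := by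
  rw [expandZW]
  split_ifs with h
  · exact zsmul_mem_hsub _ (hf _)
  · exact Submodule.zero_mem _

/-- The kernel requires `0 ≤ q` and `p + q ≤ 0`, while `D` has no positive powers of `z`. This
leaves finitely many terms, whatever the coefficients of `f` are. -/
theorem uFin_dmul_ZW {f : R⟦X⟧} {D : ℤ → ℤ → R}
    (hD : ∀ m n, 0 < m → D m n = 0) (m n : ℤ) :
    UFin fun p : ℤ × ℤ => D (m - p.1) (n - p.2) * expandZW f p.1 p.2 := by
  refine UFin.of_finite ((Finset.Icc m 0 ×ˢ Finset.Icc 0 (-m)).finite_toSet.subset ?_)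
  rintro ⟨p, q⟩ h
  simp only [Set.mem_ofPred_eq, expandZW] at h
  have h1 : m - p ≤ 0 := by
    by_contra h'
    exact h (by rw [hD _ _ (not_le.1 h'), zero_mul])
  have h2 : 0 ≤ q ∧ p + q ≤ 0 := by
    by_contra h'
    exact h (by rw [if_neg h', mul_zero])
  simp; omega

/-- Here the exponent of `w` in the kernel is not bounded below and the sum may be infinite. It
converges because the coefficient of `x ^ (-m)` in `f` is divisible by `ħ ^ m`. -/
theorem uFin_dmul_WZ {f : R⟦X⟧} (hf : HSer f) {D : ℤ → ℤ → R}
    (hD : ∀ m n, m < 0 → D m n = 0) (m n : ℤ) :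
    UFin fun p : ℤ × ℤ => D (m - p.1) (n - p.2) * expandWZ f p.1 p.2 := by
  intro r
  refine (Finset.Icc 0 m ×ˢ Finset.Icc (-r - m) 0).finite_toSet.subset ?_
  rintro ⟨p, q⟩ h
  simp only [Set.mem_ofPred_eq, expandWZ] at h
  have h1 : 0 ≤ m - p := by
    by_contra h'
    exact h (by rw [hD _ _ (not_le.1 h'), zero_mul]; exact Submodule.zero_mem _)
  have h2 : 0 ≤ p ∧ q + p ≤ 0 := by
    by_contra h'
    exact h (by rw [expandZW, if_neg h', mul_zero]; exact Submodule.zero_mem _)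
  have h3 : (-(q + p)).toNat < r := by
    by_contra h'
    exact h (mul_mem_hsub_left _ (hsub_anti (not_lt.1 h') (expandZW_mem hf q p)))
  simp; omega

theorem uFin_wmul_delta {c : R} (hc : c ∈ hsub R 1) (a : ℤ → R) (m n : ℤ) :
    UFin fun k : ℤ => a (n - k) * delta c m k := by
  intro r
  refine (Finset.Icc (min (-r - m - 1) n) (-m - 1)).finite_toSet.subset ?_
  intro k h
  simp only [Set.mem_ofPred_eq, delta] at h
  have h2 : m + k + 1 ≤ 0 := by
    by_contra h'
    exact h (by rw [if_neg h', mul_zero]; exact Submodule.zero_mem _)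
  have h3 : (-m - 1 - k).toNat < r := by
    by_contra h'
    rw [if_pos h2] at h
    exact h (mul_mem_hsub_left _ (hsub_anti (not_lt.1 h') (zsmul_mem_hsub _ (pow_mem_hsub hc _))))
  simp; omega

theorem uFin_fshift {μ : R} (hμ : μ ∈ hsub R 1) (a : ℤ → R) (n : ℤ) :
    UFin fun k : ℕ => Ring.choose (n + (k : ℤ)) k • (μ ^ k * a (n + k)) := by
  intro r
  refine (Finset.range r).finite_toSet.subset fun k hk => ?_
  by_contra h
  simp only [Finset.coe_range, Set.mem_Iio, not_lt] at h
  exact hk (zsmul_mem_hsub _ (mul_mem_hsub_right _ (hsub_anti h (pow_mem_hsub hμ k))))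

end Small

section Map

variable {I : Type*} {R R' : Type*} [Ring R] [Algebra ℂ⟦X⟧ R] [TopologicalSpace R]
  [Ring R'] [Algebra ℂ⟦X⟧ R'] [TopologicalSpace R']

/-- A homomorphism which is compatible with the sums of families tending to zero. -/
def HCont (π : R →ₐ[ℂ⟦X⟧] R') : Prop :=
  ∀ {ι : Type} (f : ι → R), UFin f → π (∑' i, f i) = ∑' i, π (f i)

variable {π : R →ₐ[ℂ⟦X⟧] R'} (hπ : HCont π) (g : Gens I R)

theorem map_expandZW (π : R →ₐ[ℂ⟦X⟧] R') (f : R⟦X⟧) (p q : ℤ) :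
    π (expandZW f p q) = expandZW (PowerSeries.map (π : R →+* R') f) p q := by
  rw [expandZW, expandZW]
  split_ifs <;> simp

theorem map_expandWZ (π : R →ₐ[ℂ⟦X⟧] R') (f : R⟦X⟧) (p q : ℤ) :
    π (expandWZ f p q) = expandWZ (PowerSeries.map (π : R →+* R') f) p q :=
  map_expandZW π f q p

theorem map_ratio (π : R →ₐ[ℂ⟦X⟧] R') (μ ν : R) :
    PowerSeries.map (π : R →+* R') (ratio μ ν) = ratio (π μ) (π ν) := by
  rw [ratio, ratio, map_mul]
  congr 1
  · simp
  · ext n; simp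

theorem map_hb (π : R →ₐ[ℂ⟦X⟧] R') (c : ℂ) : π (Gens.hb R c) = Gens.hb R' c := by
  simp [Gens.hb]

theorem map_kh (π : R →ₐ[ℂ⟦X⟧] R') (c : ℂ) : π (g.kh c) = (g.map π).kh c := by
  simp [Gens.kh, Gens.map]

theorem map_Hc (π : R →ₐ[ℂ⟦X⟧] R') (s : ℤˣ) (i : I) (e : ℤ) :
    π (g.Hc s i e) = (g.map π).Hc s i e := by
  simp only [Gens.Hc, Gens.A, fone, map_add, map_smul, Gens.map]
  split_ifs <;> simp

theorem map_Xc (π : R →ₐ[ℂ⟦X⟧] R') (s : ℤˣ) (i : I) (e : ℤ) :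
    π (g.Xc s i e) = (g.map π).Xc s i e := rfl

theorem map_delta (π : R →ₐ[ℂ⟦X⟧] R') (c : R) (p q : ℤ) :
    π (delta c p q) = delta (π c) p q := by
  rw [delta, delta]
  split_ifs <;> simp

include hπ in
theorem map_fshift {μ : R} (hμ : μ ∈ hsub R 1) (a : ℤ → R) (n : ℤ) :
    π (fshift μ a n) = fshift (π μ) (fun e => π (a e)) n := by
  rw [fshift, hπ _ (uFin_fshift hμ a n), fshift]
  simp

theorem Hc_one_eq_zero (i : I) {e : ℤ} (h : 0 < e) : g.Hc 1 i e = 0 := by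
  simp [Gens.Hc, Gens.A, fone, h.ne', not_lt.2 h.le]

theorem Hc_neg_eq_zero (i : I) {e : ℤ} (h : e < 0) : g.Hc (-1) i e = 0 := by
  have : ¬ (-1 : ℤˣ) = 1 := by decide
  simp [Gens.Hc, Gens.A, fone, h.ne, not_le.2 h, this]

include hπ in
theorem map_dmul_ZW {f : R⟦X⟧} {D : ℤ → ℤ → R}
    (hD : ∀ m n, 0 < m → D m n = 0) (m n : ℤ) :
    π (dmul D (expandZW f) m n) =
      dmul (fun m n => π (D m n)) (expandZW (PowerSeries.map (π : R →+* R') f)) m n := by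
  rw [dmul, hπ _ (uFin_dmul_ZW hD m n), dmul]
  simp only [map_mul, map_expandZW]

include hπ in
theorem map_dmul_WZ {f : R⟦X⟧} (hf : HSer f) {D : ℤ → ℤ → R}
    (hD : ∀ m n, m < 0 → D m n = 0) (m n : ℤ) :
    π (dmul D (expandWZ f) m n) =
      dmul (fun m n => π (D m n)) (expandWZ (PowerSeries.map (π : R →+* R') f)) m n := by
  rw [dmul, hπ _ (uFin_dmul_WZ hf hD m n), dmul]
  simp only [map_mul, map_expandWZ]

theorem map_dy1 (π : R →ₐ[ℂ⟦X⟧] R') (s : ℤˣ) (i j : I) (m n : ℤ) :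
    π (g.dy1 s i j m n) = (g.map π).dy1 s i j m n := by
  simp [Gens.dy1, zw, wz, map_Hc]

include hπ in
theorem map_dy2 (a : ℂ) (i j : I) (m n : ℤ) :
    π (g.dy2 a i j m n) = (g.map π).dy2 a i j m n := by
  simp only [Gens.dy2, Pi.sub_apply, map_sub]
  rw [map_dmul_ZW hπ (fun m n h => by simp [wz, Hc_one_eq_zero g i h])]
  simp only [map_mul, map_ratio, map_sub, map_add, map_neg, map_hb, map_kh]
  congr 2
  · simp [zw, map_Hc]
  · funext m n; simp [wz, map_Hc]

include hπ in
theorem map_dy3 (a : ℂ) (s : ℤˣ) (i j : I) (m n : ℤ) :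
    π (g.dy3 a s i j m n) = (g.map π).dy3 a s i j m n := by
  simp only [Gens.dy3, Pi.sub_apply, map_sub]
  rw [map_dmul_ZW hπ (fun m n h => by simp [wz, Hc_one_eq_zero g i h])]
  congr 2
  · simp [zw, map_Hc, map_Xc]
  · funext m n; simp [wz, map_Hc, map_Xc]
  · split_ifs <;> simp only [map_ratio, map_sub, map_add, map_neg, map_hb, map_kh]

include hπ in
theorem map_dy4 (a : ℂ) (s : ℤˣ) (i j : I) (m n : ℤ) :
    π (g.dy4 a s i j m n) = (g.map π).dy4 a s i j m n := by
  simp only [Gens.dy4, Pi.sub_apply, map_sub]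
  rw [map_dmul_WZ hπ]
  · congr 2
    · simp [zw, map_Hc, map_Xc]
    · funext m n; simp [wz, map_Hc, map_Xc]
    · split_ifs <;> simp only [map_ratio, map_sub, map_add, map_neg, map_hb, map_kh]
  · split_ifs
    · exact hser_ratio (Submodule.add_mem _ (Submodule.neg_mem _ (hb_mem _)) (kh_mem _ _))
        (Submodule.add_mem _ (hb_mem _) (kh_mem _ _))
    · exact hser_ratio (Submodule.sub_mem _ (hb_mem _) (kh_mem _ _))
        (Submodule.sub_mem _ (Submodule.neg_mem _ (hb_mem _)) (kh_mem _ _))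
  · intro m n h; simp [wz, Hc_neg_eq_zero g i h]

include hπ in
theorem map_dy5 [DecidableEq I] (i j : I) (m n : ℤ) :
    π (g.dy5 i j m n) = (g.map π).dy5 i j m n := by
  have key : ∀ (c d : ℂ) (s : ℤˣ), π (wmul (fshift (g.kh c) (g.Hc s i)) (delta (g.kh d)) m n) =
      wmul (fshift ((g.map π).kh c) ((g.map π).Hc s i)) (delta ((g.map π).kh d)) m n := by
    intro c d s
    rw [wmul, hπ, wmul]
    · simp only [map_mul, map_delta, map_kh, map_fshift hπ (kh_mem g c), map_Hc]
    · exact uFin_wmul_delta (kh_mem g d) _ m n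
  simp only [Gens.dy5]
  split_ifs
  · simp only [Pi.sub_apply, Pi.smul_apply, map_sub, map_smul, key]
    simp [zw, wz, map_Xc]
  · simp [zw, wz, map_Xc]

theorem map_dy6 (π : R →ₐ[ℂ⟦X⟧] R') (a : ℂ) (s : ℤˣ) (i j : I) (m n : ℤ) :
    π (g.dy6 a s i j m n) = (g.map π).dy6 a s i j m n := by
  simp [Gens.dy6, zw, wz, map_Xc, mulSub, map_hb]

theorem map_dy7 (π : R →ₐ[ℂ⟦X⟧] R') (s : ℤˣ) (i j : I) (m n : ℤ) :
    π (g.dy7 s i j m n) = (g.map π).dy7 s i j m n := by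
  simp [Gens.dy7, zw, wz, map_Xc]

theorem map_serre (π : R →ₐ[ℂ⟦X⟧] R') (a b : ℤ → R) (m₁ m₂ n : ℤ) :
    π (serre a b m₁ m₂ n) = serre (fun e => π (a e)) (fun e => π (b e)) m₁ m₂ n := by
  have h2 : π (2 : R) = 2 := map_ofNat π 2
  simp [serre, h2]

-- Apart from finite algebraic operations, the relators involve only sums of families tending to
-- zero, and `HCont` lets the homomorphism pass through those.
include hπ in
theorem relator_map_iff [DecidableEq I] (A : Matrix I I ℤ) (y : R') :
    (g.map π).Relator A y ↔ ∃ x, g.Relator A x ∧ π x = y := by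
  constructor
  · rintro (⟨s, i, j, m, n⟩ | ⟨i, j, m, n⟩ | ⟨s, i, j, m, n⟩ | ⟨s, i, j, m, n⟩ | ⟨i, j, m, n⟩ |
      ⟨s, i, j, m, n⟩ | ⟨s, i, j, m, n, h⟩ | ⟨s, i, j, m₁, m₂, n, h⟩)
    · exact ⟨_, .dy1 s i j m n, map_dy1 g π s i j m n⟩
    · exact ⟨_, .dy2 i j m n, map_dy2 hπ g _ i j m n⟩
    · exact ⟨_, .dy3 s i j m n, map_dy3 hπ g _ s i j m n⟩
    · exact ⟨_, .dy4 s i j m n, map_dy4 hπ g _ s i j m n⟩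
    · exact ⟨_, .dy5 i j m n, map_dy5 hπ g i j m n⟩
    · exact ⟨_, .dy6 s i j m n, map_dy6 g π _ s i j m n⟩
    · exact ⟨_, .dy7 s i j m n h, map_dy7 g π s i j m n⟩
    · exact ⟨_, .dy8 s i j m₁ m₂ n h, map_serre π _ _ m₁ m₂ n⟩
  · rintro ⟨x, hx, rfl⟩
    rcases hx with (⟨s, i, j, m, n⟩ | ⟨i, j, m, n⟩ | ⟨s, i, j, m, n⟩ | ⟨s, i, j, m, n⟩ |
      ⟨i, j, m, n⟩ | ⟨s, i, j, m, n⟩ | ⟨s, i, j, m, n, h⟩ | ⟨s, i, j, m₁, m₂, n, h⟩)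
    · rw [map_dy1]; exact .dy1 s i j m n
    · rw [map_dy2 hπ]; exact .dy2 i j m n
    · rw [map_dy3 hπ]; exact .dy3 s i j m n
    · rw [map_dy4 hπ]; exact .dy4 s i j m n
    · rw [map_dy5 hπ]; exact .dy5 i j m n
    · rw [map_dy6]; exact .dy6 s i j m n
    · rw [map_dy7]; exact .dy7 s i j m n h
    · rw [map_serre]; exact .dy8 s i j m₁ m₂ n h

end Map

/-! ### The algebra `Ã[[ħ]]` -/

section Atilde

variable {I : Type*}

theorem coeff_smul_atilde (c : ℂ⟦X⟧) (x : (Atilde I)⟦X⟧) :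
    c • x = PowerSeries.map (algebraMap ℂ (Atilde I)) c * x := rfl

theorem hv_pow_smul_atilde (r : ℕ) (x : (Atilde I)⟦X⟧) :
    hv ^ r • x = PowerSeries.X ^ r * x := by
  rw [coeff_smul_atilde]; simp

theorem mem_hsub_atilde {r : ℕ} {x : (Atilde I)⟦X⟧} :
    x ∈ hsub (Atilde I)⟦X⟧ r ↔ ∀ n < r, PowerSeries.coeff n x = 0 := by
  rw [mem_hsub]
  constructor
  · rintro ⟨u, rfl⟩ n hn
    rw [hv_pow_smul_atilde, PowerSeries.coeff_X_pow_mul', if_neg (by omega)]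
  · intro h
    refine ⟨PowerSeries.mk fun n => PowerSeries.coeff (n + r) x, ?_⟩
    rw [hv_pow_smul_atilde]
    ext n
    rw [PowerSeries.coeff_X_pow_mul']
    split_ifs with hn
    · simp [Nat.sub_add_cancel hn]
    · rw [h n (by omega)]

instance topFree_atilde : TopFree (Atilde I)⟦X⟧ where
  tf v h := by
    ext n
    have := congrArg (PowerSeries.coeff (n + 1)) h
    have h1 := hv_pow_smul_atilde 1 v
    rw [pow_one, pow_one] at h1
    rwa [h1, PowerSeries.coeff_succ_X_mul, map_zero] at this
  sep v h := by
    ext n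
    exact mem_hsub_atilde.1 (mem_hsub.2 (h (n + 1))) n (Nat.lt_succ_self n)
  compl a := by
    refine ⟨PowerSeries.mk fun n => ∑ k ∈ Finset.range (n + 1), PowerSeries.coeff (n - k) (a k),
      fun r => mem_hsub.1 (mem_hsub_atilde.2 fun n hn => ?_)⟩
    rw [map_sub, map_sum, PowerSeries.coeff_mk, sub_eq_zero]
    rw [← Finset.sum_subset (s₁ := Finset.range (n + 1)) (Finset.range_mono hn)]
    · refine Finset.sum_congr rfl fun k hk => ?_
      rw [hv_pow_smul_atilde, PowerSeries.coeff_X_pow_mul', if_pos]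
      simp at hk; omega
    · intro k _ hk
      rw [hv_pow_smul_atilde, PowerSeries.coeff_X_pow_mul', if_neg]
      simp at hk; omega

end Atilde

section Modules

open Topology Filter

variable {I W : Type*} [AddCommGroup W] [Module ℂ⟦X⟧ W]

theorem hCont_atilde [TopFree W] (π : (Atilde I)⟦X⟧ →ₐ[ℂ⟦X⟧] Module.End ℂ⟦X⟧ W) : HCont π :=
  fun _ hf => map_tsum_of_uFin hf π.toLinearMap

/-- If the relators act by zero, the kernel of `π` is one of the ideals whose intersection is
`dyIdeal A`: it is closed because `π` preserves divisibility by `ħ ^ r` and `End W` is separated,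
and saturated because `End W` is torsion-free. Hence `π` factors. Conversely the relators already
vanish in the quotient. -/
theorem isRestrictedDYModule_iff [DecidableEq I] (A : Matrix I I ℤ)
    (π : (Atilde I)⟦X⟧ →ₐ[ℂ⟦X⟧] Module.End ℂ⟦X⟧ W) (hW : IsRestricted ((Atilde.gens I).map π)) :
    IsRestrictedDYModule A ((Atilde.gens I).map π) ↔
      ∀ x, ((Atilde.gens I).map π).Relator A x → x = 0 := by
  haveI := hW.1.topFree
  let q : (Atilde I)⟦X⟧ →ₐ[ℂ⟦X⟧] DY A :=
    { toRingHom := (dyIdeal A).ringCon.mk', commutes' := fun _ => rfl }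
  constructor
  · rintro ⟨ρ, hρ, -⟩ x hx
    have hmap : (Atilde.gens I).map π = (Atilde.gens I).map (ρ.comp q) := by
      rw [← hρ]; rfl
    rw [hmap, relator_map_iff (hCont_atilde _)] at hx
    obtain ⟨y, hy, rfl⟩ := hx
    have : q y = 0 := by
      have hy' : y ∈ dyIdeal A := by
        rw [dyIdeal, TwoSidedIdeal.mem_sInf]
        exact fun J hJ => hJ.1 y hy
      exact (RingCon.eq _).2 hy'
    rw [AlgHom.comp_apply, this, map_zero]
  · intro h
    have hker : dyIdeal A ≤ TwoSidedIdeal.ker π := by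
      refine sInf_le ⟨fun x hx => ?_, ?_, fun x hx => ?_⟩
      · rw [TwoSidedIdeal.mem_ker]
        exact h _ ((relator_map_iff (hCont_atilde _) _ A _).2 ⟨x, hx, rfl⟩)
      · letI := hTop (Atilde I)⟦X⟧
        haveI := hTop_isTopologicalAddGroup (M := (Atilde I)⟦X⟧)
        rw [← isOpen_compl_iff, isOpen_iff_mem_nhds]
        intro x hx
        have : ∃ r, π x ∉ hsub (Module.End ℂ⟦X⟧ W) r := by
          by_contra h
          push Not at h
          exact hx ((TwoSidedIdeal.mem_ker _).2 (eq_of_hsub fun r => by simpa using h r))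
        obtain ⟨r, hr⟩ := this
        rw [← map_add_left_nhds_zero x, mem_map]
        refine hTop_hasBasis.mem_of_superset (i := r) trivial ?_
        intro y hy h0
        apply hr
        have h1 : π (x + y) = 0 := (TwoSidedIdeal.mem_ker _).1 h0
        rw [map_add] at h1
        rw [eq_neg_of_add_eq_zero_left h1]
        exact Submodule.neg_mem _ (map_mem_hsub π.toLinearMap hy)
      · rw [TwoSidedIdeal.mem_ker, map_smul] at hx
        exact (TwoSidedIdeal.mem_ker _).2 (TopFree.tf _ hx)
    let ρ₀ : (dyIdeal A).ringCon.Quotient →+* Module.End ℂ⟦X⟧ W :=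
      (dyIdeal A).ringCon.lift (π : (Atilde I)⟦X⟧ →+* Module.End ℂ⟦X⟧ W) (by
        intro x y hxy
        have := hker ((TwoSidedIdeal.rel_iff _ _ _).1 hxy)
        rw [TwoSidedIdeal.mem_ker, map_sub, sub_eq_zero] at this
        exact this)
    let ρ : DY A →ₐ[ℂ⟦X⟧] Module.End ℂ⟦X⟧ W :=
      { toRingHom := ρ₀
        commutes' := fun c => π.commutes c }
    have hρ : (DY.gens A).map ρ = (Atilde.gens I).map π := rfl
    exact ⟨ρ, hρ, hρ ▸ hW⟩

end Modules

end

section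
/-! ## Formal calculus in one variable -/

section Linear

variable {R : Type*} [Ring R] [Algebra ℂ⟦X⟧ R]

/-- `∂_z` as an operator on `R[[z, z⁻¹]]`. -/
def derL (R : Type*) [Ring R] [Algebra ℂ⟦X⟧ R] : Module.End ℂ⟦X⟧ (ℤ → R) where
  toFun := fderiv
  map_add' a b := by funext n; simp [fderiv]
  map_smul' c a := by funext n; simp only [fderiv, Pi.smul_apply]; rw [smul_comm]; rfl

/-- Left multiplication by an element of `R` on `R[[z, z⁻¹]]`. -/
def kL (κ : R) : Module.End ℂ⟦X⟧ (ℤ → R) where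
  toFun a n := κ * a n
  map_add' a b := by funext n; simp [mul_add]
  map_smul' c a := by funext n; simp

theorem commute_kL_derL (κ : R) : Commute (kL κ) (derL R) := by
  refine LinearMap.ext fun a => funext fun n => ?_
  simp only [kL, derL, fderiv, Module.End.mul_apply, LinearMap.coe_mk, AddHom.coe_mk]
  rw [mul_smul_comm]

theorem kL_pow_apply (κ : R) (k : ℕ) (a : ℤ → R) (n : ℤ) : (kL κ ^ k) a n = κ ^ k * a n := by
  induction k generalizing a with
  | zero => simp
  | succ k ih => rw [pow_succ, Module.End.mul_apply, ih, pow_succ, mul_assoc]; rfl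

theorem fderiv_iterate (a : ℤ → R) (k : ℕ) (n : ℤ) :
    fderiv^[k] a n = k.factorial • Ring.choose (n + (k : ℤ)) k • a (n + k) := by
  induction k generalizing n with
  | zero => simp
  | succ k ih =>
    rw [Function.iterate_succ', Function.comp_apply, fderiv, ih]
    have h : (n + 1) * (k.factorial * Ring.choose (n + 1 + (k : ℤ)) k) =
        ((k + 1).factorial : ℤ) * Ring.choose (n + ((k + 1 : ℕ) : ℤ)) (k + 1) := by
      have h1 := Ring.choose_smul_choose (n + 1 + (k : ℤ)) (Nat.le_succ k)
      rw [Nat.succ_sub (le_refl k), Nat.sub_self, Ring.choose_one_right, Nat.choose_succ_self_right,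
        nsmul_eq_mul] at h1
      rw [show n + ((k + 1 : ℕ) : ℤ) = n + 1 + (k : ℤ) by push_cast; ring, Nat.factorial_succ]
      push_cast at h1 ⊢
      linear_combination -(k.factorial : ℤ) * h1
    rw [← natCast_zsmul, ← natCast_zsmul, smul_smul, smul_smul, smul_smul,
      show n + 1 + (k : ℤ) = n + ((k + 1 : ℕ) : ℤ) by push_cast; ring]
    rw [show n + 1 + (k : ℤ) = n + ((k + 1 : ℕ) : ℤ) by push_cast; ring] at h
    rw [← h, mul_assoc]

theorem derL_pow_apply (a : ℤ → R) (k : ℕ) : (derL R ^ k) a = fderiv^[k] a := by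
  rw [Module.End.pow_apply]; rfl

end Linear

section Operators

variable {W : Type*} [AddCommGroup W] [Module ℂ⟦X⟧ W] [TopFree W]

/-- The algebra of operators on `W`. -/
abbrev Op (W : Type*) [AddCommGroup W] [Module ℂ⟦X⟧ W] := Module.End ℂ⟦X⟧ W

/-- The operator `a(z) ↦ a(z + c κ ħ)` on `(End W)[[z, z⁻¹]]`. -/
def Tsh (κ : Op W) (c : ℂ) : Module.End ℂ⟦X⟧ (ℤ → Op W) := ev (kL κ * derL (Op W)) (expS c)

theorem ch_pow (c : ℂ) (k : ℕ) : ch c ^ k = hv ^ k * PowerSeries.C (c ^ k) := by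
  rw [ch, mul_pow, map_pow, mul_comm]

/-- Taylor's formula: `∂ ^ k` contributes `k!` times a binomial coefficient, and the factorial
cancels that of the exponential series. -/
theorem fshift_eq (κ : Op W) (c : ℂ) (a : ℤ → Op W) : fshift (ch c • κ) a = Tsh κ c a := by
  funext n
  rw [Tsh, ev_apply, hsum_apply, fshift, ← tsum_hpow]
  congr 1; funext k
  rw [(commute_kL_derL κ).mul_pow, Module.End.mul_apply, derL_pow_apply, Pi.smul_apply,
    kL_pow_apply, fderiv_iterate, smul_pow, ch_pow, coeff_expS, smul_mul_assoc, mul_smul,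
    smul_comm (Ring.choose _ _) (hv ^ k), smul_comm (Ring.choose _ _) (PowerSeries.C _ : ℂ⟦X⟧)]
  congr 1
  rw [mul_smul_comm, mul_smul_comm, ← Nat.cast_smul_eq_nsmul ℂ⟦X⟧, smul_smul]
  congr 1
  rw [← map_natCast (PowerSeries.C : ℂ →+* ℂ⟦X⟧), ← map_mul]
  congr 1
  have : (k.factorial : ℂ) ≠ 0 := by exact_mod_cast k.factorial_ne_zero
  field_simp

theorem fdiffop_eq (P : ℂ⟦X⟧) (a : ℤ → Op W) : fdiffop P a = ev (derL (Op W)) P a := by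
  funext n
  rw [ev_apply, hsum_apply, fdiffop, ← tsum_hpow]
  congr 1; funext k
  rw [derL_pow_apply, mul_comm, mul_smul]; rfl

theorem Tsh_add (κ : Op W) (c d : ℂ) : Tsh κ (c + d) = Tsh κ c * Tsh κ d := by
  rw [Tsh, expS_add, map_mul]; rfl

theorem Tsh_zero (κ : Op W) : Tsh κ 0 = 1 := by rw [Tsh, expS_zero, map_one]

theorem Tsh_apply_neg (κ : Op W) (c : ℂ) (a : ℤ → Op W) : Tsh κ c (Tsh κ (-c) a) = a := by
  rw [← Module.End.mul_apply, ← Tsh_add, add_neg_cancel, Tsh_zero]; rfl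

end Operators

/-! ### One-sided series -/

section Series

variable {R : Type*} [Ring R] [Algebra ℂ⟦X⟧ R]

/-- The power series in `z⁻¹` (for `s = 1`) or in `z` (for `s = -1`) as distributions. -/
def iota (s : ℤˣ) : R⟦X⟧ →ₗ[ℂ⟦X⟧] (ℤ → R) where
  toFun f e := if (s : ℤ) * e ≤ 0 then PowerSeries.coeff (-((s : ℤ) * e)).toNat f else 0
  map_add' f f' := by funext e; simp only [Pi.add_apply]; split_ifs <;> simp
  map_smul' c f := by
    funext e; simp only [Pi.smul_apply, RingHom.id_apply]; split_ifs <;> simp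

theorem iota_apply (s : ℤˣ) (f : R⟦X⟧) (e : ℤ) : iota s f e =
    if (s : ℤ) * e ≤ 0 then PowerSeries.coeff (-((s : ℤ) * e)).toNat f else 0 := rfl

theorem sgn_mul_self (s : ℤˣ) : (s : ℤ) * s = 1 := by
  rw [← Units.val_mul, Int.units_mul_self]; rfl

theorem iota_at (s : ℤˣ) (f : R⟦X⟧) (n : ℕ) :
    iota s f (-((s : ℤ) * n)) = PowerSeries.coeff n f := by
  have h : (s : ℤ) * (-((s : ℤ) * n)) = -(n : ℤ) := by
    rw [mul_neg, ← mul_assoc, sgn_mul_self, one_mul]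
  rw [iota_apply, h, if_pos (by omega)]
  simp

theorem iota_of_pos {s : ℤˣ} (f : R⟦X⟧) {e : ℤ} (h : 0 < (s : ℤ) * e) : iota s f e = 0 := by
  rw [iota_apply, if_neg (not_le.2 h)]

theorem exists_of_nonpos {s : ℤˣ} {e : ℤ} (h : (s : ℤ) * e ≤ 0) :
    ∃ n : ℕ, e = -((s : ℤ) * n) := by
  refine ⟨(-((s : ℤ) * e)).toNat, ?_⟩
  rw [Int.toNat_of_nonneg (by omega), mul_neg, neg_neg, ← mul_assoc, sgn_mul_self, one_mul]

theorem iota_injective (s : ℤˣ) : Function.Injective (iota (R := R) s) := fun f f' h => by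
  ext n
  rw [← iota_at s f n, h, iota_at]

/-- A distribution supported on one side comes from a power series. -/
theorem iota_mk (s : ℤˣ) (a : ℤ → R) (ha : ∀ e, 0 < (s : ℤ) * e → a e = 0) :
    iota s (PowerSeries.mk fun n => a (-((s : ℤ) * n))) = a := by
  funext e
  by_cases h : (s : ℤ) * e ≤ 0
  · obtain ⟨n, rfl⟩ := exists_of_nonpos h
    rw [iota_at, PowerSeries.coeff_mk]
  · rw [iota_of_pos _ (not_le.1 h), ha _ (not_le.1 h)]

theorem iota_one (s : ℤˣ) : iota s (1 : R⟦X⟧) = fone := by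
  funext e
  by_cases h : (s : ℤ) * e ≤ 0
  · obtain ⟨n, rfl⟩ := exists_of_nonpos h
    rw [iota_at, PowerSeries.coeff_one, fone]
    simp
  · rw [iota_of_pos _ (not_le.1 h), fone, if_neg]
    rintro rfl; simp at h

/-- The derivative `∂_z` on one-sided series. -/
def dB (R : Type*) [Ring R] [Algebra ℂ⟦X⟧ R] (s : ℤˣ) : Module.End ℂ⟦X⟧ R⟦X⟧ where
  toFun f := PowerSeries.mk fun n => derL R (iota s f) (-((s : ℤ) * n))
  map_add' f f' := by ext n; simp
  map_smul' c f := by ext n; simp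

theorem iota_dB (s : ℤˣ) (f : R⟦X⟧) : iota s (dB R s f) = derL R (iota s f) := by
  refine iota_mk (R := R) s (derL R (iota s f)) fun e he => ?_
  change (e + 1) • (iota s f : ℤ → R) (e + 1) = 0
  rcases Int.units_eq_one_or s with rfl | rfl
  · rw [iota_of_pos, smul_zero]; simp at he ⊢; omega
  -- For series in `z`, the constant term could only produce `z⁻¹`; its factor `e + 1` vanishes.
  · by_cases h : e + 1 = 0
    · rw [h, zero_smul]
    · rw [iota_of_pos, smul_zero]; simp at he ⊢; omega

/-- The Euler operator `z ∂_z` on one-sided series. -/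
def eulerB (s : ℤˣ) (f : R⟦X⟧) : R⟦X⟧ :=
  PowerSeries.mk fun n => (-((s : ℤ) * n)) • PowerSeries.coeff n f

theorem eulerB_mul (s : ℤˣ) (f f' : R⟦X⟧) :
    eulerB s (f * f') = eulerB s f * f' + f * eulerB s f' := by
  ext n
  rw [map_add, eulerB, PowerSeries.coeff_mk, PowerSeries.coeff_mul, PowerSeries.coeff_mul,
    PowerSeries.coeff_mul, ← Finset.sum_add_distrib, Finset.smul_sum]
  refine Finset.sum_congr rfl fun p hp => ?_
  rw [eulerB, eulerB, PowerSeries.coeff_mk, PowerSeries.coeff_mk, smul_mul_assoc, mul_smul_comm,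
    ← add_smul, ← Finset.HasAntidiagonal.mem_antidiagonal.1 hp]
  push_cast
  congr 1; ring

theorem coeff_dB (s : ℤˣ) (f : R⟦X⟧) (n : ℕ) : PowerSeries.coeff n (dB R s f) =
    (-((s : ℤ) * n) + 1) • iota s f (-((s : ℤ) * n) + 1) := by
  exact PowerSeries.coeff_mk (R := R) n fun n => derL R (iota s f) (-((s : ℤ) * n))

theorem dB_one_eq (f : R⟦X⟧) : dB R 1 f = PowerSeries.X * eulerB 1 f := by
  ext n
  rw [coeff_dB]
  rcases n with _ | n
  · rw [iota_of_pos]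
    · simp
    · simp
  · have : -(((1 : ℤˣ) : ℤ) * (n + 1 : ℕ)) + 1 = -(((1 : ℤˣ) : ℤ) * n) := by push_cast; ring
    rw [this, iota_at, PowerSeries.coeff_succ_X_mul, eulerB, PowerSeries.coeff_mk]

theorem X_mul_dB_neg (f : R⟦X⟧) : PowerSeries.X * dB R (-1) f = eulerB (-1) f := by
  ext n
  rcases n with _ | n
  · simp [eulerB]
  · rw [PowerSeries.coeff_succ_X_mul, eulerB, PowerSeries.coeff_mk]
    rw [coeff_dB]
    have : -(((-1 : ℤˣ) : ℤ) * n) + 1 = -(((-1 : ℤˣ) : ℤ) * (n + 1 : ℕ)) := by push_cast; ring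
    rw [this, iota_at]

theorem X_mul_inj {f f' : R⟦X⟧} (h : PowerSeries.X * f = PowerSeries.X * f') : f = f' := by
  ext n
  have := congrArg (PowerSeries.coeff (n + 1)) h
  simpa using this

/-- The Euler operator `z ∂_z` multiplies by the degree and is clearly a derivation. For series in
`z⁻¹`, `∂_z` is `X` times it; for series in `z`, it is `X` times `∂_z`, and the central element `X`
can be cancelled. -/
theorem dB_mul (s : ℤˣ) (f f' : R⟦X⟧) : dB R s (f * f') = dB R s f * f' + f * dB R s f' := by
  rcases Int.units_eq_one_or s with rfl | rfl
  · rw [dB_one_eq, dB_one_eq, dB_one_eq, eulerB_mul, mul_add, ← mul_assoc, ← mul_assoc,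
      (PowerSeries.commute_X f).symm.eq, mul_assoc f]
  · apply X_mul_inj
    rw [X_mul_dB_neg, eulerB_mul, mul_add, ← mul_assoc, ← mul_assoc,
      (PowerSeries.commute_X f).symm.eq, mul_assoc f, X_mul_dB_neg, X_mul_dB_neg]

theorem dB_C (s : ℤˣ) (x : R) : dB R s (PowerSeries.C x) = 0 := by
  have h : eulerB s (PowerSeries.C x) = 0 := by
    ext n; rcases n with _ | n <;> simp [eulerB, PowerSeries.coeff_C]
  rcases Int.units_eq_one_or s with rfl | rfl
  · rw [dB_one_eq, h, mul_zero]
  · apply X_mul_inj; rw [X_mul_dB_neg, h, mul_zero]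

/-- Left multiplication by a constant on one-sided series. -/
def kB (κ : R) : Module.End ℂ⟦X⟧ R⟦X⟧ := LinearMap.mulLeft ℂ⟦X⟧ (PowerSeries.C κ)

theorem kB_apply (κ : R) (f : R⟦X⟧) : kB κ f = PowerSeries.C κ * f := rfl

theorem iota_kB (s : ℤˣ) (κ : R) (f : R⟦X⟧) : iota s (kB κ f) = kL κ (iota s f) := by
  funext e
  simp only [iota_apply, kB_apply, kL, LinearMap.coe_mk, AddHom.coe_mk]
  split_ifs <;> simp

theorem commute_kB_dB (s : ℤˣ) (κ : R) : Commute (kB κ) (dB R s) := by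
  refine LinearMap.ext fun f => ?_
  simp only [Module.End.mul_apply, kB_apply, dB_mul, dB_C, zero_mul, zero_add]

theorem commute_dB {s : ℤˣ} {κ : R} {f : R⟦X⟧} (h : Commute (PowerSeries.C κ) f) :
    Commute (PowerSeries.C κ) (dB R s f) := by
  have := congrArg (dB R s) h.eq
  rwa [dB_mul, dB_mul, dB_C, zero_mul, mul_zero, zero_add, add_zero] at this

variable [TopFree R]

/-- The shift `f(z) ↦ f(z + c κ ħ)` on one-sided series. -/
def TB (s : ℤˣ) (κ : R) (c : ℂ) : Module.End ℂ⟦X⟧ R⟦X⟧ := ev (kB κ * dB R s) (expS c)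

theorem TB_add (s : ℤˣ) (κ : R) (c d : ℂ) : TB s κ (c + d) = TB s κ c * TB s κ d := by
  rw [TB, expS_add, map_mul]; rfl

theorem TB_zero (s : ℤˣ) (κ : R) : TB s κ 0 = 1 := by rw [TB, expS_zero, map_one]

theorem leibniz_pow {D : Module.End ℂ⟦X⟧ R⟦X⟧} {S : Set R⟦X⟧} (hS : ∀ a ∈ S, D a ∈ S)
    (hD : ∀ a ∈ S, ∀ b, D (a * b) = D a * b + a * D b) (n : ℕ) :
    ∀ a ∈ S, ∀ b, (D ^ n) (a * b) =
      ∑ p ∈ Finset.HasAntidiagonal.antidiagonal n, n.choose p.1 • ((D ^ p.1) a * (D ^ p.2) b) := by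
  induction n with
  | zero => intro a _ b; simp
  | succ n ih =>
    intro a ha b
    rw [Finset.sum_antidiagonal_choose_succ_nsmul
      (fun i j => (D ^ i) a * (D ^ j) b), pow_succ, Module.End.mul_apply, hD a ha, map_add,
      ih _ (hS a ha), ih a ha, add_comm]
    congr 1
    refine Finset.sum_congr rfl fun p hp => ?_
    rw [pow_succ, Module.End.mul_apply,
      Nat.choose_symm_of_eq_add (Finset.HasAntidiagonal.mem_antidiagonal.1 hp).symm]

/-- The exponential of a derivation is multiplicative. The coefficients do not commute, and `κ ∂`
obeys the Leibniz rule only when the left factor commutes with `κ`; such factors form a set stable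
under `κ ∂`. -/
theorem TB_mul (s : ℤˣ) {κ : R} (c : ℂ) {a : R⟦X⟧} (b : R⟦X⟧)
    (ha : Commute (PowerSeries.C κ) a) : TB s κ c (a * b) = TB s κ c a * TB s κ c b := by
  have hS : ∀ a ∈ {a : R⟦X⟧ | Commute (PowerSeries.C κ) a},
      (kB κ * dB R s) a ∈ {a : R⟦X⟧ | Commute (PowerSeries.C κ) a} := fun a ha =>
    (Commute.refl _).mul_right (commute_dB ha)
  have hD : ∀ a ∈ {a : R⟦X⟧ | Commute (PowerSeries.C κ) a}, ∀ b, (kB κ * dB R s) (a * b) =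
      (kB κ * dB R s) a * b + a * (kB κ * dB R s) b := by
    intro a ha b
    simp only [Module.End.mul_apply, kB_apply, dB_mul, mul_add, ← mul_assoc]
    rw [ha.eq]
  rw [TB, ev_apply, ev_apply, ev_apply, hsum_mul]
  congr 1; funext n
  rw [leibniz_pow hS hD n a ha b, Finset.smul_sum]
  refine Finset.sum_congr rfl fun p hp => ?_
  rw [smul_mul_smul_comm, ← map_mul, ← Nat.cast_smul_eq_nsmul ℂ⟦X⟧, smul_smul]
  congr 1
  rw [← map_natCast (PowerSeries.C : ℂ →+* ℂ⟦X⟧), ← map_mul, coeff_expS, coeff_expS, coeff_expS]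
  congr 1
  obtain rfl := Finset.HasAntidiagonal.mem_antidiagonal.1 hp
  have h1 : (p.1.factorial : ℂ) ≠ 0 := by exact_mod_cast p.1.factorial_ne_zero
  have h2 : (p.2.factorial : ℂ) ≠ 0 := by exact_mod_cast p.2.factorial_ne_zero
  have h3 : ((p.1 + p.2).factorial : ℂ) ≠ 0 := by exact_mod_cast (p.1 + p.2).factorial_ne_zero
  have h4 : (((p.1 + p.2).choose p.1 : ℕ) : ℂ) * p.1.factorial * p.2.factorial =
      (p.1 + p.2).factorial := by
    have := Nat.add_choose_mul_factorial_mul_factorial p.1 p.2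
    rw [← this, Nat.choose_symm_add]; push_cast
    ring
  field_simp
  rw [pow_add, ← h4]; ring

theorem ev_apply_of_eq_zero {M : Type*} [AddCommGroup M] [Module ℂ⟦X⟧ M] [TopFree M]
    (D : Module.End ℂ⟦X⟧ M) (P : ℂ⟦X⟧) {m : M} (h : D m = 0) :
    ev D P m = (PowerSeries.C (PowerSeries.coeff 0 P) : ℂ⟦X⟧) • m := by
  rw [ev_apply, hsum_succ]
  simp [pow_succ, h, hsum_zero]

theorem TB_one (s : ℤˣ) (κ : R) (c : ℂ) : TB s κ c 1 = 1 := by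
  rw [TB, ev_apply_of_eq_zero]
  · simp [coeff_expS]
  · have := dB_C s (1 : R)
    rw [map_one] at this
    rw [Module.End.mul_apply, this, map_zero]

theorem commute_TB {s : ℤˣ} {κ : R} {c : ℂ} {f : R⟦X⟧} (h : Commute (PowerSeries.C κ) f) :
    Commute (PowerSeries.C κ) (TB s κ c f) := by
  rw [TB, ev_apply]
  refine commute_hsum fun n => Commute.smul_right ?_ _
  induction n with
  | zero => simpa using h
  | succ n ih =>
    rw [pow_succ', Module.End.mul_apply, Module.End.mul_apply]
    exact (Commute.refl _).mul_right (commute_dB ih)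

theorem TB_pow (s : ℤˣ) {κ : R} (c : ℂ) {a : R⟦X⟧} (ha : Commute (PowerSeries.C κ) a) (k : ℕ) :
    TB s κ c (a ^ k) = TB s κ c a ^ k := by
  induction k with
  | zero => simp [TB_one]
  | succ k ih => rw [pow_succ', TB_mul s c _ ha, ih, pow_succ']

theorem TB_Flog (s : ℤˣ) {κ : R} (c : ℂ) {a : R⟦X⟧} (ha : Commute (PowerSeries.C κ) a) :
    TB s κ c (Flog a) = Flog (TB s κ c a) := by
  rw [Flog, TB_mul s c _ ha, map_ev_eq _ (TB_pow s c ha), Flog]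

/-- `(1 + 2ħ b)⁻¹`. -/
def Finv (b : R) : R := ev b (PowerSeries.mk fun k => (-2) ^ k)

theorem Finv_mul (b : R) : Finv b * (1 + ch 2 • b) = 1 := by
  have := congrArg (ev b) geom_two_mul
  rw [map_mul, map_one, map_add, map_one, map_mul, ev_X, map_ofNat] at this
  rw [Finv, two_smul_hv, mul_smul, two_smul, ← two_mul, this]

theorem mul_Finv (b : R) : (1 + ch 2 • b) * Finv b = 1 := by
  have h : Commute (1 + ch 2 • b) (Finv b) :=
    commute_ev ((Commute.one_left b).add_left ((Commute.refl b).smul_left _)) _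
  rw [h.eq, Finv_mul]

theorem EXP_neg_Flog (b : R) : EXP (-Flog b) = Finv b := by
  have h := EXP_neg_mul (Flog b)
  rw [EXP_Flog] at h
  calc EXP (-Flog b) = EXP (-Flog b) * ((1 + ch 2 • b) * Finv b) := by rw [mul_Finv, mul_one]
    _ = Finv b := by rw [← mul_assoc, h, one_mul]

end Series

section OpSeries

variable {W : Type*} [AddCommGroup W] [Module ℂ⟦X⟧ W] [TopFree W]

theorem iota_TB (s : ℤˣ) (κ : Op W) (c : ℂ) (f : (Op W)⟦X⟧) :
    iota s (TB s κ c f) = Tsh κ c (iota s f) :=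
  ev_intertwine (M := (Op W)⟦X⟧) (N := ℤ → Op W) (D := kB κ * dB (Op W) s)
    (D' := kL κ * derL (Op W)) (iota s) (fun m => by
    rw [Module.End.mul_apply, Module.End.mul_apply, iota_kB, iota_dB]) _ _

theorem iota_ev_dB (s : ℤˣ) (P : ℂ⟦X⟧) (f : (Op W)⟦X⟧) :
    iota s (ev (dB (Op W) s) P f) = fdiffop P (iota s f) := by
  rw [fdiffop_eq]
  exact ev_intertwine (M := (Op W)⟦X⟧) (N := ℤ → Op W) (D := dB (Op W) s) (D' := derL (Op W))
    (iota s) (fun m => iota_dB s m) _ _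

theorem fmul_iota (s : ℤˣ) (f f' : (Op W)⟦X⟧) :
    fmul (iota s f) (iota s f') = iota s (f * f') := by
  funext e
  rw [fmul]
  have hinj : Function.Injective fun n : ℕ => -((s : ℤ) * n) := fun m n h => by
    have h' := congrArg (fun x => -((s : ℤ) * x)) h
    simp only [mul_neg, neg_neg, ← mul_assoc, sgn_mul_self, one_mul] at h'
    exact_mod_cast h'
  by_cases he : (s : ℤ) * e ≤ 0
  · obtain ⟨n, rfl⟩ := exists_of_nonpos he
    rw [iota_at, PowerSeries.coeff_mul, Finset.Nat.sum_antidiagonal_eq_sum_range_succ_mk,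
      ← Finset.sum_range_reflect,
      tsum_eq_sum (s := (Finset.range (n + 1)).map ⟨_, hinj⟩), Finset.sum_map]
    · refine Finset.sum_congr rfl fun k hk => ?_
      have hk' : k ≤ n := Nat.lt_succ_iff.1 (Finset.mem_range.1 hk)
      simp only [Function.Embedding.coeFn_mk]
      rw [iota_at, show -((s : ℤ) * n) - -((s : ℤ) * k) = -((s : ℤ) * ((n - k : ℕ) : ℤ)) by
        push_cast [hk']; ring, iota_at]
      congr 3; omega
    · intro b hb
      by_cases hb1 : (s : ℤ) * b ≤ 0
      · obtain ⟨k, rfl⟩ := exists_of_nonpos hb1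
        rw [iota_of_pos, zero_mul]
        have : n < k := by
          by_contra h
          exact hb (Finset.mem_map.2 ⟨k, Finset.mem_range.2 (by omega), rfl⟩)
        have h2 : (s : ℤ) * (-((s : ℤ) * n) - -((s : ℤ) * k)) = k - n := by
          linear_combination ((k : ℤ) - n) * sgn_mul_self s
        rw [h2]; omega
      · rw [iota_of_pos f' (not_le.1 hb1), mul_zero]
  · rw [iota_of_pos _ (not_le.1 he)]
    rw [tsum_congr (g := fun _ => 0), tsum_zero]
    intro k
    by_cases hk : (s : ℤ) * k ≤ 0
    · rw [iota_of_pos f, zero_mul]; rw [mul_sub]; omega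
    · rw [iota_of_pos f' (not_le.1 hk), mul_zero]

theorem fpow_iota (s : ℤˣ) (f : (Op W)⟦X⟧) (k : ℕ) : fpow (iota s f) k = iota s (f ^ k) := by
  induction k with
  | zero => rw [pow_zero, iota_one]; rfl
  | succ k ih => rw [fpow, ih, fmul_iota, pow_succ']

theorem flog_iota (s : ℤˣ) (b : (Op W)⟦X⟧) : flog (iota s b) = iota s (Flog b) := by
  funext n
  rw [Flog, ev_def, mul_hsum, map_hsum, hsum_apply, ← tsum_hpow, flog]
  congr 1; funext k
  rw [fpow_iota, logS, PowerSeries.coeff_mk, ch_pow, mul_assoc, ← map_mul, mul_smul,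
    mul_smul_comm, ← pow_succ', map_smul]
  rfl

theorem finv_iota (s : ℤˣ) (b : (Op W)⟦X⟧) : finv (iota s b) = iota s (Finv b) := by
  funext n
  rw [Finv, ev_def, map_hsum, hsum_apply, ← tsum_hpow, finv]
  congr 1; funext k
  rw [fpow_iota, PowerSeries.coeff_mk, ch_pow, mul_smul, map_smul]
  rfl

theorem fexp_iota (s : ℤˣ) (b : (Op W)⟦X⟧) :
    fexp (ch (-2) • iota s b) = iota s (EXP (-b)) := by
  funext n
  rw [EXP, ev_def, map_hsum, hsum_apply, ← tsum_hpow, fexp]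
  congr 1; funext k
  rw [← map_smul, fpow_iota, smul_pow, ch_pow, coeff_expS, map_smul, map_smul, neg_pow b]
  have : (-1 : (Op W)⟦X⟧) ^ k * b ^ k = (PowerSeries.C ((-1) ^ k) : ℂ⟦X⟧) • b ^ k := by
    rcases Nat.even_or_odd k with h | h <;> simp [h.neg_one_pow]
  rw [this, map_smul]
  simp only [Pi.smul_apply]
  rw [mul_smul, smul_comm (PowerSeries.C _ : ℂ⟦X⟧) (hv ^ k), smul_smul (PowerSeries.C _ : ℂ⟦X⟧),
    smul_smul (PowerSeries.C _ : ℂ⟦X⟧), ← map_mul, ← map_mul]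
  congr 3
  rw [show (-2 : ℂ) = -1 * 2 by norm_num, mul_pow]
  ring

end OpSeries

end

section
/-! ## Distributions in two variables -/

section Submodule

variable {M : Type*} [AddCommGroup M] [Module ℂ⟦X⟧ M] [TopFree M]

/-- Saturated closed submodules of topologically free modules are topologically free. -/
theorem topFree_submodule (N : Submodule ℂ⟦X⟧ M) (hsat : ∀ v, hv • v ∈ N → v ∈ N)
    (hcl : ∀ v, (∀ r, ∃ u ∈ N, v - u ∈ hsub M r) → v ∈ N) : TopFree N where
  tf v h := Subtype.ext (TopFree.tf _ (congrArg Subtype.val h))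
  sep v h := Subtype.ext (TopFree.sep _ fun r => by
    obtain ⟨u, hu⟩ := h r
    exact ⟨u, congrArg Subtype.val hu⟩)
  compl a := by
    have hsat' : ∀ r v, hv ^ r • v ∈ N → v ∈ N := by
      intro r
      induction r with
      | zero => intro v h; simpa using h
      | succ r ih => intro v h; exact hsat v (ih _ (by rwa [smul_smul, ← pow_succ]))
    have hm : hsum (fun k => (a k : M)) ∈ N := hcl _ fun r =>
      ⟨_, Submodule.sum_mem _ fun k _ => N.smul_mem _ (a k).2, hsum_spec _ r⟩
    refine ⟨⟨_, hm⟩, fun r => ?_⟩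
    obtain ⟨u, hu⟩ := mem_hsub.1 (hsum_spec (fun k => (a k : M)) r)
    have hu' : u ∈ N := hsat' r u (by
      rw [hu]
      exact N.sub_mem hm (Submodule.sum_mem _ fun k _ => N.smul_mem _ (a k).2))
    refine ⟨⟨u, hu'⟩, Subtype.ext ?_⟩
    simpa using hu

end Submodule

section Commutation

variable {R : Type*} [Ring R] [Algebra ℂ⟦X⟧ R] [TopFree R]

theorem pow_mul_of_comm {D x K : R} (h : D * x = x * D + K) (hK : Commute D K) (n : ℕ) :
    D ^ (n + 1) * x = x * D ^ (n + 1) + (n + 1) • (K * D ^ n) := by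
  induction n with
  | zero => simp [h]
  | succ n ih =>
    rw [pow_succ', mul_assoc, ih, mul_add, ← mul_assoc, h, add_mul, mul_smul_comm, ← mul_assoc,
      hK.eq, mul_assoc, mul_assoc, ← pow_succ', ← pow_succ', add_assoc, ← succ_nsmul']

/-- If `[D, x] = K` commutes with `D` then `exp (c ħ D) x = (x + c ħ K) exp (c ħ D)`. -/
theorem ev_expS_mul {D x K : R} (h : D * x = x * D + K) (hK : Commute D K) (c : ℂ) :
    ev D (expS c) * x = (x + ch c • K) * ev D (expS c) := by
  rw [ev_def, hsum_mul_right, add_mul, smul_mul_assoc, mul_hsum, mul_hsum, ch, mul_comm, mul_smul,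
    hsum_succ, hsum_succ (fun n => x * _), add_assoc, ← smul_add, ← hsum_smul (PowerSeries.C c), ← hsum_add]
  congr 1
  · simp
  · congr 2; funext n
    rw [smul_mul_assoc, pow_mul_of_comm h hK, smul_add, mul_smul_comm, mul_smul_comm,
      ← Nat.cast_smul_eq_nsmul ℂ⟦X⟧, smul_smul, smul_smul,
      ← map_natCast (PowerSeries.C : ℂ →+* ℂ⟦X⟧), ← map_mul, ← map_mul, coeff_expS, coeff_expS]
    congr 3
    have h1 : (n.factorial : ℂ) ≠ 0 := by exact_mod_cast n.factorial_ne_zero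
    have h2 : ((n : ℂ) + 1) ≠ 0 := by exact_mod_cast n.succ_ne_zero
    rw [Nat.factorial_succ]; push_cast
    field_simp
    ring

end Commutation

section Injective

variable {W : Type*} [AddCommGroup W] [Module ℂ⟦X⟧ W] [TopFree W]

/-- Uniqueness of solutions of `D g = D (g + δ) + c D (g + η)` which tend to zero in the direction
of `δ`. -/
theorem eq_zero_of_recursion {G : Type*} [AddCommGroup G] {D : G → Op W} {δ η : G} {c : Op W}
    (hc : c ∈ hsub (Op W) 1) (h : ∀ g, D g = D (g + δ) + c * D (g + η))
    (hn : ∀ g v r, ∃ j : ℕ, D (g + j • δ) v ∈ hsub W r) : D = 0 := by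
  -- If `D` is divisible by `ħ ^ r`, the term with `c` is divisible by `ħ ^ (r + 1)`. Modulo that
  -- power `D` is then constant along `δ`, where it tends to zero.
  have key : ∀ r g, D g ∈ hsub (Op W) r := by
    intro r
    induction r with
    | zero => intro g; exact hsub_zero _
    | succ r ih =>
      intro g
      refine mem_hsub_hom.2 fun v => ?_
      have hj : ∀ j : ℕ, D g v - D (g + j • δ) v ∈ hsub W (r + 1) := by
        intro j
        induction j with
        | zero => simp
        | succ j ihj =>
          have h1 := h (g + j • δ)
          have h2 : c * D (g + j • δ + η) ∈ hsub (Op W) (r + 1) := by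
            rw [add_comm r]; exact mul_mem_hsub hc (ih _)
          have h3 := (hsub W (r + 1)).add_mem ihj (mem_hsub_hom.1 h2 v)
          rw [h1, add_assoc g, ← succ_nsmul] at h3
          convert h3 using 1
          simp only [LinearMap.add_apply]; abel
      obtain ⟨j, hj'⟩ := hn g v (r + 1)
      simpa using (hsub W (r + 1)).add_mem (hj j) hj'
  funext g
  exact eq_of_hsub fun r => by simpa using key r g

end Injective

section TwoVariables

variable {R : Type*} [Ring R] [Algebra ℂ⟦X⟧ R]

/-- Multiplication by `z`. -/
def mz (R : Type*) [Ring R] [Algebra ℂ⟦X⟧ R] : Module.End ℂ⟦X⟧ (ℤ → ℤ → R) where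
  toFun D m n := D (m - 1) n
  map_add' _ _ := rfl
  map_smul' _ _ := rfl

/-- Multiplication by `w`. -/
def mw (R : Type*) [Ring R] [Algebra ℂ⟦X⟧ R] : Module.End ℂ⟦X⟧ (ℤ → ℤ → R) where
  toFun D m n := D m (n - 1)
  map_add' _ _ := rfl
  map_smul' _ _ := rfl

/-- Left multiplication by a constant. -/
def kY (c : R) : Module.End ℂ⟦X⟧ (ℤ → ℤ → R) where
  toFun D m n := c * D m n
  map_add' _ _ := by funext m n; simp [mul_add]
  map_smul' _ _ := by funext m n; simp

/-- The derivative `∂_z`. -/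
def dz (R : Type*) [Ring R] [Algebra ℂ⟦X⟧ R] : Module.End ℂ⟦X⟧ (ℤ → ℤ → R) where
  toFun D m n := (m + 1) • D (m + 1) n
  map_add' _ _ := by funext m n; simp
  map_smul' c D := by
    funext m n; simp only [Pi.smul_apply, RingHom.id_apply]; rw [smul_comm]

/-- The derivative `∂_w`. -/
def dw (R : Type*) [Ring R] [Algebra ℂ⟦X⟧ R] : Module.End ℂ⟦X⟧ (ℤ → ℤ → R) where
  toFun := wderiv
  map_add' _ _ := by funext m n; simp [wderiv]
  map_smul' c D := by
    funext m n; simp only [wderiv, Pi.smul_apply, RingHom.id_apply]; rw [smul_comm]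

/-- Multiplication by `z - w - c`. -/
def mulSubL (c : R) : Module.End ℂ⟦X⟧ (ℤ → ℤ → R) := mz R - mw R - kY c

theorem mulSubL_apply (c : R) (D : ℤ → ℤ → R) : mulSubL c D = mulSub c D := rfl

theorem dz_mz : dz R * mz R = mz R * dz R + 1 := by
  refine LinearMap.ext fun D => funext fun m => funext fun n => ?_
  simp only [dz, mz, Module.End.mul_apply, LinearMap.add_apply, LinearMap.coe_mk, AddHom.coe_mk,
    Pi.add_apply, Module.End.one_apply, add_sub_cancel_right, sub_add_cancel]
  rw [add_smul, one_smul]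

theorem dw_mw : dw R * mw R = mw R * dw R + 1 := by
  refine LinearMap.ext fun D => funext fun m => funext fun n => ?_
  simp only [dw, mw, wderiv, Module.End.mul_apply, LinearMap.add_apply, LinearMap.coe_mk,
    AddHom.coe_mk, Pi.add_apply, Module.End.one_apply, add_sub_cancel_right, sub_add_cancel]
  rw [add_smul, one_smul]

theorem commute_dz_mw : Commute (dz R) (mw R) := rfl

theorem commute_dw_mz : Commute (dw R) (mz R) := rfl

theorem commute_dz_kY (c : R) : Commute (dz R) (kY c) := by
  refine LinearMap.ext fun D => funext fun m => funext fun n => ?_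
  simp only [dz, kY, Module.End.mul_apply, LinearMap.coe_mk, AddHom.coe_mk, mul_smul_comm]

theorem commute_dw_kY (c : R) : Commute (dw R) (kY c) := by
  refine LinearMap.ext fun D => funext fun m => funext fun n => ?_
  simp only [dw, wderiv, kY, Module.End.mul_apply, LinearMap.coe_mk, AddHom.coe_mk, mul_smul_comm]

theorem commute_mz_kY (c : R) : Commute (mz R) (kY c) := rfl

theorem commute_mw_kY (c : R) : Commute (mw R) (kY c) := rfl

theorem commute_mz_mw : Commute (mz R) (mw R) := rfl

theorem commute_kY {c d : R} (h : Commute c d) : Commute (kY c) (kY d) := by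
  refine LinearMap.ext fun D => funext fun m => funext fun n => ?_
  simp only [kY, Module.End.mul_apply, LinearMap.coe_mk, AddHom.coe_mk, ← mul_assoc, h.eq]

theorem kY_add (c d : R) : kY (c + d) = kY c + kY d := by
  refine LinearMap.ext fun D => funext fun m => funext fun n => ?_
  simp [kY, add_mul]

theorem kY_sub (c d : R) : kY (c - d) = kY c - kY d := by
  refine LinearMap.ext fun D => funext fun m => funext fun n => ?_
  simp [kY, sub_mul]

theorem kY_smul (c : ℂ⟦X⟧) (d : R) : kY (c • d) = c • kY d := by
  refine LinearMap.ext fun D => funext fun m => funext fun n => ?_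
  simp [kY]

theorem commute_mulSubL {c d : R} (h : Commute c d) : Commute (mulSubL c) (mulSubL d) := by
  have h1 := commute_mz_kY (R := R) d
  have h2 := commute_mw_kY (R := R) d
  have h3 := (commute_mz_kY (R := R) c).symm
  have h4 := (commute_mw_kY (R := R) c).symm
  have h5 := commute_kY h
  exact (((Commute.refl _).sub_right commute_mz_mw).sub_right h1).sub_left
    ((commute_mz_mw.symm.sub_right (Commute.refl _)).sub_right h2) |>.sub_left
    ((h3.sub_right h4).sub_right h5)

variable [TopFree R]

/-- The shift `D(z, w) ↦ D(z + c κ ħ, w)`. -/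
def Tz (κ : R) (c : ℂ) : Module.End ℂ⟦X⟧ (ℤ → ℤ → R) := ev (kY κ * dz R) (expS c)

/-- The shift `D(z, w) ↦ D(z, w + c κ ħ)`. -/
def Tw (κ : R) (c : ℂ) : Module.End ℂ⟦X⟧ (ℤ → ℤ → R) := ev (kY κ * dw R) (expS c)

theorem Tz_neg_mul (κ : R) (c : ℂ) : Tz κ (-c) * Tz κ c = 1 := by
  rw [Tz, Tz, ← map_mul, ← expS_add, neg_add_cancel, expS_zero, map_one]

theorem Tw_neg_mul (κ : R) (c : ℂ) : Tw κ (-c) * Tw κ c = 1 := by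
  rw [Tw, Tw, ← map_mul, ← expS_add, neg_add_cancel, expS_zero, map_one]

/-- The commutator of `κ ∂_z` with `z - w - ν` is `κ`, which commutes with `κ ∂_z`; conjugation by
the exponential therefore only moves `ν`. For `∂_w` the commutator, and so the sign, is opposite. -/
theorem Tz_mulSub {κ ν : R} (h : Commute κ ν) (c : ℂ) (D : ℤ → ℤ → R) :
    Tz κ c (mulSub ν D) = mulSub (ν - ch c • κ) (Tz κ c D) := by
  have h1 : kY κ * dz R * mulSubL ν = mulSubL ν * (kY κ * dz R) + kY κ := by
    have e1 : kY κ * dz R * mz R = mz R * (kY κ * dz R) + kY κ := by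
      rw [mul_assoc, dz_mz, mul_add, mul_one, ← mul_assoc, ← mul_assoc,
        (commute_mz_kY (R := R) κ).eq]
    have e2 : Commute (kY κ * dz R) (mw R) :=
      (commute_mw_kY (R := R) κ).symm.mul_left commute_dz_mw
    have e3 : Commute (kY κ * dz R) (kY ν) := (commute_kY h).mul_left (commute_dz_kY ν)
    rw [mulSubL, mul_sub, mul_sub, e1, e2.eq, e3.eq, sub_mul, sub_mul]; abel
  have h2 : Commute (kY κ * dz R) (kY κ) := (Commute.refl _).mul_left (commute_dz_kY κ)
  have h3 := LinearMap.congr_fun (ev_expS_mul h1 h2 c) D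
  rw [Module.End.mul_apply, mulSubL_apply] at h3
  rw [Tz, h3, Module.End.mul_apply, ← mulSubL_apply]
  congr 1
  rw [mulSubL, mulSubL, kY_sub, kY_smul]; abel

theorem Tw_mulSub {κ ν : R} (h : Commute κ ν) (c : ℂ) (D : ℤ → ℤ → R) :
    Tw κ c (mulSub ν D) = mulSub (ν + ch c • κ) (Tw κ c D) := by
  have h1 : kY κ * dw R * mulSubL ν = mulSubL ν * (kY κ * dw R) + -kY κ := by
    have e1 : kY κ * dw R * mw R = mw R * (kY κ * dw R) + kY κ := by
      rw [mul_assoc, dw_mw, mul_add, mul_one, ← mul_assoc, ← mul_assoc,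
        (commute_mw_kY (R := R) κ).eq]
    have e2 : Commute (kY κ * dw R) (mz R) :=
      (commute_mz_kY (R := R) κ).symm.mul_left commute_dw_mz
    have e3 : Commute (kY κ * dw R) (kY ν) := (commute_kY h).mul_left (commute_dw_kY ν)
    rw [mulSubL, mul_sub, mul_sub, e1, e2.eq, e3.eq, sub_mul, sub_mul]; abel
  have h2 : Commute (kY κ * dw R) (-kY κ) :=
    ((Commute.refl _).mul_left (commute_dw_kY κ)).neg_right
  have h3 := LinearMap.congr_fun (ev_expS_mul h1 h2 c) D
  rw [Module.End.mul_apply, mulSubL_apply] at h3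
  rw [Tw, h3, Module.End.mul_apply, ← mulSubL_apply]
  congr 1
  rw [mulSubL, mulSubL, kY_add, kY_smul, smul_neg]; abel

end TwoVariables

section OpTwoVariables

variable {W : Type*} [AddCommGroup W] [Module ℂ⟦X⟧ W] [TopFree W]

theorem Tz_zw (κ : Op W) (c : ℂ) (a b : ℤ → Op W) : Tz κ c (zw a b) = zw (Tsh κ c a) b := by
  let f : (ℤ → Op W) →ₗ[ℂ⟦X⟧] (ℤ → ℤ → Op W) :=
    { toFun := fun a => zw a b
      map_add' := fun x y => by funext m n; simp [zw, add_mul]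
      map_smul' := fun x y => by funext m n; simp [zw] }
  refine (ev_intertwine (M := ℤ → Op W) (N := ℤ → ℤ → Op W) f (fun a => ?_) (expS c) a).symm
  funext m n
  change κ * ((m + 1) • a (m + 1)) * b n = κ * ((m + 1) • (a (m + 1) * b n))
  rw [mul_assoc, smul_mul_assoc]

theorem Tz_wz {κ : Op W} (c : ℂ) {b : ℤ → Op W} (a : ℤ → Op W) (hb : ∀ n, Commute κ (b n)) :
    Tz κ c (wz b a) = wz b (Tsh κ c a) := by
  let f : (ℤ → Op W) →ₗ[ℂ⟦X⟧] (ℤ → ℤ → Op W) :=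
    { toFun := fun a => wz b a
      map_add' := fun x y => by funext m n; simp [wz, mul_add]
      map_smul' := fun x y => by funext m n; simp [wz] }
  refine (ev_intertwine (M := ℤ → Op W) (N := ℤ → ℤ → Op W) f (fun a => ?_) (expS c) a).symm
  funext m n
  change b n * (κ * ((m + 1) • a (m + 1))) = κ * ((m + 1) • (b n * a (m + 1)))
  rw [← mul_assoc, ← (hb n).eq, mul_assoc, mul_smul_comm]

theorem Tw_wz (κ : Op W) (c : ℂ) (b a : ℤ → Op W) : Tw κ c (wz b a) = wz (Tsh κ c b) a := by
  let f : (ℤ → Op W) →ₗ[ℂ⟦X⟧] (ℤ → ℤ → Op W) :=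
    { toFun := fun b => wz b a
      map_add' := fun x y => by funext m n; simp [wz, add_mul]
      map_smul' := fun x y => by funext m n; simp [wz] }
  refine (ev_intertwine (M := ℤ → Op W) (N := ℤ → ℤ → Op W) f (fun b => ?_) (expS c) b).symm
  funext m n
  change κ * ((n + 1) • b (n + 1)) * a m = κ * ((n + 1) • (b (n + 1) * a m))
  rw [mul_assoc, smul_mul_assoc]

theorem Tw_zw {κ : Op W} (c : ℂ) {a : ℤ → Op W} (b : ℤ → Op W) (ha : ∀ n, Commute κ (a n)) :
    Tw κ c (zw a b) = zw a (Tsh κ c b) := by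
  let f : (ℤ → Op W) →ₗ[ℂ⟦X⟧] (ℤ → ℤ → Op W) :=
    { toFun := fun b => zw a b
      map_add' := fun x y => by funext m n; simp [zw, mul_add]
      map_smul' := fun x y => by funext m n; simp [zw] }
  refine (ev_intertwine (M := ℤ → Op W) (N := ℤ → ℤ → Op W) f (fun b => ?_) (expS c) b).symm
  funext m n
  change a m * (κ * ((n + 1) • b (n + 1))) = κ * ((n + 1) • (a m * b (n + 1)))
  rw [← mul_assoc, ← (ha m).eq, mul_assoc, mul_smul_comm]

theorem commute_Tsh {κ x : Op W} (h : Commute x κ) (c : ℂ) {a : ℤ → Op W}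
    (ha : ∀ n, Commute x (a n)) (n : ℤ) : Commute x (Tsh κ c a n) := by
  rw [Tsh, ev_apply, hsum_apply]
  refine commute_hsum fun k => ?_
  rw [Pi.smul_apply]
  refine Commute.smul_right ?_ _
  rw [(commute_kL_derL κ).mul_pow, Module.End.mul_apply, kL_pow_apply, derL_pow_apply,
    fderiv_iterate]
  exact (h.pow_right k).mul_right (((ha _).smul_right _).smul_right _)

end OpTwoVariables

section Kernels

variable {R : Type*} [Ring R] [Algebra ℂ⟦X⟧ R]

/-- `f(z - w)` in nonnegative powers of `w` (for `s = 1`), and `f(w - z)` in nonnegative powers of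
`z` (for `s = -1`). -/
def expd (s : ℤˣ) : R⟦X⟧ →ₗ[ℂ⟦X⟧] (ℤ → ℤ → R) where
  toFun f := if s = 1 then expandZW f else expandWZ f
  map_add' f f' := by
    split_ifs <;> funext p q <;> simp only [expandWZ, expandZW, Pi.add_apply, map_add] <;>
      split_ifs <;> simp
  map_smul' c f := by
    split_ifs <;> funext p q <;>
      simp only [expandWZ, expandZW, Pi.smul_apply, PowerSeries.coeff_smul, RingHom.id_apply] <;>
      split_ifs <;> simp

theorem expd_one_apply (f : R⟦X⟧) : expd 1 f = expandZW f := rfl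

theorem expd_neg_apply (f : R⟦X⟧) : expd (-1) f = expandWZ f := by
  change (if (-1 : ℤˣ) = 1 then expandZW f else expandWZ f) = _
  rw [if_neg (by decide)]

/-- Coefficientwise this is Pascal's rule. On the line `p + q = 1` the left side could contribute,
but only through the constant coefficient of `X * f`, which is zero. -/
theorem mulSub_expandZW (f : R⟦X⟧) : mulSub 0 (expandZW (PowerSeries.X * f)) = expandZW f := by
  funext p q
  simp only [mulSub, zero_mul, sub_zero, expandZW]
  by_cases hpq : p + q ≤ 0
  · obtain ⟨N, hN⟩ := Int.eq_ofNat_of_zero_le (neg_nonneg.2 hpq)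
    have e1 : (-(p - 1 + q)).toNat = N + 1 := by omega
    have e2 : (-(p + (q - 1))).toNat = N + 1 := by omega
    have e3 : (-(p + q)).toNat = N := by omega
    rw [e1, e2, e3, PowerSeries.coeff_succ_X_mul]
    rcases lt_trichotomy q 0 with hq | rfl | hq
    · rw [if_neg (by omega), if_neg (by omega), if_neg (by omega), sub_zero]
    · rw [if_pos (by omega), if_neg (by omega), if_pos (by omega)]; simp
    · obtain ⟨k, rfl⟩ : ∃ k : ℕ, q = k + 1 := ⟨(q - 1).toNat, by omega⟩
      rw [if_pos (by omega), if_pos (by omega), if_pos (by omega), ← sub_smul]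
      congr 1
      have e4 : ((k : ℤ) + 1).toNat = k + 1 := by omega
      have e5 : ((k : ℤ) + 1 - 1).toNat = k := by omega
      rw [e4, e5, show p + ((k : ℤ) + 1) = (p + k) + 1 by ring, Ring.choose_succ_succ,
        show p - 1 + ((k : ℤ) + 1) = p + k by ring, show p + ((k : ℤ) + 1 - 1) = p + k by ring]
      ring
  · rw [if_neg (by omega : ¬ (0 ≤ q ∧ p + q ≤ 0))]
    by_cases h1 : p + q = 1
    · have e1 : (-(p - 1 + q)).toNat = 0 := by omega
      have e2 : (-(p + (q - 1))).toNat = 0 := by omega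
      rw [e1, e2]; simp
    · rw [if_neg (by omega), if_neg (by omega), sub_zero]

theorem mulSub_expd (s : ℤˣ) (f : R⟦X⟧) :
    mulSub 0 (expd s (PowerSeries.X * f)) = (s : ℤ) • expd s f := by
  rcases Int.units_eq_one_or s with rfl | rfl
  · rw [expd_one_apply, expd_one_apply, mulSub_expandZW]; simp
  · rw [expd_neg_apply, expd_neg_apply]
    funext p q
    have := congrFun (congrFun (mulSub_expandZW f) q) p
    simp only [mulSub, zero_mul, sub_zero, expandWZ, Pi.smul_apply] at this ⊢
    rw [← this]; simp

theorem expd_one_eq (s : ℤˣ) (p q : ℤ) :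
    expd s (1 : R⟦X⟧) p q = if p = 0 ∧ q = 0 then 1 else 0 := by
  have key : ∀ p q : ℤ, expandZW (1 : R⟦X⟧) p q = if p = 0 ∧ q = 0 then 1 else 0 := by
    intro p q
    rw [expandZW]
    by_cases h : 0 ≤ q ∧ p + q ≤ 0
    · rw [if_pos h, PowerSeries.coeff_one]
      by_cases h1 : p + q = 0
      · rw [h1]
        rcases h.1.eq_or_lt with h2 | h2
        · subst h2
          have : p = 0 := by omega
          simp [this]
        · obtain ⟨k, hk⟩ : ∃ k : ℕ, q.toNat = k + 1 := ⟨q.toNat - 1, by omega⟩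
          rw [hk, Ring.choose_zero_succ, mul_zero, zero_smul, if_neg (by omega)]
      · rw [if_neg (by omega), smul_zero, if_neg (by omega)]
    · rw [if_neg h, if_neg (by omega)]
  rcases Int.units_eq_one_or s with rfl | rfl
  · exact key p q
  · rw [expd_neg_apply, expandWZ, key]; simp [and_comm]

/-- Power series with coefficients tending to zero. -/
def Tate (R : Type*) [Ring R] [Algebra ℂ⟦X⟧ R] : Submodule ℂ⟦X⟧ R⟦X⟧ where
  carrier := {f | ∀ r, ∃ K, ∀ k ≥ K, PowerSeries.coeff k f ∈ hsub R r}
  add_mem' {f f'} hf hf' r := by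
    obtain ⟨K, hK⟩ := hf r
    obtain ⟨K', hK'⟩ := hf' r
    refine ⟨max K K', fun k hk => ?_⟩
    rw [map_add]
    exact (hsub R r).add_mem (hK k (le_trans (le_max_left _ _) hk))
      (hK' k (le_trans (le_max_right _ _) hk))
  zero_mem' r := ⟨0, fun k _ => by rw [map_zero]; exact Submodule.zero_mem _⟩
  smul_mem' c f hf r := by
    obtain ⟨K, hK⟩ := hf r
    exact ⟨K, fun k hk => by rw [PowerSeries.coeff_smul]; exact (hsub R r).smul_mem c (hK k hk)⟩

theorem HSer.mem_tate {f : R⟦X⟧} (h : HSer f) : f ∈ Tate R := fun r =>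
  ⟨r, fun k hk => hsub_anti hk (h k)⟩

theorem X_mul_mem_tate {f : R⟦X⟧} (h : f ∈ Tate R) : PowerSeries.X * f ∈ Tate R := fun r => by
  obtain ⟨K, hK⟩ := h r
  refine ⟨K + 1, fun k hk => ?_⟩
  obtain ⟨k, rfl⟩ : ∃ j, k = j + 1 := ⟨k - 1, by omega⟩
  rw [PowerSeries.coeff_succ_X_mul]
  exact hK k (by omega)

theorem C_mul_mem_tate (c : R) {f : R⟦X⟧} (h : f ∈ Tate R) : PowerSeries.C c * f ∈ Tate R :=
  fun r => by
  obtain ⟨K, hK⟩ := h r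
  refine ⟨K, fun k hk => ?_⟩
  rw [PowerSeries.coeff_C_mul]
  exact mul_mem_hsub_left _ (hK k hk)

theorem one_mem_tate : (1 : R⟦X⟧) ∈ Tate R := fun r =>
  ⟨1, fun k hk => by
    rw [PowerSeries.coeff_one, if_neg (by omega)]; exact Submodule.zero_mem _⟩

/-- Completeness of this submodule is what keeps `ev D P` inside it when `D` preserves it. Products
with kernels are linear in the kernel only there, because elsewhere they need not converge. -/
theorem topFree_tate [TopFree R] : TopFree (Tate R) := by
  refine topFree_submodule _ (fun f hf r => ?_) fun f hf r => ?_
  · obtain ⟨K, hK⟩ := hf (r + 1)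
    refine ⟨K, fun k hk => ?_⟩
    obtain ⟨u, hu⟩ := mem_hsub.1 (hK k hk)
    rw [PowerSeries.coeff_smul, pow_succ', mul_smul] at hu
    exact mem_hsub.2 ⟨u, hv_inj hu⟩
  · obtain ⟨u, hu, hfu⟩ := hf r
    obtain ⟨K, hK⟩ := hu r
    refine ⟨K, fun k hk => ?_⟩
    have := map_mem_hsub (coeffL R k) hfu
    have h2 := (hsub R r).add_mem this (hK k hk)
    simpa [coeffL] using h2

end Kernels

section Product

variable {W : Type*} [AddCommGroup W] [Module ℂ⟦X⟧ W] [TopFree W]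

/-- Distributions which tend pointwise to zero as the exponent of `z` tends to `s∞`, uniformly in
the exponent of `w`. -/
def Null (s : ℤˣ) (D : ℤ → ℤ → Op W) : Prop :=
  ∀ v r, ∃ N : ℤ, ∀ m n, N ≤ (s : ℤ) * m → D m n v ∈ hsub W r

theorem expd_bound {s : ℤˣ} {f : (Op W)⟦X⟧} {p q : ℤ} (h : expd s f p q ≠ 0) :
    (s : ℤ) * p ≤ 0 ∧ p + q ≤ 0 ∧ (s = 1 → 0 ≤ q) := by
  rcases Int.units_eq_one_or s with rfl | rfl
  · rw [expd_one_apply, expandZW] at h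
    by_contra h'
    refine h (if_neg ?_)
    simp at h'; omega
  · rw [expd_neg_apply, expandWZ, expandZW] at h
    have h3 : ¬ ((-1 : ℤˣ) = 1) := by decide
    by_contra h'
    refine h (if_neg ?_)
    simp at h'; omega

theorem expd_mem (s : ℤˣ) (f : (Op W)⟦X⟧) (p q : ℤ) :
    ∃ c : ℤ, expd s f p q = c • PowerSeries.coeff (-(p + q)).toNat f := by
  rcases Int.units_eq_one_or s with rfl | rfl
  · rw [expd_one_apply, expandZW]
    split_ifs
    · exact ⟨_, rfl⟩
    · exact ⟨0, by simp⟩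
  · rw [expd_neg_apply, expandWZ, expandZW, add_comm p]
    split_ifs
    · exact ⟨_, rfl⟩
    · exact ⟨0, by simp⟩

theorem exists_uniform {s : ℤˣ} {D : ℤ → ℤ → Op W} (hD : Null s D) (f : ℕ → W) (r K : ℕ) :
    ∃ N : ℤ, ∀ k < K, ∀ m n, N ≤ (s : ℤ) * m → D m n (f k) ∈ hsub W r := by
  induction K with
  | zero => exact ⟨0, fun k hk => absurd hk (Nat.not_lt_zero k)⟩
  | succ K ih =>
    obtain ⟨N, hN⟩ := ih
    obtain ⟨N', hN'⟩ := hD (f K) r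
    refine ⟨max N N', fun k hk m n hm => ?_⟩
    rcases Nat.lt_succ_iff_lt_or_eq.1 hk with h | rfl
    · exact hN k h m n (le_trans (le_max_left _ _) hm)
    · exact hN' m n (le_trans (le_max_right _ _) hm)

/-- From some order `K` on, the coefficients of `f` are themselves divisible by `ħ ^ r`. The
finitely many earlier ones send `v` to finitely many vectors, on which `D` is uniformly small. -/
theorem Null.bound {s : ℤˣ} {D : ℤ → ℤ → Op W} (hD : Null s D) {f : (Op W)⟦X⟧}
    (hf : f ∈ Tate (Op W)) (v : W) (r : ℕ) : ∃ (K : ℕ) (N : ℤ), ∀ m n p q,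
      (K ≤ (-(p + q)).toNat ∨ N ≤ (s : ℤ) * m) → (D m n * expd s f p q) v ∈ hsub W r := by
  obtain ⟨K, hK⟩ := hf r
  obtain ⟨N, hN⟩ := exists_uniform hD (fun k => PowerSeries.coeff k f v) r K
  refine ⟨K, N, fun m n p q h => ?_⟩
  obtain ⟨c, hc⟩ := expd_mem s f p q
  rw [hc]
  by_cases h1 : K ≤ (-(p + q)).toNat
  · exact mem_hsub_hom.1 (mul_mem_hsub_left (D m n) (zsmul_mem_hsub c (hK _ h1))) v
  · have := zsmul_mem_hsub c (hN _ (not_le.1 h1) m n (h.resolve_left h1))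
    simpa using this

theorem pFin_dmul {s : ℤˣ} {D : ℤ → ℤ → Op W} (hD : Null s D) {f : (Op W)⟦X⟧}
    (hf : f ∈ Tate (Op W)) (m n : ℤ) :
    PFin fun p : ℤ × ℤ => D (m - p.1) (n - p.2) * expd s f p.1 p.2 := by
  intro v r
  obtain ⟨K, N, h⟩ := hD.bound hf v r
  refine ((Finset.Icc (-(|m| + |N|)) (|m| + |N|)) ×ˢ
    (Finset.Icc (-(|m| + |N| + K)) (|m| + |N|))).finite_toSet.subset ?_
  rintro ⟨p, q⟩ hpq
  simp only [Set.mem_ofPred_eq] at hpq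
  have h1 : expd s f p q ≠ 0 := fun h0 => hpq (by rw [h0, mul_zero]; exact Submodule.zero_mem _)
  have h2 := expd_bound h1
  have h3 : ¬ (K ≤ (-(p + q)).toNat ∨ N ≤ (s : ℤ) * (m - p)) := fun h0 => hpq (h _ _ _ _ h0)
  simp only [Finset.coe_product, Finset.coe_Icc, Set.mem_prod, Set.mem_Icc]
  have := le_abs_self m; have := neg_abs_le m; have := le_abs_self N; have := neg_abs_le N
  rcases Int.units_eq_one_or s with rfl | rfl
  · simp at h2 h3; omega
  · simp at h2 h3; omega

theorem Null.dmul {s : ℤˣ} {D : ℤ → ℤ → Op W} (hD : Null s D) {f : (Op W)⟦X⟧}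
    (hf : f ∈ Tate (Op W)) : Null s (dmul D (expd s f)) := by
  intro v r
  obtain ⟨K, N, h⟩ := hD.bound hf v r
  refine ⟨N, fun m n hm => (pFin_dmul hD hf m n).tsum_mem v r fun p => ?_⟩
  by_cases h1 : expd s f p.1 p.2 = 0
  · rw [h1, mul_zero]; exact Submodule.zero_mem _
  · refine h _ _ _ _ (Or.inr ?_)
    have := (expd_bound h1).1
    rw [mul_sub]; omega

theorem dmul_one (s : ℤˣ) (D : ℤ → ℤ → Op W) : dmul D (expd s 1) = D := by
  funext m n
  rw [dmul, tsum_eq_single (0, 0)]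
  · simp [expd_one_eq]
  · rintro ⟨p, q⟩ h
    rw [expd_one_eq, if_neg, mul_zero]
    simpa using h

theorem dmul_add {s : ℤˣ} {D : ℤ → ℤ → Op W} (hD : Null s D) {f f' : (Op W)⟦X⟧}
    (hf : f ∈ Tate (Op W)) (hf' : f' ∈ Tate (Op W)) :
    dmul D (expd s (f + f')) = dmul D (expd s f) + dmul D (expd s f') := by
  funext m n
  rw [Pi.add_apply, Pi.add_apply, dmul, dmul, dmul,
    ← (pFin_dmul hD hf m n).summable.tsum_add (pFin_dmul hD hf' m n).summable]
  congr 1; funext p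
  rw [map_add, Pi.add_apply, Pi.add_apply, mul_add]

theorem expd_C_mul (s : ℤˣ) (c : Op W) (f : (Op W)⟦X⟧) (p q : ℤ) :
    expd s (PowerSeries.C c * f) p q = c * expd s f p q := by
  rcases Int.units_eq_one_or s with rfl | rfl
  · rw [expd_one_apply, expd_one_apply, expandZW, expandZW]
    split_ifs
    · rw [PowerSeries.coeff_C_mul, mul_smul_comm]
    · simp
  · rw [expd_neg_apply, expd_neg_apply, expandWZ, expandWZ, expandZW, expandZW]
    split_ifs
    · rw [PowerSeries.coeff_C_mul, mul_smul_comm]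
    · simp

theorem dmul_C_mul {s : ℤˣ} {D : ℤ → ℤ → Op W} (hD : Null s D) {f : (Op W)⟦X⟧}
    (hf : f ∈ Tate (Op W)) {c : Op W} (hc : ∀ m n, Commute c (D m n)) :
    dmul D (expd s (PowerSeries.C c * f)) = kY c (dmul D (expd s f)) := by
  funext m n
  change _ = c * dmul D (expd s f) m n
  rw [dmul, dmul, ← (pFin_dmul hD hf m n).tsum_mul_left]
  congr 1; funext p
  rw [expd_C_mul, ← mul_assoc, ← mul_assoc, (hc _ _).eq]

theorem mulSub_dmul {D K : ℤ → ℤ → Op W}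
    (h : ∀ m n, PFin fun p : ℤ × ℤ => D (m - p.1) (n - p.2) * K p.1 p.2) :
    mulSub 0 (dmul D K) = dmul D (mulSub 0 K) := by
  funext m n
  simp only [mulSub, zero_mul, sub_zero, dmul]
  rw [← (Equiv.subRight ((1 : ℤ), (0 : ℤ))).tsum_eq
      (fun p : ℤ × ℤ => D (m - 1 - p.1) (n - p.2) * K p.1 p.2),
    ← (Equiv.subRight ((0 : ℤ), (1 : ℤ))).tsum_eq
      (fun p : ℤ × ℤ => D (m - p.1) (n - 1 - p.2) * K p.1 p.2), ← Summable.tsum_sub]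
  · congr 1; funext p
    simp only [Equiv.subRight_apply, Prod.fst_sub, Prod.snd_sub, sub_zero, mul_sub]
    congr 3 <;> ring
  · exact ((h (m - 1) n).comp (Equiv.injective _)).summable
  · exact ((h m (n - 1)).comp (Equiv.injective _)).summable

theorem mulSub_dmul_X {s : ℤˣ} {D : ℤ → ℤ → Op W} (hD : Null s D) {f : (Op W)⟦X⟧}
    (hf : f ∈ Tate (Op W)) :
    mulSub 0 (dmul D (expd s (PowerSeries.X * f))) = (s : ℤ) • dmul D (expd s f) := by
  rw [mulSub_dmul (pFin_dmul hD (X_mul_mem_tate hf)), mulSub_expd]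
  funext m n
  simp only [dmul, Pi.smul_apply, mul_smul_comm]
  rcases Int.units_eq_one_or s with rfl | rfl
  · simp
  · simp [tsum_neg]

/-- Along a line of constant total degree in `z` and `w`, the equation determines each coefficient
by the next one up to a term divisible by `ħ`, and nullness says that the coefficients tend to zero
along the line. This permits the cancellation of linear factors. -/
theorem Null.eq_zero {s : ℤˣ} {D : ℤ → ℤ → Op W} (hD : Null s D) {c : Op W}
    (hc : c ∈ hsub (Op W) 1) (h : mulSub c D = 0) : D = 0 := by
  have h0 : ∀ m n, D (m - 1) n - D m (n - 1) - c * D m n = 0 := fun m n =>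
    congrFun (congrFun h m) n
  suffices h : (fun g : ℤ × ℤ => D g.1 g.2) = 0 by
    funext m n; exact congrFun h (m, n)
  rcases Int.units_eq_one_or s with rfl | rfl
  · refine eq_zero_of_recursion (δ := ((1 : ℤ), (-1 : ℤ))) (η := ((1 : ℤ), (0 : ℤ))) hc
      (fun g => ?_) fun g v r => ?_
    · have := h0 (g.1 + 1) g.2
      rw [add_sub_cancel_right] at this
      simp only [Prod.fst_add, Prod.snd_add, add_zero, ← sub_eq_add_neg]
      rw [sub_sub, sub_eq_zero] at this
      exact this
    · obtain ⟨N, hN⟩ := hD v r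
      refine ⟨(N - g.1).toNat, hN _ _ ?_⟩
      simp; omega
  · refine eq_zero_of_recursion (δ := ((-1 : ℤ), (1 : ℤ))) (η := ((0 : ℤ), (1 : ℤ)))
      ((hsub _ 1).neg_mem hc) (fun g => ?_) fun g v r => ?_
    · have := h0 g.1 (g.2 + 1)
      rw [add_sub_cancel_right] at this
      simp only [Prod.fst_add, Prod.snd_add, add_zero, ← sub_eq_add_neg, neg_mul]
      rw [sub_sub, sub_eq_zero] at this
      rw [this]; abel
    · obtain ⟨N, hN⟩ := hD v r
      refine ⟨(N + g.1).toNat, hN _ _ ?_⟩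
      simp

end Product

end

section
/-! ## Calculus of kernels -/

section Evaluation

variable {R : Type*} [Ring R] [Algebra ℂ⟦X⟧ R] [TopFree R]

theorem ev_smul_rescale (a : ℂ) (y : R) (P : ℂ⟦X⟧) :
    ev ((PowerSeries.C a : ℂ⟦X⟧) • y) P = ev y (PowerSeries.rescale a P) := by
  rw [ev_def, ev_def]
  congr 1; funext k
  rw [smul_pow, smul_smul, ← map_pow, ← map_mul, PowerSeries.coeff_rescale, mul_comm]

theorem rescale_neg_S : PowerSeries.rescale (-1 : ℂ) S = S := by
  ext n
  rw [PowerSeries.coeff_rescale, S, PowerSeries.coeff_mk]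
  split_ifs with h
  · rw [h.neg_one_pow, one_mul]
  · rw [mul_zero]

theorem constantCoeff_S : PowerSeries.constantCoeff S = 1 := by
  rw [← PowerSeries.coeff_zero_eq_constantCoeff_apply, S, PowerSeries.coeff_mk]; simp

theorem S_mul_inv : S * S⁻¹ = 1 :=
  PowerSeries.mul_inv_cancel _ (by rw [constantCoeff_S]; exact one_ne_zero)

theorem rescale_neg_S_inv : PowerSeries.rescale (-1 : ℂ) S⁻¹ = S⁻¹ := by
  have h := congrArg (PowerSeries.rescale (-1 : ℂ)) S_mul_inv
  rw [map_mul, rescale_neg_S, map_one] at h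
  calc PowerSeries.rescale (-1 : ℂ) S⁻¹ = (S * PowerSeries.rescale (-1 : ℂ) S⁻¹) * S⁻¹ := by
        rw [mul_right_comm, S_mul_inv, one_mul]
    _ = S⁻¹ := by rw [h, one_mul]

theorem ev_sign_S (s : ℤˣ) (y : R) : ev ((s : ℤ) • y) S = ev y S := by
  rcases Int.units_eq_one_or s with rfl | rfl
  · simp
  · have := ev_smul_rescale (-1) y S
    rw [rescale_neg_S] at this
    rw [← this]; simp

theorem ev_sign_S_inv (s : ℤˣ) (y : R) : ev ((s : ℤ) • y) S⁻¹ = ev y S⁻¹ := by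
  rcases Int.units_eq_one_or s with rfl | rfl
  · simp
  · have := ev_smul_rescale (-1) y S⁻¹
    rw [rescale_neg_S_inv] at this
    rw [← this]; simp

theorem ev_add_expS {y z : R} (h : Commute y z) (a c : ℂ) :
    ev ((PowerSeries.C a : ℂ⟦X⟧) • y + (PowerSeries.C c : ℂ⟦X⟧) • z) (expS 1) =
      ev y (expS a) * ev z (expS c) := by
  have key : ∀ (b : ℂ) (x : R), EXP ((PowerSeries.C (b / 2) : ℂ⟦X⟧) • x) = ev x (expS b) := by
    intro b x
    rw [EXP, ev_smul_rescale, expS, expS, PowerSeries.rescale_rescale]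
    congr 2; ring_nf
  rw [← key a, ← key c, ← EXP_add ((h.smul_left _).smul_right _)]
  have := key 1 ((PowerSeries.C a : ℂ⟦X⟧) • y + (PowerSeries.C c : ℂ⟦X⟧) • z)
  rw [← this, smul_add, smul_smul, smul_smul, ← map_mul, ← map_mul, one_div_mul_eq_div,
    one_div_mul_eq_div]

/-- The series `a S(a t) = sinh (a t) / t`. -/
def aS (a : ℂ) : ℂ⟦X⟧ := PowerSeries.C a * PowerSeries.rescale a S

theorem two_X_aS (a : ℂ) : 2 * (PowerSeries.X * aS a) = expS a - expS (-a) := by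
  rw [← map_ofNat (PowerSeries.C : ℂ →+* ℂ⟦X⟧) 2]
  ext n
  rw [PowerSeries.coeff_C_mul, map_sub, coeff_expS, coeff_expS]
  rcases n with _ | n
  · simp
  · rw [PowerSeries.coeff_succ_X_mul, aS, PowerSeries.coeff_C_mul, PowerSeries.coeff_rescale, S,
      PowerSeries.coeff_mk]
    split_ifs with h
    · rw [(Even.add_one h).neg_pow]; ring
    · rw [((Nat.not_even_iff_odd.1 h).add_one).neg_pow]; simp

theorem hsum_ite (n : ℕ) (x : R) : hsum (fun k => if n = k then x else 0) = hv ^ n • x := by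
  refine (hsum_unique fun r => ?_).symm
  by_cases h : n < r
  · rw [Finset.sum_eq_single n (fun k _ hk => by rw [if_neg hk.symm, smul_zero])
      (fun h' => absurd (Finset.mem_range.2 h) h'), if_pos rfl, sub_self]
    exact Submodule.zero_mem _
  · rw [Finset.sum_eq_zero, sub_zero]
    · exact hsub_anti (not_lt.1 h) (smul_mem_hsub n x)
    · intro k hk
      rw [if_neg (by have := Finset.mem_range.1 hk; omega), smul_zero]

end Evaluation

section OneVariable

variable {R : Type*} [Ring R] [Algebra ℂ⟦X⟧ R]

theorem dB_monomial (x : R) (m : ℕ) : dB R 1 (PowerSeries.C x * PowerSeries.X ^ m) =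
    (-(m : ℤ)) • (PowerSeries.C x * PowerSeries.X ^ (m + 1)) := by
  have h : eulerB 1 (PowerSeries.C x * PowerSeries.X ^ m) =
      (-(m : ℤ)) • (PowerSeries.C x * PowerSeries.X ^ m : R⟦X⟧) := by
    ext n
    rw [eulerB, PowerSeries.coeff_mk, map_zsmul, PowerSeries.coeff_C_mul, PowerSeries.coeff_X_pow]
    split_ifs with h
    · rw [h]; simp
    · simp
  rw [dB_one_eq, h, mul_smul_comm, ← mul_assoc, ← (PowerSeries.commute_X _).eq, mul_assoc,
    ← pow_succ']

theorem coeff_zero_dB (f : R⟦X⟧) : PowerSeries.coeff 0 (dB R 1 f) = 0 := by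
  rw [dB_one_eq]; simp

theorem dB_injective {f f' : R⟦X⟧} (h : dB R 1 f = dB R 1 f')
    (h0 : PowerSeries.coeff 0 f = PowerSeries.coeff 0 f') : f = f' := by
  ext n
  rcases n with _ | n
  · exact h0
  · have h1 := congrArg (PowerSeries.coeff (n + 2)) h
    rw [dB_one_eq, dB_one_eq, PowerSeries.coeff_succ_X_mul, PowerSeries.coeff_succ_X_mul, eulerB,
      eulerB, PowerSeries.coeff_mk, PowerSeries.coeff_mk] at h1
    have h2 : ∀ x : R, (PowerSeries.C (-(1 / ((n : ℂ) + 1))) : ℂ⟦X⟧) •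
        ((-(((1 : ℤˣ) : ℤ) * ((n + 1 : ℕ) : ℤ))) • x) = x := by
      intro x
      rw [← Int.cast_smul_eq_zsmul ℂ⟦X⟧, smul_smul,
        ← map_intCast (PowerSeries.C : ℂ →+* ℂ⟦X⟧), ← map_mul]
      have h3 : ((n : ℂ) + 1) ≠ 0 := by exact_mod_cast n.succ_ne_zero
      have h4 : -(1 / ((n : ℂ) + 1)) * ((-(((1 : ℤˣ) : ℤ) * ((n + 1 : ℕ) : ℤ)) : ℤ) : ℂ) = 1 := by
        push_cast; field_simp
      rw [h4, map_one, one_smul]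
    rw [← h2 (PowerSeries.coeff (n + 1) f), h1, h2]

theorem kB_dB_pow_X (r : R) (k : ℕ) : ((kB r * dB R 1) ^ k) PowerSeries.X =
    ((-1) ^ k * k.factorial : ℤ) • (PowerSeries.C (r ^ k) * PowerSeries.X ^ (k + 1) : R⟦X⟧) := by
  induction k with
  | zero => simp
  | succ k ih =>
    rw [pow_succ', Module.End.mul_apply, ih, map_zsmul, Module.End.mul_apply, dB_monomial,
      map_zsmul, kB_apply, ← mul_assoc, ← map_mul, ← pow_succ', smul_smul, Nat.factorial_succ]
    congr 1
    push_cast; ring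

variable [TopFree R]

/-- The kernel `(2ħ)⁻¹ log (1 + r ħ x⁻¹)`. -/
def phi (r : R) : R⟦X⟧ := Flog ((PowerSeries.C (1 / 2 : ℂ) : ℂ⟦X⟧) •
  (PowerSeries.C r * PowerSeries.X))

theorem phi_eq (r : R) : phi r = hsum fun k =>
    (PowerSeries.C ((-1) ^ k / (2 * (k + 1)) : ℂ) : ℂ⟦X⟧) •
      (PowerSeries.C (r ^ (k + 1)) * PowerSeries.X ^ (k + 1) : R⟦X⟧) := by
  have hc : Commute (PowerSeries.C r : R⟦X⟧) PowerSeries.X := PowerSeries.commute_X _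
  rw [phi, Flog, ev_def, mul_hsum]
  congr 1; funext k
  rw [mul_smul_comm, ← pow_succ', smul_pow, hc.mul_pow, smul_smul, ← map_pow, ← map_mul,
    ← map_pow, logS, PowerSeries.coeff_mk]
  congr 2
  rw [pow_succ, show (-2 : ℂ) ^ k = (-1) ^ k * 2 ^ k by rw [← mul_pow]; norm_num]
  have h3 : ((k : ℂ) + 1) ≠ 0 := by exact_mod_cast k.succ_ne_zero
  field_simp
  rw [← mul_pow]; norm_num

theorem ev_expS_X (r : R) (c : ℂ) : ev (kB r * dB R 1) (expS c) PowerSeries.X = hsum fun k =>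
    (PowerSeries.C ((-c) ^ k) : ℂ⟦X⟧) •
      (PowerSeries.C (r ^ k) * PowerSeries.X ^ (k + 1) : R⟦X⟧) := by
  rw [ev_apply]
  congr 1; funext k
  rw [kB_dB_pow_X, ← Int.cast_smul_eq_zsmul ℂ⟦X⟧, smul_smul,
    ← map_intCast (PowerSeries.C : ℂ →+* ℂ⟦X⟧), ← map_mul, coeff_expS]
  congr 2
  have h1 : (k.factorial : ℂ) ≠ 0 := by exact_mod_cast k.factorial_ne_zero
  push_cast; field_simp
  rw [neg_pow c, mul_comm]

/-- The derivative of `log (1 + r ħ x⁻¹)` is `(x + r ħ)⁻¹ - x⁻¹`, and the first term is a shift of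
`x⁻¹`. -/
theorem two_dB_phi (r : R) : (2 * hv) • dB R 1 (phi r) =
    ev (kB r * dB R 1) (expS 1) PowerSeries.X - PowerSeries.X := by
  rw [ev_expS_X, hsum_succ, phi_eq, map_hsum, mul_comm, mul_smul]
  have h0 : (PowerSeries.C ((-1 : ℂ) ^ 0) : ℂ⟦X⟧) •
      (PowerSeries.C (r ^ 0) * PowerSeries.X ^ (0 + 1) : R⟦X⟧) = PowerSeries.X := by simp
  rw [h0, add_sub_cancel_left, ← hsum_smul]
  congr 2; funext k
  rw [map_smul, dB_monomial, ← Int.cast_smul_eq_zsmul ℂ⟦X⟧, smul_smul, smul_smul,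
    ← map_intCast (PowerSeries.C : ℂ →+* ℂ⟦X⟧), ← map_ofNat (PowerSeries.C : ℂ →+* ℂ⟦X⟧) 2,
    ← map_mul, ← map_mul]
  congr 2
  have h3 : ((k : ℂ) + 1) ≠ 0 := by exact_mod_cast k.succ_ne_zero
  push_cast; field_simp
  ring

/-- The element `a + c κ`. -/
def lin (κ : R) (a c : ℂ) : R := (PowerSeries.C a : ℂ⟦X⟧) • (1 : R) + (PowerSeries.C c : ℂ⟦X⟧) • κ

theorem kB_lin (κ : R) (a c : ℂ) : kB (lin κ a c) * dB R 1 =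
    (PowerSeries.C a : ℂ⟦X⟧) • dB R 1 + (PowerSeries.C c : ℂ⟦X⟧) • (kB κ * dB R 1) := by
  refine LinearMap.ext fun f => ?_
  ext n
  simp [lin, kB_apply, add_mul, Module.End.mul_apply]

/-- The kernel `(2ħ)⁻¹ log ((x + (cκ + a)ħ) / (x + (cκ - a)ħ))`. -/
def psi (κ : R) (a c : ℂ) : R⟦X⟧ := TB 1 κ c (ev (dB R 1) (aS a) PowerSeries.X)

theorem coeff_zero_ev_X (κ : R) (P : ℂ⟦X⟧) {f : R⟦X⟧} (hf : PowerSeries.coeff 0 f = 0) :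
    PowerSeries.coeff 0 (ev (kB κ * dB R 1) P f) = 0 := by
  have := ev_intertwine (D := kB κ * dB R 1) (D' := 0) (coeffL R 0) (fun m => by
    change PowerSeries.coeff 0 (PowerSeries.C κ * dB R 1 m) = 0
    rw [PowerSeries.coeff_C_mul, coeff_zero_dB, mul_zero]) P f
  change PowerSeries.coeff 0 _ = ev (0 : Module.End ℂ⟦X⟧ R) P (PowerSeries.coeff 0 f) at this
  rw [this, hf, map_zero]

theorem kB_one : kB (1 : R) = 1 := by
  refine LinearMap.ext fun f => ?_
  simp [kB_apply]

theorem commute_TB_ev (κ : R) (c : ℂ) (P : ℂ⟦X⟧) : Commute (TB 1 κ c) (ev (dB R 1) P) :=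
  commute_ev ((commute_ev ((commute_kB_dB 1 κ).symm.mul_right (Commute.refl _)) _).symm) _

theorem two_hv_inj {M : Type*} [AddCommGroup M] [Module ℂ⟦X⟧ M] [TopFree M] {x y : M}
    (h : (2 * hv) • x = (2 * hv) • y) : x = y := by
  rw [mul_comm, mul_smul, mul_smul] at h
  have h2 := congrArg (fun z => (PowerSeries.C (1 / 2 : ℂ) : ℂ⟦X⟧) • z) (hv_inj h)
  simp only [smul_smul, ← map_ofNat (PowerSeries.C : ℂ →+* ℂ⟦X⟧) 2, ← map_mul] at h2
  norm_num at h2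
  exact h2

/-- Both sides have zero constant term, so it suffices to compare derivatives. Since `2ħ∂` times `a
S(aħ∂)` is `exp (aħ∂) - exp (-aħ∂)`, both become `(x + (cκ + a)ħ)⁻¹ - (x + (cκ - a)ħ)⁻¹` after
multiplication by `2ħ`. -/
theorem psi_eq (κ : R) (a c : ℂ) : psi κ a c = phi (lin κ a c) - phi (lin κ (-a) c) := by
  have hphi : ∀ r : R, PowerSeries.coeff 0 (phi r) = 0 := fun r => by
    change coeffL R 0 (phi r) = 0
    rw [phi_eq, map_hsum, ← hsum_zero]
    congr 1; funext k
    simp [coeffL]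
  refine dB_injective (two_hv_inj ?_) ?_
  · have hc : Commute (dB R 1) (kB κ * dB R 1) :=
      (commute_kB_dB 1 κ).symm.mul_right (Commute.refl _)
    have hd : Commute (dB R 1) (TB 1 κ c) := commute_ev hc _
    rw [map_sub, smul_sub, two_dB_phi, two_dB_phi, sub_sub_sub_cancel_right, kB_lin, kB_lin,
      ev_add_expS hc, ev_add_expS hc, ← LinearMap.sub_apply, ← sub_mul, ← map_sub, ← two_X_aS,
      psi, ← Module.End.mul_apply, ← Module.End.mul_apply, ← LinearMap.smul_apply]
    congr 1
    rw [map_mul, map_mul, ev_X, map_ofNat, ← TB, mul_assoc (dB R 1),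
      (commute_TB_ev κ c _).eq, smul_mul_assoc, mul_assoc 2, smul_mul_assoc, mul_assoc (dB R 1)]
    exact (mul_smul _ _ _).trans (by rw [two_smul, two_mul])
  · have h1 : dB R 1 = kB 1 * dB R 1 := by rw [kB_one, one_mul]
    rw [map_sub, hphi, hphi, sub_zero, psi, TB, coeff_zero_ev_X]
    rw [h1]
    exact coeff_zero_ev_X _ _ (by simp)

theorem inv1_eq (κ : R) (c : ℂ) : inv1 (ch c • κ) = TB 1 κ c PowerSeries.X := by
  rw [TB, ev_expS_X]
  ext n
  change _ = coeffL R n _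
  rw [map_hsum]
  rcases n with _ | n
  · rw [inv1, PowerSeries.coeff_zero_X_mul, ← hsum_zero]
    congr 1; funext k
    simp [coeffL]
  · rw [inv1, PowerSeries.coeff_succ_X_mul, PowerSeries.coeff_mk]
    have : (fun k => coeffL R (n + 1) ((PowerSeries.C ((-c) ^ k) : ℂ⟦X⟧) •
        (PowerSeries.C (κ ^ k) * PowerSeries.X ^ (k + 1) : R⟦X⟧))) =
        fun k => if n = k then (PowerSeries.C ((-c) ^ n) : ℂ⟦X⟧) • κ ^ n else 0 := by
      funext k
      rw [map_smul]
      change _ • PowerSeries.coeff (n + 1) _ = _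
      rw [PowerSeries.coeff_C_mul, PowerSeries.coeff_X_pow]
      by_cases h : n = k
      · subst h; simp
      · rw [if_neg (by omega), if_neg h, mul_zero, smul_zero]
    rw [this, hsum_ite, smul_smul, ← neg_smul, smul_pow]
    congr 1
    rw [ch, ← neg_mul, mul_pow, map_pow, map_neg, mul_comm]

/-- `[c]_{q^∂} f` for the kernel `f`. -/
def qker (c : R) (f : R⟦X⟧) : R⟦X⟧ := kB c (ev (kB c * dB R 1) S (ev (dB R 1) S⁻¹ f))

theorem qker_intCast (a : ℤ) (f : R⟦X⟧) : qker (a : R) f = ev (dB R 1) (aS a * S⁻¹) f := by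
  have h : kB (a : R) = (PowerSeries.C (a : ℂ) : ℂ⟦X⟧) • (1 : Module.End ℂ⟦X⟧ R⟦X⟧) := by
    refine LinearMap.ext fun f => ?_
    rw [kB_apply, LinearMap.smul_apply, Module.End.one_apply, map_intCast, map_intCast,
      Int.cast_smul_eq_zsmul, zsmul_eq_mul]
  rw [qker, h, smul_mul_assoc, one_mul, ev_smul_rescale, LinearMap.smul_apply,
    Module.End.one_apply, map_mul, aS, map_mul, ev_C, Module.End.mul_apply, smul_mul_assoc, one_mul,
    LinearMap.smul_apply]

/-- The factor `S(ħ∂)` cancels the denominator of `[a]_{q^∂}` and leaves `a S(aħ∂)`, the operator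
that defines `psi`; the kernel `(x + κħ)⁻¹` is `x⁻¹` shifted. -/
theorem ev_S_qker_inv1 (κ : R) (a : ℤ) :
    ev (dB R 1) S (qker (a : R) (inv1 (ch 1 • κ))) = psi κ a 1 := by
  rw [qker_intCast, inv1_eq, ← Module.End.mul_apply, ← map_mul, mul_comm, mul_assoc,
    mul_comm S⁻¹, S_mul_inv, mul_one, psi, ← Module.End.mul_apply, ← Module.End.mul_apply,
    (commute_TB_ev κ 1 _).eq]

/-- The two factors `S(ħ∂)` cancel the denominators of both quantum numbers. Now `(x + κħ)⁻²` is
minus the derivative of `(x + κħ)⁻¹`, and `2ħ∂` times the numerator of `[κ]` is the difference of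
the shifts by `κħ` and `-κħ`. Starting from `x + κħ`, these lead to the parameters `2` and `0`. -/
theorem ev_S_S_qker_inv1 (κ : R) (a : ℤ) : (2 * hv) • ev (dB R 1) S (ev (dB R 1) S
    (qker (a : R) (qker κ (inv1 (ch 1 • κ) ^ 2)))) = psi κ a 0 - psi κ a 2 := by
  have hX : Commute (PowerSeries.C κ : R⟦X⟧) PowerSeries.X := PowerSeries.commute_X _
  have hdX : dB R 1 PowerSeries.X = -(PowerSeries.X ^ 2 : R⟦X⟧) := by
    have := dB_monomial (1 : R) 1
    simpa using this
  have hc : Commute (dB R 1) (kB κ * dB R 1) :=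
    (commute_kB_dB 1 κ).symm.mul_right (Commute.refl _)
  have hT : ∀ c, Commute (dB R 1) (TB 1 κ c) := fun c => commute_ev hc _
  have h1 : (inv1 (ch 1 • κ) ^ 2 : R⟦X⟧) = -dB R 1 (TB 1 κ 1 PowerSeries.X) := by
    rw [inv1_eq, ← TB_pow 1 1 hX, ← Module.End.mul_apply (dB R 1), (hT 1).eq,
      Module.End.mul_apply, hdX, map_neg, neg_neg]
  set E := ev (kB κ * dB R 1) S with hE
  have h2 : (2 * hv) • (kB κ * E * dB R 1) = TB 1 κ 1 - TB 1 κ (-1) := by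
    rw [TB, TB, ← map_sub, ← two_X_aS, map_mul, map_mul, ev_X, map_ofNat, aS, map_one, one_mul,
      PowerSeries.rescale_one, RingHom.id_apply, mul_assoc,
      ← (commute_ev hc S : Commute (dB R 1) E).eq, ← mul_assoc (kB κ), smul_mul_assoc]
    exact (mul_smul _ _ _).trans (by rw [two_smul, two_mul])
  have hZ : ∀ P, Commute (kB κ * E) (ev (dB R 1) P) := fun P =>
    (commute_ev (commute_kB_dB 1 κ) P).mul_left (commute_ev (commute_ev hc S).symm P)
  have h3 : ev (dB R 1) S * (ev (dB R 1) S * (ev (dB R 1) (aS a * S⁻¹) *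
      (kB κ * E * ev (dB R 1) S⁻¹))) = ev (dB R 1) (aS a) * (kB κ * E) := by
    rw [(hZ S⁻¹).eq, ← mul_assoc, ← mul_assoc, ← mul_assoc, ← map_mul, ← map_mul, ← map_mul]
    congr 2
    calc S * S * (aS a * S⁻¹) * S⁻¹ = aS a * (S * S⁻¹) * (S * S⁻¹) := by ring
      _ = aS a := by rw [S_mul_inv, mul_one, mul_one]
  have h4 := LinearMap.congr_fun h3 (inv1 (ch 1 • κ) ^ 2)
  simp only [Module.End.mul_apply] at h4
  rw [qker_intCast, qker, ← hE, h4, ← map_smul, h1, map_neg, map_neg, smul_neg]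
  have h5 := LinearMap.congr_fun h2 (TB 1 κ 1 PowerSeries.X)
  simp only [LinearMap.smul_apply, Module.End.mul_apply, LinearMap.sub_apply] at h5
  rw [h5, ← Module.End.mul_apply (TB 1 κ 1), ← TB_add, ← Module.End.mul_apply (TB 1 κ (-1)),
    ← TB_add, psi, psi, map_neg, map_sub, neg_sub, ← Module.End.mul_apply (TB 1 κ 0),
    ← Module.End.mul_apply (TB 1 κ 2), (commute_TB_ev κ 0 _).eq, (commute_TB_ev κ 2 _).eq,
    Module.End.mul_apply, Module.End.mul_apply]
  norm_num

end OneVariable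

section Kernels

variable {R : Type*} [Ring R] [Algebra ℂ⟦X⟧ R]

theorem succ_mul_choose (s : ℤ) (k : ℕ) :
    ((k : ℤ) + 1) * Ring.choose (s + 1) (k + 1) = (s + 1) * Ring.choose s k := by
  have h1 := Ring.choose_add_smul_choose s 1 k
  have h2 := Ring.choose_smul_choose (s + 1) (Nat.succ_le_succ (Nat.zero_le k))
  simp only [Nat.succ_eq_add_one, zero_add, Nat.choose_one_right, Ring.choose_one_right,
    add_tsub_cancel_right, Nat.cast_one, nsmul_eq_mul] at h2
  push_cast at h2
  exact h2

theorem dw_expandZW (f : R⟦X⟧) : dw R (expandZW f) = -expandZW (dB R 1 f) := by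
  funext p q
  change (q + 1) • expandZW f p (q + 1) = -expandZW (dB R 1 f) p q
  by_cases h : 0 ≤ q ∧ p + q ≤ 0
  · obtain ⟨k, rfl⟩ := Int.eq_ofNat_of_zero_le h.1
    rw [expandZW, expandZW, if_pos h]
    by_cases h0 : p + k = 0
    · rw [if_neg (by omega), h0, neg_zero, Int.toNat_zero, coeff_zero_dB]; simp
    · obtain ⟨N, hN⟩ : ∃ N : ℕ, p + k = -((N : ℤ) + 1) := ⟨(-(p + k) - 1).toNat, by omega⟩
      have e1 : (-(p + (k : ℤ))).toNat = N + 1 := by omega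
      have e2 : (-(p + ((k : ℤ) + 1))).toNat = N := by omega
      have e3 : ((k : ℤ) + 1).toNat = k + 1 := by omega
      rw [if_pos (by omega), e1, e2, e3, Int.toNat_natCast, dB_one_eq,
        PowerSeries.coeff_succ_X_mul, eulerB, PowerSeries.coeff_mk, smul_smul, smul_smul,
        ← neg_smul, ← add_assoc, hN]
      congr 1
      have := succ_mul_choose (-((N : ℤ) + 1)) k
      rw [pow_succ]; push_cast
      linear_combination (-(-1) ^ k) * this
  · rw [expandZW, expandZW, if_neg h]
    by_cases h0 : q + 1 = 0
    · rw [h0]; simp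
    · rw [if_neg (by omega)]; simp

theorem dz_expandZW (f : R⟦X⟧) : dz R (expandZW f) = expandZW (dB R 1 f) := by
  funext p q
  change (p + 1) • expandZW f (p + 1) q = expandZW (dB R 1 f) p q
  by_cases h : 0 ≤ q ∧ p + q ≤ 0
  · obtain ⟨k, rfl⟩ := Int.eq_ofNat_of_zero_le h.1
    rw [expandZW, expandZW, if_pos h]
    by_cases h0 : p + k = 0
    · rw [if_neg (by omega), h0, neg_zero, Int.toNat_zero, coeff_zero_dB]; simp
    · obtain ⟨N, hN⟩ : ∃ N : ℕ, p + k = -((N : ℤ) + 1) := ⟨(-(p + k) - 1).toNat, by omega⟩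
      have e1 : (-(p + (k : ℤ))).toNat = N + 1 := by omega
      have e2 : (-(p + 1 + (k : ℤ))).toNat = N := by omega
      rw [if_pos (by omega), e1, e2, Int.toNat_natCast, dB_one_eq,
        PowerSeries.coeff_succ_X_mul, eulerB, PowerSeries.coeff_mk, smul_smul, smul_smul,
        show p + 1 + (k : ℤ) = (p + k) + 1 by ring, hN]
      congr 1
      rcases k with _ | k
      · have : p = -((N : ℤ) + 1) := by simpa using hN
        rw [this]; simp
      · have h1 := succ_mul_choose (-((N : ℤ) + 1)) k
        have h2 := Ring.choose_succ_succ (-((N : ℤ) + 1)) k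
        have h3 := succ_mul_choose (-((N : ℤ) + 1) - 1) k
        rw [sub_add_cancel] at h3
        push_cast at hN ⊢
        have hp : p = -((N : ℤ) + 1) - (k + 1) := by linear_combination hN
        rw [hp, h2]
        rw [h2] at h1
        linear_combination (-(-1) ^ (k + 1)) * h1
  · rw [expandZW, expandZW, if_neg h]
    by_cases h0 : p + q + 1 = 1
    · rw [if_neg (by omega)]; simp
    · by_cases h1 : 0 ≤ q
      · rw [if_neg (by omega)]; simp
      · rw [if_neg (by omega)]; simp

theorem dw_expd (s : ℤˣ) (f : R⟦X⟧) :
    dw R (expd s f) = expd s (-((s : ℤ) • dB R 1 f)) := by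
  rcases Int.units_eq_one_or s with rfl | rfl
  · rw [expd_one_apply, dw_expandZW, map_neg, Units.val_one, one_smul]; rfl
  · rw [expd_neg_apply, Units.val_neg, Units.val_one, neg_smul, one_smul, neg_neg, expd_neg_apply]
    funext p q
    exact congrFun (congrFun (dz_expandZW f) q) p

theorem dz_expd (s : ℤˣ) (f : R⟦X⟧) : dz R (expd s f) = expd s ((s : ℤ) • dB R 1 f) := by
  rcases Int.units_eq_one_or s with rfl | rfl
  · rw [expd_one_apply, dz_expandZW, Units.val_one, one_smul]; rfl
  · rw [expd_neg_apply, Units.val_neg, Units.val_one, neg_smul, one_smul, map_neg, expd_neg_apply]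
    funext p q
    exact congrFun (congrFun (dw_expandZW f) q) p

end Kernels

section QNumbers

variable {W : Type*} [AddCommGroup W] [Module ℂ⟦X⟧ W] [TopFree W]

theorem dw_pow_apply (D : ℤ → ℤ → Op W) (k : ℕ) : (dw (Op W) ^ k) D = wderiv^[k] D := by
  rw [Module.End.pow_apply]; rfl

theorem kY_mul (c d : Op W) : kY (c * d) = kY c * kY d := by
  refine LinearMap.ext fun D => funext fun m => funext fun n => ?_
  simp [kY, mul_assoc]

theorem kY_pow (c : Op W) (k : ℕ) : kY (c ^ k) = kY c ^ k := by
  induction k with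
  | zero =>
    refine LinearMap.ext fun D => funext fun m => funext fun n => ?_
    simp [kY]
  | succ k ih => rw [pow_succ, kY_mul, ih, pow_succ]

theorem wdiffop_qnum (c : Op W) (D : ℤ → ℤ → Op W) : wdiffop (qnum c) D =
    kY c (ev (kY c * dw (Op W)) S (ev (dw (Op W)) S⁻¹ D)) := by
  have hc : ∀ k, PowerSeries.coeff k (qnum c) = hv ^ k • (c * ∑ p ∈
      Finset.HasAntidiagonal.antidiagonal k, (PowerSeries.C (PowerSeries.coeff p.1 S *
        PowerSeries.coeff p.2 S⁻¹) : ℂ⟦X⟧) • c ^ p.1) := by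
    intro k
    rw [qnum, mul_assoc, PowerSeries.coeff_C_mul, PowerSeries.coeff_mul, ← mul_smul_comm,
      Finset.smul_sum]
    congr 1
    refine Finset.sum_congr rfl fun p hp => ?_
    rw [PowerSeries.coeff_mk, PowerSeries.coeff_mk, ← Finset.HasAntidiagonal.mem_antidiagonal.1 hp,
      Algebra.algebraMap_eq_smul_one, smul_mul_smul_comm, mul_one, smul_smul]
    congr 1
    rw [pow_add, map_mul]; ring
  rw [← Module.End.mul_apply, ← Module.End.mul_apply, ev_def, ev_def, mul_assoc, hsum_mul,
    mul_hsum]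
  funext m n
  rw [hsum_hom_apply, hsum_apply, hsum_apply, ← tsum_hpow, wdiffop]
  congr 1; funext k
  rw [hc, ← dw_pow_apply, smul_mul_assoc]
  congr 1
  have hterm : ∀ p ∈ Finset.HasAntidiagonal.antidiagonal k,
      ((PowerSeries.C (PowerSeries.coeff p.1 S) : ℂ⟦X⟧) • (kY c * dw (Op W)) ^ p.1) *
      ((PowerSeries.C (PowerSeries.coeff p.2 S⁻¹) : ℂ⟦X⟧) • dw (Op W) ^ p.2) =
      kY ((PowerSeries.C (PowerSeries.coeff p.1 S *
        PowerSeries.coeff p.2 S⁻¹) : ℂ⟦X⟧) • c ^ p.1) * dw (Op W) ^ k := by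
    intro p hp
    rw [smul_mul_smul_comm, (commute_dw_kY c).symm.mul_pow, mul_assoc, ← pow_add,
      Finset.HasAntidiagonal.mem_antidiagonal.1 hp, kY_smul, kY_pow, smul_mul_assoc, map_mul]
  rw [Finset.sum_congr rfl hterm, ← Finset.sum_mul]
  have hsum' : ∑ p ∈ Finset.HasAntidiagonal.antidiagonal k,
      kY ((PowerSeries.C (PowerSeries.coeff p.1 S * PowerSeries.coeff p.2 S⁻¹) : ℂ⟦X⟧) • c ^ p.1) =
      kY (∑ p ∈ Finset.HasAntidiagonal.antidiagonal k, (PowerSeries.C (PowerSeries.coeff p.1 S *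
        PowerSeries.coeff p.2 S⁻¹) : ℂ⟦X⟧) • c ^ p.1) := by
    refine LinearMap.ext fun D => funext fun m => funext fun n => ?_
    simp [kY, Finset.sum_mul]
  rw [hsum', ← mul_assoc, ← kY_mul]
  rfl

theorem kY_expd (s : ℤˣ) (c : Op W) (f : (Op W)⟦X⟧) : kY c (expd s f) = expd s (kB c f) := by
  funext p q
  exact (expd_C_mul s c f p q).symm

/-- The derivative `∂_w` acts on `f(z - w)` as `-∂_x` and on `f(w - z)` as `∂_x`. The series `S` and
`S⁻¹` are even, so the same kernel results in both cases. -/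
theorem wdiffop_qnum_expd (s : ℤˣ) (c : Op W) (f : (Op W)⟦X⟧) :
    wdiffop (qnum c) (expd s f) = expd s (qker c f) := by
  have h1 : ∀ f, expd s (((-s : ℤˣ) : ℤ) • dB (Op W) 1 f) = dw (Op W) (expd s f) := fun f => by
    rw [dw_expd, Units.val_neg, neg_smul]
  have h2 : ∀ f, expd s (((-s : ℤˣ) : ℤ) • (kB c * dB (Op W) 1) f) =
      (kY c * dw (Op W)) (expd s f) := fun f => by
    rw [Module.End.mul_apply, Module.End.mul_apply, ← h1, kY_expd, map_zsmul (kB c)]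
  have e1 := ev_intertwine (M := (Op W)⟦X⟧) (N := ℤ → ℤ → Op W)
    (D := ((-s : ℤˣ) : ℤ) • dB (Op W) 1) (expd s) h1 S⁻¹ f
  rw [ev_sign_S_inv] at e1
  have e2 := ev_intertwine (M := (Op W)⟦X⟧) (N := ℤ → ℤ → Op W)
    (D := ((-s : ℤˣ) : ℤ) • (kB c * dB (Op W) 1)) (expd s) h2 S (ev (dB (Op W) 1) S⁻¹ f)
  rw [ev_sign_S] at e2
  rw [wdiffop_qnum, ← e1, ← e2, kY_expd]
  rfl

theorem wdiffop_qnum_add (c : Op W) (D D' : ℤ → ℤ → Op W) :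
    wdiffop (qnum c) (D + D') = wdiffop (qnum c) D + wdiffop (qnum c) D' := by
  simp only [wdiffop_qnum, map_add]

theorem wdiffop_qnum_sub (c : Op W) (D D' : ℤ → ℤ → Op W) :
    wdiffop (qnum c) (D - D') = wdiffop (qnum c) D - wdiffop (qnum c) D' := by
  simp only [wdiffop_qnum, map_sub]

end QNumbers

end

section
/-! ## Exchange relations with one-sided series -/

section OneSided

variable {W : Type*} [AddCommGroup W] [Module ℂ⟦X⟧ W] [TopFree W]

/-- Distributions in `z`, `w` which are one-sided in `z`. -/
abbrev OneSided (W : Type*) [AddCommGroup W] [Module ℂ⟦X⟧ W] := ℤ → (Op W)⟦X⟧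

/-- The distribution in two variables given by a family of one-sided series. -/
def iota2 (s : ℤˣ) : OneSided W →ₗ[ℂ⟦X⟧] (ℤ → ℤ → Op W) where
  toFun E m n := iota s (E n) m
  map_add' E F := by funext m n; simp
  map_smul' c E := by funext m n; simp

theorem iota2_apply (s : ℤˣ) (E : OneSided W) (m n : ℤ) : iota2 s E m n = iota s (E n) m := rfl

theorem iota2_injective (s : ℤˣ) : Function.Injective (iota2 (W := W) s) := fun E F h => by
  funext n
  refine iota_injective s (funext fun m => ?_)
  exact congrFun (congrFun h m) n

theorem null_of_support {s : ℤˣ} {D : ℤ → ℤ → Op W} (h : ∀ m n, 0 < (s : ℤ) * m → D m n = 0) :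
    Null s D := fun v r => ⟨1, fun m n hm => by
  rw [h m n (by omega)]; exact Submodule.zero_mem _⟩

theorem null_iota2 (s : ℤˣ) (E : OneSided W) : Null s (iota2 s E) :=
  null_of_support fun _ _ h => iota_of_pos _ h

theorem Null.sub {s : ℤˣ} {D D' : ℤ → ℤ → Op W} (h : Null s D) (h' : Null s D') :
    Null s (D - D') := fun v r => by
  obtain ⟨N, hN⟩ := h v r
  obtain ⟨N', hN'⟩ := h' v r
  refine ⟨max N N', fun m n hm => ?_⟩
  exact (hsub W r).sub_mem (hN m n (le_trans (le_max_left _ _) hm))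
    (hN' m n (le_trans (le_max_right _ _) hm))

theorem Null.mulSub {s : ℤˣ} {D : ℤ → ℤ → Op W} (h : Null s D) (c : Op W) :
    Null s (mulSub c D) := fun v r => by
  obtain ⟨N, hN⟩ := h v r
  refine ⟨N + 1, fun m n hm => ?_⟩
  refine (hsub W r).sub_mem ((hsub W r).sub_mem (hN _ _ ?_) (hN _ _ (by omega)))
    (map_mem_hsub c (hN _ _ (by omega)))
  rcases Int.units_eq_one_or s with rfl | rfl
  · simp at hm ⊢; omega
  · simp at hm ⊢; omega

theorem Null.mulSub_injective {s : ℤˣ} {D D' : ℤ → ℤ → Op W} (hD : Null s D) (hD' : Null s D')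
    {c : Op W} (hc : c ∈ hsub (Op W) 1) (h : DoubleYangian.mulSub c D = DoubleYangian.mulSub c D') :
    D = D' := by
  refine sub_eq_zero.1 ((hD.sub hD').eq_zero hc ?_)
  rw [← mulSubL_apply] at h ⊢
  rw [map_sub, sub_eq_zero]
  exact h

theorem zero_mem_hsub_one : (0 : Op W) ∈ hsub (Op W) 1 := Submodule.zero_mem _

theorem exists_iota2 {s : ℤˣ} {D : ℤ → ℤ → Op W} (h : ∀ m n, 0 < (s : ℤ) * m → D m n = 0) :
    iota2 s (fun n => PowerSeries.mk fun k => D (-((s : ℤ) * k)) n) = D := by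
  funext m n
  exact congrFun (iota_mk s (fun m => D m n) fun m hm => h m n hm) m

/-- The product of a one-sided distribution with a kernel. -/
def ker (s : ℤˣ) (E : OneSided W) (f : (Op W)⟦X⟧) : OneSided W := fun n =>
  PowerSeries.mk fun k => dmul (iota2 s E) (expd s f) (-((s : ℤ) * k)) n

theorem iota2_ker (s : ℤˣ) (E : OneSided W) (f : (Op W)⟦X⟧) :
    iota2 s (ker s E f) = dmul (iota2 s E) (expd s f) := by
  refine exists_iota2 fun m n h => ?_
  rw [dmul, tsum_congr (g := fun _ => 0), tsum_zero]
  intro p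
  by_cases h1 : expd s f p.1 p.2 = 0
  · rw [h1, mul_zero]
  · rw [iota2_apply, iota_of_pos, zero_mul]
    have := (expd_bound h1).1
    rw [mul_sub]; omega

theorem ker_add (s : ℤˣ) (E : OneSided W) {f f' : (Op W)⟦X⟧} (hf : f ∈ Tate (Op W))
    (hf' : f' ∈ Tate (Op W)) : ker s E (f + f') = ker s E f + ker s E f' := by
  apply iota2_injective s
  rw [map_add, iota2_ker, iota2_ker, iota2_ker, dmul_add (null_iota2 s E) hf hf']

theorem ker_one (s : ℤˣ) (E : OneSided W) : ker s E 1 = E := by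
  apply iota2_injective s
  rw [iota2_ker, dmul_one]

/-- Left multiplication by a series. -/
def lB (b : (Op W)⟦X⟧) : Module.End ℂ⟦X⟧ (OneSided W) where
  toFun E n := b * E n
  map_add' E F := by funext n; simp [mul_add]
  map_smul' c E := by funext n; simp

/-- Right multiplication by a series. -/
def rB (b : (Op W)⟦X⟧) : Module.End ℂ⟦X⟧ (OneSided W) where
  toFun E n := E n * b
  map_add' E F := by funext n; simp [add_mul]
  map_smul' c E := by funext n; simp

theorem iota2_lB_C (s : ℤˣ) (c : Op W) (E : OneSided W) :
    iota2 s (lB (PowerSeries.C c) E) = kY c (iota2 s E) := by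
  funext m n
  exact congrFun (iota_kB s c (E n)) m

theorem commute_iota {s : ℤˣ} {c : Op W} {f : (Op W)⟦X⟧} (h : Commute (PowerSeries.C c) f) (m : ℤ) :
    Commute c (iota s f m) := by
  rw [iota_apply]
  split_ifs
  · have := congrArg (PowerSeries.coeff (-((s : ℤ) * m)).toNat) h.eq
    rwa [PowerSeries.coeff_C_mul, PowerSeries.coeff_mul_C] at this
  · exact Commute.zero_right _

theorem ker_C_mul (s : ℤˣ) {E : OneSided W} {c : Op W} (hc : ∀ n, Commute (PowerSeries.C c) (E n))
    {f : (Op W)⟦X⟧} (hf : f ∈ Tate (Op W)) :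
    ker s E (PowerSeries.C c * f) = lB (PowerSeries.C c) (ker s E f) := by
  apply iota2_injective s
  rw [iota2_ker, iota2_lB_C, iota2_ker,
    dmul_C_mul (null_iota2 s E) hf fun m n => commute_iota (hc n) m]

theorem ker_smul (s : ℤˣ) (E : OneSided W) (c : ℂ⟦X⟧) {f : (Op W)⟦X⟧} (hf : f ∈ Tate (Op W)) :
    ker s E (c • f) = c • ker s E f := by
  have h1 : ∀ g : (Op W)⟦X⟧, PowerSeries.C (algebraMap ℂ⟦X⟧ (Op W) c) * g = c • g := fun g => by
    ext n : 1
    rw [PowerSeries.coeff_C_mul, PowerSeries.coeff_smul, Algebra.smul_def]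
  have h2 : ∀ g : (Op W)⟦X⟧, g * PowerSeries.C (algebraMap ℂ⟦X⟧ (Op W) c) = c • g := fun g => by
    ext n : 1
    rw [PowerSeries.coeff_mul_C, PowerSeries.coeff_smul, Algebra.smul_def, Algebra.commutes]
  rw [← h1, ker_C_mul s (fun n => (h1 _).trans (h2 _).symm) hf]
  funext n
  exact h1 _

/-- The product with a kernel, as a linear map. -/
def kerL (s : ℤˣ) (E : OneSided W) : Tate (Op W) →ₗ[ℂ⟦X⟧] OneSided W where
  toFun f := ker s E f
  map_add' f f' := ker_add s E f.2 f'.2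
  map_smul' c f := ker_smul s E c f.2

theorem ker_sub (s : ℤˣ) (E : OneSided W) {f f' : (Op W)⟦X⟧} (hf : f ∈ Tate (Op W))
    (hf' : f' ∈ Tate (Op W)) : ker s E (f - f') = ker s E f - ker s E f' := by
  have h : f - f' = f + (-1 : ℂ⟦X⟧) • f' := by rw [neg_smul, one_smul, sub_eq_add_neg]
  rw [h, ker_add s E hf ((Tate (Op W)).smul_mem _ hf'), ker_smul s E _ hf', neg_smul, one_smul,
    sub_eq_add_neg]

theorem X_mem_tate : (PowerSeries.X : (Op W)⟦X⟧) ∈ Tate (Op W) := by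
  have := X_mul_mem_tate (one_mem_tate (R := Op W))
  rwa [mul_one] at this

theorem mulSub_iota2_ker_X (s : ℤˣ) (E : OneSided W) {f : (Op W)⟦X⟧} (hf : f ∈ Tate (Op W)) :
    mulSub 0 (iota2 s (ker s E (PowerSeries.X * f))) = (s : ℤ) • iota2 s (ker s E f) := by
  rw [iota2_ker, iota2_ker, mulSub_dmul_X (null_iota2 s E) hf]

theorem eq_of_mulSub_iota2 {s : ℤˣ} {E F : OneSided W}
    (h : mulSub 0 (iota2 s E) = mulSub 0 (iota2 s F)) : E = F :=
  iota2_injective s ((null_iota2 s E).mulSub_injective (null_iota2 s F) zero_mem_hsub_one h)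

/-- Multiplication by `(z - w)⁻¹` (for `s = 1`), respectively `(w - z)⁻¹` (for `s = -1`). -/
def invB (s : ℤˣ) : Module.End ℂ⟦X⟧ (OneSided W) where
  toFun E := ker s E (PowerSeries.X * 1)
  map_add' E F := by
    apply eq_of_mulSub_iota2 (s := s)
    rw [← mulSubL_apply, ← mulSubL_apply, map_add, map_add, mulSubL_apply, mulSubL_apply,
      mulSubL_apply, mulSub_iota2_ker_X s _ one_mem_tate, mulSub_iota2_ker_X s _ one_mem_tate,
      mulSub_iota2_ker_X s _ one_mem_tate, ker_one, ker_one, ker_one, map_add, smul_add]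
  map_smul' c E := by
    apply eq_of_mulSub_iota2 (s := s)
    rw [RingHom.id_apply, ← mulSubL_apply, ← mulSubL_apply, map_smul, map_smul, mulSubL_apply,
      mulSubL_apply, mulSub_iota2_ker_X s _ one_mem_tate, mulSub_iota2_ker_X s _ one_mem_tate,
      ker_one, ker_one, map_smul, smul_comm]

theorem mulSub_invB (s : ℤˣ) (E : OneSided W) :
    mulSub 0 (iota2 s (invB s E)) = (s : ℤ) • iota2 s E := by
  change mulSub 0 (iota2 s (ker s E (PowerSeries.X * 1))) = _
  rw [mulSub_iota2_ker_X s _ one_mem_tate, ker_one]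

theorem ker_X_mul (s : ℤˣ) (E : OneSided W) {f : (Op W)⟦X⟧} (hf : f ∈ Tate (Op W)) :
    ker s E (PowerSeries.X * f) = invB s (ker s E f) := by
  apply eq_of_mulSub_iota2 (s := s)
  rw [mulSub_iota2_ker_X s E hf, mulSub_invB]

/-- Multiplication by the variable of the one-sided series. -/
def zetaB (W : Type*) [AddCommGroup W] [Module ℂ⟦X⟧ W] : Module.End ℂ⟦X⟧ (OneSided W) :=
  lB PowerSeries.X

/-- Multiplication by `w`. -/
def shB (W : Type*) [AddCommGroup W] [Module ℂ⟦X⟧ W] : Module.End ℂ⟦X⟧ (OneSided W) where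
  toFun E n := E (n - 1)
  map_add' _ _ := rfl
  map_smul' _ _ := rfl

/-- Multiplication by `1 - w / z`, respectively by `w - z`. -/
def clearA (W : Type*) [AddCommGroup W] [Module ℂ⟦X⟧ W] (s : ℤˣ) : Module.End ℂ⟦X⟧ (OneSided W) :=
  if s = 1 then 1 - zetaB W * shB W else shB W - zetaB W

/-- Multiplication by `1 / z`, respectively by `1`. -/
def clearB (W : Type*) [AddCommGroup W] [Module ℂ⟦X⟧ W] (s : ℤˣ) : Module.End ℂ⟦X⟧ (OneSided W) :=
  if s = 1 then zetaB W else 1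

theorem neg_one_ne_one_units : ¬ ((-1 : ℤˣ) = 1) := by decide

theorem iota_one_X_mul (f : (Op W)⟦X⟧) (m : ℤ) :
    iota 1 (PowerSeries.X * f) m = iota 1 f (m + 1) := by
  rcases lt_trichotomy m 0 with h | rfl | h
  · obtain ⟨k, rfl⟩ : ∃ k : ℕ, m = -(k + 1) := ⟨(-m - 1).toNat, by omega⟩
    have e1 := iota_at 1 (PowerSeries.X * f) (k + 1)
    have e2 := iota_at 1 f k
    rw [PowerSeries.coeff_succ_X_mul, ← e2] at e1
    simpa using e1
  · have e1 := iota_at 1 (PowerSeries.X * f) 0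
    rw [PowerSeries.coeff_zero_X_mul] at e1
    rw [iota_of_pos f (by simp)]
    simpa using e1
  · rw [iota_of_pos _ (by simpa using h), iota_of_pos _ (by simp; omega)]

theorem iota_neg_X_mul (f : (Op W)⟦X⟧) (m : ℤ) :
    iota (-1) (PowerSeries.X * f) m = iota (-1) f (m - 1) := by
  rcases lt_trichotomy m 0 with h | rfl | h
  · rw [iota_of_pos _ (by simpa using h), iota_of_pos _ (by simp; omega)]
  · have e1 := iota_at (-1) (PowerSeries.X * f) 0
    rw [PowerSeries.coeff_zero_X_mul] at e1
    rw [iota_of_pos f (by simp)]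
    simpa using e1
  · obtain ⟨k, rfl⟩ : ∃ k : ℕ, m = k + 1 := ⟨(m - 1).toNat, by omega⟩
    have e1 := iota_at (-1) (PowerSeries.X * f) (k + 1)
    have e2 := iota_at (-1) f k
    rw [PowerSeries.coeff_succ_X_mul, ← e2] at e1
    simpa using e1

/-- Multiplication by `z` does not preserve series in `z⁻¹`. For `s = 1` the equation `(z - w) F =
E` is therefore multiplied by `z⁻¹`, which is injective, so as to become an equation between
endomorphisms of `OneSided W`. -/
theorem clearA_eq_clearB {s : ℤˣ} {E F : OneSided W} :
    clearA W s F = clearB W s E ↔ mulSub 0 (iota2 s F) = (s : ℤ) • iota2 s E := by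
  rcases Int.units_eq_one_or s with rfl | rfl
  · rw [clearA, clearB, if_pos rfl, if_pos rfl, ← (iota2_injective 1).eq_iff]
    have key : ∀ m n, iota2 1 ((1 - zetaB W * shB W) F) m n = mulSub 0 (iota2 1 F) (m + 1) n ∧
        iota2 1 (zetaB W E) m n = iota2 1 E (m + 1) n := by
      intro m n
      refine ⟨?_, iota_one_X_mul (E n) m⟩
      rw [LinearMap.sub_apply, map_sub]
      have := iota_one_X_mul (F (n - 1)) m
      simp only [Pi.sub_apply, mulSub, zero_mul, sub_zero, add_sub_cancel_right]
      exact congrArg _ this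
    constructor
    · intro h
      funext m n
      have h1 := congrFun (congrFun h (m - 1)) n
      rw [(key _ _).1, (key _ _).2, sub_add_cancel] at h1
      simpa using h1
    · intro h
      funext m n
      rw [(key _ _).1, (key _ _).2, h]; simp
  · rw [clearA, clearB, if_neg neg_one_ne_one_units, if_neg neg_one_ne_one_units,
      ← (iota2_injective (-1)).eq_iff]
    have key : iota2 (-1) ((shB W - zetaB W) F) = -mulSub 0 (iota2 (-1) F) := by
      funext m n
      rw [LinearMap.sub_apply, map_sub]
      have := iota_neg_X_mul (F n) m
      simp only [Pi.sub_apply, Pi.neg_apply, mulSub, zero_mul, sub_zero, neg_sub]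
      exact congrArg _ this
    rw [key, Module.End.one_apply]
    simp [neg_eq_iff_eq_neg]

theorem clearA_injective (s : ℤˣ) : Function.Injective (clearA W s) := by
  refine (injective_iff_map_eq_zero _).2 fun F h => ?_
  have h1 : clearA W s F = clearB W s 0 := by rw [h, map_zero]
  rw [clearA_eq_clearB, map_zero, smul_zero] at h1
  refine eq_of_mulSub_iota2 (s := s) ?_
  rw [h1, map_zero, ← mulSubL_apply, map_zero]

/-- Since `clearA` composed with `invB` is `clearB` and `clearA` is injective, an operator that
commutes with multiplication by both variables also commutes with division by `z - w`. -/
theorem commute_invB (s : ℤˣ) {T : Module.End ℂ⟦X⟧ (OneSided W)} (h1 : Commute T (zetaB W))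
    (h2 : Commute T (shB W)) : Commute T (invB s) := by
  have hA : Commute T (clearA W s) := by
    rw [clearA]; split_ifs
    · exact (Commute.one_right T).sub_right (h1.mul_right h2)
    · exact h2.sub_right h1
  have hB : Commute T (clearB W s) := by
    rw [clearB]; split_ifs
    · exact h1
    · exact Commute.one_right T
  have hU : clearA W s * invB s = clearB W s :=
    LinearMap.ext fun E => clearA_eq_clearB.2 (mulSub_invB s E)
  refine LinearMap.ext fun E => clearA_injective s ?_
  have : clearA W s * (T * invB s) = clearA W s * (invB s * T) := by
    rw [← mul_assoc, ← hA.eq, mul_assoc, hU, hB.eq, ← mul_assoc, hU]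
  exact LinearMap.congr_fun this E

theorem commute_lB_rB (b b' : (Op W)⟦X⟧) : Commute (lB b) (rB b') :=
  LinearMap.ext fun E => funext fun n => (mul_assoc b (E n) b').symm

theorem lB_mul (b b' : (Op W)⟦X⟧) : lB (b * b') = lB b * lB b' :=
  LinearMap.ext fun E => funext fun n => mul_assoc b b' (E n)

theorem rB_mul (b b' : (Op W)⟦X⟧) : rB (b * b') = rB b' * rB b :=
  LinearMap.ext fun E => funext fun n => (mul_assoc (E n) b b').symm

theorem commute_lB {b b' : (Op W)⟦X⟧} (h : Commute b b') : Commute (lB b) (lB b') := by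
  rw [Commute, SemiconjBy, ← lB_mul, h.eq, lB_mul]

theorem commute_lB_invB (s : ℤˣ) (b : (Op W)⟦X⟧) : Commute (lB b) (invB s) :=
  commute_invB s (commute_lB (PowerSeries.commute_X b)) rfl

theorem commute_rB_invB (s : ℤˣ) (b : (Op W)⟦X⟧) : Commute (rB b) (invB s) :=
  commute_invB s (commute_lB_rB _ _).symm rfl

theorem lB_one : lB (1 : (Op W)⟦X⟧) = 1 :=
  LinearMap.ext fun E => funext fun n => one_mul (E n)

theorem rB_one : rB (1 : (Op W)⟦X⟧) = 1 :=
  LinearMap.ext fun E => funext fun n => mul_one (E n)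

theorem lB_pow (b : (Op W)⟦X⟧) (k : ℕ) : lB (b ^ k) = lB b ^ k := by
  induction k with
  | zero => rw [pow_zero, lB_one, pow_zero]
  | succ k ih => rw [pow_succ, lB_mul, ih, pow_succ]

theorem rB_pow (b : (Op W)⟦X⟧) (k : ℕ) : rB (b ^ k) = rB b ^ k := by
  induction k with
  | zero => rw [pow_zero, rB_one, pow_zero]
  | succ k ih => rw [pow_succ', rB_mul, ih, pow_succ]

/-- `lB` as a linear map. -/
def lBL (W : Type*) [AddCommGroup W] [Module ℂ⟦X⟧ W] :
    (Op W)⟦X⟧ →ₗ[ℂ⟦X⟧] Module.End ℂ⟦X⟧ (OneSided W) where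
  toFun := lB
  map_add' b b' := LinearMap.ext fun E => funext fun n => add_mul b b' (E n)
  map_smul' c b := LinearMap.ext fun E => funext fun n => smul_mul_assoc c b (E n)

/-- `rB` as a linear map. -/
def rBL (W : Type*) [AddCommGroup W] [Module ℂ⟦X⟧ W] :
    (Op W)⟦X⟧ →ₗ[ℂ⟦X⟧] Module.End ℂ⟦X⟧ (OneSided W) where
  toFun := rB
  map_add' b b' := LinearMap.ext fun E => funext fun n => mul_add (E n) b b'
  map_smul' c b := LinearMap.ext fun E => funext fun n => mul_smul_comm c (E n) b

theorem lB_Flog (b : (Op W)⟦X⟧) : lB (Flog b) = Flog (lB b) := by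
  rw [Flog, lB_mul, Flog]
  congr 1
  exact map_ev_eq (lBL W) (lB_pow b) logS

theorem rB_Flog (b : (Op W)⟦X⟧) : rB (Flog b) = Flog (rB b) := by
  rw [Flog, rB_mul, Flog, ((commute_ev (Commute.refl (rB b)) logS).eq : rB b * _ = _)]
  congr 1
  exact map_ev_eq (rBL W) (rB_pow b) logS

theorem ev_intertwine_tate {N : Type*} [AddCommGroup N] [Module ℂ⟦X⟧ N] [TopFree N]
    (Φ : Tate (Op W) →ₗ[ℂ⟦X⟧] N) {D : Module.End ℂ⟦X⟧ (Op W)⟦X⟧}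
    (hD : ∀ f ∈ Tate (Op W), D f ∈ Tate (Op W)) {D' : Module.End ℂ⟦X⟧ N}
    (h : ∀ f : Tate (Op W), Φ ⟨D f, hD f f.2⟩ = D' (Φ f)) (P : ℂ⟦X⟧) {f : (Op W)⟦X⟧}
    (hf : f ∈ Tate (Op W)) :
    ∃ hf' : ev D P f ∈ Tate (Op W), Φ ⟨ev D P f, hf'⟩ = ev D' P (Φ ⟨f, hf⟩) := by
  haveI := topFree_tate (R := Op W)
  have h1 := ev_intertwine (D := D.restrict hD) (D' := D) (Tate (Op W)).subtype (fun m => rfl) P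
    ⟨f, hf⟩
  change _ = ev D P f at h1
  refine ⟨by rw [← h1]; exact Subtype.coe_prop _, ?_⟩
  rw [← ev_intertwine (D := D.restrict hD) Φ h P ⟨f, hf⟩]
  congr 1
  exact Subtype.ext h1.symm

theorem ev_mem_tate {D : Module.End ℂ⟦X⟧ (Op W)⟦X⟧} (hD : ∀ f ∈ Tate (Op W), D f ∈ Tate (Op W))
    (P : ℂ⟦X⟧) {f : (Op W)⟦X⟧} (hf : f ∈ Tate (Op W)) : ev D P f ∈ Tate (Op W) := by
  haveI := topFree_tate (R := Op W)
  exact (ev_intertwine_tate (D' := D.restrict hD) LinearMap.id hD (fun f => rfl) P hf).1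

/-- Multiplication by `r x⁻¹ / 2`. -/
def hfac (s : ℤˣ) (r : Op W) : Module.End ℂ⟦X⟧ (OneSided W) :=
  (PowerSeries.C (1 / 2 : ℂ) : ℂ⟦X⟧) • (lB (PowerSeries.C r) * invB s)

/-- The map `f ↦ ker s E f` turns multiplication by `r x⁻¹ / 2` into `hfac s r` and sends `1` to
`E`. Applying the logarithmic series to both operators identifies the two constructions. -/
theorem phi_spec (s : ℤˣ) {E : OneSided W} {r : Op W}
    (hr : ∀ n, Commute (PowerSeries.C r) (E n)) :
    phi r ∈ Tate (Op W) ∧ (Flog (hfac s r) : Module.End ℂ⟦X⟧ (OneSided W)) E = ker s E (phi r) := by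
  set b : (Op W)⟦X⟧ := (PowerSeries.C (1 / 2 : ℂ) : ℂ⟦X⟧) • (PowerSeries.C r * PowerSeries.X)
    with hb
  set D' := hfac s r with hD'
  have hbf : ∀ f : (Op W)⟦X⟧, b * f = (PowerSeries.C (1 / 2 : ℂ) : ℂ⟦X⟧) •
      (PowerSeries.C r * (PowerSeries.X * f)) := fun f => by
    rw [hb, smul_mul_assoc, mul_assoc]
  have hD : ∀ f ∈ Tate (Op W), LinearMap.mulLeft ℂ⟦X⟧ b f ∈ Tate (Op W) := fun f hf => by
    rw [LinearMap.mulLeft_apply, hbf]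
    exact (Tate _).smul_mem _ (C_mul_mem_tate _ (X_mul_mem_tate hf))
  have h : ∀ f : Tate (Op W), kerL s E ⟨LinearMap.mulLeft ℂ⟦X⟧ b f, hD f f.2⟩ =
      D' (kerL s E f) := fun f => by
    change ker s E (b * (f : (Op W)⟦X⟧)) = D' (ker s E f)
    rw [hbf, ker_smul s E _ (C_mul_mem_tate _ (X_mul_mem_tate f.2)),
      ker_C_mul s hr (X_mul_mem_tate f.2), ker_X_mul s E f.2]
    rfl
  obtain ⟨h1, h2⟩ := ev_intertwine_tate (kerL s E) hD h logS one_mem_tate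
  have h3 : ev (LinearMap.mulLeft ℂ⟦X⟧ b) logS 1 = ev b logS := by
    rw [ev_apply, ev_def]
    congr 1; funext k
    rw [LinearMap.pow_mulLeft, LinearMap.mulLeft_apply, mul_one]
  have h4 : phi r = LinearMap.mulLeft ℂ⟦X⟧ b (ev (LinearMap.mulLeft ℂ⟦X⟧ b) logS 1) := by
    rw [h3]; rfl
  refine ⟨by rw [h4]; exact hD _ h1, ?_⟩
  have h5 := h ⟨_, h1⟩
  rw [h2] at h5
  change ker s E _ = D' (ev D' logS (ker s E 1)) at h5
  rw [ker_one] at h5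
  rw [h4, h5]; rfl

/-- As `P` and `Q` commute, the first equation says that `exp (2ħ(P - Q))` fixes `m`; this is the
case `c = 0` of `EXP_apply_iff`. -/
theorem EXP_apply_eq_iff {M : Type*} [AddCommGroup M] [Module ℂ⟦X⟧ M] [TopFree M]
    {P Q : Module.End ℂ⟦X⟧ M} (h : Commute P Q) (m : M) :
    (EXP P : Module.End ℂ⟦X⟧ M) m = (EXP Q : Module.End ℂ⟦X⟧ M) m ↔ P m = Q m := by
  have h1 := EXP_apply_iff (P - Q) m 0 (map_zero _)
  rw [smul_zero, add_zero, LinearMap.sub_apply, sub_eq_zero, sub_eq_add_neg, add_comm,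
    EXP_add h.symm.neg_left, Module.End.mul_apply] at h1
  rw [← h1]
  constructor
  · intro h2
    rw [h2, ← Module.End.mul_apply, EXP_neg_mul, Module.End.one_apply]
  · intro h2
    have := congrArg (fun x => (EXP Q : Module.End ℂ⟦X⟧ M) x) h2
    rwa [← Module.End.mul_apply, EXP_mul_neg, Module.End.one_apply] at this

/-- Multiplication by `1 + r ħ x⁻¹`. -/
def facB (s : ℤˣ) (r : Op W) : Module.End ℂ⟦X⟧ (OneSided W) :=
  1 + hv • (lB (PowerSeries.C r) * invB s)

theorem facB_eq (s : ℤˣ) (r : Op W) : facB s r = EXP (Flog (hfac s r)) := by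
  rw [EXP_Flog, facB, hfac, smul_smul]
  congr 2
  rw [ch, mul_right_comm, ← map_mul]; norm_num

/-- With `x = s (z - w)`, the product of `z - w` and `1 + r ħ x⁻¹` is the linear factor `z - w + s r
ħ`. -/
theorem mulSub_facB (s : ℤˣ) (r : Op W) (E : OneSided W) :
    mulSub 0 (iota2 s (facB s r E)) = mulSub (-((s : ℤ) • hv • r)) (iota2 s E) := by
  rw [facB, LinearMap.add_apply, map_add, ← mulSubL_apply, map_add, mulSubL_apply,
    LinearMap.smul_apply, map_smul, map_smul, Module.End.mul_apply, iota2_lB_C]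
  have h1 : mulSubL 0 (kY r (iota2 s (invB s E))) = kY r (mulSub 0 (iota2 s (invB s E))) := by
    funext m n
    simp [mulSubL_apply, mulSub, kY, mul_sub]
  rw [h1, mulSub_invB]
  funext m n
  simp only [mulSub, kY, Module.End.one_apply, Pi.add_apply, Pi.smul_apply, LinearMap.coe_mk,
    AddHom.coe_mk, zero_mul, sub_zero, neg_mul, sub_neg_eq_add, smul_mul_assoc, mul_smul_comm]
  rw [smul_comm]

theorem mulSub_eq_iff_facB {s : ℤˣ} {r r' : Op W} {E F : OneSided W} :
    mulSub (-((s : ℤ) • hv • r')) (iota2 s E) = mulSub (-((s : ℤ) • hv • r)) (iota2 s F) ↔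
      facB s r' E = facB s r F := by
  rw [← mulSub_facB, ← mulSub_facB]
  exact ⟨eq_of_mulSub_iota2, fun h => by rw [h]⟩

theorem commute_smul_End {M : Type*} [AddCommGroup M] [Module ℂ⟦X⟧ M]
    {x y : Module.End ℂ⟦X⟧ M} (h : Commute x y) (c c' : ℂ⟦X⟧) : Commute (c • x) (c' • y) :=
  (h.smul_left c).smul_right c'

theorem commute_hfac {r r' : Op W} (s : ℤˣ) (h : Commute r r') :
    Commute (hfac (W := W) s r) (hfac s r') := by
  have h1 : Commute (lB (PowerSeries.C r)) (lB (PowerSeries.C r')) := by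
    refine commute_lB ?_
    rw [Commute, SemiconjBy, ← map_mul, h.eq, map_mul]
  exact commute_smul_End ((h1.mul_right (commute_lB_invB s _)).mul_left
    ((commute_lB_invB s _).symm.mul_right (Commute.refl _))) _ _

theorem commute_hfac_lB (s : ℤˣ) {r : Op W} {b : (Op W)⟦X⟧} (h : Commute (PowerSeries.C r) b) :
    Commute (hfac (W := W) s r) (lB b) := by
  have := commute_smul_End ((commute_lB h).mul_left (commute_lB_invB s b).symm)
    (PowerSeries.C (1 / 2 : ℂ) : ℂ⟦X⟧) 1
  rwa [one_smul] at this

theorem commute_hfac_rB (s : ℤˣ) (r : Op W) (b : (Op W)⟦X⟧) :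
    Commute (hfac (W := W) s r) (rB b) := by
  have := commute_smul_End ((commute_lB_rB (PowerSeries.C r) b).mul_left
    (commute_rB_invB s b).symm) (PowerSeries.C (1 / 2 : ℂ) : ℂ⟦X⟧) 1
  rwa [one_smul] at this

/-- The commutators with the coefficients of a series. -/
def commB (l : (Op W)⟦X⟧) (d : ℤ → Op W) : OneSided W := fun n =>
  l * PowerSeries.C (d n) - PowerSeries.C (d n) * l

/-- A distribution in `w` as a distribution in two variables. -/
def cst (d : ℤ → Op W) : OneSided W := fun n => PowerSeries.C (d n)

theorem commB_Flog (b : (Op W)⟦X⟧) (d : ℤ → Op W) :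
    commB (Flog b) d = Flog (lB b) (cst d) - Flog (rB b) (cst d) := by
  rw [← lB_Flog, ← rB_Flog]; rfl

theorem commute_Flog_Flog {R : Type*} [Ring R] [Algebra ℂ⟦X⟧ R] [TopFree R] {x y : R}
    (h : Commute x y) : Commute (Flog x) (Flog y) :=
  (commute_Flog (commute_Flog h).symm).symm

theorem iota2_lB_cst (s : ℤˣ) (b : (Op W)⟦X⟧) (d : ℤ → Op W) :
    iota2 s ((1 + ch 2 • lB b) (cst d)) = zw (iota s (1 + ch 2 • b)) d := by
  funext m n
  have : (1 + ch 2 • lB b) (cst d) n = (1 + ch 2 • b) * PowerSeries.C (d n) := by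
    rw [add_mul, one_mul, smul_mul_assoc]; rfl
  rw [iota2_apply, this, zw, iota_apply, iota_apply]
  split_ifs
  · rw [PowerSeries.coeff_mul_C]
  · rw [zero_mul]

theorem iota2_rB_cst (s : ℤˣ) (b : (Op W)⟦X⟧) (d : ℤ → Op W) :
    iota2 s ((1 + ch 2 • rB b) (cst d)) = wz d (iota s (1 + ch 2 • b)) := by
  funext m n
  have : (1 + ch 2 • rB b) (cst d) n = PowerSeries.C (d n) * (1 + ch 2 • b) := by
    rw [mul_add, mul_one, mul_smul_comm]; rfl
  rw [iota2_apply, this, wz, iota_apply, iota_apply]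
  split_ifs
  · rw [PowerSeries.coeff_C_mul]
  · rw [mul_zero]

theorem EXP_Flog_apply_iff {M : Type*} [AddCommGroup M] [Module ℂ⟦X⟧ M] [TopFree M]
    {u u' x y : Module.End ℂ⟦X⟧ M} (c1 : Commute u' x) (c2 : Commute u y) (c3 : Commute u' u)
    (c4 : Commute u' y) (c5 : Commute u x) (c6 : Commute x y) (m : M) :
    (EXP (Flog u') * EXP (Flog x) : Module.End ℂ⟦X⟧ M) m =
        (EXP (Flog u) * EXP (Flog y) : Module.End ℂ⟦X⟧ M) m ↔
      (Flog x : Module.End ℂ⟦X⟧ M) m - (Flog y : Module.End ℂ⟦X⟧ M) m =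
        (Flog u : Module.End ℂ⟦X⟧ M) m - (Flog u' : Module.End ℂ⟦X⟧ M) m := by
  rw [← EXP_add (commute_Flog_Flog c1), ← EXP_add (commute_Flog_Flog c2), EXP_apply_eq_iff
    (((commute_Flog_Flog c3).add_right (commute_Flog_Flog c4)).add_left
      ((commute_Flog_Flog c5.symm).add_right (commute_Flog_Flog c6))), LinearMap.add_apply,
    LinearMap.add_apply, sub_eq_sub_iff_add_eq_add, add_comm]

/-- After division by `z - w`, the exchange relation says that two products of exponentials agree at
`cst d`. The operators involved are `lB b`, `rB b` and the two `hfac`; they commute in pairs, since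
left and right multiplications commute and `r`, `r'` commute with `b`. Comparing exponents gives the
commutator formula. -/
theorem mulSub_eq_iff_commB (s : ℤˣ) {b : (Op W)⟦X⟧} {d : ℤ → Op W} {r r' : Op W}
    (hrr : Commute r r') (hrb : Commute (PowerSeries.C r) b) (hrb' : Commute (PowerSeries.C r') b) :
    mulSub (-((s : ℤ) • hv • r')) (zw (iota s (1 + ch 2 • b)) d) =
        mulSub (-((s : ℤ) • hv • r)) (wz d (iota s (1 + ch 2 • b))) ↔
      commB (Flog b) d = (Flog (hfac s r) : Module.End ℂ⟦X⟧ (OneSided W)) (cst d) -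
        (Flog (hfac s r') : Module.End ℂ⟦X⟧ (OneSided W)) (cst d) := by
  have key := EXP_Flog_apply_iff (commute_hfac_lB s hrb') (commute_hfac_rB s r b)
    (commute_hfac s hrr.symm) (commute_hfac_rB s r' b) (commute_hfac_lB s hrb)
    (commute_lB_rB b b) (cst d)
  rw [← commB_Flog, ← facB_eq, ← facB_eq, EXP_Flog, EXP_Flog,
    Module.End.mul_apply, Module.End.mul_apply, ← mulSub_eq_iff_facB, iota2_lB_cst,
    iota2_rB_cst] at key
  exact key

theorem commute_C_cst {d : ℤ → Op W} {r : Op W} (h : ∀ n, Commute r (d n)) (n : ℤ) :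
    Commute (PowerSeries.C r) (cst d n) := by
  rw [Commute, SemiconjBy, cst, ← map_mul, (h n).eq, map_mul]

/-- Exchange relations between `1 + 2ħ b(z)` and `d(w)` in terms of commutators with
`(2ħ)⁻¹ log (1 + 2ħ b(z))`. -/
theorem exchange_iff (s : ℤˣ) {b : (Op W)⟦X⟧} {d : ℤ → Op W} {r r' : Op W}
    (hrr : Commute r r') (hrb : Commute (PowerSeries.C r) b) (hrb' : Commute (PowerSeries.C r') b)
    (hrd : ∀ n, Commute r (d n)) (hrd' : ∀ n, Commute r' (d n)) :
    mulSub (-((s : ℤ) • hv • r')) (zw (iota s (1 + ch 2 • b)) d) =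
        mulSub (-((s : ℤ) • hv • r)) (wz d (iota s (1 + ch 2 • b))) ↔
      commB (Flog b) d = ker s (cst d) (phi r - phi r') := by
  obtain ⟨ht, hp⟩ := phi_spec s (commute_C_cst hrd)
  obtain ⟨ht', hp'⟩ := phi_spec s (commute_C_cst hrd')
  rw [mulSub_eq_iff_commB s hrr hrb hrb', hp, hp', ker_sub s _ ht ht']

end OneSided

end

section
/-! ## Right multiplication by a pointwise null series -/

section NullSer

variable {W : Type*} [AddCommGroup W] [Module ℂ⟦X⟧ W] [TopFree W]

/-- Series whose coefficients tend to zero pointwise. -/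
def nullSer (W : Type*) [AddCommGroup W] [Module ℂ⟦X⟧ W] : Subalgebra ℂ⟦X⟧ (Op W)⟦X⟧ where
  carrier := {b | ∀ v r, ∃ K, ∀ k ≥ K, PowerSeries.coeff k b v ∈ hsub W r}
  mul_mem' {b b'} hb hb' v r := by
    obtain ⟨L, hL⟩ := hb' v r
    choose K hK using fun l => hb (PowerSeries.coeff l b' v) r
    refine ⟨L + (Finset.range L).sup K, fun m hm => ?_⟩
    rw [PowerSeries.coeff_mul, LinearMap.sum_apply]
    refine Submodule.sum_mem _ fun p hp => ?_
    rw [Finset.HasAntidiagonal.mem_antidiagonal] at hp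
    rw [Module.End.mul_apply]
    by_cases h : L ≤ p.2
    · exact map_mem_hsub _ (hL _ h)
    · refine hK _ _ ?_
      have : K p.2 ≤ (Finset.range L).sup K := Finset.le_sup (Finset.mem_range.2 (by omega))
      omega
  add_mem' {b b'} hb hb' v r := by
    obtain ⟨K, hK⟩ := hb v r
    obtain ⟨K', hK'⟩ := hb' v r
    refine ⟨max K K', fun k hk => ?_⟩
    rw [map_add]
    exact (hsub W r).add_mem (hK k (le_trans (le_max_left _ _) hk))
      (hK' k (le_trans (le_max_right _ _) hk))
  algebraMap_mem' c v r := by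
    refine ⟨1, fun k hk => ?_⟩
    have : PowerSeries.coeff k (algebraMap ℂ⟦X⟧ (Op W)⟦X⟧ c) = 0 := by
      rw [Algebra.algebraMap_eq_smul_one, PowerSeries.coeff_smul, PowerSeries.coeff_one,
        if_neg (by omega), smul_zero]
    rw [this]
    exact Submodule.zero_mem _

theorem C_mem_nullSer (x : Op W) : PowerSeries.C x ∈ nullSer W := fun v r =>
  ⟨1, fun k hk => by
    rw [PowerSeries.coeff_C, if_neg (by omega)]; exact Submodule.zero_mem _⟩

theorem hsum_mem_nullSer {a : ℕ → (Op W)⟦X⟧} (ha : ∀ k, a k ∈ nullSer W) :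
    hsum a ∈ nullSer W := fun v r => by
  obtain ⟨K, hK⟩ := (Subalgebra.sum_mem _ fun k (_ : k ∈ Finset.range r) =>
    Subalgebra.smul_mem _ (ha k) (hv ^ k) : ∑ k ∈ Finset.range r, hv ^ k • a k ∈ nullSer W) v r
  refine ⟨K, fun k hk => ?_⟩
  have h1 := map_mem_hsub (coeffL (Op W) k) (hsum_spec a r)
  rw [map_sub] at h1
  have h2 := (hsub W r).add_mem (mem_hsub_hom.1 h1 v) (hK k hk)
  simpa [coeffL] using h2

theorem ev_mem_nullSer {b : (Op W)⟦X⟧} (hb : b ∈ nullSer W) (P : ℂ⟦X⟧) : ev b P ∈ nullSer W := by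
  rw [ev_def]
  exact hsum_mem_nullSer fun k => Subalgebra.smul_mem _ (Subalgebra.pow_mem _ hb k) _

theorem ev_apply_mem_nullSer {D : Module.End ℂ⟦X⟧ (Op W)⟦X⟧}
    (hD : ∀ b ∈ nullSer W, D b ∈ nullSer W) {b : (Op W)⟦X⟧} (hb : b ∈ nullSer W) (P : ℂ⟦X⟧) :
    ev D P b ∈ nullSer W := by
  rw [ev_apply]
  refine hsum_mem_nullSer fun k => Subalgebra.smul_mem _ ?_ _
  induction k with
  | zero => exact hb
  | succ k ih => rw [pow_succ']; exact hD _ ih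

theorem dB_mem_nullSer {b : (Op W)⟦X⟧} (hb : b ∈ nullSer W) : dB (Op W) 1 b ∈ nullSer W :=
  fun v r => by
  obtain ⟨K, hK⟩ := hb v r
  refine ⟨K + 1, fun k hk => ?_⟩
  obtain ⟨k, rfl⟩ : ∃ j, k = j + 1 := ⟨k - 1, by omega⟩
  have h1 := iota_at 1 b k
  rw [coeff_dB]
  have h2 : (-(((1 : ℤˣ) : ℤ) * ((k + 1 : ℕ) : ℤ)) + 1) = -(((1 : ℤˣ) : ℤ) * (k : ℤ)) := by
    simp
  rw [h2, h1, LinearMap.smul_apply]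
  exact zsmul_mem (hK k (by omega)) _

theorem kB_mem_nullSer (κ : Op W) {b : (Op W)⟦X⟧} (hb : b ∈ nullSer W) : kB κ b ∈ nullSer W :=
  Subalgebra.mul_mem _ (C_mem_nullSer κ) hb

theorem TB_mem_nullSer (κ : Op W) (c : ℂ) {b : (Op W)⟦X⟧} (hb : b ∈ nullSer W) :
    TB 1 κ c b ∈ nullSer W :=
  ev_apply_mem_nullSer (D := kB κ * dB (Op W) 1)
    (fun b h => kB_mem_nullSer κ (b := dB (Op W) 1 b) (dB_mem_nullSer h)) hb _

theorem pFin_mul_coeff (a : ℕ → Op W) {b : (Op W)⟦X⟧} (hb : b ∈ nullSer W) :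
    PFin fun k => a k * PowerSeries.coeff k b := fun v r => by
  obtain ⟨K, hK⟩ := hb v r
  refine (Set.finite_lt_nat K).subset fun k hk => ?_
  by_contra h
  exact hk (map_mem_hsub (a k) (hK k (not_lt.1 h)))

/-- The sum `∑ a_k b_k`. -/
def rsum (b : nullSer W) : (ℕ → Op W) →ₗ[ℂ⟦X⟧] Op W where
  toFun a := ∑' k, a k * PowerSeries.coeff k (b : (Op W)⟦X⟧)
  map_add' a a' := by
    simp only [Pi.add_apply, add_mul]
    exact (pFin_mul_coeff a b.2).summable.tsum_add (pFin_mul_coeff a' b.2).summable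
  map_smul' c a := by
    have h1 : ∀ T : Op W, c • T = algebraMap ℂ⟦X⟧ (Op W) c * T := fun T => Algebra.smul_def c T
    rw [RingHom.id_apply, h1, ← (pFin_mul_coeff a b.2).tsum_mul_left]
    simp only [Pi.smul_apply, h1, mul_assoc]

theorem rsum_def (b : nullSer W) (a : ℕ → Op W) :
    rsum b a = ∑' k, a k * PowerSeries.coeff k (b : (Op W)⟦X⟧) := rfl

theorem rsum_mul_left (b : nullSer W) (T : Op W) (a : ℕ → Op W) :
    rsum b (fun k => T * a k) = T * rsum b a := by
  rw [rsum_def, rsum_def, ← (pFin_mul_coeff a b.2).tsum_mul_left]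
  simp only [mul_assoc]

theorem rsum_add_left (b b' : nullSer W) (a : ℕ → Op W) :
    rsum (b + b') a = rsum b a + rsum b' a := by
  rw [rsum_def, rsum_def, rsum_def, ← (pFin_mul_coeff a b.2).summable.tsum_add
    (pFin_mul_coeff a b'.2).summable]
  congr 1; funext k; rw [← mul_add]; rfl

theorem rsum_of_coeff {b : nullSer W} {a : ℕ → Op W}
    (h : ∀ k, k ≠ 0 → PowerSeries.coeff k (b : (Op W)⟦X⟧) = 0) :
    rsum b a = a 0 * PowerSeries.coeff 0 (b : (Op W)⟦X⟧) := by
  rw [rsum_def, tsum_eq_single 0 fun k hk => by rw [h k hk, mul_zero]]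

theorem rsum_C (x : Op W) (a : ℕ → Op W) : rsum ⟨_, C_mem_nullSer x⟩ a = a 0 * x := by
  rw [rsum_of_coeff fun k hk => by rw [PowerSeries.coeff_C, if_neg hk]]
  simp

theorem rsum_one (a : ℕ → Op W) : rsum 1 a = a 0 := by
  rw [rsum_of_coeff fun k hk => by
    rw [Subalgebra.coe_one, PowerSeries.coeff_one, if_neg hk]]
  simp

theorem rsum_mem {b : nullSer W} {a : ℕ → Op W} {v : W} {r : ℕ}
    (h : ∀ k, a k (PowerSeries.coeff k (b : (Op W)⟦X⟧) v) ∈ hsub W r) :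
    rsum b a v ∈ hsub W r :=
  (pFin_mul_coeff a b.2).tsum_mem v r h

theorem pFin_mul_mul (F : ℕ → ℕ → Op W) (b b' : nullSer W) :
    PFin fun p : ℕ × ℕ => F p.1 p.2 * PowerSeries.coeff p.2 (b' : (Op W)⟦X⟧) *
      PowerSeries.coeff p.1 (b : (Op W)⟦X⟧) := fun v r => by
  obtain ⟨K, hK⟩ := b.2 v r
  choose L hL using fun k => b'.2 (PowerSeries.coeff k (b : (Op W)⟦X⟧) v) r
  refine ((Set.finite_lt_nat K).prod (Set.finite_lt_nat ((Finset.range K).sup L))).subset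
    fun p hp => ?_
  have h1 : p.1 < K := by
    by_contra h
    exact hp (map_mem_hsub (F p.1 p.2 * PowerSeries.coeff p.2 (b' : (Op W)⟦X⟧))
      (hK _ (not_lt.1 h)))
  refine ⟨h1, ?_⟩
  by_contra h
  refine hp ?_
  change (F p.1 p.2) _ ∈ _
  refine map_mem_hsub _ (hL _ _ ?_)
  exact le_trans (Finset.le_sup (Finset.mem_range.2 h1)) (not_lt.1 h)

theorem rsum_rsum_eq (F : ℕ → ℕ → Op W) (b b' : nullSer W) :
    rsum b (fun k => rsum b' (F k)) = ∑' p : ℕ × ℕ, F p.1 p.2 *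
      PowerSeries.coeff p.2 (b' : (Op W)⟦X⟧) * PowerSeries.coeff p.1 (b : (Op W)⟦X⟧) := by
  have hs := (pFin_mul_mul F b b').summable
  have h1 : ∀ k, PFin fun l => F k l * PowerSeries.coeff l (b' : (Op W)⟦X⟧) *
      PowerSeries.coeff k (b : (Op W)⟦X⟧) := fun k =>
    (pFin_mul_coeff (F k) b'.2).mul_right _
  rw [hs.tsum_prod' fun k => (h1 k).summable, rsum_def]
  congr 1; funext k
  exact ((pFin_mul_coeff (F k) b'.2).tsum_mul_right _).symm

/-- The double family is pointwise null on `ℕ × ℕ` and may be summed along antidiagonals. The inner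
series multiplies first, hence the order `b' * b`. -/
theorem rsum_rsum_add (F : ℕ → Op W) (b b' : nullSer W) :
    rsum b (fun k => rsum b' fun l => F (k + l)) = rsum (b' * b) F := by
  rw [rsum_rsum_eq (fun k l => F (k + l)), rsum_def]
  have hs := (pFin_mul_mul (fun k l => F (k + l)) b b').summable
  rw [← Finset.HasAntidiagonal.sigmaAntidiagonalEquivProd.tsum_eq]
  refine (Summable.tsum_sigma' (fun n => Summable.of_finite)
    ((Finset.HasAntidiagonal.sigmaAntidiagonalEquivProd.summable_iff).2 hs)).trans ?_
  refine tsum_congr fun n => ?_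
  rw [tsum_fintype, Subalgebra.coe_mul, PowerSeries.coeff_mul, Finset.mul_sum,
    ← Finset.Nat.sum_antidiagonal_swap]
  refine (Finset.sum_coe_sort (Finset.HasAntidiagonal.antidiagonal n) fun p : ℕ × ℕ =>
    F (p.1 + p.2) * PowerSeries.coeff p.2 (b' : (Op W)⟦X⟧) *
      PowerSeries.coeff p.1 (b : (Op W)⟦X⟧)).trans ?_
  refine Finset.sum_congr rfl fun p hp => ?_
  rw [Finset.HasAntidiagonal.mem_antidiagonal.1 hp, Prod.fst_swap, Prod.snd_swap, mul_assoc]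

theorem rsum_comm {b b' : nullSer W}
    (h : ∀ k l, Commute (PowerSeries.coeff k (b : (Op W)⟦X⟧))
      (PowerSeries.coeff l (b' : (Op W)⟦X⟧))) (F : ℕ → ℕ → Op W) :
    rsum b (fun k => rsum b' (F k)) = rsum b' fun l => rsum b fun k => F k l := by
  rw [rsum_rsum_eq, rsum_rsum_eq (fun l k => F k l), ← (Equiv.prodComm ℕ ℕ).tsum_eq]
  congr 1; funext p
  rw [mul_assoc, mul_assoc]
  congr 1
  exact ((h _ _).eq).symm

/-- The commutator of an operator with a series. -/
def adS (T : Op W) (b : nullSer W) : nullSer W :=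
  ⟨PowerSeries.C T * b - b * PowerSeries.C T,
    Subalgebra.sub_mem _ (Subalgebra.mul_mem _ (C_mem_nullSer T) b.2)
      (Subalgebra.mul_mem _ b.2 (C_mem_nullSer T))⟩

theorem rsum_commutator (T : Op W) (b : nullSer W) (a : ℕ → Op W) :
    T * rsum b a - rsum b a * T = rsum b (fun k => T * a k - a k * T) + rsum (adS T b) a := by
  rw [← rsum_mul_left, rsum_def, rsum_def, rsum_def, rsum_def,
    ← (pFin_mul_coeff a b.2).tsum_mul_right, ← Summable.tsum_sub
      (pFin_mul_coeff (fun k => T * a k) b.2).summable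
      ((pFin_mul_coeff a b.2).mul_right T).summable, ← Summable.tsum_add
      (pFin_mul_coeff (fun k => T * a k - a k * T) b.2).summable
      (pFin_mul_coeff a (adS T b).2).summable]
  congr 1; funext k
  simp only [adS, map_sub, PowerSeries.coeff_C_mul, PowerSeries.coeff_mul_C]
  noncomm_ring

/-- Right multiplication of a distribution by a series in `w⁻¹`. -/
def rho (b : nullSer W) : Module.End ℂ⟦X⟧ (ℤ → Op W) where
  toFun a n := rsum b fun k => a (n + k)
  map_add' a _ := funext fun n => map_add (rsum b) (fun k : ℕ => a (n + k)) _
  map_smul' c a := funext fun n => map_smul (rsum b) c (fun k : ℕ => a (n + k))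

theorem rho_apply (b : nullSer W) (a : ℤ → Op W) (n : ℤ) :
    rho b a n = rsum b fun k => a (n + k) := rfl

theorem rho_one : rho (1 : nullSer W) = 1 := by
  refine LinearMap.ext fun a => funext fun n => ?_
  rw [rho_apply, rsum_one]; simp

theorem rho_rho (b b' : nullSer W) (a : ℤ → Op W) : rho b (rho b' a) = rho (b' * b) a := by
  funext n
  rw [rho_apply, rho_apply, ← rsum_rsum_add (fun k => a (n + k))]
  congr 1; funext k
  rw [rho_apply]
  congr 1; funext l
  push_cast; rw [add_assoc]

theorem rho_add (b b' : nullSer W) (a : ℤ → Op W) : rho (b + b') a = rho b a + rho b' a :=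
  funext fun _ => rsum_add_left b b' _

theorem fmul_iota_one (a : ℤ → Op W) (b : nullSer W) :
    fmul a (iota 1 (b : (Op W)⟦X⟧)) = rho b a := by
  funext n
  rw [rho_apply, rsum_def, fmul]
  have hinj : Function.Injective fun k : ℕ => -(k : ℤ) := fun x y h => by simpa using h
  rw [← hinj.tsum_eq]
  · congr 1; funext k
    have := iota_at 1 (b : (Op W)⟦X⟧) k
    simp only [Units.val_one, one_mul] at this
    rw [this, sub_neg_eq_add]
  · intro k hk
    have h1 : ¬ 0 < ((1 : ℤˣ) : ℤ) * k := fun h => hk (by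
      change a (n - k) * _ = 0
      rw [iota_of_pos _ h, mul_zero])
    rw [Units.val_one, one_mul, not_lt] at h1
    exact ⟨(-k).toNat, by change -(((-k).toNat : ℕ) : ℤ) = k; omega⟩

end NullSer

end

section
/-! ## Currents on restricted modules -/

namespace Gens

variable {I W : Type*} [AddCommGroup W] [Module ℂ⟦X⟧ W]

/-- The properties of the operators on a restricted module. -/
structure IsGood (g : Gens I (Op W)) : Prop where
  commH : ∀ i n, Commute g.kappa (g.H i n)
  commX : ∀ s i n, Commute g.kappa (g.X s i n)
  nullH : ∀ i v r, ∃ N : ℕ, ∀ n ≥ N, g.H i n v ∈ hsub W r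
  nullX : ∀ s i v r, ∃ N : ℕ, ∀ n ≥ N, g.X s i n v ∈ hsub W r

theorem isGood_map (π : (Atilde I)⟦X⟧ →ₐ[ℂ⟦X⟧] Op W)
    (hW : IsRestricted ((Atilde.gens I).map π)) : ((Atilde.gens I).map π).IsGood := by
  have hc : ∀ x : Gen I, Commute (π (PowerSeries.C (Atilde.gen Gen.kappa)))
      (π (PowerSeries.C (Atilde.gen x))) := fun x => by
    have h1 : (Atilde.gen Gen.kappa * Atilde.gen x : Atilde I) =
        Atilde.gen x * Atilde.gen Gen.kappa := by
      have := RingQuot.mkAlgHom_rel ℂ (AtildeRel.comm x)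
      rwa [map_mul, map_mul] at this
    rw [Commute, SemiconjBy, ← map_mul, ← map_mul, ← map_mul, ← map_mul, h1]
  have hz : ∀ {f : ℕ → W}, HTendsZero f → ∀ r, ∃ N, ∀ n ≥ N, f n ∈ hsub W r := fun hf r => by
    obtain ⟨N, hN⟩ := hf r
    refine ⟨N, fun n hn => ?_⟩
    obtain ⟨u, hu⟩ := hN n hn
    rw [hu]
    exact smul_mem_hsub r u
  exact ⟨fun i n => hc _, fun s i n => hc _, fun i v => hz (hW.2.1 i v),
    fun s i v => hz (hW.2.2 s i v)⟩

/-- The series `A_i^±` as a power series in `z^{∓1}`. -/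
def bA (g : Gens I (Op W)) (s : ℤˣ) (i : I) : (Op W)⟦X⟧ :=
  PowerSeries.mk fun n => g.A s i (-((s : ℤ) * n))

variable (g : Gens I (Op W))

theorem iota_bA (s : ℤˣ) (i : I) : iota s (g.bA s i) = g.A s i := by
  refine iota_mk s _ fun e he => ?_
  rw [A, if_neg]
  rcases Int.units_eq_one_or s with rfl | rfl
  · rintro (⟨-, h⟩ | ⟨h, -⟩)
    · simp at he; omega
    · exact absurd h.symm neg_one_ne_one_units
  · rintro (⟨h, -⟩ | ⟨-, h⟩)
    · exact absurd h neg_one_ne_one_units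
    · simp at he; omega

theorem Hc_eq (s : ℤˣ) (i : I) : g.Hc s i = iota s (1 + ch 2 • g.bA s i) := by
  rw [map_add, map_smul, iota_one, iota_bA]
  rfl

variable {g}

theorem IsGood.commute_A (hg : g.IsGood) (s : ℤˣ) (i : I) (e : ℤ) :
    Commute g.kappa (g.A s i e) := by
  rw [A]
  split_ifs
  · exact hg.commH i _
  · exact Commute.zero_right _

theorem IsGood.commute_Xc (hg : g.IsGood) (s : ℤˣ) (i : I) (e : ℤ) :
    Commute g.kappa (g.Xc s i e) := hg.commX s i _

theorem commute_C_mk {x : Op W} {a : ℕ → Op W} (h : ∀ n, Commute x (a n)) :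
    Commute (PowerSeries.C x) (PowerSeries.mk a) := by
  ext n : 1
  rw [PowerSeries.coeff_C_mul, PowerSeries.coeff_mul_C, PowerSeries.coeff_mk]
  exact h n

theorem IsGood.commute_bA (hg : g.IsGood) (s : ℤˣ) (i : I) :
    Commute (PowerSeries.C g.kappa) (g.bA s i) :=
  commute_C_mk fun _ => hg.commute_A s i _

variable [TopFree W]

theorem IsGood.bA_mem (hg : g.IsGood) (i : I) : g.bA 1 i ∈ nullSer W := fun v r => by
  obtain ⟨N, hN⟩ := hg.nullH i v r
  refine ⟨N + 1, fun k hk => ?_⟩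
  obtain ⟨k, rfl⟩ : ∃ j, k = j + 1 := ⟨k - 1, by omega⟩
  rw [bA, PowerSeries.coeff_mk, A, if_pos (Or.inl ⟨rfl, by simp; omega⟩)]
  have : (-(-(((1 : ℤˣ) : ℤ) * ((k + 1 : ℕ) : ℤ))) - 1) = (k : ℤ) := by simp
  rw [this]
  exact hN k (by omega)

variable (g)

/-- The series `A_i^±(z + cκħ)`. -/
def sA (s : ℤˣ) (c : ℂ) (i : I) : (Op W)⟦X⟧ := TB s g.kappa c (g.bA s i)

theorem iota_sA (s : ℤˣ) (c : ℂ) (i : I) : iota s (g.sA s c i) = fshift (g.kh c) (g.A s i) := by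
  rw [sA, iota_TB, kh, fshift_eq, iota_bA]

theorem Tsh_Hc (s : ℤˣ) (c : ℂ) (i : I) :
    Tsh g.kappa c (g.Hc s i) = iota s (1 + ch 2 • g.sA s c i) := by
  rw [Hc_eq, ← iota_TB, map_add, map_smul, TB_one]
  rfl

/-- The series `(2ħ)⁻¹ log H_i^±(z ± κħ/2)`. -/
def lH (s : ℤˣ) (i : I) : (Op W)⟦X⟧ := Flog (g.sA s (((s : ℤ) : ℂ) / 2) i)

theorem hpm_eq (s : ℤˣ) (i : I) :
    g.hpm s i = (s : ℤ) • iota s (ev (dB (Op W) s) S⁻¹ (g.lH s i)) := by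
  rw [hpm, lH, iota_ev_dB, ← flog_iota, iota_sA]

variable {g}

theorem IsGood.commute_sA (hg : g.IsGood) (s : ℤˣ) (c : ℂ) (i : I) :
    Commute (PowerSeries.C g.kappa) (g.sA s c i) :=
  commute_TB (hg.commute_bA s i)

theorem IsGood.sA_mem (hg : g.IsGood) (c : ℂ) (i : I) : g.sA 1 c i ∈ nullSer W :=
  TB_mem_nullSer _ _ (hg.bA_mem i)

/-- The series `H_i^+(z + cκħ)⁻¹`. -/
def IsGood.iH (hg : g.IsGood) (c : ℂ) (i : I) : nullSer W :=
  ⟨Finv (g.sA 1 c i), ev_mem_nullSer (hg.sA_mem c i) _⟩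

theorem IsGood.Hinv_eq (hg : g.IsGood) (i : I) :
    g.Hinv i = iota 1 (hg.iH (-1 / 2) i : (Op W)⟦X⟧) := by
  rw [Hinv, ← iota_sA, finv_iota]
  rfl

variable (g) in
/-- The current `X_i^-(z - κħ)`. -/
def Xs (i : I) : ℤ → Op W := Tsh g.kappa (-1) (g.Xc (-1) i)

theorem IsGood.commute_Xs (hg : g.IsGood) (i : I) (n : ℤ) : Commute g.kappa (g.Xs i n) :=
  commute_Tsh (Commute.refl _) _ (hg.commute_Xc (-1) i) n

theorem xY_one (i : I) : g.xY 1 i = g.Xc 1 i := if_pos rfl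

theorem IsGood.xY_neg (hg : g.IsGood) (i : I) :
    g.xY (-1) i = rho (hg.iH (-1 / 2) i) (g.Xs i) := by
  rw [xY, if_neg neg_one_ne_one_units, hg.Hinv_eq, fmul_iota_one, kh, fshift_eq]
  rfl

theorem IsGood.Cc_eq (hg : g.IsGood) (i : I) :
    g.Cc i = rho (hg.iH (-1 / 2) i) (iota (-1) (1 + ch 2 • g.sA (-1) (-3 / 2) i)) := by
  rw [Cc, hg.Hinv_eq, fmul_iota_one, kh, fshift_eq, Tsh_Hc]

/-- The factor from `H^-` has no negative powers. A coefficient of `x ^ (-n)` therefore only uses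
coefficients of `(H^+)⁻¹` of order at least `n`, and these tend to zero pointwise. -/
theorem IsGood.isField_Cc (hg : g.IsGood) (i : I) : IsField (g.Cc i) := fun v r => by
  obtain ⟨K, hK⟩ := (hg.iH (-1 / 2) i).2 v r
  refine ⟨K + 1, fun n hn => ?_⟩
  suffices h : g.Cc i (-(n : ℤ)) v ∈ hsub W r by
    obtain ⟨u, hu⟩ := mem_hsub.1 h
    exact ⟨u, hu.symm⟩
  rw [hg.Cc_eq, rho_apply]
  refine rsum_mem fun k => ?_
  by_cases hk : K ≤ k
  · exact map_mem_hsub _ (hK k hk)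
  · rw [iota_of_pos _ (by simp; omega)]
    exact Submodule.zero_mem _

/-- This is `F G = 1`: `S(ħ∂)` undoes the `S⁻¹(ħ∂)` in `hpm`, and what is left is the logarithm of
`H_i^±` with the shifts `±κħ/2` and `-κħ` combined. -/
theorem IsGood.expG_eq (hg : g.IsGood) (s : ℤˣ) (i : I) :
    g.expG s i = iota s (EXP (-((s : ℤ) • Flog (g.sA s (((s : ℤ) : ℂ) / 2 - 1) i)))) := by
  have h1 : ev (dB (Op W) s) S (TB s g.kappa (-1) (ev (dB (Op W) s) S⁻¹ (g.lH s i))) =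
      Flog (g.sA s (((s : ℤ) : ℂ) / 2 - 1) i) := by
    have hc : Commute (TB s g.kappa (-1)) (ev (dB (Op W) s) S) :=
      commute_ev (commute_ev ((commute_kB_dB s g.kappa).symm.mul_right (Commute.refl _))
        (expS (-1))).symm S
    rw [← Module.End.mul_apply, ← Module.End.mul_apply, ← hc.eq, mul_assoc, ← map_mul, S_mul_inv,
      map_one, mul_one, lH, TB_Flog s _ (hg.commute_sA s _ i), sA, sA, ← Module.End.mul_apply,
      ← TB_add]
    congr 3; ring
  rw [expG, hpm_eq, kh, fshift_eq, ← map_zsmul (iota s), ← iota_TB, ← iota_ev_dB, fexp_iota,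
    map_zsmul, map_zsmul, h1]

/-- The sign in `h^±` makes the minus part exponentiate to `H^-` and the plus part to `(H^+)⁻¹`. The
shifts `-1/2 - 1` and `1/2 - 1` are the `-3/2` and `-1/2` of `C_i`. -/
theorem IsGood.Cc_eq_expG (hg : g.IsGood) (i : I) : g.Cc i = fmul (g.expG (-1) i) (g.expG 1 i) := by
  have h1 : (((1 : ℤˣ) : ℤ) : ℂ) / 2 - 1 = -1 / 2 := by norm_num
  have h2 : (((-1 : ℤˣ) : ℤ) : ℂ) / 2 - 1 = -3 / 2 := by norm_num
  rw [hg.expG_eq, hg.expG_eq, h1, h2, Cc, hg.Hinv_eq, kh, fshift_eq, Tsh_Hc]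
  congr 2
  · rw [← EXP_Flog]
    congr 1; simp
  · change Finv _ = _
    rw [← EXP_neg_Flog]
    congr 1; simp

end Gens

end

section
/-! ## Products with rational kernels -/

section Ratio

variable {R : Type*} [Ring R] [Algebra ℂ⟦X⟧ R]

theorem one_add_C_mul_X_mul_geom (ν : R) :
    (1 + PowerSeries.C ν * PowerSeries.X) * PowerSeries.mk (fun n => (-ν) ^ n) = 1 := by
  ext n
  rw [add_mul, one_mul, mul_assoc, map_add, PowerSeries.coeff_C_mul, PowerSeries.coeff_mk]
  rcases n with _ | n
  · simp
  · rw [PowerSeries.coeff_succ_X_mul, PowerSeries.coeff_mk, PowerSeries.coeff_one,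
      if_neg (Nat.succ_ne_zero n), pow_succ']
    noncomm_ring

theorem commute_one_add_C_mul_X {μ ν : R} (h : Commute μ ν) :
    Commute (1 + PowerSeries.C μ * PowerSeries.X) (1 + PowerSeries.C ν * PowerSeries.X : R⟦X⟧) := by
  have h1 : Commute (PowerSeries.C μ : R⟦X⟧) (PowerSeries.C ν) := by
    rw [Commute, SemiconjBy, ← map_mul, h.eq, map_mul]
  have h2 : ∀ f : R⟦X⟧, Commute f PowerSeries.X := PowerSeries.commute_X
  exact (Commute.one_right _).add_right (((Commute.one_left _).add_left
    ((h1.mul_left (h2 _).symm))).mul_right (h2 _))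

theorem one_add_C_mul_X_mul_ratio {μ ν : R} (h : Commute μ ν) :
    (1 + PowerSeries.C ν * PowerSeries.X) * ratio μ ν = 1 + PowerSeries.C μ * PowerSeries.X := by
  rw [ratio, ← mul_assoc, (commute_one_add_C_mul_X h).symm.eq, mul_assoc,
    one_add_C_mul_X_mul_geom, mul_one]

end Ratio

section Kernel

variable {W : Type*} [AddCommGroup W] [Module ℂ⟦X⟧ W] [TopFree W]

theorem fac_mul_mem_tate (ν : Op W) {f : (Op W)⟦X⟧} (hf : f ∈ Tate (Op W)) :
    (1 + PowerSeries.C ν * PowerSeries.X) * f ∈ Tate (Op W) := by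
  rw [add_mul, one_mul, mul_assoc]
  exact (Tate _).add_mem hf (C_mul_mem_tate _ (X_mul_mem_tate hf))

theorem mulSub_comm {c d : Op W} (h : Commute c d) (D : ℤ → ℤ → Op W) :
    mulSub c (mulSub d D) = mulSub d (mulSub c D) :=
  LinearMap.congr_fun (commute_mulSubL h).eq D

theorem mulSub_dmul_fac {s : ℤˣ} {D : ℤ → ℤ → Op W} (hD : Null s D) {f : (Op W)⟦X⟧}
    (hf : f ∈ Tate (Op W)) {ν : Op W} (hν : ∀ m n, Commute ν (D m n)) :
    mulSub 0 (dmul D (expd s ((1 + PowerSeries.C ν * PowerSeries.X) * f))) =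
      mulSub (-((s : ℤ) • ν)) (dmul D (expd s f)) := by
  rw [add_mul, one_mul, mul_assoc, dmul_add hD hf (C_mul_mem_tate _ (X_mul_mem_tate hf)),
    dmul_C_mul hD (X_mul_mem_tate hf) hν, ← mulSubL_apply, map_add, mulSubL_apply]
  have h1 : mulSubL 0 (kY ν (dmul D (expd s (PowerSeries.X * f)))) =
      kY ν (mulSub 0 (dmul D (expd s (PowerSeries.X * f)))) :=
    LinearMap.congr_fun (show mulSubL 0 * kY ν = kY ν * mulSubL 0 from
      (((commute_mz_kY ν).sub_left (commute_mw_kY ν)).sub_left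
        (commute_kY (Commute.zero_left ν))).eq) _
  rw [h1, mulSub_dmul_X hD hf]
  funext m n
  simp only [mulSub, kY, Pi.add_apply, Pi.smul_apply, LinearMap.coe_mk,
    AddHom.coe_mk, zero_mul, sub_zero, neg_mul, sub_neg_eq_add, smul_mul_assoc, mul_smul_comm]

theorem hsub_one_zsmul {s : ℤˣ} {ν : Op W} (h : ν ∈ hsub (Op W) 1) :
    -((s : ℤ) • ν) ∈ hsub (Op W) 1 :=
  Submodule.neg_mem _ (zsmul_mem_hsub _ h)

/-- Clearing the denominator is reversible: both sides are null in `z`, where multiplication by a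
linear factor is injective. -/
theorem eq_dmul_ratio_iff {s : ℤˣ} {E D : ℤ → ℤ → Op W} (hE : Null s E) (hD : Null s D)
    {μ ν : Op W} (hμ : μ ∈ hsub (Op W) 1) (hν : ν ∈ hsub (Op W) 1) (h : Commute μ ν)
    (cμ : ∀ m n, Commute μ (D m n)) (cν : ∀ m n, Commute ν (D m n)) :
    E = dmul D (expd s (ratio μ ν)) ↔ mulSub (-((s : ℤ) • ν)) E = mulSub (-((s : ℤ) • μ)) D := by
  have hf := (hser_ratio hμ hν).mem_tate
  have key : mulSub (-((s : ℤ) • ν)) (dmul D (expd s (ratio μ ν))) =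
      mulSub (-((s : ℤ) • μ)) D := by
    rw [← mulSub_dmul_fac hD hf cν, one_add_C_mul_X_mul_ratio h,
      ← mul_one (1 + PowerSeries.C μ * PowerSeries.X), mulSub_dmul_fac hD one_mem_tate cμ, dmul_one]
  rw [← key]
  exact ⟨fun h => by rw [h], hE.mulSub_injective (hD.dmul hf) (hsub_one_zsmul hν)⟩

theorem eq_dmul_ratio_mul_iff {s : ℤˣ} {E D : ℤ → ℤ → Op W} (hE : Null s E) (hD : Null s D)
    {μ ν μ' ν' : Op W} (hμ : μ ∈ hsub (Op W) 1) (hν : ν ∈ hsub (Op W) 1)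
    (hμ' : μ' ∈ hsub (Op W) 1) (hν' : ν' ∈ hsub (Op W) 1) (h : Commute μ ν) (h' : Commute μ' ν')
    (h1 : Commute ν' μ) (h2 : Commute ν' ν) (cμ : ∀ m n, Commute μ (D m n)) (cν : ∀ m n, Commute ν (D m n))
    (cμ' : ∀ m n, Commute μ' (D m n)) (cν' : ∀ m n, Commute ν' (D m n)) :
    E = dmul D (expd s (ratio μ ν * ratio μ' ν')) ↔
      mulSub (-((s : ℤ) • ν)) (mulSub (-((s : ℤ) • ν')) E) =
        mulSub (-((s : ℤ) • μ)) (mulSub (-((s : ℤ) • μ')) D) := by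
  have hf := ((hser_ratio hμ hν).mul (hser_ratio hμ' hν')).mem_tate
  have h0 : ∀ (c c' : Op W) (f : (Op W)⟦X⟧), f ∈ Tate (Op W) → (∀ m n, Commute c (D m n)) →
      (∀ m n, Commute c' (D m n)) →
      mulSub 0 (mulSub 0 (dmul D (expd s ((1 + PowerSeries.C c * PowerSeries.X) *
        ((1 + PowerSeries.C c' * PowerSeries.X) * f))))) =
      mulSub (-((s : ℤ) • c)) (mulSub (-((s : ℤ) • c')) (dmul D (expd s f))) := by
    intro c c' f hf hc hc'
    rw [mulSub_dmul_fac hD (fac_mul_mem_tate _ hf) hc, mulSub_comm (Commute.zero_left _),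
      mulSub_dmul_fac hD hf hc']
  have key : mulSub (-((s : ℤ) • ν)) (mulSub (-((s : ℤ) • ν'))
      (dmul D (expd s (ratio μ ν * ratio μ' ν')))) =
      mulSub (-((s : ℤ) • μ)) (mulSub (-((s : ℤ) • μ')) D) := by
    rw [← h0 ν ν' _ hf cν cν']
    have e1 : (1 + PowerSeries.C ν * PowerSeries.X) * ((1 + PowerSeries.C ν' * PowerSeries.X) *
        (ratio μ ν * ratio μ' ν')) = (1 + PowerSeries.C μ * PowerSeries.X) *
          ((1 + PowerSeries.C μ' * PowerSeries.X) * 1) := by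
      rw [mul_one, ← mul_assoc, (commute_one_add_C_mul_X h2).symm.eq, mul_assoc,
        ← mul_assoc _ (ratio μ ν), one_add_C_mul_X_mul_ratio h, ← mul_assoc,
        (commute_one_add_C_mul_X h1).eq, mul_assoc, one_add_C_mul_X_mul_ratio h']
    rw [e1, h0 μ μ' 1 one_mem_tate cμ cμ', dmul_one]
  rw [← key]
  exact ⟨fun h => by rw [h], fun h => hE.mulSub_injective (hD.dmul hf) (hsub_one_zsmul hν')
    ((hE.mulSub _).mulSub_injective ((hD.dmul hf).mulSub _) (hsub_one_zsmul hν) h)⟩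

theorem mulSub_mulSub_eq_iff_facB {s : ℤˣ} {r₁ r₂ r₁' r₂' : Op W} {E F : OneSided W} :
    mulSub (-((s : ℤ) • hv • r₁')) (mulSub (-((s : ℤ) • hv • r₂')) (iota2 s E)) =
      mulSub (-((s : ℤ) • hv • r₁)) (mulSub (-((s : ℤ) • hv • r₂)) (iota2 s F)) ↔
      facB s r₁' (facB s r₂' E) = facB s r₁ (facB s r₂ F) := by
  have h : ∀ (r r' : Op W) (E : OneSided W),
      mulSub (-((s : ℤ) • hv • r)) (mulSub (-((s : ℤ) • hv • r')) (iota2 s E)) =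
        mulSub 0 (mulSub 0 (iota2 s (facB s r (facB s r' E)))) := fun r r' E => by
    rw [mulSub_facB, mulSub_comm (Commute.zero_left _), mulSub_facB]
  rw [h, h]
  exact ⟨fun h1 => eq_of_mulSub_iota2 (((null_iota2 s _).mulSub 0).mulSub_injective
    ((null_iota2 s _).mulSub 0) zero_mem_hsub_one h1), fun h => by rw [h]⟩

theorem EXP_Flog_apply_iff₂ {M : Type*} [AddCommGroup M] [Module ℂ⟦X⟧ M] [TopFree M]
    {u u' v v' x y : Module.End ℂ⟦X⟧ M} (huv : Commute u v) (huv' : Commute u' v')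
    (hu : Commute u' u) (hv : Commute v' v) (h1 : Commute u' v) (h2 : Commute v' u)
    (hux : Commute u x) (hux' : Commute u' x) (hvx : Commute v x) (hvx' : Commute v' x)
    (huy : Commute u y) (huy' : Commute u' y) (hvy : Commute v y) (hvy' : Commute v' y)
    (hxy : Commute x y) (m : M) :
    (EXP (Flog u') * (EXP (Flog v') * EXP (Flog x)) : Module.End ℂ⟦X⟧ M) m =
        (EXP (Flog u) * (EXP (Flog v) * EXP (Flog y)) : Module.End ℂ⟦X⟧ M) m ↔
      (Flog x : Module.End ℂ⟦X⟧ M) m - (Flog y : Module.End ℂ⟦X⟧ M) m =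
        ((Flog u : Module.End ℂ⟦X⟧ M) m + (Flog v : Module.End ℂ⟦X⟧ M) m) -
          ((Flog u' : Module.End ℂ⟦X⟧ M) m + (Flog v' : Module.End ℂ⟦X⟧ M) m) := by
  have f := @commute_Flog_Flog (Module.End ℂ⟦X⟧ M) _ _ _
  rw [← EXP_add (f hvx'), ← EXP_add (f hvy), ← EXP_add ((f huv').add_right (f hux')),
    ← EXP_add ((f huv).add_right (f huy)), EXP_apply_eq_iff]
  · simp only [LinearMap.add_apply]
    rw [sub_eq_sub_iff_add_eq_add]
    constructor <;> intro h
    · rw [add_comm, add_assoc, h]; abel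
    · rw [← add_assoc, add_comm, h]; abel
  · exact ((f hu).add_right ((f h1).add_right (f huy'))).add_left
      (((f h2).add_right ((f hv).add_right (f hvy'))).add_left
        ((f hux.symm).add_right ((f hvx.symm).add_right (f hxy))))

theorem mulSub_mulSub_eq_iff_commB (s : ℤˣ) {b : (Op W)⟦X⟧} {d : ℤ → Op W}
    {r₁ r₂ r₁' r₂' : Op W} (h12 : Commute r₁ r₂) (h12' : Commute r₁' r₂') (h11 : Commute r₁' r₁)
    (h22 : Commute r₂' r₂) (h1 : Commute r₁' r₂) (h2 : Commute r₂' r₁)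
    (hb₁ : Commute (PowerSeries.C r₁) b) (hb₂ : Commute (PowerSeries.C r₂) b)
    (hb₁' : Commute (PowerSeries.C r₁') b) (hb₂' : Commute (PowerSeries.C r₂') b) :
    mulSub (-((s : ℤ) • hv • r₁')) (mulSub (-((s : ℤ) • hv • r₂'))
      (zw (iota s (1 + ch 2 • b)) d)) =
        mulSub (-((s : ℤ) • hv • r₁)) (mulSub (-((s : ℤ) • hv • r₂))
          (wz d (iota s (1 + ch 2 • b)))) ↔
      commB (Flog b) d = ((Flog (hfac s r₁) : Module.End ℂ⟦X⟧ (OneSided W)) (cst d) +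
        (Flog (hfac s r₂) : Module.End ℂ⟦X⟧ (OneSided W)) (cst d)) -
        ((Flog (hfac s r₁') : Module.End ℂ⟦X⟧ (OneSided W)) (cst d) +
        (Flog (hfac s r₂') : Module.End ℂ⟦X⟧ (OneSided W)) (cst d)) := by
  have key := EXP_Flog_apply_iff₂ (commute_hfac s h12) (commute_hfac s h12') (commute_hfac s h11)
    (commute_hfac s h22) (commute_hfac s h1) (commute_hfac s h2) (commute_hfac_lB s hb₁)
    (commute_hfac_lB s hb₁') (commute_hfac_lB s hb₂) (commute_hfac_lB s hb₂')
    (commute_hfac_rB s r₁ b) (commute_hfac_rB s r₁' b) (commute_hfac_rB s r₂ b)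
    (commute_hfac_rB s r₂' b) (commute_lB_rB b b) (cst d)
  rw [← commB_Flog, ← facB_eq, ← facB_eq, ← facB_eq, ← facB_eq, EXP_Flog, EXP_Flog] at key
  rw [← key, ← iota2_lB_cst, ← iota2_rB_cst]
  exact mulSub_mulSub_eq_iff_facB

/-- The version of `exchange_iff` with two factors on either side. -/
theorem exchange_iff₂ (s : ℤˣ) {b : (Op W)⟦X⟧} {d : ℤ → Op W}
    {r₁ r₂ r₁' r₂' : Op W} (h12 : Commute r₁ r₂) (h12' : Commute r₁' r₂') (h11 : Commute r₁' r₁)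
    (h22 : Commute r₂' r₂) (h1 : Commute r₁' r₂) (h2 : Commute r₂' r₁)
    (hb₁ : Commute (PowerSeries.C r₁) b) (hb₂ : Commute (PowerSeries.C r₂) b)
    (hb₁' : Commute (PowerSeries.C r₁') b) (hb₂' : Commute (PowerSeries.C r₂') b)
    (hd₁ : ∀ n, Commute r₁ (d n)) (hd₂ : ∀ n, Commute r₂ (d n)) (hd₁' : ∀ n, Commute r₁' (d n))
    (hd₂' : ∀ n, Commute r₂' (d n)) :
    mulSub (-((s : ℤ) • hv • r₁')) (mulSub (-((s : ℤ) • hv • r₂'))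
      (zw (iota s (1 + ch 2 • b)) d)) =
        mulSub (-((s : ℤ) • hv • r₁)) (mulSub (-((s : ℤ) • hv • r₂))
          (wz d (iota s (1 + ch 2 • b)))) ↔
      commB (Flog b) d = ker s (cst d) ((phi r₁ + phi r₂) - (phi r₁' + phi r₂')) := by
  obtain ⟨t₁, p₁⟩ := phi_spec s (commute_C_cst hd₁)
  obtain ⟨t₂, p₂⟩ := phi_spec s (commute_C_cst hd₂)
  obtain ⟨t₁', p₁'⟩ := phi_spec s (commute_C_cst hd₁')
  obtain ⟨t₂', p₂'⟩ := phi_spec s (commute_C_cst hd₂')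
  rw [mulSub_mulSub_eq_iff_commB s h12 h12' h11 h22 h1 h2 hb₁ hb₂ hb₁' hb₂', p₁, p₂, p₁', p₂',
    ker_sub s _ ((Tate _).add_mem t₁ t₂) ((Tate _).add_mem t₁' t₂'), ker_add s _ t₁ t₂,
    ker_add s _ t₁' t₂']

/-! ### Shifts of exchange relations -/

theorem Tz_injective (κ : Op W) (c : ℂ) : Function.Injective (Tz κ c) := fun D D' h => by
  have := congrArg (Tz κ (-c)) h
  rwa [← Module.End.mul_apply, ← Module.End.mul_apply, Tz_neg_mul] at this

theorem Tw_injective (κ : Op W) (c : ℂ) : Function.Injective (Tw κ c) := fun D D' h => by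
  have := congrArg (Tw κ (-c)) h
  rwa [← Module.End.mul_apply, ← Module.End.mul_apply, Tw_neg_mul] at this

theorem mulSub_shift_z_iff {κ μ ν : Op W} (hμ : Commute κ μ) (hν : Commute κ ν) (c : ℂ)
    {a b : ℤ → Op W} (hb : ∀ n, Commute κ (b n)) :
    mulSub ν (zw a b) = mulSub μ (wz b a) ↔ mulSub (ν - ch c • κ) (zw (Tsh κ c a) b) =
      mulSub (μ - ch c • κ) (wz b (Tsh κ c a)) := by
  rw [← Tz_zw, ← Tz_wz c a hb, ← Tz_mulSub hμ, ← Tz_mulSub hν, (Tz_injective κ c).eq_iff]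

theorem mulSub_shift_w_iff {κ μ ν : Op W} (hμ : Commute κ μ) (hν : Commute κ ν) (c : ℂ)
    {a b : ℤ → Op W} (ha : ∀ n, Commute κ (a n)) :
    mulSub ν (zw a b) = mulSub μ (wz b a) ↔ mulSub (ν + ch c • κ) (zw a (Tsh κ c b)) =
      mulSub (μ + ch c • κ) (wz (Tsh κ c b) a) := by
  rw [← Tw_wz, ← Tw_zw c b ha, ← Tw_mulSub hμ, ← Tw_mulSub hν, (Tw_injective κ c).eq_iff]

theorem mulSub₂_shift_z_iff {κ μ ν μ' ν' : Op W} (hμ : Commute κ μ) (hν : Commute κ ν)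
    (hμ' : Commute κ μ') (hν' : Commute κ ν') (c : ℂ) {a b : ℤ → Op W}
    (hb : ∀ n, Commute κ (b n)) :
    mulSub ν (mulSub ν' (zw a b)) = mulSub μ (mulSub μ' (wz b a)) ↔
      mulSub (ν - ch c • κ) (mulSub (ν' - ch c • κ) (zw (Tsh κ c a) b)) =
      mulSub (μ - ch c • κ) (mulSub (μ' - ch c • κ) (wz b (Tsh κ c a))) := by
  rw [← Tz_zw, ← Tz_wz c a hb, ← Tz_mulSub hμ', ← Tz_mulSub hν', ← Tz_mulSub hμ, ← Tz_mulSub hν,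
    (Tz_injective κ c).eq_iff]

theorem mulSub₂_shift_w_iff {κ μ ν μ' ν' : Op W} (hμ : Commute κ μ) (hν : Commute κ ν)
    (hμ' : Commute κ μ') (hν' : Commute κ ν') (c : ℂ) {a b : ℤ → Op W}
    (ha : ∀ n, Commute κ (a n)) :
    mulSub ν (mulSub ν' (zw a b)) = mulSub μ (mulSub μ' (wz b a)) ↔
      mulSub (ν + ch c • κ) (mulSub (ν' + ch c • κ) (zw a (Tsh κ c b))) =
      mulSub (μ + ch c • κ) (mulSub (μ' + ch c • κ) (wz (Tsh κ c b) a)) := by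
  rw [← Tw_wz, ← Tw_zw c b ha, ← Tw_mulSub hμ', ← Tw_mulSub hν', ← Tw_mulSub hμ, ← Tw_mulSub hν,
    (Tw_injective κ c).eq_iff]

end Kernel

end

/-! ### The relations of `H_i^±` with other currents in logarithmic form -/

section
section Lin

variable {R : Type*} [Ring R] [Algebra ℂ⟦X⟧ R]

theorem ch_add (c d : ℂ) : ch (c + d) = ch c + ch d := by
  rw [ch, ch, ch, map_add, add_mul]

theorem ch_neg (c : ℂ) : ch (-c) = -ch c := by
  rw [ch, ch, map_neg, neg_mul]

theorem hv_smul_lin (κ : R) (a c : ℂ) : hv • lin κ a c = Gens.hb R a + ch c • κ := by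
  rw [lin, smul_add, smul_smul, smul_smul, mul_comm, mul_comm hv, Gens.hb,
    Algebra.algebraMap_eq_smul_one]
  rfl

theorem hb_neg (a : ℂ) : Gens.hb R (-a) = -Gens.hb R a := by
  rw [Gens.hb, ch_neg, map_neg, Gens.hb]

theorem hv_smul_mem (x : R) : hv • x ∈ hsub R 1 := by
  have := smul_mem_hsub 1 x
  rwa [pow_one] at this

theorem commute_lin {κ x : R} (h : Commute κ x) (a c : ℂ) : Commute (lin κ a c) x :=
  ((Commute.one_left x).smul_left _).add_left (h.smul_left _)

theorem commute_lin_lin (κ : R) (a c a' c' : ℂ) : Commute (lin κ a c) (lin κ a' c') :=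
  commute_lin (commute_lin (Commute.refl κ) a' c').symm a c

theorem commute_C_iff {x : R} {f : R⟦X⟧} :
    Commute (PowerSeries.C x) f ↔ ∀ n, Commute x (PowerSeries.coeff n f) := by
  constructor
  · intro h n
    have := congrArg (PowerSeries.coeff n) h.eq
    rwa [PowerSeries.coeff_C_mul, PowerSeries.coeff_mul_C] at this
  · intro h
    ext n : 1
    rw [PowerSeries.coeff_C_mul, PowerSeries.coeff_mul_C]
    exact h n

theorem lin_shift (κ : R) (s : ℤˣ) (a c : ℂ) (t : ℂ) :
    -((s : ℤ) • hv • lin κ a c) - ch t • κ =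
      -((s : ℤ) • hv • lin κ a (c + ((s : ℤ) : ℂ) * t)) := by
  rw [hv_smul_lin, hv_smul_lin, ch_add, add_smul]
  rcases Int.units_eq_one_or s with rfl | rfl
  · simp; abel
  · simp [ch_neg]; abel

end Lin

namespace Gens

variable {I W : Type*} [AddCommGroup W] [Module ℂ⟦X⟧ W] [TopFree W] {g : Gens I (Op W)}

/-- The relations of `H_i^±` with `X_j^±` are all brought to this shape, with `H_i^±` at `z ± κħ/2`
as in `h^±`; they differ only in `x`, in the sign of `a` and in the shift `c`. -/
theorem IsGood.exchange_H (hg : g.IsGood) (s : ℤˣ) (i : I) {x : ℤ → Op W}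
    (hx : ∀ n, Commute g.kappa (x n)) (a c : ℂ) :
    mulSub (-((s : ℤ) • hv • lin g.kappa (-a) c)) (zw (Tsh g.kappa (((s : ℤ) : ℂ) / 2) (g.Hc s i)) x) =
      mulSub (-((s : ℤ) • hv • lin g.kappa a c))
        (wz x (Tsh g.kappa (((s : ℤ) : ℂ) / 2) (g.Hc s i))) ↔
      commB (g.lH s i) x = ker s (cst x) (psi g.kappa a c) := by
  have hc := fun a c => commute_C_iff.2 fun n =>
    commute_lin (commute_C_iff.1 (hg.commute_sA s (((s : ℤ) : ℂ) / 2) i) n) a c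
  rw [Tsh_Hc, exchange_iff s (commute_lin_lin _ _ _ _ _) (hc _ _) (hc _ _)
    (fun n => commute_lin (hx n) _ _) (fun n => commute_lin (hx n) _ _), psi_eq]
  rfl

theorem null_zw_Hc (g : Gens I (Op W)) (s : ℤˣ) (i : I) (x : ℤ → Op W) :
    Null s (zw (g.Hc s i) x) :=
  null_of_support fun m n h => by rw [zw, Hc_eq, iota_of_pos _ h, zero_mul]

theorem null_wz_Hc (g : Gens I (Op W)) (s : ℤˣ) (i : I) (x : ℤ → Op W) :
    Null s (wz x (g.Hc s i)) :=
  null_of_support fun m n h => by rw [wz, Hc_eq, iota_of_pos _ h, mul_zero]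

theorem IsGood.commute_Hc (hg : g.IsGood) (s : ℤˣ) (i : I) (n : ℤ) :
    Commute g.kappa (g.Hc s i n) := by
  rw [Hc_eq]
  exact commute_iota (((Commute.one_right _)).add_right ((hg.commute_bA s i).smul_right _)) n

theorem commute_lin_wz {κ : Op W} {x y : ℤ → Op W} (hx : ∀ n, Commute κ (x n))
    (hy : ∀ n, Commute κ (y n)) (a c : ℂ) (m n : ℤ) : Commute (hv • lin κ a c) (wz x y m n) :=
  (commute_lin ((hx n).mul_right (hy m)) a c).smul_left _

theorem IsGood.zw_eq_dmul_iff (hg : g.IsGood) (s : ℤˣ) (i : I) {x : ℤ → Op W}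
    (hx : ∀ n, Commute g.kappa (x n)) (a a' c : ℂ) :
    zw (g.Hc s i) x = dmul (wz x (g.Hc s i))
      (expd s (ratio (hv • lin g.kappa a c) (hv • lin g.kappa a' c))) ↔
    mulSub (-((s : ℤ) • hv • lin g.kappa a' (c + 1 / 2)))
      (zw (Tsh g.kappa (((s : ℤ) : ℂ) / 2) (g.Hc s i)) x) =
      mulSub (-((s : ℤ) • hv • lin g.kappa a (c + 1 / 2)))
        (wz x (Tsh g.kappa (((s : ℤ) : ℂ) / 2) (g.Hc s i))) := by
  have hk : ∀ a c, Commute g.kappa (-((s : ℤ) • hv • lin g.kappa a c)) := fun a c =>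
    (((commute_lin (Commute.refl g.kappa) a c).symm.smul_right hv).smul_right (s : ℤ)).neg_right
  have hs : ((s : ℤ) : ℂ) * (((s : ℤ) : ℂ) / 2) = 1 / 2 := by
    rw [← mul_div_assoc, ← Int.cast_mul, sgn_mul_self]; norm_num
  rw [eq_dmul_ratio_iff (null_zw_Hc g s i x) (null_wz_Hc g s i x) (hv_smul_mem _) (hv_smul_mem _)
    (((commute_lin_lin g.kappa a c a' c).smul_left hv).smul_right hv)
    (commute_lin_wz hx (hg.commute_Hc s i) _ _) (commute_lin_wz hx (hg.commute_Hc s i) _ _),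
    mulSub_shift_z_iff (hk _ _) (hk _ _) (((s : ℤ) : ℂ) / 2) hx, lin_shift, lin_shift, hs]

theorem IsGood.dy3_one_iff (hg : g.IsGood) (a : ℂ) (i j : I) :
    g.dy3 a 1 i j = 0 ↔
      commB (g.lH 1 i) (g.Xc 1 j) = ker 1 (cst (g.Xc 1 j)) (psi g.kappa a 1) := by
  rw [dy3, sub_eq_zero, if_pos rfl, ← expd_one_apply, kh, ← hb_neg, ← hv_smul_lin, ← hv_smul_lin,
    hg.zw_eq_dmul_iff 1 i (hg.commute_Xc 1 j), ← hg.exchange_H 1 i (hg.commute_Xc 1 j)]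
  norm_num

theorem IsGood.dy4_one_iff (hg : g.IsGood) (a : ℂ) (i j : I) :
    g.dy4 a 1 i j = 0 ↔
      commB (g.lH (-1) i) (g.Xc 1 j) = ker (-1) (cst (g.Xc 1 j)) (psi g.kappa (-a) 1) := by
  rw [dy4, sub_eq_zero, if_pos rfl, ← expd_neg_apply, kh, ← hb_neg, ← hv_smul_lin, ← hv_smul_lin,
    hg.zw_eq_dmul_iff (-1) i (hg.commute_Xc 1 j), ← hg.exchange_H (-1) i (hg.commute_Xc 1 j)]
  norm_num

theorem IsGood.commute_Tsh_Hc (hg : g.IsGood) (s : ℤˣ) (c : ℂ) (i : I) (n : ℤ) :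
    Commute g.kappa (Tsh g.kappa c (g.Hc s i) n) :=
  commute_Tsh (Commute.refl _) _ (hg.commute_Hc s i) n

/-- Moving `w` to `w - κħ` adds `κħ` to `z - w`, which changes the shift of `x = s (z - w)` by `s`.
-/
theorem IsGood.shift_Xs_iff (hg : g.IsGood) (s : ℤˣ) (i j : I) (a a' c : ℂ) :
    mulSub (-((s : ℤ) • hv • lin g.kappa a' c))
      (zw (Tsh g.kappa (((s : ℤ) : ℂ) / 2) (g.Hc s i)) (g.Xc (-1) j)) =
      mulSub (-((s : ℤ) • hv • lin g.kappa a c))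
        (wz (g.Xc (-1) j) (Tsh g.kappa (((s : ℤ) : ℂ) / 2) (g.Hc s i))) ↔
    mulSub (-((s : ℤ) • hv • lin g.kappa a' (c + ((s : ℤ) : ℂ))))
      (zw (Tsh g.kappa (((s : ℤ) : ℂ) / 2) (g.Hc s i)) (g.Xs j)) =
      mulSub (-((s : ℤ) • hv • lin g.kappa a (c + ((s : ℤ) : ℂ))))
        (wz (g.Xs j) (Tsh g.kappa (((s : ℤ) : ℂ) / 2) (g.Hc s i))) := by
  have hk : ∀ a c, Commute g.kappa (-((s : ℤ) • hv • lin g.kappa a c)) := fun a c =>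
    (((commute_lin (Commute.refl g.kappa) a c).symm.smul_right hv).smul_right (s : ℤ)).neg_right
  rw [mulSub_shift_w_iff (hk _ _) (hk _ _) (-1) (hg.commute_Tsh_Hc s _ i), ch_neg, neg_smul,
    ← sub_eq_add_neg, ← sub_eq_add_neg, lin_shift, lin_shift, mul_one]
  rfl

theorem IsGood.dy3_neg_iff (hg : g.IsGood) (a : ℂ) (i j : I) :
    g.dy3 a (-1) i j = 0 ↔
      commB (g.lH 1 i) (g.Xs j) = ker 1 (cst (g.Xs j)) (psi g.kappa (-a) 1) := by
  have h1 : ∀ b : ℂ, hb (Op W) b - ch (1 / 2) • g.kappa = hv • lin g.kappa b (-1 / 2) := fun b => by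
    rw [hv_smul_lin, neg_div, ch_neg, neg_smul, sub_eq_add_neg]
  rw [dy3, sub_eq_zero, if_neg neg_one_ne_one_units, ← expd_one_apply, kh, ← hb_neg, h1, h1,
    hg.zw_eq_dmul_iff 1 i (hg.commute_Xc (-1) j), hg.shift_Xs_iff,
    ← hg.exchange_H 1 i (hg.commute_Xs j)]
  norm_num

/-- The shift of the kernel is `-1` here, in contrast to the `1` which the relation for `[h, x]`
demands. The factor `(H_j^+)⁻¹` in `x_j^-` makes up the difference. -/
theorem IsGood.dy4_neg_iff (hg : g.IsGood) (a : ℂ) (i j : I) :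
    g.dy4 a (-1) i j = 0 ↔
      commB (g.lH (-1) i) (g.Xs j) = ker (-1) (cst (g.Xs j)) (psi g.kappa a (-1)) := by
  have h1 : ∀ b : ℂ, hb (Op W) b - ch (1 / 2) • g.kappa = hv • lin g.kappa b (-1 / 2) := fun b => by
    rw [hv_smul_lin, neg_div, ch_neg, neg_smul, sub_eq_add_neg]
  rw [dy4, sub_eq_zero, if_neg neg_one_ne_one_units, ← expd_neg_apply, kh, ← hb_neg, h1, h1,
    hg.zw_eq_dmul_iff (-1) i (hg.commute_Xc (-1) j), hg.shift_Xs_iff,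
    ← hg.exchange_H (-1) i (hg.commute_Xs j)]
  norm_num

/-- The two quotients have shifts `-1` and `1`. Moving `z` by `κħ/2` and `w` by `-κħ/2` adds `1/2`
twice, which gives `0` and `2`; in the first quotient the roles of `a` and `-a` are reversed, hence
the minus sign. -/
theorem IsGood.dy2_iff (hg : g.IsGood) (a : ℂ) (i j : I) :
    g.dy2 a i j = 0 ↔
      commB (g.lH 1 i) (Tsh g.kappa (-1 / 2) (g.Hc (-1) j)) =
        ker 1 (cst (Tsh g.kappa (-1 / 2) (g.Hc (-1) j)))
          (psi g.kappa a 2 - psi g.kappa a 0) := by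
  have h1 : ∀ b : ℂ, hb (Op W) b - ch 1 • g.kappa = hv • lin g.kappa b (-1) := fun b => by
    rw [hv_smul_lin, ch_neg, neg_smul, sub_eq_add_neg]
  have hl : ∀ b c, Commute g.kappa (hv • lin g.kappa b c) := fun b c =>
    (commute_lin (Commute.refl g.kappa) b c).symm.smul_right hv
  have hk : ∀ b c, Commute g.kappa (-(((1 : ℤˣ) : ℤ) • hv • lin g.kappa b c)) := fun b c =>
    ((hl b c).smul_right ((1 : ℤˣ) : ℤ)).neg_right
  have hll : ∀ b c b' c', Commute (hv • lin g.kappa b c) (hv • lin g.kappa b' c') := fun b c b' c' =>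
    ((commute_lin_lin g.kappa b c b' c').smul_left hv).smul_right hv
  have hD := fun b c => commute_lin_wz (hg.commute_Hc (-1) j) (hg.commute_Hc 1 i) b c
  have hcA := fun a c => commute_C_iff.2 fun n =>
    commute_lin (commute_C_iff.1 (hg.commute_sA 1 (((1 : ℤˣ) : ℤ) / 2 : ℂ) i) n) a c
  have hcd := fun a c n => commute_lin (hg.commute_Tsh_Hc (-1) (-1 / 2) j n) a c
  have hw : ∀ b c, -(((1 : ℤˣ) : ℤ) • hv • lin g.kappa b c) + ch (-1 / 2) • g.kappa =
      -(((1 : ℤˣ) : ℤ) • hv • lin g.kappa b (c + 1 / 2)) := fun b c => by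
    rw [neg_div, ch_neg, neg_smul, ← sub_eq_add_neg, lin_shift]; norm_num
  have hz : ∀ b c, -(((1 : ℤˣ) : ℤ) • hv • lin g.kappa b c) - ch (((1 : ℤˣ) : ℤ) / 2 : ℂ) • g.kappa =
      -(((1 : ℤˣ) : ℤ) • hv • lin g.kappa b (c + 1 / 2)) := fun b c => by
    rw [lin_shift]; norm_num
  rw [dy2, sub_eq_zero, ← expd_one_apply, kh, ← hb_neg, h1, h1, ← hv_smul_lin, ← hv_smul_lin,
    eq_dmul_ratio_mul_iff (null_zw_Hc g 1 i _) (null_wz_Hc g 1 i _) (hv_smul_mem _) (hv_smul_mem _)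
    (hv_smul_mem _) (hv_smul_mem _) (hll _ _ _ _) (hll _ _ _ _) (hll _ _ _ _) (hll _ _ _ _)
    (hD _ _) (hD _ _) (hD _ _) (hD _ _),
    mulSub₂_shift_z_iff (hk _ _) (hk _ _) (hk _ _) (hk _ _) (((1 : ℤˣ) : ℤ) / 2 : ℂ)
      (hg.commute_Hc (-1) j),
    mulSub₂_shift_w_iff (by rw [hz]; exact hk _ _) (by rw [hz]; exact hk _ _)
      (by rw [hz]; exact hk _ _) (by rw [hz]; exact hk _ _) (-1 / 2) (hg.commute_Tsh_Hc 1 _ i)]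
  simp only [hz, hw]
  rw [Tsh_Hc g 1, exchange_iff₂ 1 (commute_lin_lin _ _ _ _ _) (commute_lin_lin _ _ _ _ _)
    (commute_lin_lin _ _ _ _ _) (commute_lin_lin _ _ _ _ _) (commute_lin_lin _ _ _ _ _)
    (commute_lin_lin _ _ _ _ _) (hcA _ _) (hcA _ _) (hcA _ _) (hcA _ _) (hcd _ _) (hcd _ _)
    (hcd _ _) (hcd _ _), psi_eq, psi_eq]
  have e : ((-1 : ℂ) + 1 / 2 + 1 / 2) = 0 := by norm_num
  have e' : ((1 : ℂ) + 1 / 2 + 1 / 2) = 2 := by norm_num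
  have e2 : phi (lin g.kappa (-a) 0) + phi (lin g.kappa a 2) - (phi (lin g.kappa a 0) + phi (lin g.kappa (-a) 2)) =
      phi (lin g.kappa a 2) - phi (lin g.kappa (-a) 2) - (phi (lin g.kappa a 0) - phi (lin g.kappa (-a) 0)) := by abel
  rw [e, e', e2]
  rfl

end Gens

end

/-! ### Separation of the positive and the negative half of `h_{i,𝒴}` -/

section
section Rows

variable {W : Type*} [AddCommGroup W] [Module ℂ⟦X⟧ W] [TopFree W]

theorem iota2_cst (s : ℤˣ) (x : ℤ → Op W) (m n : ℤ) :
    iota2 s (cst x) m n = if m = 0 then x n else 0 := by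
  rw [iota2_apply, cst, iota_apply, PowerSeries.coeff_C]
  rcases Int.units_eq_one_or s with rfl | rfl <;> simp <;> split_ifs <;> first | rfl | omega

theorem wmul_expd (s : ℤˣ) (x : ℤ → Op W) (f : (Op W)⟦X⟧) :
    wmul x (expd s f) = iota2 s (ker s (cst x) f) := by
  rw [iota2_ker]
  funext m n
  have hinj : Function.Injective fun k : ℤ => (m, k) := fun a b h => (Prod.ext_iff.1 h).2
  rw [wmul, dmul, ← hinj.tsum_eq]
  · congr 1; funext k
    rw [iota2_cst, sub_self, if_pos rfl]
  · rintro ⟨p, k⟩ h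
    by_contra hp
    refine h ?_
    change iota2 s (cst x) (m - p) (n - k) * _ = 0
    rw [iota2_cst, if_neg, zero_mul]
    intro h0
    exact hp ⟨k, Prod.ext (by simp; omega) rfl⟩

theorem pFin_wmul (s : ℤˣ) (x : ℤ → Op W) {f : (Op W)⟦X⟧} (hf : f ∈ Tate (Op W)) (m n : ℤ) :
    PFin fun k : ℤ => x (n - k) * expd s f m k := by
  have h := (pFin_dmul (null_iota2 s (cst x)) hf m n).comp (e := fun k : ℤ => (m, k))
    fun a b h => (Prod.ext_iff.1 h).2
  convert h using 2 with k
  rw [iota2_cst, sub_self, if_pos rfl]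

theorem wmul_add (x : ℤ → Op W) {K K' : ℤ → ℤ → Op W}
    (h : ∀ m n, PFin fun k : ℤ => x (n - k) * K m k)
    (h' : ∀ m n, PFin fun k : ℤ => x (n - k) * K' m k) :
    wmul x (K + K') = wmul x K + wmul x K' := by
  funext m n
  simp only [wmul, Pi.add_apply, mul_add]
  exact (h m n).summable.tsum_add (h' m n).summable

theorem wmul_fone (K : ℤ → ℤ → Op W) : wmul fone K = K := by
  funext m n
  rw [wmul, tsum_eq_single n fun k hk => by rw [fone, if_neg (by omega), zero_mul]]
  rw [sub_self, fone, if_pos rfl, one_mul]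

/-- The derivative of a one-sided distribution. -/
def dQ (W : Type*) [AddCommGroup W] [Module ℂ⟦X⟧ W] (s : ℤˣ) :
    Module.End ℂ⟦X⟧ (OneSided W) where
  toFun E n := dB (Op W) s (E n)
  map_add' _ _ := funext fun _ => map_add _ _ _
  map_smul' c E := funext fun n => (dB (Op W) s).map_smul c (E n)

theorem iota2_dQ (s : ℤˣ) (E : OneSided W) : iota2 s (dQ W s E) = dz (Op W) (iota2 s E) := by
  funext m n
  exact congrFun (iota_dB s (E n)) m

/-- `commB` as a linear map. -/
def commBL (d : ℤ → Op W) : (Op W)⟦X⟧ →ₗ[ℂ⟦X⟧] OneSided W where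
  toFun l := commB l d
  map_add' l l' := funext fun n => by simp only [commB, add_mul, mul_add, Pi.add_apply]; abel
  map_smul' c l := funext fun n => by
    simp only [commB, smul_mul_assoc, mul_smul_comm, Pi.smul_apply, smul_sub, RingHom.id_apply]

theorem commB_dB (s : ℤˣ) (l : (Op W)⟦X⟧) (d : ℤ → Op W) :
    commB (dB (Op W) s l) d = dQ W s (commB l d) := by
  funext n
  change _ = dB (Op W) s (l * _ - _ * l)
  rw [map_sub, dB_mul, dB_mul, dB_C, mul_zero, zero_mul, add_zero, zero_add]
  rfl

theorem commB_ev (s : ℤˣ) (P : ℂ⟦X⟧) (l : (Op W)⟦X⟧) (d : ℤ → Op W) :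
    commB (ev (dB (Op W) s) P l) d = ev (dQ W s) P (commB l d) :=
  ev_intertwine (commBL d) (fun m => commB_dB s m d) P l

theorem dB_mem_tate {f : (Op W)⟦X⟧} (hf : f ∈ Tate (Op W)) : dB (Op W) 1 f ∈ Tate (Op W) := by
  intro r
  obtain ⟨K, hK⟩ := hf r
  refine ⟨K + 1, fun k hk => ?_⟩
  obtain ⟨k, rfl⟩ : ∃ j, k = j + 1 := ⟨k - 1, by omega⟩
  rw [dB_one_eq, PowerSeries.coeff_succ_X_mul, eulerB, PowerSeries.coeff_mk]
  exact zsmul_mem_hsub _ (hK k (by omega))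

theorem zsmul_dB_mem_tate (s : ℤˣ) : ∀ f ∈ Tate (Op W),
    ((s : ℤ) • dB (Op W) 1) f ∈ Tate (Op W) := fun f hf => by
  rw [LinearMap.smul_apply]
  exact zsmul_mem (dB_mem_tate hf) _

theorem dQ_ker (s : ℤˣ) (x : ℤ → Op W) {f : (Op W)⟦X⟧} (hf : f ∈ Tate (Op W)) :
    dQ W s (ker s (cst x) f) = ker s (cst x) (((s : ℤ) • dB (Op W) 1) f) := by
  apply iota2_injective s
  rw [iota2_dQ, ← wmul_expd, ← wmul_expd, LinearMap.smul_apply, ← dz_expd]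
  funext m n
  change (m + 1) • ∑' k : ℤ, _ = ∑' k : ℤ, x (n - k) * ((m + 1) • expd s f (m + 1) k)
  rw [zsmul_eq_mul, ← (pFin_wmul s x hf (m + 1) n).tsum_mul_left]
  congr 1; funext k
  rw [mul_smul_comm, zsmul_eq_mul]

/-- Since `cst x` does not involve `z`, the derivative falls on the kernel, where it is `s ∂_x`. The
hypothesis on `P` expresses insensitivity to that sign. -/
theorem ev_dQ_ker (s : ℤˣ) (x : ℤ → Op W) {P : ℂ⟦X⟧}
    (hP : ev ((s : ℤ) • dB (Op W) 1) P = ev (dB (Op W) 1) P) {f : (Op W)⟦X⟧}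
    (hf : f ∈ Tate (Op W)) :
    ev (dQ W s) P (ker s (cst x) f) = ker s (cst x) (ev (dB (Op W) 1) P f) := by
  obtain ⟨h1, h2⟩ := ev_intertwine_tate (D' := dQ W s) (kerL s (cst x)) (zsmul_dB_mem_tate s)
    (fun f => (dQ_ker s x f.2).symm) P hf
  rw [← hP]
  exact h2.symm

theorem phi_mem_tate (r : Op W) : phi r ∈ Tate (Op W) :=
  (phi_spec (E := 0) 1 fun _ => Commute.zero_right _).1

theorem psi_mem_tate (κ : Op W) (a c : ℂ) : psi κ a c ∈ Tate (Op W) := by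
  rw [psi_eq]
  exact (Tate (Op W)).sub_mem (phi_mem_tate _) (phi_mem_tate _)

theorem ev_S_apply_inv {M : Type*} [AddCommGroup M] [Module ℂ⟦X⟧ M] [TopFree M]
    (D : Module.End ℂ⟦X⟧ M) (m : M) : ev D S (ev D S⁻¹ m) = m := by
  rw [← Module.End.mul_apply, ← map_mul, S_mul_inv, map_one, Module.End.one_apply]

theorem ev_S_inv_apply {M : Type*} [AddCommGroup M] [Module ℂ⟦X⟧ M] [TopFree M]
    (D : Module.End ℂ⟦X⟧ M) (m : M) : ev D S⁻¹ (ev D S m) = m := by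
  rw [← Module.End.mul_apply, ← map_mul, mul_comm, S_mul_inv, map_one, Module.End.one_apply]

/-- Without a constant term, series in `z⁻¹` use only negative powers of `z`, so they have no
overlap with series in `z`. -/
theorem iota2_add_eq_iff {E E' F F' : OneSided W} (hE : ∀ n, PowerSeries.coeff 0 (E n) = 0)
    (hF : ∀ n, PowerSeries.coeff 0 (F n) = 0) :
    iota2 1 E + iota2 (-1) E' = iota2 1 F + iota2 (-1) F' ↔ E = F ∧ E' = F' := by
  constructor
  · intro h
    have h1 : ∀ m n, iota2 1 E m n = iota2 1 F m n ∧ iota2 (-1) E' m n = iota2 (-1) F' m n := by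
      intro m n
      have h2 := congrFun (congrFun h m) n
      simp only [Pi.add_apply] at h2
      rcases lt_or_ge m 0 with hm | hm
      · have h3 : ∀ E : OneSided W, iota2 (-1) E m n = 0 := fun E =>
          iota_of_pos _ (by simpa using hm)
        rw [h3, h3, add_zero, add_zero] at h2
        exact ⟨h2, by rw [h3, h3]⟩
      · have h3 : ∀ E : OneSided W, (∀ n, PowerSeries.coeff 0 (E n) = 0) →
            iota2 1 E m n = 0 := fun E hE => by
          rcases hm.eq_or_lt with rfl | hm
          · have := iota_at 1 (E n) 0
            rw [hE] at this
            simpa [iota2_apply] using this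
          · exact iota_of_pos _ (by simpa using hm)
        rw [h3 E hE, h3 F hF, zero_add, zero_add] at h2
        exact ⟨by rw [h3 E hE, h3 F hF], h2⟩
    exact ⟨iota2_injective 1 (funext fun m => funext fun n => (h1 m n).1),
      iota2_injective (-1) (funext fun m => funext fun n => (h1 m n).2)⟩
  · rintro ⟨rfl, rfl⟩; rfl

theorem coeff_zero_ker (x : ℤ → Op W) {f : (Op W)⟦X⟧} (hf : PowerSeries.coeff 0 f = 0) (n : ℤ) :
    PowerSeries.coeff 0 (ker 1 (cst x) f n) = 0 := by
  have h1 := iota_at 1 (ker 1 (cst x) f n) 0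
  have h2 := congrFun (congrFun (wmul_expd 1 x f) 0) n
  rw [iota2_apply] at h2
  rw [← h1]
  simp only [Nat.cast_zero, mul_zero, neg_zero]
  rw [← h2, wmul, tsum_congr (g := fun _ => 0), tsum_zero]
  intro k
  by_cases hk : k = 0
  · subst hk
    obtain ⟨c, hc⟩ := expd_mem 1 f 0 0
    rw [hc]; simp [hf]
  · have : expd 1 f 0 k = 0 := by
      by_contra h
      have := expd_bound h
      have h3 := this.2.2 rfl
      omega
    rw [this, mul_zero]

theorem coeff_zero_ev_dB (P : ℂ⟦X⟧) {f : (Op W)⟦X⟧} (hf : PowerSeries.coeff 0 f = 0) :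
    PowerSeries.coeff 0 (ev (dB (Op W) 1) P f) = 0 := by
  have := coeff_zero_ev_X (1 : Op W) P hf
  rwa [kB_one, one_mul] at this

theorem coeff_zero_Flog {b : (Op W)⟦X⟧} (hb : PowerSeries.coeff 0 b = 0) :
    PowerSeries.coeff 0 (Flog b) = 0 := by
  rw [Flog, PowerSeries.coeff_mul]
  simp only [PowerSeries.coeff_zero_eq_constantCoeff] at hb ⊢; simp [hb]

end Rows

namespace Gens

variable {I W : Type*} [AddCommGroup W] [Module ℂ⟦X⟧ W] [TopFree W] (g : Gens I (Op W))

theorem coeff_zero_lH (i : I) : PowerSeries.coeff 0 (g.lH 1 i) = 0 := by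
  refine coeff_zero_Flog (coeff_zero_ev_X _ _ ?_)
  rw [bA, PowerSeries.coeff_mk, A, if_neg]
  rintro (⟨-, h⟩ | ⟨h, -⟩)
  · simp at h
  · exact neg_one_ne_one_units h.symm

/-- A commutation relation of `h_i(z)` in terms of the logarithms of `H_i^±(z)`. -/
theorem hY_relation_iff (i : I) (x y : ℤ → Op W) (ε : ℤˣ → ℤ) {f : (Op W)⟦X⟧}
    (hf : f ∈ Tate (Op W)) (hf0 : PowerSeries.coeff 0 f = 0) :
    zw (g.hY i) x - wz x (g.hY i) = ε 1 • wmul y (expd 1 f) + ε (-1) • wmul y (expd (-1) f) ↔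
      ∀ σ : ℤˣ, (σ : ℤ) • commB (g.lH σ i) x =
        ε σ • ker σ (cst y) (ev (dB (Op W) 1) S f) := by
  have h1 : zw (g.hY i) x - wz x (g.hY i) =
      iota2 1 (((1 : ℤˣ) : ℤ) • ev (dQ W 1) S⁻¹ (commB (g.lH 1 i) x)) +
      iota2 (-1) (((-1 : ℤˣ) : ℤ) • ev (dQ W (-1)) S⁻¹ (commB (g.lH (-1) i) x)) := by
    rw [← commB_ev, ← commB_ev, map_zsmul, map_zsmul]
    funext m n
    have h2 : ∀ (s : ℤˣ) (l : (Op W)⟦X⟧), iota2 s (commB l x) m n =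
        iota s l m * x n - x n * iota s l m := fun s l => by
      rw [iota2_apply, commB, map_sub, Pi.sub_apply, iota_apply, iota_apply, iota_apply]
      split_ifs
      · rw [PowerSeries.coeff_mul_C, PowerSeries.coeff_C_mul]
      · simp
    simp only [Pi.add_apply, Pi.sub_apply, Pi.smul_apply, h2]
    simp only [zw, wz, hY, hpm_eq, Pi.add_apply, Pi.smul_apply, add_mul, mul_add, smul_mul_assoc,
      mul_smul_comm, smul_sub]
    abel
  -- Both halves are now written as images under the invertible operator `S⁻¹(ħ∂_z)`; on the kernel
  -- side this uses that `S⁻¹` is even.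
  have h2 : ∀ σ : ℤˣ, ker σ (cst y) f =
      ev (dQ W σ) S⁻¹ (ker σ (cst y) (ev (dB (Op W) 1) S f)) := fun σ => by
    rw [ev_dQ_ker σ y (ev_sign_S_inv σ _) (ev_mem_tate (fun _ h => dB_mem_tate h) S hf),
      ev_S_inv_apply]
  have h3 : ∀ σ : ℤˣ, (σ : ℤ) • ev (dQ W σ) S⁻¹ (commB (g.lH σ i) x) = ε σ • ker σ (cst y) f ↔
      (σ : ℤ) • commB (g.lH σ i) x = ε σ • ker σ (cst y) (ev (dB (Op W) 1) S f) := fun σ => by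
    rw [h2, ← map_zsmul (ev (dQ W σ) S⁻¹), ← map_zsmul (ev (dQ W σ) S⁻¹)]
    exact ⟨fun h => by rw [← ev_S_apply_inv (dQ W σ) ((σ : ℤ) • _), h, ev_S_apply_inv],
      fun h => by rw [h]⟩
  rw [h1, wmul_expd, wmul_expd, ← map_zsmul (iota2 1), ← map_zsmul (iota2 (-1)), iota2_add_eq_iff,
    h3, h3]
  · constructor
    · rintro ⟨ha, hb⟩ σ
      rcases Int.units_eq_one_or σ with rfl | rfl
      · exact ha
      · exact hb
    · exact fun h => ⟨h 1, h (-1)⟩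
  · intro n
    rw [← commB_ev]
    have h4 := coeff_zero_ev_dB S⁻¹ (g.coeff_zero_lH i)
    rw [PowerSeries.coeff_zero_eq_constantCoeff] at h4
    simp [commB, h4]
  · intro n
    have h4 := coeff_zero_ker y hf0 n
    rw [PowerSeries.coeff_zero_eq_constantCoeff] at h4
    simp [h4]

end Gens

end

/-! ### Rows of kernels and commutators with logarithms -/

section
section Rows

variable {W : Type*} [AddCommGroup W] [Module ℂ⟦X⟧ W] [TopFree W]

/-- The row of a kernel in which the first variable has a given exponent. -/
def krow (σ : ℤˣ) (m : ℕ) : (Op W)⟦X⟧ →ₗ[ℂ⟦X⟧] (Op W)⟦X⟧ where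
  toFun f := PowerSeries.mk fun k => expd σ f (-((σ : ℤ) * m)) (-(((-σ : ℤˣ) : ℤ) * k))
  map_add' f f' := by ext k : 1; simp
  map_smul' c f := by ext k : 1; simp

theorem coeff_krow (σ : ℤˣ) (m k : ℕ) (f : (Op W)⟦X⟧) : PowerSeries.coeff k (krow σ m f) =
    expd σ f (-((σ : ℤ) * m)) (-(((-σ : ℤˣ) : ℤ) * k)) := by
  rw [← PowerSeries.coeff_mk k fun k : ℕ => expd σ f (-((σ : ℤ) * m)) (-(((-σ : ℤˣ) : ℤ) * k))]
  rfl

theorem iota_krow (σ : ℤˣ) (m : ℕ) (f : (Op W)⟦X⟧) :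
    iota (-σ) (krow σ m f) = expd σ f (-((σ : ℤ) * m)) := by
  refine iota_mk (-σ) _ fun n hn => ?_
  by_contra h
  have h1 := expd_bound h
  rcases Int.units_eq_one_or σ with rfl | rfl
  · have := h1.2.2 rfl
    simp at hn; omega
  · simp at hn h1; omega

theorem dB_krow (σ : ℤˣ) (m : ℕ) (f : (Op W)⟦X⟧) :
    dB (Op W) (-σ) (krow σ m f) = krow σ m ((((-σ : ℤˣ) : ℤ) • dB (Op W) 1) f) := by
  apply iota_injective (-σ)
  rw [iota_dB, iota_krow, iota_krow]
  have h := congrFun (dw_expd σ f) (-((σ : ℤ) * m))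
  rw [Units.val_neg, neg_smul, LinearMap.neg_apply, LinearMap.smul_apply, ← h]
  rfl

theorem kB_krow (σ : ℤˣ) (m : ℕ) (c : Op W) (f : (Op W)⟦X⟧) :
    kB c (krow σ m f) = krow σ m (kB c f) := by
  apply iota_injective (-σ)
  rw [iota_kB, iota_krow, iota_krow]
  funext n
  exact (expd_C_mul σ c f _ _).symm

theorem ev_dB_krow (σ : ℤˣ) (m : ℕ) (f : (Op W)⟦X⟧) :
    ev (dB (Op W) (-σ)) S (krow σ m f) = krow σ m (ev (dB (Op W) 1) S f) := by
  rw [← ev_intertwine (krow σ m) (fun f => (dB_krow σ m f).symm), ev_sign_S]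

theorem TB_krow (m : ℕ) (κ : Op W) (c : ℂ) (f : (Op W)⟦X⟧) :
    TB 1 κ c (krow (-1) m f) = krow (-1) m (TB 1 κ c f) := by
  refine (ev_intertwine (krow (-1) m) (fun f => ?_) _ f).symm
  have h := dB_krow (-1) m f
  simp only [neg_neg, Units.val_one, one_smul] at h
  rw [Module.End.mul_apply, Module.End.mul_apply, h, kB_krow]

theorem krow_mem_nullSer (m : ℕ) {f : (Op W)⟦X⟧} (hf : f ∈ Tate (Op W)) :
    krow (-1) m f ∈ nullSer W := fun v r => by
  obtain ⟨K, hK⟩ := hf r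
  refine ⟨K + m, fun k hk => ?_⟩
  obtain ⟨c, hc⟩ := expd_mem (-1) f (-(((-1 : ℤˣ) : ℤ) * m)) (-(((- -1 : ℤˣ) : ℤ) * k))
  rw [coeff_krow, hc, LinearMap.smul_apply]
  refine zsmul_mem_hsub _ ?_
  obtain ⟨T, hT⟩ := mem_hsub.1 (hK _ (show K ≤ (-(-(((-1 : ℤˣ) : ℤ) * m) +
    -(((- -1 : ℤˣ) : ℤ) * k))).toNat by simp; omega))
  rw [← hT, LinearMap.smul_apply]
  exact smul_mem_hsub r _

theorem commute_krow {x : Op W} {f : (Op W)⟦X⟧} (h : Commute (PowerSeries.C x) f) (σ : ℤˣ) (m k : ℕ) :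
    Commute x (PowerSeries.coeff k (krow σ m f)) := by
  rw [coeff_krow]
  obtain ⟨c, hc⟩ := expd_mem σ f (-((σ : ℤ) * m)) (-(((-σ : ℤˣ) : ℤ) * k))
  rw [hc]
  exact (commute_C_iff.1 h _).smul_right c

theorem commute_C_phi {x r : Op W} (h : Commute x r) : Commute (PowerSeries.C x) (phi r) := by
  refine commute_Flog (Commute.smul_right (Commute.mul_right ?_ (PowerSeries.commute_X _)) _)
  rw [Commute, SemiconjBy, ← map_mul, h.eq, map_mul]

theorem commute_C_psi {x κ : Op W} (h : Commute x κ) (a c : ℂ) :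
    Commute (PowerSeries.C x) (psi κ a c) := by
  rw [psi_eq]
  exact (commute_C_phi (commute_lin h.symm _ _).symm).sub_right
    (commute_C_phi (commute_lin h.symm _ _).symm)

/-- Commutators with an operator. -/
def adL (T : Op W) : (Op W)⟦X⟧ →ₗ[ℂ⟦X⟧] (Op W)⟦X⟧ :=
  LinearMap.mulLeft ℂ⟦X⟧ (PowerSeries.C T) - LinearMap.mulRight ℂ⟦X⟧ (PowerSeries.C T)

theorem adL_apply (T : Op W) (f : (Op W)⟦X⟧) :
    adL T f = PowerSeries.C T * f - f * PowerSeries.C T := rfl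

theorem coeff_adL (T : Op W) (f : (Op W)⟦X⟧) (n : ℕ) :
    PowerSeries.coeff n (adL T f) = T * PowerSeries.coeff n f - PowerSeries.coeff n f * T := by
  rw [adL_apply, map_sub, PowerSeries.coeff_C_mul, PowerSeries.coeff_mul_C]

theorem adL_eq_zero_iff {T : Op W} {f : (Op W)⟦X⟧} :
    adL T f = 0 ↔ Commute (PowerSeries.C T) f := sub_eq_zero

theorem iota_adL (s : ℤˣ) (T : Op W) (f : (Op W)⟦X⟧) (n : ℤ) :
    iota s (adL T f) n = T * iota s f n - iota s f n * T := by
  rw [iota_apply, iota_apply]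
  split_ifs
  · rw [coeff_adL]
  · simp

theorem adL_dB (s : ℤˣ) (T : Op W) (f : (Op W)⟦X⟧) : adL T (dB (Op W) s f) = dB (Op W) s (adL T f) := by
  rw [adL_apply, adL_apply, map_sub, dB_mul, dB_mul, dB_C, zero_mul, mul_zero, zero_add, add_zero]

theorem adL_ev_dB (s : ℤˣ) (T : Op W) (P : ℂ⟦X⟧) (f : (Op W)⟦X⟧) :
    adL T (ev (dB (Op W) s) P f) = ev (dB (Op W) s) P (adL T f) :=
  ev_intertwine (adL T) (adL_dB s T) P f

theorem adL_TB (s : ℤˣ) {T κ : Op W} (h : Commute T κ) (c : ℂ) (f : (Op W)⟦X⟧) :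
    adL T (TB s κ c f) = TB s κ c (adL T f) := by
  refine ev_intertwine (adL T) (fun f => ?_) _ f
  have h1 : Commute (PowerSeries.C T) (PowerSeries.C κ) := by
    rw [Commute, SemiconjBy, ← map_mul, h.eq, map_mul]
  rw [Module.End.mul_apply, Module.End.mul_apply, ← adL_dB, kB_apply, kB_apply, adL_apply, adL_apply,
    ← mul_assoc, h1.eq, mul_sub, mul_assoc, mul_assoc]

/-- Exponentiating the logarithm recovers `1 + 2ħ b`, and the factor `2ħ` can be cancelled. -/
theorem commute_Flog_iff {R : Type*} [Ring R] [Algebra ℂ⟦X⟧ R] [TopFree R] {x b : R} :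
    Commute x (Flog b) ↔ Commute x b := by
  refine ⟨fun h => ?_, commute_Flog⟩
  have h1 : Commute x (EXP (Flog b)) := commute_ev h _
  rw [EXP_Flog, Commute, SemiconjBy, mul_add, add_mul, mul_one, one_mul, add_right_inj,
    mul_smul_comm, smul_mul_assoc, two_smul_hv] at h1
  exact two_hv_inj h1

theorem TB_injective {R : Type*} [Ring R] [Algebra ℂ⟦X⟧ R] [TopFree R] (s : ℤˣ) (κ : R) (c : ℂ) :
    Function.Injective (TB s κ c) := fun f f' h => by
  have := congrArg (TB s κ (-c)) h
  rwa [← Module.End.mul_apply, ← Module.End.mul_apply, ← TB_add, neg_add_cancel, TB_zero] at this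

theorem commute_C_TB_iff (s : ℤˣ) {T κ : Op W} (h : Commute T κ) (c : ℂ) {f : (Op W)⟦X⟧} :
    Commute (PowerSeries.C T) (TB s κ c f) ↔ Commute (PowerSeries.C T) f := by
  rw [← adL_eq_zero_iff, ← adL_eq_zero_iff, adL_TB s h, map_eq_zero_iff _ (TB_injective s κ c)]

theorem EXP_mulLeft {R : Type*} [Ring R] [Algebra ℂ⟦X⟧ R] [TopFree R] (x : R) :
    EXP (LinearMap.mulLeft ℂ⟦X⟧ x) = LinearMap.mulLeft ℂ⟦X⟧ (EXP x) :=
  (map_ev_eq (LinearMap.mul ℂ⟦X⟧ R) (fun k => (LinearMap.pow_mulLeft _ _ x k).symm) _).symm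

theorem EXP_mulRight {R : Type*} [Ring R] [Algebra ℂ⟦X⟧ R] [TopFree R] (x : R) :
    EXP (LinearMap.mulRight ℂ⟦X⟧ x) = LinearMap.mulRight ℂ⟦X⟧ (EXP x) :=
  (map_ev_eq (LinearMap.mul ℂ⟦X⟧ R).flip (fun k => (LinearMap.pow_mulRight _ _ x k).symm) _).symm

/-- Commutators with a logarithm. -/
theorem commutator_Flog_iff {R : Type*} [Ring R] [Algebra ℂ⟦X⟧ R] [TopFree R] {T b c : R}
    (h : Commute b c) :
    Flog b * T - T * Flog b = c ↔
      (1 + ch 2 • b) * T - T * (1 + ch 2 • b) = ch 2 • (c * (1 + ch 2 • b)) := by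
  -- This is the inner derivation of `Flog b`; its exponential is conjugation by `1 + 2ħ b`. It
  -- kills `c` because `b` and `c` commute, so `EXP_apply_iff` applies.
  set y : Module.End ℂ⟦X⟧ R := LinearMap.mulLeft ℂ⟦X⟧ (Flog b) + LinearMap.mulRight ℂ⟦X⟧ (-Flog b)
    with hy
  have hyc : y c = 0 := by
    have : Commute (Flog b) c := (commute_Flog h.symm).symm
    simp [hy, this.eq]
  have key := EXP_apply_iff y T c hyc
  rw [hy, EXP_add (LinearMap.commute_mulLeft_right _ _), EXP_mulLeft, EXP_mulRight, EXP_Flog,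
    EXP_neg_Flog] at key
  have h1 : ∀ m, (LinearMap.mulLeft ℂ⟦X⟧ (Flog b) + LinearMap.mulRight ℂ⟦X⟧ (-Flog b)) m =
      Flog b * m - m * Flog b := fun m => by simp [sub_eq_add_neg]
  rw [h1] at key
  rw [← key]
  simp only [Module.End.mul_apply, LinearMap.mulLeft_apply, LinearMap.mulRight_apply]
  constructor
  · intro h2
    have h3 := congrArg (· * (1 + ch 2 • b)) h2
    simp only [mul_assoc, Finv_mul, mul_one] at h3
    rw [h3, add_mul, add_sub_cancel_left, smul_mul_assoc]
  · intro h2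
    have h3 : (1 + ch 2 • b) * T = (T + ch 2 • c) * (1 + ch 2 • b) := by
      rw [add_mul T, smul_mul_assoc (ch 2) c, ← h2]; abel
    rw [← mul_assoc, h3, mul_assoc, mul_Finv, mul_one]

theorem rows_iff {σ : ℤˣ} {l : (Op W)⟦X⟧} {d y : ℤ → Op W} {f : (Op W)⟦X⟧} :
    commB l d = ker σ (cst y) f ↔ ∀ (m : ℕ) (n : ℤ),
      PowerSeries.coeff m l * d n - d n * PowerSeries.coeff m l =
        wmul y (expd σ f) (-((σ : ℤ) * m)) n := by
  have h1 : ∀ (m : ℕ) n, PowerSeries.coeff m (ker σ (cst y) f n) =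
      wmul y (expd σ f) (-((σ : ℤ) * m)) n := fun m n => by
    rw [wmul_expd, iota2_apply, iota_at]
  have h2 : ∀ (m : ℕ) n, PowerSeries.coeff m (commB l d n) =
      PowerSeries.coeff m l * d n - d n * PowerSeries.coeff m l := fun m n => by
    rw [commB, map_sub, PowerSeries.coeff_mul_C, PowerSeries.coeff_C_mul]
  constructor
  · intro h m n
    rw [← h1, ← h2, h]
  · intro h
    funext n
    ext m : 1
    rw [h1, h2, h]

theorem wmul_iota (s : ℤˣ) (D f : (Op W)⟦X⟧) (m : ℕ) (n : ℤ) :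
    wmul (iota (-s) D) (expd s f) (-((s : ℤ) * m)) n = iota (-s) (D * krow s m f) n := by
  rw [← fmul_iota, iota_krow]
  rfl

theorem iota_add_eq_iff {E E' F F' : (Op W)⟦X⟧} (hE : PowerSeries.coeff 0 E = 0)
    (hF : PowerSeries.coeff 0 F = 0) :
    iota 1 E + iota (-1) E' = iota 1 F + iota (-1) F' ↔ E = F ∧ E' = F' := by
  have h := iota2_add_eq_iff (E := fun _ => E) (E' := fun _ => E') (F := fun _ => F)
    (F' := fun _ => F') (fun _ => hE) (fun _ => hF)
  constructor
  · intro h1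
    have h2 := h.1 (funext fun m => funext fun n => congrFun h1 m)
    exact ⟨congrFun h2.1 0, congrFun h2.2 0⟩
  · rintro ⟨rfl, rfl⟩; rfl

end Rows

end

/-! ### The brackets `[h, h]` and `[h, x]` as commutators of logarithms -/

section
namespace Gens

variable {I W : Type*} [AddCommGroup W] [Module ℂ⟦X⟧ W] [TopFree W]

section Kernels

variable (κ : Op W)

theorem inv1_mem_tate : inv1 (ch 1 • κ) ∈ Tate (Op W) := by
  rw [inv1_eq]
  exact ev_mem_tate (D := kB κ * dB (Op W) 1)
    (fun f hf => C_mul_mem_tate κ (f := dB (Op W) 1 f) (dB_mem_tate hf)) _ X_mem_tate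

theorem inv1_sq_mem_tate : inv1 (ch 1 • κ) ^ 2 ∈ Tate (Op W) := by
  rw [inv1_eq, ← TB_pow 1 _ (PowerSeries.commute_X _), pow_two]
  exact ev_mem_tate (D := kB κ * dB (Op W) 1)
    (fun f hf => C_mul_mem_tate κ (f := dB (Op W) 1 f) (dB_mem_tate hf)) _
    (X_mul_mem_tate X_mem_tate)

theorem coeff_zero_inv1 (c : Op W) : PowerSeries.coeff 0 (inv1 c) = 0 := by
  rw [inv1, PowerSeries.coeff_zero_X_mul]

theorem coeff_zero_inv1_sq (c : Op W) : PowerSeries.coeff 0 (inv1 c ^ 2) = 0 := by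
  rw [inv1, pow_two, mul_assoc, PowerSeries.coeff_zero_X_mul]

theorem qker_mem_tate (c : Op W) {f : (Op W)⟦X⟧} (hf : f ∈ Tate (Op W)) :
    qker c f ∈ Tate (Op W) :=
  C_mul_mem_tate _ (ev_mem_tate (D := kB c * dB (Op W) 1)
    (fun f hf => C_mul_mem_tate c (f := dB (Op W) 1 f) (dB_mem_tate hf)) _
    (ev_mem_tate (fun _ h => dB_mem_tate h) _ hf))

theorem coeff_zero_qker (c : Op W) {f : (Op W)⟦X⟧} (hf : PowerSeries.coeff 0 f = 0) :
    PowerSeries.coeff 0 (qker c f) = 0 := by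
  rw [qker, kB_apply, PowerSeries.coeff_C_mul,
    coeff_zero_ev_X _ _ (coeff_zero_ev_dB _ hf), mul_zero]

/-- The kernel of the commutators between the logarithms of `H_i^±(z)` and `H_j^∓(w)`. -/
def hker (a : ℤ) : (Op W)⟦X⟧ :=
  ev (dB (Op W) 1) S (ev (dB (Op W) 1) S (qker (a : Op W) (qker κ (inv1 (ch 1 • κ) ^ 2))))

theorem two_hv_smul_hker (a : ℤ) : (2 * hv) • hker κ a = psi κ a 0 - psi κ a 2 :=
  ev_S_S_qker_inv1 κ a

variable {κ}

theorem commute_C_hker {x : Op W} (h : Commute x κ) (a : ℤ) :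
    Commute (PowerSeries.C x) (hker κ a) := by
  have h1 : Commute (PowerSeries.C x) ((2 * hv) • hker κ a) := by
    rw [two_hv_smul_hker]
    exact (commute_C_psi h _ _).sub_right (commute_C_psi h _ _)
  have h2 := h1.eq
  rw [mul_smul_comm, smul_mul_assoc] at h2
  exact two_hv_inj h2

end Kernels

variable {g : Gens I (Op W)}

theorem wdiffop_qnum_inv1 (x : ℤ → Op W) (a : ℤ) :
    wmul x (wdiffop (qnum (a : Op W)) (expandZW (inv1 (g.kh 1)) + expandWZ (inv1 (g.kh 1)))) =
      wmul x (expd 1 (qker (a : Op W) (inv1 (g.kh 1)))) +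
        wmul x (expd (-1) (qker (a : Op W) (inv1 (g.kh 1)))) := by
  have h := qker_mem_tate (a : Op W) (inv1_mem_tate g.kappa)
  rw [wdiffop_qnum_add, ← expd_one_apply, ← expd_neg_apply, wdiffop_qnum_expd, wdiffop_qnum_expd]
  exact wmul_add _ (pFin_wmul 1 x h) (pFin_wmul (-1) x h)

theorem h_x_iff (i : I) (x : ℤ → Op W) (s : ℤˣ) (a : ℤ) :
    zw (g.hY i) x - wz x (g.hY i) = (s : ℤ) • wmul x (wdiffop (qnum (a : Op W))
      (expandZW (inv1 (g.kh 1)) + expandWZ (inv1 (g.kh 1)))) ↔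
    ∀ σ : ℤˣ, (σ : ℤ) • commB (g.lH σ i) x = (s : ℤ) • ker σ (cst x) (psi g.kappa a 1) := by
  have h := g.hY_relation_iff i x x (fun _ => s) (qker_mem_tate (a : Op W) (inv1_mem_tate g.kappa))
    (coeff_zero_qker _ (coeff_zero_inv1 _))
  rw [wdiffop_qnum_inv1, smul_add, ← ev_S_qker_inv1]
  exact h

theorem h_h_iff_ker (i j : I) (a : ℤ) :
    zw (g.hY i) (g.hY j) - wz (g.hY j) (g.hY i) =
      wdiffop (qnum (a : Op W)) (wdiffop (qnum g.kappa)
        (expandZW (inv1 (g.kh 1) ^ 2) - expandWZ (inv1 (g.kh 1) ^ 2))) ↔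
    ∀ σ : ℤˣ, commB (g.lH σ i) (g.hY j) = ker σ (cst fone) (ev (dB (Op W) 1) S
      (qker (a : Op W) (qker g.kappa (inv1 (g.kh 1) ^ 2)))) := by
  have h := g.hY_relation_iff i (g.hY j) fone (fun σ => σ)
    (qker_mem_tate (a : Op W) (qker_mem_tate g.kappa (inv1_sq_mem_tate g.kappa)))
    (coeff_zero_qker _ (coeff_zero_qker _ (coeff_zero_inv1_sq _)))
  have e : wdiffop (qnum (a : Op W)) (wdiffop (qnum g.kappa)
        (expandZW (inv1 (g.kh 1) ^ 2) - expandWZ (inv1 (g.kh 1) ^ 2))) =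
      ((1 : ℤˣ) : ℤ) • wmul fone (expd 1 (qker (a : Op W)
        (qker g.kappa (inv1 (ch 1 • g.kappa) ^ 2)))) +
      ((-1 : ℤˣ) : ℤ) • wmul fone (expd (-1) (qker (a : Op W)
        (qker g.kappa (inv1 (ch 1 • g.kappa) ^ 2)))) := by
    rw [wdiffop_qnum_sub, wdiffop_qnum_sub, ← expd_one_apply, ← expd_neg_apply, wdiffop_qnum_expd,
      wdiffop_qnum_expd, wdiffop_qnum_expd, wdiffop_qnum_expd, wmul_fone, wmul_fone]
    simp [kh, sub_eq_add_neg]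
  rw [e, h]
  refine forall_congr' fun σ => ?_
  rcases Int.units_eq_one_or σ with rfl | rfl
  · simp only [Units.val_one, one_smul]; rfl
  · simp only [Units.val_neg, Units.val_one, neg_smul, one_smul, neg_inj]; rfl

/-- Fix a coefficient `T` of the logarithm of `H_i^σ`. The bracket of `T` with `h_j(w)` has a part
in negative and a part in nonnegative powers of `w`, while the corresponding row of the kernel lies
entirely in the part of sign `-σ`. Hence logarithms of equal sign commute, and the kernel is the
bracket of those of opposite sign. -/
theorem h_h_iff (i j : I) (a : ℤ) :
    zw (g.hY i) (g.hY j) - wz (g.hY j) (g.hY i) =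
      wdiffop (qnum (a : Op W)) (wdiffop (qnum g.kappa)
        (expandZW (inv1 (g.kh 1) ^ 2) - expandWZ (inv1 (g.kh 1) ^ 2))) ↔
    ∀ (σ : ℤˣ) (m : ℕ), adL (PowerSeries.coeff m (g.lH σ i)) (g.lH σ j) = 0 ∧
      adL (PowerSeries.coeff m (g.lH σ i)) (g.lH (-σ) j) =
        -((σ : ℤ) • krow σ m (hker g.kappa a)) := by
  rw [h_h_iff_ker]
  refine forall_congr' fun σ => ?_
  rw [rows_iff]
  refine forall_congr' fun m => ?_
  set T := PowerSeries.coeff m (g.lH σ i)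
  set f := ev (dB (Op W) 1) S (qker (a : Op W) (qker g.kappa (inv1 (g.kh 1) ^ 2))) with hf
  have hker_eq : hker g.kappa a = ev (dB (Op W) 1) S f := rfl
  have hf0 : PowerSeries.coeff 0 f = 0 := coeff_zero_ev_dB _
    (coeff_zero_qker _ (coeff_zero_qker _ (coeff_zero_inv1_sq _)))
  have hL0 : PowerSeries.coeff 0 (ev (dB (Op W) 1) S⁻¹ (adL T (g.lH 1 j))) = 0 := by
    refine coeff_zero_ev_dB _ ?_
    rw [coeff_adL, coeff_zero_lH]; simp
  have h1 : (∀ n, T * g.hY j n - g.hY j n * T = wmul fone (expd σ f) (-((σ : ℤ) * m)) n) ↔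
      iota 1 (ev (dB (Op W) 1) S⁻¹ (adL T (g.lH 1 j))) +
        iota (-1) (-ev (dB (Op W) (-1)) S⁻¹ (adL T (g.lH (-1) j))) =
        iota (-σ) (krow σ m f) := by
    rw [wmul_fone, iota_krow, ← adL_ev_dB, ← adL_ev_dB, map_neg, funext_iff]
    refine forall_congr' fun n => ?_
    rw [Pi.add_apply, Pi.neg_apply, iota_adL, iota_adL]
    simp only [hY, hpm_eq, Pi.add_apply, Pi.neg_apply, Units.val_one, Units.val_neg, one_smul,
      neg_smul, mul_add, add_mul, mul_neg, neg_mul]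
    rw [← sub_eq_zero, ← sub_eq_zero (a := _ + _)]
    refine iff_of_eq (congrArg (· = (0 : Op W)) ?_)
    abel
  have hk : krow σ m (hker g.kappa a) = ev (dB (Op W) (-σ)) S (krow σ m f) := by
    rw [hker_eq, ev_dB_krow]
  rw [h1, hk]
  clear_value f
  have hS : ∀ (s : ℤˣ) (x : (Op W)⟦X⟧), ev (dB (Op W) s) S⁻¹ x = 0 ↔ x = 0 := fun s x =>
    ⟨fun h => by rw [← ev_S_apply_inv (dB (Op W) s) x, h, map_zero], fun h => by rw [h, map_zero]⟩
  have hS' : ∀ (s : ℤˣ) (x y : (Op W)⟦X⟧), ev (dB (Op W) s) S⁻¹ x = y ↔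
      x = ev (dB (Op W) s) S y := fun s x y =>
    ⟨fun h => by rw [← h, ev_S_apply_inv], fun h => by rw [h, ev_S_inv_apply]⟩
  rcases Int.units_eq_one_or σ with hσ | hσ
  · rw [hσ]
    have h2 : iota (-1) (krow 1 m f) = iota 1 0 + iota (-1) (krow 1 m f) := by
      rw [map_zero, zero_add]
    rw [h2, iota_add_eq_iff hL0 (map_zero _), hS, neg_eq_iff_eq_neg, hS', map_neg, Units.val_one,
      one_smul]
  · rw [hσ]
    have h2 : iota (- -1) (krow (-1) m f) = iota 1 (krow (-1) m f) + iota (-1) 0 := by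
      rw [map_zero, add_zero, neg_neg]
    -- The kernel has no constant coefficient, so for `σ = -1` the row starts at `w⁻¹` and does not
    -- meet the series in `w`.
    have h3 : PowerSeries.coeff 0 (krow (-1) m f) = 0 := by
      rw [coeff_krow]
      obtain ⟨c, hc⟩ := expd_mem (-1) f (-(((-1 : ℤˣ) : ℤ) * m)) (-(((- -1 : ℤˣ) : ℤ) * (0 : ℕ)))
      rw [hc]
      simp only [PowerSeries.coeff_zero_eq_constantCoeff] at hf0
      simp [hf0]
    rw [h2, iota_add_eq_iff hL0 h3, hS', neg_eq_zero, hS, Units.val_neg, Units.val_one, neg_smul,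
      one_smul, neg_neg, neg_neg, and_comm]

end Gens

end

/-! ### The relation `[h, h]` and the relations among the currents `H_i^±` -/

section
namespace Gens

variable {I W : Type*} [AddCommGroup W] [Module ℂ⟦X⟧ W] [TopFree W] {g : Gens I (Op W)}

theorem IsGood.commute_lH (hg : g.IsGood) (s : ℤˣ) (i : I) (m : ℕ) :
    Commute (PowerSeries.coeff m (g.lH s i)) g.kappa :=
  (commute_C_iff.1 (commute_Flog (hg.commute_sA s _ i)) m).symm

theorem commute_C_Flog_sA_iff {T : Op W} (h : Commute T g.kappa) (s : ℤˣ) (c : ℂ) (i : I) :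
    Commute (PowerSeries.C T) (Flog (g.sA s c i)) ↔ Commute (PowerSeries.C T) (g.bA s i) := by
  rw [commute_Flog_iff, sA, commute_C_TB_iff s h]

theorem commute_coeff_symm {p q : (Op W)⟦X⟧} :
    (∀ m, Commute (PowerSeries.C (PowerSeries.coeff m p)) q) ↔
      ∀ m, Commute (PowerSeries.C (PowerSeries.coeff m q)) p := by
  simp only [commute_C_iff]
  exact ⟨fun h m n => (h n m).symm, fun h m n => (h n m).symm⟩

/-- A fixed operator commutes with a series exactly when it commutes with its shifted logarithm,
provided the operator commutes with `κ`. This is used for one of the two series at a time, with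
their roles exchanged in between. -/
theorem IsGood.commute_lH_iff (hg : g.IsGood) (s : ℤˣ) (i j : I) :
    (∀ m, adL (PowerSeries.coeff m (g.lH s i)) (g.lH s j) = 0) ↔
      ∀ m n, Commute (PowerSeries.coeff m (g.bA s i)) (PowerSeries.coeff n (g.bA s j)) := by
  simp only [adL_eq_zero_iff]
  have h1 : (∀ m, Commute (PowerSeries.C (PowerSeries.coeff m (g.lH s i))) (g.lH s j)) ↔
      ∀ m, Commute (PowerSeries.C (PowerSeries.coeff m (g.lH s i))) (g.bA s j) :=
    forall_congr' fun m => commute_C_Flog_sA_iff (hg.commute_lH s i m) s _ j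
  have h2 : (∀ m, Commute (PowerSeries.C (PowerSeries.coeff m (g.bA s j))) (g.lH s i)) ↔
      ∀ m, Commute (PowerSeries.C (PowerSeries.coeff m (g.bA s j))) (g.bA s i) :=
    forall_congr' fun m => commute_C_Flog_sA_iff
      (commute_C_iff.1 (hg.commute_bA s j) m).symm s _ i
  rw [h1, commute_coeff_symm, h2, ← commute_coeff_symm]
  simp only [commute_C_iff]

theorem dy1_iff (s : ℤˣ) (i j : I) :
    g.dy1 s i j = 0 ↔
      ∀ m n, Commute (PowerSeries.coeff m (g.bA s i)) (PowerSeries.coeff n (g.bA s j)) := by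
  have h1 : g.dy1 s i j = 0 ↔ ∀ m n, Commute (g.A s i m) (g.A s j n) := by
    rw [dy1, sub_eq_zero, funext_iff]
    refine forall_congr' fun m => ?_
    rw [funext_iff]
    refine forall_congr' fun n => ?_
    have hf : ∀ (n : ℤ) (x : Op W), Commute (fone n) x := fun n x => by
      rw [fone]; split_ifs
      · exact Commute.one_left x
      · exact Commute.zero_left x
    have h2 : zw (g.Hc s i) (g.Hc s j) m n - wz (g.Hc s j) (g.Hc s i) m n =
        (ch 2 * ch 2) • (g.A s i m * g.A s j n - g.A s j n * g.A s i m) := by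
      simp only [zw, wz, Hc, mul_add, add_mul, mul_smul_comm, smul_mul_assoc]
      rw [(hf m (fone n)).eq, (hf m _).eq, ← (hf n (g.A s i m)).eq]
      simp only [mul_smul, smul_sub, smul_add]
      abel
    rw [← sub_eq_zero, h2, Commute, SemiconjBy, ← sub_eq_zero (a := _ * _)]
    refine ⟨fun h => ?_, fun h => by rw [h, smul_zero]⟩
    rw [mul_smul, two_smul_hv] at h
    exact two_hv_inj ((two_hv_inj (h.trans (smul_zero _).symm)).trans (smul_zero _).symm)
  rw [h1, ← iota_bA, ← iota_bA]
  constructor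
  · intro h m n
    rw [← iota_at s (g.bA s i), ← iota_at s (g.bA s j)]
    exact h _ _
  · intro h m n
    rw [iota_apply, iota_apply]
    split_ifs
    · exact h _ _
    · exact Commute.zero_right _
    · exact Commute.zero_left _
    · exact Commute.zero_left _

theorem IsGood.dy1_iff_lH (hg : g.IsGood) (s : ℤˣ) (i j : I) :
    g.dy1 s i j = 0 ↔ ∀ m, adL (PowerSeries.coeff m (g.lH s i)) (g.lH s j) = 0 := by
  rw [hg.commute_lH_iff, dy1_iff]

theorem IsGood.commute_sA_krow (hg : g.IsGood) (s : ℤˣ) (c : ℂ) (i : I) (σ : ℤˣ) (m : ℕ)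
    {f : (Op W)⟦X⟧} (hf : ∀ x : Op W, Commute x g.kappa → Commute (PowerSeries.C x) f) :
    Commute (g.sA s c i) (krow σ m f) := by
  ext n
  rw [PowerSeries.coeff_mul, PowerSeries.coeff_mul, ← Finset.Nat.sum_antidiagonal_swap]
  congr 1
  refine Finset.sum_congr rfl fun p _ => ?_
  exact (commute_krow (hf _ (commute_C_iff.1 (hg.commute_sA s c i) _).symm) σ m _).eq

/-- `dy2_iff` involves a logarithm in `z` only. For every coefficient of that logarithm,
`commutator_Flog_iff` passes to the logarithm in `w`; this is possible because the kernel commutes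
with the coefficients of `H_j^-`. The factor `2ħ` is absorbed by `psi κ a 0 - psi κ a 2 = 2ħ hker κ
a`. -/
theorem IsGood.dy2_iff_lH (hg : g.IsGood) (a : ℤ) (i j : I) :
    g.dy2 a i j = 0 ↔ ∀ m, adL (PowerSeries.coeff m (g.lH 1 i)) (g.lH (-1) j) =
      -krow 1 m (hker g.kappa a) := by
  rw [hg.dy2_iff, rows_iff]
  refine forall_congr' fun m => ?_
  have hs : (((-1 : ℤˣ) : ℤ) : ℂ) / 2 = -1 / 2 := by norm_num
  have hk : psi g.kappa a 2 - psi g.kappa a 0 = -(ch 2 • hker g.kappa a) := by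
    rw [two_smul_hv, two_hv_smul_hker, neg_sub]
  set T := PowerSeries.coeff m (g.lH 1 i)
  have hc := commutator_Flog_iff (T := PowerSeries.C T) (hg.commute_sA_krow (-1) (-1 / 2) j 1 m
    (fun x hx => commute_C_hker hx a))
  have h1 : (∀ n, T * Tsh g.kappa (-1 / 2) (g.Hc (-1) j) n -
      Tsh g.kappa (-1 / 2) (g.Hc (-1) j) n * T =
        wmul (Tsh g.kappa (-1 / 2) (g.Hc (-1) j)) (expd 1 (psi g.kappa a 2 - psi g.kappa a 0))
          (-(((1 : ℤˣ) : ℤ) * m)) n) ↔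
      adL T (1 + ch 2 • g.sA (-1) (-1 / 2) j) =
        -(ch 2 • ((1 + ch 2 • g.sA (-1) (-1 / 2) j) * krow 1 m (hker g.kappa a))) := by
    rw [← (iota_injective (-1)).eq_iff, funext_iff]
    refine forall_congr' fun n => ?_
    rw [iota_adL, Tsh_Hc, hk, wmul_iota, map_neg, map_smul, mul_neg, mul_smul_comm]
  rw [h1, lH, hs, adL_apply, adL_apply, ← neg_inj, neg_sub, neg_neg]
  have h2 : (1 + ch 2 • g.sA (-1) (-1 / 2) j) * krow 1 m (hker g.kappa a) =
      krow 1 m (hker g.kappa a) * (1 + ch 2 • g.sA (-1) (-1 / 2) j) := by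
    have := (hg.commute_sA_krow (-1) (-1 / 2) j 1 m (fun x hx => commute_C_hker hx a)).eq
    rw [mul_add, add_mul, smul_mul_assoc, mul_smul_comm, this, mul_one, one_mul]
  rw [h2, ← hc, ← neg_inj (b := -krow 1 m _), neg_sub, neg_neg]

/-- Antisymmetry of the commutator and the exchange of `z` and `w`, which turns the expansion of
`f(z - w)` into that of `f(w - z)`. With `A` symmetric, it yields the half of `[h, h]` that is not
among the relations of the double Yangian. -/
theorem lH_transpose (a : ℤ) (i j : I)
    (h : ∀ m, adL (PowerSeries.coeff m (g.lH 1 j)) (g.lH (-1) i) = -krow 1 m (hker g.kappa a))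
    (m : ℕ) : adL (PowerSeries.coeff m (g.lH (-1) i)) (g.lH 1 j) = krow (-1) m (hker g.kappa a) := by
  ext n : 1
  have h1 := congrArg (PowerSeries.coeff m) (h n)
  rw [coeff_adL, map_neg, coeff_krow] at h1
  rw [coeff_adL, ← neg_inj, neg_sub, h1, coeff_krow, expd_one_apply, expd_neg_apply, expandWZ]
  simp

theorem IsGood.h_h_iff_dy (hg : g.IsGood) {A : I → I → ℤ} (hA : ∀ i j, A i j = A j i) :
    (∀ i j, zw (g.hY i) (g.hY j) - wz (g.hY j) (g.hY i) =
      wdiffop (qnum (A i j : Op W)) (wdiffop (qnum g.kappa)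
        (expandZW (inv1 (g.kh 1) ^ 2) - expandWZ (inv1 (g.kh 1) ^ 2)))) ↔
    (∀ s i j, g.dy1 s i j = 0) ∧ ∀ i j, g.dy2 (A i j) i j = 0 := by
  simp only [h_h_iff, hg.dy1_iff_lH, hg.dy2_iff_lH]
  constructor
  · intro h
    refine ⟨fun s i j m => (h i j s m).1, fun i j m => ?_⟩
    have := (h i j 1 m).2
    rwa [Units.val_one, one_smul] at this
  · rintro ⟨h1, h2⟩ i j σ m
    refine ⟨h1 σ i j m, ?_⟩
    rcases Int.units_eq_one_or σ with rfl | rfl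
    · rw [Units.val_one, one_smul]
      exact h2 i j m
    · rw [neg_neg, Units.val_neg, Units.val_one, neg_smul, one_smul, neg_neg]
      exact lH_transpose _ i j (hA i j ▸ h2 j i) m

/-- The currents `H_i^±(z)` satisfy the relations of the double Yangian. -/
structure HRel (A : I → I → ℤ) (g : Gens I (Op W)) : Prop where
  comm : ∀ s i j m n, Commute (PowerSeries.coeff m (g.bA s i)) (PowerSeries.coeff n (g.bA s j))
  log : ∀ i j m, adL (PowerSeries.coeff m (g.lH (-1) i)) (g.lH 1 j) =
    krow (-1) m (hker g.kappa (A i j))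

theorem IsGood.hRel (hg : g.IsGood) {A : I → I → ℤ} (hA : ∀ i j, A i j = A j i)
    (h1 : ∀ s i j, g.dy1 s i j = 0) (h2 : ∀ i j, g.dy2 (A i j) i j = 0) : HRel A g :=
  ⟨fun s i j => dy1_iff s i j |>.1 (h1 s i j), fun i j =>
    lH_transpose _ i j (hA i j ▸ (hg.dy2_iff_lH _ _ _).1 (h2 j i))⟩

end Gens

end

/-! ### Right multiplication by `H_j^+(w - κħ/2)⁻¹` and its commutators -/

section
section Rho

variable {W : Type*} [AddCommGroup W] [Module ℂ⟦X⟧ W] [TopFree W]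

theorem rsum_mul_right {b : nullSer W} {T : Op W}
    (h : ∀ k, Commute T (PowerSeries.coeff k (b : (Op W)⟦X⟧))) (a : ℕ → Op W) :
    rsum b (fun k => a k * T) = rsum b a * T := by
  rw [rsum_def, rsum_def, ← (pFin_mul_coeff a b.2).tsum_mul_right]
  congr 1; funext k
  rw [mul_assoc, (h k).eq, mul_assoc]

theorem commute_rho {b : nullSer W} {T : Op W}
    (h : ∀ k, Commute T (PowerSeries.coeff k (b : (Op W)⟦X⟧))) {a : ℤ → Op W}
    (ha : ∀ n, Commute T (a n)) (n : ℤ) : Commute T (rho b a n) := by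
  rw [Commute, SemiconjBy, rho_apply, ← rsum_mul_right h, ← rsum_mul_left]
  congr 1; funext k
  exact ha _

/-- Right multiplication by a series in `w⁻¹` of a distribution in two variables. -/
def rhoW (b : nullSer W) : Module.End ℂ⟦X⟧ (ℤ → ℤ → Op W) where
  toFun D m := rho b (D m)
  map_add' _ _ := funext fun _ => map_add (rho b) _ _
  map_smul' c D := funext fun m => (rho b).map_smul c (D m)

theorem rhoW_apply (b : nullSer W) (D : ℤ → ℤ → Op W) (m n : ℤ) :
    rhoW b D m n = rsum b fun k => D m (n + k) := rfl

theorem rhoW_mulSub (b : nullSer W) (c : Op W) (D : ℤ → ℤ → Op W) :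
    rhoW b (mulSub c D) = mulSub c (rhoW b D) := by
  funext m n
  simp only [rhoW_apply, mulSub]
  rw [← rsum_mul_left, ← map_sub, ← map_sub]
  congr 1; funext k
  simp only [Pi.sub_apply]
  congr 3
  ring

theorem rhoW_zw (b : nullSer W) (a x : ℤ → Op W) : rhoW b (zw a x) = zw a (rho b x) := by
  funext m n
  exact rsum_mul_left b (a m) fun k => x (n + k)

theorem rhoW_wz {b : nullSer W} {a : ℤ → Op W}
    (h : ∀ m k, Commute (a m) (PowerSeries.coeff k (b : (Op W)⟦X⟧))) (x : ℤ → Op W) :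
    rhoW b (wz x a) = wz (rho b x) a := by
  funext m n
  exact rsum_mul_right (h m) fun k => x (n + k)

theorem TB_psi (κ : Op W) (a c c' : ℂ) : TB 1 κ c (psi κ a c') = psi κ a (c + c') := by
  rw [psi, psi, ← Module.End.mul_apply, ← TB_add]

/-- The row of a kernel as a null series. -/
def kr (m : ℕ) (f : Tate (Op W)) : nullSer W := ⟨krow (-1) m f, krow_mem_nullSer m f.2⟩

theorem wmul_neg_expd (x : ℤ → Op W) (f : Tate (Op W)) (m : ℕ) (n : ℤ) :
    wmul x (expd (-1) f) (-(((-1 : ℤˣ) : ℤ) * m)) n = rho (kr m f) x n := by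
  rw [← fmul_iota_one]
  have h := iota_krow (-1) m (f : (Op W)⟦X⟧)
  rw [neg_neg] at h
  rw [kr, h]
  rfl

end Rho

namespace Gens

variable {I W : Type*} [AddCommGroup W] [Module ℂ⟦X⟧ W] [TopFree W] {g : Gens I (Op W)}
  {A : I → I → ℤ}

theorem IsGood.commute_iH (hg : g.IsGood) (c : ℂ) (i : I) (m : ℕ) :
    Commute g.kappa (PowerSeries.coeff m (hg.iH c i : (Op W)⟦X⟧)) :=
  commute_C_iff.1 (commute_ev (hg.commute_sA 1 c i) _) m

theorem commute_C_iH (hg : g.IsGood) {T : Op W} (h : Commute T g.kappa) {i : I}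
    (hT : Commute (PowerSeries.C T) (g.bA 1 i)) (c : ℂ) :
    Commute (PowerSeries.C T) (hg.iH c i : (Op W)⟦X⟧) :=
  commute_ev ((commute_C_TB_iff 1 h c).2 hT) _

theorem HRel.commute_iH_bA (hH : HRel A g) (hg : g.IsGood) (c : ℂ) (i j : I) (m n : ℕ) :
    Commute (PowerSeries.coeff m (hg.iH c i : (Op W)⟦X⟧)) (PowerSeries.coeff n (g.bA 1 j)) :=
  (commute_C_iff.1 (commute_C_iH hg (commute_C_iff.1 (hg.commute_bA 1 j) n).symm
    (commute_C_iff.2 fun m => hH.comm 1 j i n m) c) m).symm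

theorem HRel.commute_iH_sA (hH : HRel A g) (hg : g.IsGood) (c c' : ℂ) (i j : I) (m n : ℕ) :
    Commute (PowerSeries.coeff m (hg.iH c i : (Op W)⟦X⟧)) (PowerSeries.coeff n (g.sA 1 c' j)) :=
  commute_C_iff.1 ((commute_C_TB_iff 1 (hg.commute_iH c i m).symm c').2
    (commute_C_iff.2 fun n => hH.commute_iH_bA hg c i j m n)) n

theorem HRel.commute_iH_iH (hH : HRel A g) (hg : g.IsGood) (c c' : ℂ) (i j : I) (m n : ℕ) :
    Commute (PowerSeries.coeff m (hg.iH c i : (Op W)⟦X⟧))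
      (PowerSeries.coeff n (hg.iH c' j : (Op W)⟦X⟧)) :=
  commute_C_iff.1 (commute_C_iH hg (hg.commute_iH c i m).symm
    (commute_C_iff.2 fun n => hH.commute_iH_bA hg c i j m n) c') n

/-- The current `H_i^+(z + cκħ)` as a null series. -/
def IsGood.pH (hg : g.IsGood) (c : ℂ) (i : I) : nullSer W :=
  1 + ch 2 • ⟨g.sA 1 c i, hg.sA_mem c i⟩

theorem IsGood.iH_mul_pH (hg : g.IsGood) (c : ℂ) (i : I) : hg.iH c i * hg.pH c i = 1 :=
  Subtype.ext (Finv_mul _)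

theorem IsGood.pH_mul_iH (hg : g.IsGood) (c : ℂ) (i : I) : hg.pH c i * hg.iH c i = 1 :=
  Subtype.ext (mul_Finv _)

theorem IsGood.rho_iH_injective (hg : g.IsGood) (c : ℂ) (i : I) :
    Function.Injective (rho (hg.iH c i)) := fun x y h => by
  have := congrArg (rho (hg.pH c i)) h
  rwa [rho_rho, rho_rho, hg.iH_mul_pH, rho_one] at this

theorem IsGood.rhoW_iH_injective (hg : g.IsGood) (c : ℂ) (i : I) :
    Function.Injective (rhoW (hg.iH c i)) := fun D D' h => by
  funext m
  exact hg.rho_iH_injective c i (congrFun h m)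

theorem IsGood.commute_xY (hg : g.IsGood) (s : ℤˣ) (i : I) (n : ℤ) :
    Commute g.kappa (g.xY s i n) := by
  rcases Int.units_eq_one_or s with rfl | rfl
  · rw [xY_one]; exact hg.commute_Xc 1 i n
  · rw [hg.xY_neg]
    exact commute_rho (hg.commute_iH _ i) (hg.commute_Xs i) n

theorem HRel.commute_Tsh_Hc_iH (hH : HRel A g) (hg : g.IsGood) (c c' : ℂ) (i j : I) (m : ℤ) (k : ℕ) :
    Commute (Tsh g.kappa c (g.Hc 1 i) m) (PowerSeries.coeff k (hg.iH c' j : (Op W)⟦X⟧)) := by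
  rw [Tsh_Hc]
  refine (commute_iota (c := PowerSeries.coeff k (hg.iH c' j : (Op W)⟦X⟧)) ?_ m).symm
  exact (Commute.one_right _).add_right ((commute_C_iff.2 fun n =>
    hH.commute_iH_sA hg c' c j i k n).smul_right _)

/-- The coefficients of `H_i^+` commute with those of `(H_j^+)⁻¹`, so right multiplication by the
latter carries one exchange relation to the other; it is injective. -/
theorem HRel.lH_one_xY_iff (hH : HRel A g) (hg : g.IsGood) (i j : I) (a : ℂ) :
    commB (g.lH 1 i) (g.Xs j) = ker 1 (cst (g.Xs j)) (psi g.kappa a 1) ↔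
      commB (g.lH 1 i) (g.xY (-1) j) = ker 1 (cst (g.xY (-1) j)) (psi g.kappa a 1) := by
  have hc := hH.commute_Tsh_Hc_iH hg ((((1 : ℤˣ) : ℤ) : ℂ) / 2) (-1 / 2) i j
  rw [← hg.exchange_H 1 i (hg.commute_Xs j), ← hg.exchange_H 1 i (hg.commute_xY (-1) j), hg.xY_neg,
    ← rhoW_zw, ← rhoW_wz hc, ← rhoW_mulSub, ← rhoW_mulSub,
    (hg.rhoW_iH_injective (-1 / 2) j).eq_iff]

/-- The bracket of `T` with `log H_j^+` is known from `HRel`. `commutator_Flog_iff` exponentiates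
it, and the rule `[T, p⁻¹] = -p⁻¹ [T, p] p⁻¹` passes to the inverse. -/
theorem HRel.adS_iH (hH : HRel A g) (hg : g.IsGood) (i j : I) (m : ℕ) :
    adS (PowerSeries.coeff m (g.lH (-1) i)) (hg.iH (-1 / 2) j) =
      hg.iH (-1 / 2) j * kr m (⟨psi g.kappa (A i j) 1, psi_mem_tate _ _ _⟩ -
        ⟨psi g.kappa (A i j) (-1), psi_mem_tate _ _ _⟩) := by
  set T := PowerSeries.coeff m (g.lH (-1) i) with hT
  have hTκ : Commute T g.kappa := hg.commute_lH (-1) i m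
  set b := g.sA 1 (-1 / 2) j with hb
  set c := krow (-1) m (TB 1 g.kappa (-1) (hker g.kappa (A i j))) with hc
  have h1 : TB 1 g.kappa (-1) (g.lH 1 j) = Flog b := by
    rw [lH, TB_Flog 1 _ (hg.commute_sA 1 _ j), sA, ← Module.End.mul_apply, ← TB_add, hb, sA]
    congr 3
    norm_num
  have h2 : adL T (Flog b) = c := by
    rw [← h1, adL_TB 1 hTκ, hH.log, TB_krow]
  have hbc : Commute b (-c) := (hg.commute_sA_krow 1 (-1 / 2) j (-1) m fun x hx =>
    (commute_C_TB_iff 1 hx _).2 (commute_C_hker hx _)).neg_right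
  have h3 : Flog b * PowerSeries.C T - PowerSeries.C T * Flog b = -c := by
    rw [← h2, adL_apply, neg_sub]
  rw [commutator_Flog_iff hbc] at h3
  -- `HRel` concerns `H_j^+` at `w + κħ/2`, but `w - κħ/2` is needed; the resulting shift by `-κħ`
  -- takes the parameters `0` and `2` of the kernel to `-1` and `1`.
  have h4 : ch 2 • c = krow (-1) m (psi g.kappa (A i j) (-1) - psi g.kappa (A i j) 1) := by
    rw [hc, ← map_smul, ← map_smul, two_smul_hv, two_hv_smul_hker, map_sub, TB_psi, TB_psi]
    norm_num
  apply Subtype.ext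
  change PowerSeries.C T * Finv b - Finv b * PowerSeries.C T =
    Finv b * krow (-1) m (psi g.kappa (A i j) 1 - psi g.kappa (A i j) (-1))
  have h5 : PowerSeries.C T * Finv b - Finv b * PowerSeries.C T =
      Finv b * ((1 + ch 2 • b) * PowerSeries.C T - PowerSeries.C T * (1 + ch 2 • b)) * Finv b := by
    rw [mul_sub, sub_mul, ← mul_assoc, Finv_mul, one_mul, mul_assoc _ (_ * _), mul_assoc _ _ (Finv b),
      mul_Finv, mul_one]
  rw [h5, h3, neg_mul, smul_neg, ← smul_mul_assoc, h4, mul_neg, neg_mul, mul_assoc, mul_assoc,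
    mul_Finv, mul_one, ← mul_neg, ← map_neg, neg_sub]

end Gens

end

/-! ### The relation `[h, x]` and the relations between `H_i^±` and `X_j^±` -/

section
section Rho

variable {W : Type*} [AddCommGroup W] [Module ℂ⟦X⟧ W] [TopFree W]

theorem psi_neg (κ : Op W) (a c : ℂ) : psi κ (-a) c = -psi κ a c := by
  rw [psi_eq, psi_eq, neg_neg, neg_sub]

theorem ker_neg (s : ℤˣ) (E : OneSided W) {f : (Op W)⟦X⟧} (hf : f ∈ Tate (Op W)) :
    ker s E (-f) = -ker s E f := by
  have h := ker_smul s E (-1) hf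
  rwa [neg_one_smul, neg_one_smul] at h

theorem forall_units_iff {p : ℤˣ → Prop} : (∀ s, p s) ↔ p 1 ∧ p (-1) :=
  ⟨fun h => ⟨h 1, h (-1)⟩, fun h s => by rcases Int.units_eq_one_or s with rfl | rfl; exacts [h.1, h.2]⟩

theorem commute_of_coeff {p q : (Op W)⟦X⟧}
    (h : ∀ k l, Commute (PowerSeries.coeff k p) (PowerSeries.coeff l q)) : Commute p q := by
  ext n : 1
  rw [PowerSeries.coeff_mul, PowerSeries.coeff_mul, ← Finset.Nat.sum_antidiagonal_swap]
  exact Finset.sum_congr rfl fun x _ => (h _ _).eq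

theorem kr_sub (m : ℕ) (f f' : Tate (Op W)) : kr m (f - f') = kr m f - kr m f' :=
  Subtype.ext (map_sub (krow (-1) m) (f : (Op W)⟦X⟧) f')

theorem rho_sub (b b' : nullSer W) (a : ℤ → Op W) : rho (b - b') a = rho b a - rho b' a := by
  rw [eq_sub_iff_add_eq, ← rho_add, sub_add_cancel]

theorem rho_commutator (T : Op W) (b : nullSer W) (a : ℤ → Op W) (n : ℤ) :
    T * rho b a n - rho b a n * T =
      rho b (fun n => T * a n - a n * T) n + rho (adS T b) a n :=
  rsum_commutator T b fun k => a (n + k)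

theorem rows_neg_iff {l : (Op W)⟦X⟧} {x : ℤ → Op W} {f : (Op W)⟦X⟧} (hf : f ∈ Tate (Op W)) :
    commB l x = ker (-1) (cst x) f ↔ ∀ m : ℕ,
      (fun n => PowerSeries.coeff m l * x n - x n * PowerSeries.coeff m l) =
        rho (kr m ⟨f, hf⟩) x := by
  rw [rows_iff]
  refine forall_congr' fun m => ?_
  rw [funext_iff]
  refine forall_congr' fun n => ?_
  rw [← wmul_neg_expd x ⟨f, hf⟩]

end Rho

namespace Gens

variable {I W : Type*} [AddCommGroup W] [Module ℂ⟦X⟧ W] [TopFree W] {g : Gens I (Op W)}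
  {A : I → I → ℤ}

/-- By the Leibniz rule, the bracket with `x_j^-` is the bracket with `X_j^-` multiplied by the
series, plus the contribution of the series. The latter has kernel `psi κ a 1 - psi κ a (-1)` and
replaces the shift `-1` by `1`. Right multiplication by the series is injective, so nothing is lost.
-/
theorem HRel.lH_neg_xY_iff (hH : HRel A g) (hg : g.IsGood) (i j : I) :
    commB (g.lH (-1) i) (g.Xs j) = ker (-1) (cst (g.Xs j)) (psi g.kappa (A i j) (-1)) ↔
      commB (g.lH (-1) i) (g.xY (-1) j) =
        ker (-1) (cst (g.xY (-1) j)) (psi g.kappa (A i j) 1) := by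
  rw [rows_neg_iff (psi_mem_tate _ _ _), rows_neg_iff (psi_mem_tate _ _ _)]
  refine forall_congr' fun m => ?_
  set p : Tate (Op W) := ⟨psi g.kappa (A i j) 1, psi_mem_tate _ _ _⟩ with hp
  set q : Tate (Op W) := ⟨psi g.kappa (A i j) (-1), psi_mem_tate _ _ _⟩ with hq
  set b := hg.iH (-1 / 2) j with hb
  set T := PowerSeries.coeff m (g.lH (-1) i) with hT
  have hcomm : ∀ c : ℂ, Commute b (kr m ⟨psi g.kappa (A i j) c, psi_mem_tate _ _ _⟩) := fun c => by
    have : Commute (b : (Op W)⟦X⟧) (krow (-1) m (psi g.kappa (A i j) c)) := by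
      refine commute_of_coeff fun k l => ?_
      exact (commute_krow (commute_C_psi (hg.commute_iH (-1 / 2) j k).symm _ _) (-1) m l)
    exact Subtype.ext this
  have h1 : (fun n => T * g.xY (-1) j n - g.xY (-1) j n * T) =
      rho b (fun n => T * g.Xs j n - g.Xs j n * T) + rho b (rho (kr m p) (g.Xs j)) -
        rho b (rho (kr m q) (g.Xs j)) := by
    funext n
    rw [hg.xY_neg, rho_commutator, hH.adS_iH hg, ← hp, ← hq, kr_sub, mul_sub, rho_sub,
      (hcomm 1).eq, (hcomm (-1)).eq, rho_rho, rho_rho]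
    simp only [Pi.add_apply, Pi.sub_apply]
    rw [add_sub_assoc]
  rw [h1, hg.xY_neg, rho_rho _ b, (hcomm 1).eq, ← rho_rho, ← map_add, ← map_sub,
    (hg.rho_iH_injective (-1 / 2) j).eq_iff, sub_eq_iff_eq_add, add_comm, add_right_inj]

/-- The two halves of the bracket correspond to `dy3` and `dy4`. Where they carry `-a`, oddness of
`psi` in `a` produces the sign. -/
theorem HRel.h_x_iff_dy (hH : HRel A g) (hg : g.IsGood) (hA : ∀ i j, A i j = A j i) (s : ℤˣ)
    (i j : I) :
    zw (g.hY i) (g.xY s j) - wz (g.xY s j) (g.hY i) =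
      (s : ℤ) • wmul (g.xY s j) (wdiffop (qnum (A i j : Op W))
        (expandZW (inv1 (g.kh 1)) + expandWZ (inv1 (g.kh 1)))) ↔
      g.dy3 (A i j) s i j = 0 ∧ g.dy4 (A j i) s i j = 0 := by
  have hn : ∀ x : ℤ → Op W, ∀ σ c, ker σ (cst x) (psi g.kappa (-(A i j : ℂ)) c) =
      -ker σ (cst x) (psi g.kappa (A i j) c) := fun x σ c => by
    rw [psi_neg, ker_neg _ _ (psi_mem_tate _ _ _)]
  rw [h_x_iff, forall_units_iff, ← hA i j]
  rcases Int.units_eq_one_or s with rfl | rfl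
  · rw [hg.dy3_one_iff, hg.dy4_one_iff, hn, xY_one]
    simp [neg_eq_iff_eq_neg]
  · rw [hg.dy3_neg_iff, hg.dy4_neg_iff, hH.lH_neg_xY_iff hg, hH.lH_one_xY_iff hg, hn]
    simp
end Gens

end

/-! ### Quadratic relations between the currents `x_i^-` -/

section
section Module

variable {Λ M : Type*} [CommRing Λ] [AddCommGroup M] [Module Λ M]

theorem exch_aux₁ (c : Λ) {d d₁ d₂ G G₁ G₂ : M} (h : d₁ - d₂ - c • d = -((c + c) • G)) :
    G₁ - d₁ - (G₂ - d₂) - c • (G - d) = G₁ - G₂ - -c • G := by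
  linear_combination (norm := module) (-1 : Λ) • h

theorem exch_aux₂ (c : Λ) {x x₁ x₂ y y₁ y₂ : M} (h : x - x₁ - -c • x₂ = y - y₁ - c • y₂) :
    (x - y) - (x₁ - y₁) - c • (x₂ - y₂) = -((c + c) • x₂) := by
  linear_combination (norm := module) (1 : Λ) • h

end Module

section Rho

variable {W : Type*} [AddCommGroup W] [Module ℂ⟦X⟧ W] [TopFree W]

theorem hb_mul (c : ℂ) (x : Op W) : Gens.hb (Op W) c * x = ch c • x := by
  rw [Gens.hb, Algebra.smul_def]

theorem mulSub_hb_iota2_one (c : ℂ) (E : OneSided W) :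
    mulSub (Gens.hb (Op W) c) (iota2 1 E) = fun m n => iota 1 (E n - PowerSeries.X * E (n - 1) -
      ch c • (PowerSeries.X * E n)) (m - 1) := by
  funext m n
  simp only [mulSub, iota2_apply, hb_mul, map_sub, map_smul, Pi.sub_apply, Pi.smul_apply,
    iota_one_X_mul, sub_add_cancel]

theorem mulSub_hb_iota2_one_iff {c d : ℂ} {E F : OneSided W} :
    mulSub (Gens.hb (Op W) c) (iota2 1 E) = mulSub (Gens.hb (Op W) d) (iota2 1 F) ↔
      ∀ n, E n - PowerSeries.X * E (n - 1) - ch c • (PowerSeries.X * E n) =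
        F n - PowerSeries.X * F (n - 1) - ch d • (PowerSeries.X * F n) := by
  rw [mulSub_hb_iota2_one, mulSub_hb_iota2_one]
  refine ⟨fun h n => iota_injective 1 (funext fun m => ?_), fun h => by
    funext m n; rw [h]⟩
  have := congrFun (congrFun h (m + 1)) n
  simpa only [add_sub_cancel_right] using this

/-- The series `z⁻¹`. -/
def invX (W : Type*) [AddCommGroup W] [Module ℂ⟦X⟧ W] : nullSer W :=
  ⟨PowerSeries.X, fun v r => ⟨2, fun k hk => by
    rw [PowerSeries.coeff_X, if_neg (by omega)]; exact Submodule.zero_mem _⟩⟩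

theorem rsum_invX (a : ℕ → Op W) : rsum (invX W) a = a 1 := by
  rw [rsum_def, tsum_eq_single 1 fun k hk => ?_]
  · simp [invX]
  · simp [invX, PowerSeries.coeff_X, hk]

theorem rsum_invX_mul (b : nullSer W) (a : ℕ → Op W) :
    rsum (invX W * b) a = rsum b fun k => a (k + 1) := by
  rw [← rsum_rsum_add]
  simp only [rsum_invX]

theorem rsum_C_mul (x : Op W) (b : nullSer W) (a : ℕ → Op W) :
    rsum (⟨_, C_mem_nullSer x⟩ * b) a = rsum b fun k => a k * x := by
  rw [← rsum_rsum_add]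
  simp only [rsum_C, add_zero]

theorem rsum_smul_left (c : ℂ⟦X⟧) (b : nullSer W) (a : ℕ → Op W) :
    rsum (c • b) a = c • rsum b a := by
  rw [← map_smul, rsum_def, rsum_def]
  congr 1; funext k
  simp

theorem rsum_sub_left (b b' : nullSer W) (a : ℕ → Op W) :
    rsum (b - b') a = rsum b a - rsum b' a := by
  rw [eq_sub_iff_add_eq, ← rsum_add_left, sub_add_cancel]

/-- Right multiplication by a series in `z⁻¹` of a distribution in two variables. -/
def rhoZ (b : nullSer W) : Module.End ℂ⟦X⟧ (ℤ → ℤ → Op W) where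
  toFun D m n := rsum b fun k => D (m + k) n
  map_add' D D' := by funext m n; exact map_add (rsum b) (fun k : ℕ => D (m + k) n) _
  map_smul' c D := by funext m n; exact (rsum b).map_smul c (fun k : ℕ => D (m + k) n)

theorem rhoZ_apply (b : nullSer W) (D : ℤ → ℤ → Op W) (m n : ℤ) :
    rhoZ b D m n = rsum b fun k => D (m + k) n := rfl

/-- The exchange relation `(z - w - a) b(z) x(w) = (z - w + a) x(w) b(z)`. -/
def Exch (a : ℂ) (b : nullSer W) (x : ℤ → Op W) : Prop :=
  ∀ n, (adS (x n) b : nullSer W) - invX W * adS (x (n - 1)) b - ch a • (invX W * adS (x n) b) =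
    -(ch (2 * a) • (invX W * (⟨_, C_mem_nullSer (x n)⟩ * b)))

/-- Moving `b(z)` to the right of `x(w)` costs the term `y(z) [x(w), b(z)]`. `Exch` evaluates this
term after multiplication by `z - w - aħ`, and the two contributions combine to the factor `z - w +
aħ`. -/
theorem Exch.zw_rho {a : ℂ} {b : nullSer W} {x : ℤ → Op W} (h : Exch a b x) (y : ℤ → Op W) :
    mulSub (Gens.hb (Op W) a) (zw (rho b y) x) =
      mulSub (Gens.hb (Op W) (-a)) (rhoZ b (zw y x)) := by
  have key : ∀ m n, zw (rho b y) x m n =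
      rhoZ b (zw y x) m n - rsum (adS (x n) b) fun k => y (m + k) := fun m n => by
    have h1 := rsum_commutator (x n) b fun k => y (m + k)
    have h2 : (rsum b fun k : ℕ => x n * y (m + k) - y (m + k) * x n) =
        x n * rsum b (fun k : ℕ => y (m + k)) - rhoZ b (zw y x) m n := by
      rw [← rsum_mul_left]
      exact map_sub (rsum b) (fun k : ℕ => x n * y (m + k)) fun k : ℕ => y (m + k) * x n
    rw [h2] at h1
    rw [zw, rho_apply, ← sub_eq_zero]
    rw [← sub_eq_zero] at h1
    rw [← neg_eq_zero, ← h1]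
    abel
  have h3 : ∀ n : ℤ, ∀ u : nullSer W, ∀ m : ℤ, rsum (invX W * u) (fun k => y (m - 1 + k)) =
      rsum u fun k => y (m + k) := fun n u m => by
    rw [rsum_invX_mul]
    congr 1; funext k; congr 1; push_cast; ring
  funext m n
  -- `Exch` is written for power series, that is, divided by `z`; the index `m - 1` restores this
  -- power.
  have h4 := congrArg (fun u => rsum u fun k => y (m - 1 + k)) (h n)
  simp only [rsum_sub_left, rsum_smul_left, ← neg_smul, h3 n, rsum_C_mul] at h4
  have h5 : ∀ c : ℂ, ch (-c) = -ch c := ch_neg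
  have h6 : ch (2 * a) = ch a + ch a := by rw [two_mul, ch_add]
  simp only [mulSub, hb_mul, key, h5]
  change _ = _ - (-ch a) • rsum b (fun k : ℕ => y (m + k) * x n)
  rw [h6] at h4
  change rhoZ b (zw y x) (m - 1) n - _ - (rhoZ b (zw y x) m (n - 1) - _) -
    ch a • (rsum b (fun k : ℕ => y (m + k) * x n) - _) = _
  exact exch_aux₁ _ (h4.trans (neg_smul _ _))

/-- Multiplying the relation for `p` by `b = p⁻¹` on both sides exchanges the two orders of the
factors, and with them the sign of `a`. -/
theorem exch_of_pH {a : ℂ} {b p : nullSer W} (hbp : b * p = 1) (hpb : p * b = 1) {x : ℤ → Op W}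
    (h : mulSub (Gens.hb (Op W) (-a)) (zw (iota 1 (p : (Op W)⟦X⟧)) x) =
      mulSub (Gens.hb (Op W) a) (wz x (iota 1 (p : (Op W)⟦X⟧)))) : Exch a b x := by
  have h1 : zw (iota 1 (p : (Op W)⟦X⟧)) x =
      iota2 1 fun n => (p : (Op W)⟦X⟧) * PowerSeries.C (x n) := by
    funext m n
    rw [iota2_apply, iota_apply, PowerSeries.coeff_mul_C, zw, iota_apply, ite_mul, zero_mul]
  have h2 : wz x (iota 1 (p : (Op W)⟦X⟧)) =
      iota2 1 fun n => PowerSeries.C (x n) * (p : (Op W)⟦X⟧) := by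
    funext m n
    rw [iota2_apply, iota_apply, PowerSeries.coeff_C_mul, wz, iota_apply, mul_ite, mul_zero]
  rw [h1, h2, mulSub_hb_iota2_one_iff] at h
  intro n
  apply Subtype.ext
  obtain ⟨b, hb⟩ := b
  obtain ⟨p, hp⟩ := p
  have hn := congrArg (fun u => b * u * b) (h n)
  have Hbp : b * p = 1 := congrArg Subtype.val hbp
  have hpb' : p * b = 1 := congrArg Subtype.val hpb
  have e1 : ∀ f : (Op W)⟦X⟧, b * (p * f) * b = f * b := fun f => by
    rw [← mul_assoc, Hbp, one_mul]
  have e2 : ∀ f : (Op W)⟦X⟧, b * (f * p) * b = b * f := fun f => by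
    rw [mul_assoc, mul_assoc, hpb', mul_one]
  have e3 : ∀ f : (Op W)⟦X⟧, b * (PowerSeries.X * f) * b =
      PowerSeries.X * (b * f * b) := fun f => by
    rw [← mul_assoc, (PowerSeries.commute_X b).eq, mul_assoc, mul_assoc, mul_assoc]
  simp only [mul_sub, sub_mul, mul_smul_comm, smul_mul_assoc, e3, e1, e2, ch_neg] at hn
  change (PowerSeries.C (x n) * b - b * PowerSeries.C (x n)) -
    PowerSeries.X * (PowerSeries.C (x (n - 1)) * b - b * PowerSeries.C (x (n - 1))) -
    ch a • (PowerSeries.X * (PowerSeries.C (x n) * b - b * PowerSeries.C (x n))) =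
    -(ch (2 * a) • (PowerSeries.X * (PowerSeries.C (x n) * b)))
  rw [two_mul, ch_add]
  simp only [mul_sub]
  exact exch_aux₂ _ hn

theorem rhoZ_mulSub (b : nullSer W) (c : Op W) (D : ℤ → ℤ → Op W) :
    rhoZ b (mulSub c D) = mulSub c (rhoZ b D) := by
  funext m n
  simp only [rhoZ_apply, mulSub]
  rw [← rsum_mul_left, ← map_sub, ← map_sub]
  congr 1; funext k
  simp only [Pi.sub_apply]
  congr 3
  ring

theorem rhoZ_rhoW {b b' : nullSer W} (h : ∀ k l, Commute (PowerSeries.coeff k (b : (Op W)⟦X⟧))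
    (PowerSeries.coeff l (b' : (Op W)⟦X⟧))) (D : ℤ → ℤ → Op W) :
    rhoZ b (rhoW b' D) = rhoW b' (rhoZ b D) := by
  funext m n
  exact rsum_comm h fun k l => D (m + k) (n + l)

/-- The transpose of a distribution in two variables. -/
def tr2 (D : ℤ → ℤ → Op W) : ℤ → ℤ → Op W := fun m n => D n m

theorem tr2_zw (a b : ℤ → Op W) : tr2 (zw a b) = wz a b := rfl

theorem tr2_rhoW (b : nullSer W) (D : ℤ → ℤ → Op W) : tr2 (rhoW b D) = rhoZ b (tr2 D) := rfl

theorem tr2_rhoZ (b : nullSer W) (D : ℤ → ℤ → Op W) : tr2 (rhoZ b D) = rhoW b (tr2 D) := rfl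

theorem tr2_mulSub (c : Op W) (D : ℤ → ℤ → Op W) :
    tr2 (mulSub c D) = -mulSub (-c) (tr2 D) := by
  funext m n
  simp only [tr2, mulSub, Pi.neg_apply]
  rw [neg_mul]
  abel

theorem Exch.zw_rho_rho {a : ℂ} {b : nullSer W} {x : ℤ → Op W} (h : Exch a b x) (y : ℤ → Op W)
    {b' : nullSer W} :
    mulSub (Gens.hb (Op W) a) (zw (rho b y) (rho b' x)) =
      rhoW b' (rhoZ b (mulSub (Gens.hb (Op W) (-a)) (zw y x))) := by
  rw [← rhoW_zw, ← rhoW_mulSub, h.zw_rho, rhoZ_mulSub]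

/-- This is `Exch.zw_rho_rho` with `z` and `w` exchanged, which reverses the sign of `z - w` and so
that of `a`. The order of the two right multiplications is restored because the series commute. -/
theorem Exch.wz_rho_rho {a : ℂ} {b b' : nullSer W} {y : ℤ → Op W} (h : Exch a b' y)
    (x : ℤ → Op W) (hc : ∀ k l, Commute (PowerSeries.coeff k (b : (Op W)⟦X⟧))
      (PowerSeries.coeff l (b' : (Op W)⟦X⟧))) :
    mulSub (Gens.hb (Op W) (-a)) (wz (rho b' x) (rho b y)) =
      rhoW b' (rhoZ b (mulSub (Gens.hb (Op W) a) (wz x y))) := by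
  have h1 := congrArg tr2 (h.zw_rho_rho x (b' := b))
  rw [tr2_mulSub, tr2_rhoW, tr2_rhoZ, tr2_mulSub, map_neg, map_neg, neg_inj, tr2_zw, tr2_zw,
    ← hb_neg, ← hb_neg, neg_neg] at h1
  rw [h1, rhoZ_rhoW hc]

/-- For `a = 0` the commutator is annihilated by `z - w`. As a series in `z⁻¹` it must vanish, one
coefficient after the other. -/
theorem Exch.commute {b : nullSer W} {x : ℤ → Op W} (h : Exch 0 b x) (n : ℤ) (k : ℕ) :
    Commute (x n) (PowerSeries.coeff k (b : (Op W)⟦X⟧)) := by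
  have h0 : ch 0 = 0 := by simp [ch]
  have h1 : ∀ n, PowerSeries.C (x n) * (b : (Op W)⟦X⟧) - (b : (Op W)⟦X⟧) * PowerSeries.C (x n) =
      PowerSeries.X * (PowerSeries.C (x (n - 1)) * (b : (Op W)⟦X⟧) -
        (b : (Op W)⟦X⟧) * PowerSeries.C (x (n - 1))) :=
    fun n => by
      have := h n
      rw [mul_zero, h0, zero_smul, zero_smul, sub_zero, neg_zero, sub_eq_zero] at this
      exact congrArg Subtype.val this
  induction k generalizing n with
  | zero =>
    have := congrArg (PowerSeries.coeff 0) (h1 n)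
    rw [Commute, SemiconjBy]
    simpa [sub_eq_zero] using this
  | succ k ih =>
    have := congrArg (PowerSeries.coeff (k + 1)) (h1 n)
    rw [PowerSeries.coeff_succ_X_mul] at this
    simp only [map_sub, PowerSeries.coeff_C_mul, PowerSeries.coeff_mul_C, (ih (n - 1)).eq,
      sub_self] at this
    exact sub_eq_zero.1 this

end Rho

namespace Gens

variable {I W : Type*} [AddCommGroup W] [Module ℂ⟦X⟧ W] [TopFree W] {g : Gens I (Op W)}
  {A : I → I → ℤ}

theorem lin_zero_right (κ : Op W) (a : ℂ) : hv • lin κ a 0 = hb (Op W) a := by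
  rw [hv_smul_lin]; simp [ch]

theorem IsGood.iota_pH (hg : g.IsGood) (c : ℂ) (i : I) :
    iota 1 (hg.pH c i : (Op W)⟦X⟧) = Tsh g.kappa c (g.Hc 1 i) := by
  rw [Tsh_Hc]
  rfl

/-- In logarithmic form the relation has `H_i^+` at `z + κħ/2` with shift `1`. Moving `z` by `-κħ`
gives `H_i^+(z - κħ/2)` with shift `0`, so `κ` drops out of the linear factors. -/
theorem IsGood.exch (hg : g.IsGood) {a : ℂ} {i j : I} (h : g.dy3 a (-1) i j = 0) :
    Exch a (hg.iH (-1 / 2) i) (g.Xs j) := by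
  refine exch_of_pH (hg.iH_mul_pH _ i) (hg.pH_mul_iH _ i) ?_
  rw [hg.dy3_neg_iff, ← hg.exchange_H 1 i (hg.commute_Xs j), neg_neg,
    mulSub_shift_z_iff ((commute_lin (Commute.refl _) _ _).symm.smul_right hv |>.smul_right _ |>.neg_right)
      ((commute_lin (Commute.refl _) _ _).symm.smul_right hv |>.smul_right _ |>.neg_right) (-1)
      (hg.commute_Xs j), lin_shift, lin_shift] at h
  rw [hg.iota_pH]
  convert h using 3
  · rw [hb_neg, ← lin_zero_right g.kappa]
    norm_num
  · rw [← Module.End.mul_apply, ← Tsh_add]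
    norm_num
  · rw [← neg_neg (hb (Op W) a), ← hb_neg, ← lin_zero_right g.kappa]
    norm_num
  · rw [← Module.End.mul_apply, ← Tsh_add]
    norm_num

/-- The relation between the currents `X_j^-` and the series `H_i^+`. -/
def XRel (A : I → I → ℤ) (g : Gens I (Op W)) : Prop := ∀ i j, g.dy3 (A i j) (-1) i j = 0

theorem IsGood.rhoZ_iH_injective (hg : g.IsGood) (c : ℂ) (i : I) :
    Function.Injective (rhoZ (hg.iH c i)) := fun D D' h => by
  have : tr2 D = tr2 D' := hg.rhoW_iH_injective c i (congrArg tr2 h)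
  exact congrArg tr2 this

theorem commute_hb {κ : Op W} (c : ℂ) : Commute κ (hb (Op W) c) := Algebra.commute_algebraMap_right _ _

theorem commute_hb_sub (κ : Op W) (c t : ℂ) : Commute κ (hb (Op W) c - ch t • κ) :=
  (commute_hb c).sub_right ((Commute.refl κ).smul_right _)

/-- Shifting both variables by `-κħ` leaves `z - w` unchanged. -/
theorem IsGood.dy6_neg_iff (hg : g.IsGood) (a : ℂ) (i j : I) :
    g.dy6 a (-1) i j = 0 ↔ mulSub (hb (Op W) (-a)) (zw (g.Xs i) (g.Xs j)) =
      mulSub (hb (Op W) a) (wz (g.Xs j) (g.Xs i)) := by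
  have h1 := mulSub_shift_z_iff (commute_hb (κ := g.kappa) a) (commute_hb (κ := g.kappa) (-a)) (-1)
    (a := g.Xc (-1) i) (hg.commute_Xc (-1) j)
  have h2 := mulSub_shift_w_iff (commute_hb_sub g.kappa a (-1)) (commute_hb_sub g.kappa (-a) (-1))
    (-1) (b := g.Xc (-1) j) (hg.commute_Xs i)
  rw [sub_add_cancel, sub_add_cancel] at h2
  rw [dy6, sub_eq_zero]
  have e1 : (((-1 : ℤˣ) : ℤ) : ℂ) * a = -a := by simp
  have e2 : -(((-1 : ℤˣ) : ℤ) : ℂ) * a = a := by simp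
  rw [e1, e2]
  exact h1.trans h2

theorem IsGood.dy7_neg_iff (hg : g.IsGood) (i j : I) :
    g.dy7 (-1) i j = 0 ↔ zw (g.Xs i) (g.Xs j) = wz (g.Xs j) (g.Xs i) := by
  rw [dy7, sub_eq_zero]
  have h := Tw_zw (-1) (g.Xc (-1) j) (hg.commute_Xs i)
  rw [Xs] at h
  rw [← (Tz_injective g.kappa (-1)).eq_iff, Tz_zw,
    Tz_wz _ _ (hg.commute_Xc (-1) j), ← (Tw_injective g.kappa (-1)).eq_iff, Tw_wz, h]
  rfl

/-- When the two inverse series are collected on the right, the factor `z - w - aħ` becomes `z - w +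
aħ` on one side, and conversely on the other. This explains why `x^+` and `x^-` obey the same
relation while those of `X^+` and `X^-` differ by the sign of `a`. -/
theorem HRel.x_x_iff_dy (hH : HRel A g) (hg : g.IsGood) (hA : ∀ i j, A i j = A j i)
    (hX : XRel A g) (s : ℤˣ) (i j : I) :
    mulSub (hb (Op W) (A i j)) (zw (g.xY s i) (g.xY s j)) =
      mulSub (hb (Op W) (-(A i j : ℂ))) (wz (g.xY s j) (g.xY s i)) ↔ g.dy6 (A i j) s i j = 0 := by
  rcases Int.units_eq_one_or s with rfl | rfl
  · rw [xY_one, xY_one, dy6, sub_eq_zero]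
    simp
  · have h1 := hg.exch (hX i j)
    have h2 := hg.exch (hX j i)
    rw [← hA] at h2
    rw [hg.xY_neg, hg.xY_neg, h1.zw_rho_rho, h2.wz_rho_rho _ (hH.commute_iH_iH hg _ _ i j),
      (hg.rhoW_iH_injective _ j).eq_iff, (hg.rhoZ_iH_injective _ i).eq_iff, hg.dy6_neg_iff]

/-- For `a = 0` the series commute with the other current by `Exch.commute` and can be collected on
the right without any factor. -/
theorem HRel.x_x_zero_iff_dy (hH : HRel A g) (hg : g.IsGood) (hA : ∀ i j, A i j = A j i)
    (hX : XRel A g) (s : ℤˣ) {i j : I} (hij : A i j = 0) :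
    zw (g.xY s i) (g.xY s j) = wz (g.xY s j) (g.xY s i) ↔ g.dy7 s i j = 0 := by
  rcases Int.units_eq_one_or s with rfl | rfl
  · rw [xY_one, xY_one, dy7, sub_eq_zero]
  · have h1 := hg.exch (hX i j)
    have h2 := hg.exch (hX j i)
    rw [hij, Int.cast_zero] at h1
    rw [← hA, hij, Int.cast_zero] at h2
    have e1 : zw (g.xY (-1) i) (g.xY (-1) j) =
        rhoW (hg.iH (-1 / 2) j) (rhoZ (hg.iH (-1 / 2) i) (zw (g.Xs i) (g.Xs j))) := by
      rw [hg.xY_neg, hg.xY_neg, ← rhoW_zw]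
      congr 1
      funext m n
      exact (rsum_mul_right (h1.commute n) _).symm
    have e2 : wz (g.xY (-1) j) (g.xY (-1) i) =
        rhoW (hg.iH (-1 / 2) j) (rhoZ (hg.iH (-1 / 2) i) (wz (g.Xs j) (g.Xs i))) := by
      rw [hg.xY_neg, hg.xY_neg, ← rhoZ_rhoW (hH.commute_iH_iH hg _ _ i j)]
      change _ = tr2 (rhoW (hg.iH (-1 / 2) i) (rhoZ (hg.iH (-1 / 2) j) (zw (g.Xs j) (g.Xs i))))
      rw [← tr2_zw, ← rhoW_zw]
      congr 2
      funext m n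
      exact (rsum_mul_right (h2.commute n) _).symm
    rw [e1, e2, (hg.rhoW_iH_injective _ j).eq_iff, (hg.rhoZ_iH_injective _ i).eq_iff, hg.dy7_neg_iff]

end Gens

end

/-! ### Delta functions and the relation between `x_i^+` and `x_j^-` -/

section
section Delta

variable {R : Type*} [Ring R] [Algebra ℂ⟦X⟧ R]

theorem mulSub_delta (c : R) : mulSub c (delta c) = 0 := by
  funext p q
  simp only [mulSub, delta, Pi.zero_apply]
  rcases lt_trichotomy (p + q) 0 with h | h | h
  · obtain ⟨n, hn⟩ : ∃ n : ℕ, -p - 1 - q = n := ⟨(-p - 1 - q).toNat, by omega⟩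
    rw [if_pos (by omega), if_pos (by omega), if_pos (by omega)]
    have e1 : (-(p - 1) - 1 - q).toNat = n + 1 := by omega
    have e2 : (-p - 1 - (q - 1)).toNat = n + 1 := by omega
    have e3 : (-p - 1 - q).toNat = n := by omega
    have e4 : -(p - 1) - 1 = (-p - 1) + 1 := by ring
    rw [e1, e2, e3, e4, Ring.choose_succ_succ, add_smul, mul_smul_comm, ← pow_succ']
    abel
  · have e1 : (-(p - 1) - 1 - q).toNat = 0 := by omega
    have e2 : (-p - 1 - (q - 1)).toNat = 0 := by omega
    rw [if_pos (by omega), if_pos (by omega), if_neg (by omega), e1, e2]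
    simp
  · rw [if_neg (by omega), if_neg (by omega), if_neg (by omega)]
    simp

theorem delta_neg_one (c : R) (q : ℤ) : delta c (-1) q = if q = 0 then 1 else 0 := by
  rw [delta]
  rcases lt_trichotomy q 0 with h | h | h
  · rw [if_pos (by omega), if_neg h.ne]
    obtain ⟨n, hn⟩ : ∃ n : ℕ, -(-1) - 1 - q = n + 1 := ⟨(-q - 1).toNat, by omega⟩
    have : (-(-1) - 1 - q).toNat = n + 1 := by omega
    rw [this]
    simp
  · subst h
    simp
  · rw [if_neg (by omega), if_neg h.ne']

variable {W : Type*} [AddCommGroup W] [Module ℂ⟦X⟧ W] [TopFree W]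

theorem mulSub_wmul {c : Op W} {a : ℤ → Op W} (hc : ∀ n, Commute c (a n)) {K : ℤ → ℤ → Op W}
    (h : ∀ m n, PFin fun k : ℤ => a (n - k) * K m k) : mulSub c (wmul a K) = wmul a (mulSub c K) := by
  funext m n
  have e : (∑' k : ℤ, a (n - 1 - k) * K m k) = ∑' k : ℤ, a (n - k) * K m (k - 1) := by
    rw [← (Equiv.subRight (1 : ℤ)).tsum_eq fun k => a (n - 1 - k) * K m k]
    congr 1; funext k
    simp only [Equiv.subRight_apply]
    congr 2; ring
  have h1 : PFin fun k : ℤ => a (n - k) * K m (k - 1) := by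
    have := (h m (n - 1)).comp (Equiv.subRight (1 : ℤ)).injective
    convert this using 3 with k
    · simp only [Equiv.subRight_apply]
      congr 1; ring
    · rfl
  simp only [mulSub, wmul]
  rw [e, ← (h m n).tsum_mul_left, ← (h (m - 1) n).summable.tsum_sub h1.summable,
    ← ((h (m - 1) n).summable.sub h1.summable).tsum_sub ((h m n).mul_left c).summable]
  congr 1; funext k
  rw [mul_sub, mul_sub, ← mul_assoc c, (hc _).eq, mul_assoc]

/-- One row determines the row below it exactly. In the upward direction a vanishing row gives the
next one only up to a multiple of `c`; since `c` is divisible by `ħ`, iteration makes it divisible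
by every power of `ħ`. -/
theorem eq_zero_of_mulSub {c : Op W} (hc : c ∈ hsub (Op W) 1) {D : ℤ → ℤ → Op W}
    (h : mulSub c D = 0) (h0 : ∀ n, D (-1) n = 0) : D = 0 := by
  have hr : ∀ m n, D (m - 1) n = D m (n - 1) + c * D m n := fun m n => by
    have := congrFun (congrFun h m) n
    simp only [mulSub, Pi.zero_apply] at this
    rw [sub_sub, sub_eq_zero] at this
    exact this
  have up : ∀ m, (∀ n, D (m - 1) n = 0) → ∀ n, D m n = 0 := fun m hm n => by
    have h2 : ∀ r : ℕ, ∀ n, D m n ∈ hsub (Op W) r := fun r => by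
      induction r with
      | zero => exact fun n => hsub_zero _
      | succ r ih =>
        intro n
        have h3 := hr m (n + 1)
        rw [hm, add_sub_cancel_right] at h3
        rw [eq_neg_of_add_eq_zero_left h3.symm, add_comm r]
        exact Submodule.neg_mem _ (mul_mem_hsub hc (ih _))
    exact eq_of_hsub fun r => by rw [sub_zero]; exact h2 r n
  have down : ∀ m, (∀ n, D m n = 0) → ∀ n, D (m - 1) n = 0 := fun m hm n => by
    rw [hr, hm, hm, mul_zero, add_zero]
  have hp : ∀ k : ℕ, ∀ n, D (-1 + k) n = 0 := fun k => by
    induction k with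
    | zero => simpa using h0
    | succ k ih => exact up _ (by convert ih using 3; push_cast; ring)
  have hq : ∀ k : ℕ, ∀ n, D (-1 - k) n = 0 := fun k => by
    induction k with
    | zero => simpa using h0
    | succ k ih => convert down _ ih using 3; push_cast; ring
  funext m n
  rcases le_total (-1) m with hm | hm
  · simpa using (by convert hp (m + 1).toNat n using 2; omega : D m n = 0)
  · simpa using (by convert hq (-1 - m).toNat n using 2; omega : D m n = 0)

theorem pFin_wmul_delta {c : Op W} (hc : c ∈ hsub (Op W) 1) (a : ℤ → Op W) (m n : ℤ) :
    PFin fun k : ℤ => a (n - k) * delta c m k := (uFin_wmul_delta hc a m n).pFin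

theorem wmul_delta_neg_one (c : Op W) (a : ℤ → Op W) (n : ℤ) : wmul a (delta c) (-1) n = a n := by
  rw [wmul, tsum_eq_single 0 fun k hk => by rw [delta_neg_one, if_neg hk, mul_zero]]
  simp [delta_neg_one]

theorem mulSub_wmul_delta {c : Op W} (hc : c ∈ hsub (Op W) 1) {a : ℤ → Op W}
    (h : ∀ n, Commute c (a n)) : mulSub c (wmul a (delta c)) = 0 := by
  rw [mulSub_wmul h (pFin_wmul_delta hc a), mulSub_delta]
  funext m n
  simp [wmul]

/-- A distribution annihilated by `z - w - c` is determined by its coefficient of `z⁻¹`. Shifts and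
right multiples of delta terms are computed by checking these two properties, with no expansion. -/
theorem eq_wmul_delta {c : Op W} (hc : c ∈ hsub (Op W) 1) {a : ℤ → Op W}
    (h : ∀ n, Commute c (a n)) {D : ℤ → ℤ → Op W} (h1 : mulSub c D = 0)
    (h2 : ∀ n, D (-1) n = a n) : D = wmul a (delta c) := by
  rw [← sub_eq_zero]
  refine eq_zero_of_mulSub hc ?_ fun n => ?_
  · rw [← mulSubL_apply, map_sub, mulSubL_apply, mulSubL_apply, h1, mulSub_wmul_delta hc h, sub_zero]
  · rw [Pi.sub_apply, Pi.sub_apply, h2, wmul_delta_neg_one, sub_self]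

theorem rhoW_wmul_delta {b : nullSer W} {c : Op W} (hc : c ∈ hsub (Op W) 1) {a : ℤ → Op W}
    (h : ∀ n, Commute c (a n)) (hb : ∀ k, Commute c (PowerSeries.coeff k (b : (Op W)⟦X⟧))) :
    rhoW b (wmul a (delta c)) = wmul (rho b a) (delta c) := by
  refine eq_wmul_delta hc (commute_rho hb h) ?_ fun n => ?_
  · rw [← rhoW_mulSub, mulSub_wmul_delta hc h, map_zero]
  · rw [rhoW_apply, rho_apply]
    simp only [wmul_delta_neg_one]

theorem Tw_apply (κ : Op W) (c : ℂ) (D : ℤ → ℤ → Op W) (m : ℤ) : Tw κ c D m = Tsh κ c (D m) :=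
  ev_intertwine (LinearMap.proj m : (ℤ → ℤ → Op W) →ₗ[ℂ⟦X⟧] (ℤ → Op W))
    (D := kY κ * dw (Op W)) (D' := kL κ * derL (Op W)) (fun _ => rfl) (expS c) D

theorem Tw_wmul_delta {κ : Op W} {a : ℤ → Op W} (h : ∀ n, Commute κ (a n)) (c d : ℂ) :
    Tw κ d (wmul a (delta (ch c • κ))) = wmul (Tsh κ d a) (delta (ch (c + d) • κ)) := by
  refine eq_wmul_delta (ch_smul_mem (c + d) κ)
    (fun n => Commute.smul_left (commute_Tsh (Commute.refl κ) d h n) (ch (c + d))) ?_ fun n => ?_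
  · have h1 := Tw_mulSub (κ := κ) (ν := ch c • κ) (Commute.smul_right (Commute.refl κ) (ch c)) d
      (wmul a (delta (ch c • κ)))
    rw [mulSub_wmul_delta (ch_smul_mem c κ) fun n => Commute.smul_left (h n) (ch c), map_zero, ← add_smul,
      ← ch_add] at h1
    exact h1.symm
  · rw [Tw_apply, (funext (wmul_delta_neg_one _ a) : wmul a (delta (ch c • κ)) (-1) = a)]

end Delta

namespace Gens

variable {I W : Type*} [AddCommGroup W] [Module ℂ⟦X⟧ W] [TopFree W] {g : Gens I (Op W)}
  {A : I → I → ℤ}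

theorem IsGood.exch_one (hg : g.IsGood) {a : ℂ} {i j : I} (h : g.dy3 a 1 i j = 0) :
    Exch (-a) (hg.iH (-1 / 2) i) (g.Xc 1 j) := by
  refine exch_of_pH (hg.iH_mul_pH _ i) (hg.pH_mul_iH _ i) ?_
  have hl : ∀ b, Commute g.kappa (-((((1 : ℤˣ) : ℤ)) • hv • lin g.kappa b 1)) := fun b =>
    (Commute.smul_right (Commute.smul_right (commute_lin (Commute.refl _) _ _).symm hv) _).neg_right
  rw [hg.dy3_one_iff, ← hg.exchange_H 1 i (hg.commute_Xc 1 j),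
    mulSub_shift_z_iff (hl _) (hl _) (-1) (hg.commute_Xc 1 j), lin_shift, lin_shift] at h
  have e : Tsh g.kappa (-1) (Tsh g.kappa ((((1 : ℤˣ) : ℤ) : ℂ) / 2) (g.Hc 1 i)) =
      Tsh g.kappa (-1 / 2) (g.Hc 1 i) := by
    rw [← Module.End.mul_apply, ← Tsh_add]
    norm_num
  have e0 : (1 : ℂ) + (((1 : ℤˣ) : ℤ) : ℂ) * (-1) = 0 := by norm_num
  rw [e, e0, lin_zero_right, lin_zero_right, Units.val_one, one_smul, one_smul, ← hb_neg,
    ← hb_neg] at h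
  rw [hg.iota_pH]
  exact h

theorem IsGood.null_Xc (hg : g.IsGood) (i : I) (v : W) (r : ℕ) :
    ∃ N : ℤ, ∀ m, N ≤ -m → g.Xc 1 i m v ∈ hsub W r := by
  obtain ⟨N, hN⟩ := hg.nullX 1 i v r
  refine ⟨N + 1, fun m hm => ?_⟩
  have := hN (-m - 1).toNat (by omega)
  rwa [show (((-m - 1).toNat : ℕ) : ℤ) = -m - 1 by omega] at this

theorem IsGood.null_wz_Xc (hg : g.IsGood) (i : I) (y : ℤ → Op W) : Null (-1) (wz y (g.Xc 1 i)) :=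
  fun v r => by
    obtain ⟨N, hN⟩ := hg.null_Xc i v r
    exact ⟨N, fun m n hm => map_mem_hsub (y n) (hN m (by simpa using hm))⟩

theorem null_rhoW {s : ℤˣ} {D : ℤ → ℤ → Op W} (hD : Null s D) (b : nullSer W) :
    Null s (rhoW b D) := fun v r => by
  obtain ⟨K, hK⟩ := b.2 v r
  obtain ⟨N, hN⟩ := exists_uniform hD (fun k => PowerSeries.coeff k (b : (Op W)⟦X⟧) v) r K
  refine ⟨N, fun m n hm => rsum_mem fun k => ?_⟩
  by_cases hk : k < K
  · exact hN k hk _ _ hm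
  · exact map_mem_hsub _ (hK k (by omega))

/-- The rational factor is exactly the one which arises when `(H_j^+)⁻¹` is moved across `X_i^+(z)`.
Hence the second term of the mixed relation is `X_j^-(w - κħ) X_i^+(z)` multiplied by the same
series on the right as the first term. -/
theorem IsGood.dmul_x_x_pm (hg : g.IsGood) {a : ℂ} {i j : I} (h : g.dy3 a 1 j i = 0) :
    dmul (wz (g.xY (-1) j) (g.xY 1 i)) (expandWZ (ratio (hb (Op W) a) (-hb (Op W) a))) =
      rhoW (hg.iH (-1 / 2) j) (wz (g.Xs j) (g.Xc 1 i)) := by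
  have hc : ∀ (D : ℤ → ℤ → Op W) m n, Commute (hb (Op W) a) (D m n) := fun D m n =>
    Algebra.commute_algebraMap_left _ _
  have h1 := congrArg tr2 ((hg.exch_one h).zw_rho (g.Xs j))
  rw [tr2_mulSub, tr2_mulSub, neg_inj, tr2_rhoZ, tr2_zw, tr2_zw, ← hg.xY_neg, ← hb_neg, ← hb_neg,
    neg_neg, hb_neg] at h1
  symm
  rw [xY_one, ← expd_neg_apply, eq_dmul_ratio_iff (null_rhoW (hg.null_wz_Xc i _) _)
    (hg.null_wz_Xc i _) (hb_mem a) (Submodule.neg_mem _ (hb_mem a)) (Commute.refl _).neg_right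
    (hc _) (fun m n => (hc _ m n).neg_left)]
  simpa using h1.symm

/-- The mixed relation is obtained from the one for `X^±` by moving `w` to `w - κħ` and multiplying
on the right by `H_j^+(w - κħ/2)⁻¹`, both injective operations. In the first delta term this cancels
`H_j^+`; in the second it completes `H_j^-(w - 3κħ/2)` to `C_j`. -/
theorem IsGood.x_x_pm_iff_dy [DecidableEq I] (hg : g.IsGood) {a : ℂ} {i j : I}
    (h : g.dy3 a 1 j i = 0) :
    ch 2 • (zw (g.xY 1 i) (g.xY (-1) j) -
        dmul (wz (g.xY (-1) j) (g.xY 1 i)) (expandWZ (ratio (hb (Op W) a) (-hb (Op W) a)))) =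
      (if i = j then delta 0 - wmul (g.Cc i) (delta (g.kh (-2))) else 0) ↔ g.dy5 i j = 0 := by
  set b := hg.iH (-1 / 2) j with hb'
  have e1 : zw (g.xY 1 i) (g.xY (-1) j) = rhoW b (zw (g.Xc 1 i) (g.Xs j)) := by
    rw [hg.xY_neg, rhoW_zw, xY_one]
  have hκ : ∀ (c : ℂ) k, Commute (ch c • g.kappa) (PowerSeries.coeff k (b : (Op W)⟦X⟧)) := fun c k =>
    Commute.smul_left (hg.commute_iH _ j k) (ch c)
  have hTH : ∀ (s : ℤˣ) (c d : ℂ) n, Commute (ch d • g.kappa) (Tsh g.kappa c (g.Hc s j) n) :=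
    fun s c d n => Commute.smul_left (hg.commute_Tsh_Hc s c j n) (ch d)
  have e2 : delta 0 - wmul (g.Cc j) (delta (g.kh (-2))) =
      rhoW b (Tw g.kappa (-1) (wmul (fshift (g.kh (1 / 2)) (g.Hc 1 j)) (delta (g.kh 1)) -
        wmul (fshift (g.kh (-1 / 2)) (g.Hc (-1) j)) (delta (g.kh (-1))))) := by
    have f1 : fshift (g.kh (1 / 2)) (g.Hc 1 j) = Tsh g.kappa (1 / 2) (g.Hc 1 j) := fshift_eq _ _ _
    have f2 : fshift (g.kh (-1 / 2)) (g.Hc (-1) j) = Tsh g.kappa (-1 / 2) (g.Hc (-1) j) :=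
      fshift_eq _ _ _
    have hw : ∀ (s : ℤˣ) (c d e : ℂ), rhoW b (Tw g.kappa e
        (wmul (Tsh g.kappa c (g.Hc s j)) (delta (ch d • g.kappa)))) =
        wmul (rho b (Tsh g.kappa (e + c) (g.Hc s j))) (delta (ch (d + e) • g.kappa)) :=
      fun s c d e => by
        rw [Tw_wmul_delta (hg.commute_Tsh_Hc s c j) d e, ← Module.End.mul_apply, ← Tsh_add]
        exact rhoW_wmul_delta (ch_smul_mem (d + e) g.kappa) (hTH s (e + c) (d + e)) (hκ (d + e))
    rw [f1, f2, map_sub, map_sub, kh, kh, kh, hw, hw]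
    congr 1
    · have n1 : (-1 : ℂ) + 1 / 2 = -1 / 2 := by norm_num
      have n2 : (1 : ℂ) + -1 = 0 := by norm_num
      have n3 : ch 0 = 0 := by simp [ch]
      rw [n1, n2, n3, zero_smul, ← hg.iota_pH, ← fmul_iota_one, fmul_iota, ← Subalgebra.coe_mul,
        hg.pH_mul_iH, Subalgebra.coe_one, iota_one, wmul_fone]
    · have n1 : (-1 : ℂ) + -1 / 2 = -3 / 2 := by norm_num
      have n2 : (-1 : ℂ) + -1 = -2 := by norm_num
      rw [n1, n2, hg.Cc_eq, Tsh_Hc]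
  have e3 : (if i = j then delta 0 - wmul (g.Cc i) (delta (g.kh (-2))) else 0) =
      rhoW b (Tw g.kappa (-1) (if i = j then
        wmul (fshift (g.kh (1 / 2)) (g.Hc 1 i)) (delta (g.kh 1)) -
        wmul (fshift (g.kh (-1 / 2)) (g.Hc (-1) i)) (delta (g.kh (-1))) else 0)) := by
    split_ifs with hij
    · subst hij
      exact e2
    · rw [map_zero, map_zero]
  have e4 : zw (g.Xc 1 i) (g.Xs j) - wz (g.Xs j) (g.Xc 1 i) =
      Tw g.kappa (-1) (zw (g.Xc 1 i) (g.Xc (-1) j) - wz (g.Xc (-1) j) (g.Xc 1 i)) := by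
    rw [map_sub, Tw_zw _ _ (hg.commute_Xc 1 i), Tw_wz]
    rfl
  rw [e1, hg.dmul_x_x_pm h, e3, ← map_sub, ← map_smul, e4, ← map_smul,
    (hg.rhoW_iH_injective _ j).eq_iff, (Tw_injective _ _).eq_iff, dy5, sub_eq_zero]

end Gens

end

/-! ### Distributions in three variables as a module over Laurent polynomials -/

section
section Dist3

variable {W : Type*} [AddCommGroup W] [Module ℂ⟦X⟧ W]

/-- Formal distributions in three variables. -/
abbrev Dist3 (W : Type*) [AddCommGroup W] [Module ℂ⟦X⟧ W] := (Fin 3 → ℤ) → Op W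

/-- Laurent polynomials in three variables. -/
abbrev Lau : Type := AddMonoidAlgebra ℂ⟦X⟧ (Fin 3 → ℤ)

/-- The action of monomials on distributions. -/
def monAct (W : Type*) [AddCommGroup W] [Module ℂ⟦X⟧ W] :
    Multiplicative (Fin 3 → ℤ) →* Module.End ℂ⟦X⟧ (Dist3 W) where
  toFun x := LinearMap.funLeft ℂ⟦X⟧ (Op W) fun g => g - x.toAdd
  map_one' := by ext D g : 2; simp [LinearMap.funLeft]
  map_mul' x y := by
    ext D g : 2
    simp only [LinearMap.funLeft_apply, Module.End.mul_apply, toAdd_mul]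
    congr 1
    abel

instance : Module Lau (Dist3 W) :=
  Module.compHom (Dist3 W) (AddMonoidAlgebra.lift ℂ⟦X⟧ (Module.End ℂ⟦X⟧ (Dist3 W)) (Fin 3 → ℤ)
    (monAct W)).toRingHom

theorem single_smul (x : Fin 3 → ℤ) (c : ℂ⟦X⟧) (D : Dist3 W) :
    (AddMonoidAlgebra.single x c : Lau) • D = fun g => c • D (g - x) := by
  change (AddMonoidAlgebra.lift ℂ⟦X⟧ (Module.End ℂ⟦X⟧ (Dist3 W)) (Fin 3 → ℤ) (monAct W))
    (AddMonoidAlgebra.single x c) D = _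
  rw [AddMonoidAlgebra.lift_single]
  rfl

/-- The basis vectors. -/
def ex (s : Fin 3) : Fin 3 → ℤ := Pi.single s 1

/-- The variables. -/
def vr (s : Fin 3) : Lau := AddMonoidAlgebra.single (ex s) 1

/-- The scalar `c ħ`. -/
def sc (c : ℂ) : Lau := AddMonoidAlgebra.single 0 (ch c)

/-- The linear factor `z_s - z_t - c ħ`. -/
def fac (s t : Fin 3) (c : ℂ) : Lau := vr s - vr t - sc c

theorem fac_smul (s t : Fin 3) (c : ℂ) (D : Dist3 W) (g : Fin 3 → ℤ) :
    (fac s t c • D) g = D (g - ex s) - D (g - ex t) - ch c • D g := by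
  rw [fac, sub_smul, sub_smul, vr, vr, sc, single_smul, single_smul, single_smul]
  simp

/-- Distributions which are pointwise null along the lines in direction `z_s z_t⁻¹`. -/
def lineNull (W : Type*) [AddCommGroup W] [Module ℂ⟦X⟧ W] (s t : Fin 3) :
    Submodule Lau (Dist3 W) where
  carrier := {D | ∀ g v r, ∃ J : ℕ, ∀ j ≥ J, D (g + j • (ex s - ex t)) v ∈ hsub W r}
  add_mem' {D D'} h h' g v r := by
    obtain ⟨J, hJ⟩ := h g v r
    obtain ⟨J', hJ'⟩ := h' g v r
    exact ⟨max J J', fun j hj => Submodule.add_mem _ (hJ j (le_of_max_le_left hj))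
      (hJ' j (le_of_max_le_right hj))⟩
  zero_mem' g v r := ⟨0, fun j _ => Submodule.zero_mem _⟩
  smul_mem' p D h g v r := by
    induction p using AddMonoidAlgebra.induction_linear with
    | zero => exact ⟨0, fun j _ => by rw [zero_smul]; exact Submodule.zero_mem _⟩
    | add p p' hp hp' =>
      obtain ⟨J, hJ⟩ := hp
      obtain ⟨J', hJ'⟩ := hp'
      refine ⟨max J J', fun j hj => ?_⟩
      rw [add_smul]
      exact Submodule.add_mem _ (hJ j (le_of_max_le_left hj)) (hJ' j (le_of_max_le_right hj))
    | single x c =>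
      obtain ⟨J, hJ⟩ := h (g - x) v r
      refine ⟨J, fun j hj => ?_⟩
      rw [single_smul]
      have := hJ j hj
      rw [sub_add_eq_add_sub] at this
      exact Submodule.smul_mem _ c this

/-- Distributions which, applied to a vector, are supported modulo every power of `ħ` in a set on
which the exponents of `z_k` are bounded below, as are those of `z_j` for every given exponent
of `z_k`. -/
def lexNull (W : Type*) [AddCommGroup W] [Module ℂ⟦X⟧ W] (j k : Fin 3) :
    Submodule Lau (Dist3 W) where
  carrier := {D | ∀ v r, (∃ N : ℤ, ∀ g : Fin 3 → ℤ, g k < N → D g v ∈ hsub W r) ∧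
    ∀ q : ℤ, ∃ N : ℤ, ∀ g : Fin 3 → ℤ, g k = q → g j < N → D g v ∈ hsub W r}
  add_mem' {D D'} h h' v r := by
    obtain ⟨⟨N, hN⟩, h2⟩ := h v r
    obtain ⟨⟨N', hN'⟩, h2'⟩ := h' v r
    refine ⟨⟨min N N', fun g hg => Submodule.add_mem _ (hN g (by omega)) (hN' g (by omega))⟩,
      fun q => ?_⟩
    obtain ⟨M, hM⟩ := h2 q
    obtain ⟨M', hM'⟩ := h2' q
    exact ⟨min M M', fun g hq hg => Submodule.add_mem _ (hM g hq (by omega)) (hM' g hq (by omega))⟩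
  zero_mem' v r := ⟨⟨0, fun _ _ => Submodule.zero_mem _⟩, fun _ => ⟨0, fun _ _ _ => Submodule.zero_mem _⟩⟩
  smul_mem' p D h v r := by
    induction p using AddMonoidAlgebra.induction_linear with
    | zero =>
      rw [zero_smul]
      exact ⟨⟨0, fun _ _ => Submodule.zero_mem _⟩, fun _ => ⟨0, fun _ _ _ => Submodule.zero_mem _⟩⟩
    | add p p' hp hp' =>
      obtain ⟨⟨N, hN⟩, h2⟩ := hp
      obtain ⟨⟨N', hN'⟩, h2'⟩ := hp'
      rw [add_smul]
      refine ⟨⟨min N N', fun g hg => Submodule.add_mem _ (hN g (by omega)) (hN' g (by omega))⟩,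
        fun q => ?_⟩
      obtain ⟨M, hM⟩ := h2 q
      obtain ⟨M', hM'⟩ := h2' q
      exact ⟨min M M', fun g hq hg =>
        Submodule.add_mem _ (hM g hq (by omega)) (hM' g hq (by omega))⟩
    | single x c =>
      obtain ⟨⟨N, hN⟩, h2⟩ := h v r
      rw [single_smul]
      refine ⟨⟨N + x k, fun g hg => Submodule.smul_mem _ c (hN _ ?_)⟩, fun q => ?_⟩
      · rw [Pi.sub_apply]; omega
      · obtain ⟨M, hM⟩ := h2 (q - x k)
        refine ⟨M + x j, fun g hq hg => Submodule.smul_mem _ c (hM _ ?_ ?_)⟩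
        · rw [Pi.sub_apply]; omega
        · rw [Pi.sub_apply]; omega

variable [TopFree W]

/-- The equation is a recursion along the direction `z_s z_t⁻¹` with an error divisible by `ħ`, and
`D` tends to zero along that direction; `eq_zero_of_recursion` applies. -/
theorem fac_smul_injOn {s t : Fin 3} {c : ℂ} {D : Dist3 W} (hD : D ∈ lineNull W s t)
    (h : fac s t c • D = 0) : D = 0 := by
  refine eq_zero_of_recursion (δ := ex s - ex t) (η := ex s) (hb_mem c) (fun g => ?_) fun g v r => ?_
  · have := congrFun h (g + ex s)
    rw [fac_smul, add_sub_cancel_right, Pi.zero_apply, sub_sub, sub_eq_zero] at this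
    rw [hb_mul, this, add_sub_assoc]
  · obtain ⟨J, hJ⟩ := hD g v r
    exact ⟨J, hJ J le_rfl⟩

/-- The direction `z_s z_t⁻¹` is lexicographically decreasing. -/
def Desc (j k s t : Fin 3) : Prop := (t = k ∧ s ≠ k) ∨ (t = j ∧ s ≠ j ∧ s ≠ k ∧ j ≠ k)

theorem Desc.cases {j k s t : Fin 3} (h : Desc j k s t) :
    (ex s - ex t) k = -1 ∨ ((ex s - ex t) k = 0 ∧ (ex s - ex t) j = -1) := by
  rcases h with ⟨rfl, h⟩ | ⟨rfl, h1, h2, h3⟩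
  · left
    simp [ex, Ne.symm h]
  · right
    simp [ex, Ne.symm h1, Ne.symm h2, Ne.symm h3]

theorem lexNull_line {j k s t : Fin 3} (h : Desc j k s t) {D : Dist3 W} (hD : D ∈ lexNull W j k)
    (g : Fin 3 → ℤ) (v : W) (r : ℕ) :
    ∃ J : ℕ, ∀ a ≥ J, D (g + a • (ex s - ex t)) v ∈ hsub W r := by
  obtain ⟨⟨N, hN⟩, h2⟩ := hD v r
  rcases h.cases with h | ⟨h, h'⟩
  · refine ⟨(g k - N).toNat + 1, fun a ha => hN _ ?_⟩
    rw [Pi.add_apply, Pi.smul_apply, h]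
    simp only [smul_neg, nsmul_eq_mul, mul_one]
    omega
  · obtain ⟨M, hM⟩ := h2 (g k)
    refine ⟨(g j - M).toNat + 1, fun a ha => hM _ ?_ ?_⟩
    · rw [Pi.add_apply, Pi.smul_apply, h, smul_zero, add_zero]
    · rw [Pi.add_apply, Pi.smul_apply, h']
      simp only [smul_neg, nsmul_eq_mul, mul_one]
      omega

theorem lexNull_le_lineNull {j k s t : Fin 3} (h : Desc j k s t) :
    lexNull W j k ≤ lineNull W s t := fun _ hD g v r => lexNull_line h hD g v r

/-- Summation along a line. -/
def lineSum (δ : Fin 3 → ℤ) (D : Dist3 W) : Dist3 W := fun g => ∑' a : ℕ, D (g + a • δ)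

theorem pFin_line {j k s t : Fin 3} (h : Desc j k s t) {D : Dist3 W} (hD : D ∈ lexNull W j k)
    (g : Fin 3 → ℤ) : PFin fun a : ℕ => D (g + a • (ex s - ex t)) := fun v r => by
  obtain ⟨J, hJ⟩ := lexNull_line h hD g v r
  refine (Set.finite_lt_nat J).subset fun a ha => ?_
  by_contra hlt
  exact ha (hJ a (not_lt.1 hlt))

theorem lineSum_eq {j k s t : Fin 3} (h : Desc j k s t) {D : Dist3 W} (hD : D ∈ lexNull W j k)
    (g : Fin 3 → ℤ) : lineSum (ex s - ex t) D g = D g + lineSum (ex s - ex t) D (g + (ex s - ex t)) := by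
  rw [lineSum, (pFin_line h hD g).summable.tsum_eq_zero_add, zero_smul, add_zero, lineSum]
  congr 2
  funext a
  rw [add_smul, one_smul, add_assoc, add_comm (ex s - ex t)]

theorem exists_lower_bound (f : ℕ → ℤ) (n : ℕ) : ∃ M, ∀ a ≤ n, M ≤ f a := by
  obtain ⟨M, hM⟩ := ((Finset.range (n + 1)).image fun a => -f a).exists_le
  refine ⟨-M, fun a ha => ?_⟩
  have := hM _ (Finset.mem_image_of_mem (fun a => -f a) (Finset.mem_range.2 (by omega : a < n + 1)))
  omega

theorem lineSum_mem {j k s t : Fin 3} (h : Desc j k s t) {D : Dist3 W} (hD : D ∈ lexNull W j k) :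
    lineSum (ex s - ex t) D ∈ lexNull W j k := fun v r => by
  obtain ⟨⟨N, hN⟩, h2⟩ := hD v r
  have hk : ∀ (g : Fin 3 → ℤ) (a : ℕ) i,
      (g + a • (ex s - ex t)) i = g i + a * (ex s - ex t) i := fun g a i => by simp
  constructor
  · refine ⟨N, fun g hg => (pFin_line h hD g).tsum_mem v r fun a => hN _ ?_⟩
    rw [hk]
    rcases h.cases with h | ⟨h, -⟩ <;> rw [h] <;> omega
  · intro q
    choose M hM using h2
    rcases h.cases with h' | ⟨h', h''⟩
    -- Along the line the exponent of `z_k` decreases and falls below `N` after at most `q - N`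
    -- steps, up to one, so only finitely many of the bounds for `z_j` are needed.
    · obtain ⟨M', hM'⟩ := exists_lower_bound (fun a => M (q - a) - a * (ex s - ex t) j) (q - N).toNat
      refine ⟨M', fun g hq hg => (pFin_line h hD g).tsum_mem v r fun a => ?_⟩
      by_cases ha : a ≤ (q - N).toNat
      · refine hM (q - a) _ ?_ ?_
        · rw [hk, h']; omega
        · rw [hk]; have := hM' a ha; omega
      · refine hN _ ?_
        rw [hk, h']; omega
    · refine ⟨M q, fun g hq hg => (pFin_line h hD g).tsum_mem v r fun a => hM q _ ?_ ?_⟩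
      · rw [hk, h']; omega
      · rw [hk, h'']; omega

theorem hsum_mem_lexNull {j k : Fin 3} {D : ℕ → Dist3 W} (hD : ∀ a, D a ∈ lexNull W j k) :
    hsum D ∈ lexNull W j k := fun v r => by
  have hE : (∑ a ∈ Finset.range r, (AddMonoidAlgebra.single 0 (hv ^ a) : Lau) • D a) ∈
      lexNull W j k := Submodule.sum_mem _ fun a _ => Submodule.smul_mem _ _ (hD a)
  have hs : ∀ g, hsum D g v - (∑ a ∈ Finset.range r,
      (AddMonoidAlgebra.single 0 (hv ^ a) : Lau) • D a) g v ∈ hsub W r := fun g => by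
    have h1 := mem_hsub_hom.1 (mem_hsub_pi.1 (hsum_spec D r) g) v
    convert h1 using 1
    simp only [single_smul, sub_zero, Pi.sub_apply, LinearMap.sub_apply]
    congr 3
  have key : ∀ g, (∑ a ∈ Finset.range r, (AddMonoidAlgebra.single 0 (hv ^ a) : Lau) • D a) g v ∈
      hsub W r → hsum D g v ∈ hsub W r := fun g hg => by
    have := Submodule.add_mem _ (hs g) hg
    rwa [sub_add_cancel] at this
  obtain ⟨⟨N, hN⟩, h2⟩ := hE v r
  refine ⟨⟨N, fun g hg => key g (hN g hg)⟩, fun q => ?_⟩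
  obtain ⟨M, hM⟩ := h2 q
  exact ⟨M, fun g hq hg => key g (hM g hq hg)⟩

/-- Geometric series: `(z_s - z_t - cħ)⁻¹` is the sum of `(cħ)^n (z_s - z_t)^{-n-1}`, and `(z_s -
z_t)⁻¹`, expanded in nonnegative powers of `z_t`, is a sum along a line, which converges on
`lexNull` in descending directions. -/
theorem exists_fac_smul_eq {j k s t : Fin 3} (h : Desc j k s t) (c : ℂ) {D : Dist3 W}
    (hD : D ∈ lexNull W j k) : ∃ E ∈ lexNull W j k, fac s t c • E = D := by
  let F : ℕ → Dist3 W := fun n => Nat.rec (lineSum (ex s - ex t) ((AddMonoidAlgebra.single (-ex s) 1 : Lau) • D))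
    (fun _ E => lineSum (ex s - ex t) ((AddMonoidAlgebra.single (-ex s) (PowerSeries.C c) : Lau) • E)) n
  have hF : ∀ n, F n ∈ lexNull W j k := fun n => by
    induction n with
    | zero => exact lineSum_mem h (Submodule.smul_mem _ _ hD)
    | succ n ih => exact lineSum_mem h (Submodule.smul_mem _ _ ih)
  refine ⟨hsum F, hsum_mem_lexNull hF, ?_⟩
  have h0 : ∀ g, F 0 (g - ex s) - F 0 (g - ex t) = D g := fun g => by
    have := lineSum_eq h (Submodule.smul_mem (lexNull W j k) (AddMonoidAlgebra.single (-ex s) 1) hD)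
      (g - ex s)
    rw [sub_add_sub_cancel] at this
    rw [sub_eq_iff_eq_add]
    refine this.trans (congrArg (· + _) ?_)
    rw [single_smul]
    simp
  have h1 : ∀ n g, F (n + 1) (g - ex s) - F (n + 1) (g - ex t) = (PowerSeries.C c : ℂ⟦X⟧) • F n g :=
    fun n g => by
      have := lineSum_eq h (Submodule.smul_mem (lexNull W j k)
        (AddMonoidAlgebra.single (-ex s) (PowerSeries.C c)) (hF n)) (g - ex s)
      rw [sub_add_sub_cancel] at this
      rw [sub_eq_iff_eq_add]
      refine this.trans (congrArg (· + _) ?_)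
      rw [single_smul]
      simp
  funext g
  have h2 : hsum F (g - ex s) - hsum F (g - ex t) = D g + ch c • hsum F g := by
    rw [hsum_apply, hsum_apply, ← hsum_sub, hsum_succ]
    simp only [h0, h1]
    rw [hsum_smul, hsum_apply, ch, mul_comm, mul_smul]
  rw [fac_smul, h2, add_sub_cancel_right]

end Dist3

end

/-! ### The algebraic core of the comparison of Serre combinations -/

section
section Module

variable {Λ M : Type*} [CommRing Λ] [AddCommGroup M] [Module Λ M]

/-- The Serre combination of three distributions which arise from each other by moving the last
variable, compared with the one of the distributions obtained by reordering. -/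
theorem serre_comparison (h u v : Λ) {P₁ P₂ P₁' P₂' P : Submodule Λ M}
    (i₁ : ∀ D ∈ P₁, (u - h) • D = 0 → D = 0) (i₂ : ∀ D ∈ P₂, (v - h) • D = 0 → D = 0)
    (k₁ : ∀ D ∈ P₁', (u + h) • D = 0 → D = 0) (k₂ : ∀ D ∈ P₂', (v + h) • D = 0 → D = 0)
    (l : ∀ D ∈ P, (u - v - 2 * h) • D = 0 → D = 0) (l' : ∀ D ∈ P, (u - v + 2 * h) • D = 0 → D = 0)
    {N₁ N₂ N₃ M₁ M₂ M₃ E₁ E₃ J : M}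
    (hN₁ : ((u - v - 2 * h) * (u + h) * (v + h)) • N₁ = ((u - v + 2 * h) * (u - h) * (v - h)) • M₁)
    (hN₂ : ((u - v - 2 * h) * (u + h) * (v - h)) • N₂ = ((u - v + 2 * h) * (u - h) * (v + h)) • M₂)
    (hN₃ : ((u - v - 2 * h) * (u - h) * (v - h)) • N₃ = ((u - v + 2 * h) * (u + h) * (v + h)) • M₃)
    (h₁₂ : (v + h) • N₁ = (v - h) • N₂) (h₂₃ : (u + h) • N₂ = (u - h) • N₃)
    (mM₁ : M₁ ∈ P₁ ∧ M₁ ∈ P₂ ∧ M₁ ∈ P) (mM₂ : M₂ ∈ P₁ ∧ M₂ ∈ P₂' ∧ M₂ ∈ P)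
    (mM₃ : M₃ ∈ P₁' ∧ M₃ ∈ P₂' ∧ M₃ ∈ P)
    (mE₁ : E₁ ∈ P₁ ∧ E₁ ∈ P₂ ∧ E₁ ∈ P) (mJ : J ∈ P₁ ∧ J ∈ P₂' ∧ J ∈ P)
    (mE₃ : E₃ ∈ P₁' ∧ E₃ ∈ P₂' ∧ E₃ ∈ P)
    (mN₁ : N₁ ∈ P) (mN₂ : N₂ ∈ P) (mN₃ : N₃ ∈ P)
    (hE₁ : ((u - h) * (v - h)) • E₁ = N₁) (hE₃ : ((u + h) * (v + h)) • E₃ = N₃)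
    (hJ : ((u - h) * (v + h)) • J = (u - v - 2 * h) • N₂) :
    N₁ - 2 • N₂ + N₃ = M₁ - 2 • M₂ + M₃ - 2 • (h * (u - v - 2 * h)) • (E₁ + E₃) := by
  -- In each of `a₁`, `a₃`, `a₂` the word `N_k` is replaced by its quotient, and the two linear
  -- factors then common to both sides are cancelled in the region where they are injective.
  have a₁ : ((u + h) * (v + h) * (u - v - 2 * h)) • E₁ = (u - v + 2 * h) • M₁ := by
    rw [← sub_eq_zero]
    refine i₁ _ (P₁.sub_mem (P₁.smul_mem _ mE₁.1) (P₁.smul_mem _ mM₁.1)) (i₂ _ ?_ ?_)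
    · exact P₂.smul_mem _ (P₂.sub_mem (P₂.smul_mem _ mE₁.2.1) (P₂.smul_mem _ mM₁.2.1))
    · linear_combination (norm := module) hN₁ + ((u - v - 2 * h) * (u + h) * (v + h)) • hE₁
  have a₃ : ((u - h) * (v - h) * (u - v - 2 * h)) • E₃ = (u - v + 2 * h) • M₃ := by
    rw [← sub_eq_zero]
    refine k₁ _ (P₁'.sub_mem (P₁'.smul_mem _ mE₃.1) (P₁'.smul_mem _ mM₃.1)) (k₂ _ ?_ ?_)
    · exact P₂'.smul_mem _ (P₂'.sub_mem (P₂'.smul_mem _ mE₃.2.1) (P₂'.smul_mem _ mM₃.2.1))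
    · linear_combination (norm := module) hN₃ + ((u - v - 2 * h) * (u - h) * (v - h)) • hE₃
  have a₂ : ((u + h) * (v - h)) • J = (u - v + 2 * h) • M₂ := by
    rw [← sub_eq_zero]
    refine i₁ _ (P₁.sub_mem (P₁.smul_mem _ mJ.1) (P₁.smul_mem _ mM₂.1)) (k₂ _ ?_ ?_)
    · exact P₂'.smul_mem _ (P₂'.sub_mem (P₂'.smul_mem _ mJ.2.1) (P₂'.smul_mem _ mM₂.2.1))
    · linear_combination (norm := module) hN₂ + ((u + h) * (v - h)) • hJ
  -- Heuristically `J`, `(u - v - 2h) E₁` and `(u - v - 2h) E₃` are one expression expanded in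
  -- different regions. They need not be equal, but `E₁` and `J` agree up to factors in `v`, and
  -- `E₃` and `J` up to factors in `u`.
  have b₁ : ((v - h) * (v + h)) • J = ((v - h) * (v + h) * (u - v - 2 * h)) • E₁ := by
    rw [← sub_eq_zero]
    refine i₁ _ (P₁.sub_mem (P₁.smul_mem _ mJ.1) (P₁.smul_mem _ mE₁.1)) ?_
    linear_combination (norm := module) (v - h) • hJ - ((v + h) * (u - v - 2 * h)) • hE₁
      - (u - v - 2 * h) • h₁₂
  have b₃ : ((u - h) * (u + h)) • J = ((u - h) * (u + h) * (u - v - 2 * h)) • E₃ := by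
    rw [← sub_eq_zero]
    refine k₂ _ (P₂'.sub_mem (P₂'.smul_mem _ mJ.2.1) (P₂'.smul_mem _ mE₃.2.1)) ?_
    linear_combination (norm := module) (u + h) • hJ - ((u - h) * (u - v - 2 * h)) • hE₃
      + (u - v - 2 * h) • h₂₃
  -- After multiplication by `(u - v - 2h)(u - v + 2h)`, everything is expressed through `E₁`, `J`,
  -- `E₃`. The total coefficient of `J` is `-4h` times `(u - h)(u + h) + (v - h)(v + h)`, so `b₁`
  -- and `b₃` suffice to remove `J`.
  rw [← sub_eq_zero]
  have mem : N₁ - 2 • N₂ + N₃ - (M₁ - 2 • M₂ + M₃ - 2 • (h * (u - v - 2 * h)) • (E₁ + E₃)) ∈ P :=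
    P.sub_mem (P.add_mem (P.sub_mem mN₁ (P.smul_of_tower_mem 2 mN₂)) mN₃)
      (P.sub_mem (P.add_mem (P.sub_mem mM₁.2.2 (P.smul_of_tower_mem 2 mM₂.2.2)) mM₃.2.2)
        (P.smul_of_tower_mem 2 (P.smul_mem _ (P.add_mem mE₁.2.2 mE₃.2.2))))
  refine l _ mem (l' _ (P.smul_mem _ mem) ?_)
  linear_combination (norm := module) (-(u - v + 2 * h) * (u - v - 2 * h)) • hE₁
    - ((u - v + 2 * h) * (u - v - 2 * h)) • hE₃
    + (2 * (u - v + 2 * h)) • hJ + (u - v - 2 * h) • a₁ + (u - v - 2 * h) • a₃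
    - (2 * (u - v - 2 * h)) • a₂ + (-4 * h) • b₁ + (-4 * h) • b₃

end Module

end

/-! ### Words in three currents and right multiplication by series -/

section
section Module

variable {Λ M : Type*} [CommRing Λ] [AddCommGroup M] [Module Λ M]

theorem smul_chain {f₁ f₂ f₃ f₁' f₂' f₃' : Λ} (R : M →ₗ[Λ] M) {w A B C : M}
    (h₁ : f₁ • w = f₁' • A) (h₃ : f₃ • A = f₃' • R B) (h₂ : f₂ • B = f₂' • C) :
    (f₁ * f₂ * f₃) • w = (f₁' * f₂' * f₃') • R C := by
  have h₂' := congrArg R h₂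
  rw [map_smul, map_smul] at h₂'
  linear_combination (norm := module) (f₂ * f₃) • h₁ + (f₁' * f₂) • h₃ + (f₁' * f₃') • h₂'

end Module

section Words

variable {W : Type*} [AddCommGroup W] [Module ℂ⟦X⟧ W] [TopFree W]

/-- Right multiplication by a series in `z_s⁻¹`. -/
def rho3 (s : Fin 3) (b : nullSer W) : Dist3 W →ₗ[Lau] Dist3 W where
  toFun D g := rsum b fun k => D (g + k • ex s)
  map_add' D D' := funext fun g => map_add (rsum b) (fun k : ℕ => D (g + k • ex s)) _
  map_smul' p D := by
    induction p using AddMonoidAlgebra.induction_linear with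
    | zero =>
      funext g
      simp only [zero_smul, Pi.zero_apply, RingHom.id_apply]
      exact map_zero (rsum b)
    | add p p' hp hp' =>
      rw [RingHom.id_apply] at hp hp' ⊢
      rw [add_smul, add_smul, ← hp, ← hp']
      exact funext fun g => map_add (rsum b) (fun k : ℕ => (p • D) (g + k • ex s)) _
    | single x c =>
      funext g
      simp only [single_smul, RingHom.id_apply]
      rw [← map_smul]
      congr 1; funext k
      rw [Pi.smul_apply, sub_add_eq_add_sub]

theorem rho3_apply (s : Fin 3) (b : nullSer W) (D : Dist3 W) (g : Fin 3 → ℤ) :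
    rho3 s b D g = rsum b fun k => D (g + k • ex s) := rfl

theorem rho3_rho3 (s : Fin 3) (b b' : nullSer W) (D : Dist3 W) :
    rho3 s b (rho3 s b' D) = rho3 s (b' * b) D := by
  funext g
  simp only [rho3_apply]
  rw [← rsum_rsum_add (fun k => D (g + k • ex s))]
  congr 1; funext k; congr 1; funext l
  rw [add_smul, add_assoc]

theorem rho3_one (s : Fin 3) (D : Dist3 W) : rho3 s 1 D = D := by
  funext g
  rw [rho3_apply, rsum_one, zero_smul, add_zero]

theorem rho3_injective (s : Fin 3) {b p : nullSer W} (h : b * p = 1) :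
    Function.Injective (rho3 s b) := fun D D' hD => by
  have := congrArg (rho3 s p) hD
  rwa [rho3_rho3, rho3_rho3, h, rho3_one, rho3_one] at this

theorem rho3_comm (s t : Fin 3) {b b' : nullSer W} (h : ∀ k l,
    Commute (PowerSeries.coeff k (b : (Op W)⟦X⟧)) (PowerSeries.coeff l (b' : (Op W)⟦X⟧)))
    (D : Dist3 W) : rho3 s b (rho3 t b' D) = rho3 t b' (rho3 s b D) := by
  funext g
  simp only [rho3_apply]
  rw [rsum_comm h fun k l => D (g + k • ex s + l • ex t)]
  congr 1; funext k; congr 1; funext l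
  rw [add_right_comm]

theorem rho3_mem_lexNull (s : Fin 3) (b : nullSer W) {j k : Fin 3} {D : Dist3 W}
    (hD : D ∈ lexNull W j k) : rho3 s b D ∈ lexNull W j k := fun v r => by
  obtain ⟨K, hK⟩ := b.2 v r
  choose N hN using fun a => (hD (PowerSeries.coeff a (b : (Op W)⟦X⟧) v) r).1
  choose M hM using fun a => (hD (PowerSeries.coeff a (b : (Op W)⟦X⟧) v) r).2
  have hk : ∀ (g : Fin 3 → ℤ) (a : ℕ) i, (g + a • ex s) i = g i + a * ex s i := fun g a i => by simp
  constructor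
  · obtain ⟨N', hN'⟩ := exists_lower_bound (fun a => N a - a * ex s k) K
    refine ⟨N', fun g hg => rsum_mem fun a => ?_⟩
    by_cases ha : a ≤ K
    · refine hN a _ ?_
      rw [hk]; have := hN' a ha; omega
    · exact map_mem_hsub _ (hK a (by omega))
  · intro q
    obtain ⟨M', hM'⟩ := exists_lower_bound (fun a => M a (q + a * ex s k) - a * ex s j) K
    refine ⟨M', fun g hq hg => rsum_mem fun a => ?_⟩
    by_cases ha : a ≤ K
    · refine hM a (q + a * ex s k) _ ?_ ?_
      · rw [hk, hq]
      · rw [hk]; have := hM' a ha; omega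
    · exact map_mem_hsub _ (hK a (by omega))

/-- The product `a(z_i) b(z_j) c(z_k)`. -/
def word (i j k : Fin 3) (a b c : ℤ → Op W) : Dist3 W := fun g => a (g i) * b (g j) * c (g k)

/-- Currents whose negative coefficients tend to zero. -/
def BNull (a : ℤ → Op W) : Prop := ∀ v r, ∃ N : ℤ, ∀ n < N, a n v ∈ hsub W r

theorem word_mem_lexNull (i j k : Fin 3) (a : ℤ → Op W) {b c : ℤ → Op W} (hb : BNull b)
    (hc : BNull c) : word i j k a b c ∈ lexNull W j k := fun v r => by
  obtain ⟨N, hN⟩ := hc v r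
  refine ⟨⟨N, fun g hg => map_mem_hsub (a (g i) * b (g j)) (hN _ hg)⟩, fun q => ?_⟩
  obtain ⟨M, hM⟩ := hb (c q v) r
  refine ⟨M, fun g hq hg => ?_⟩
  rw [word, hq, mul_assoc]
  exact map_mem_hsub (a (g i)) (hM _ hg)

theorem ex_self (s : Fin 3) : ex s s = 1 := by simp [ex]

theorem ex_ne {s t : Fin 3} (h : t ≠ s) : ex s t = 0 := by simp [ex, h]

/-- This is `Exch.zw_rho` on every line in the direction of `z_s`. The hypothesis on `Y` says that
the factor to the left of `x` does not involve `z_t`. -/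
theorem Exch.fac_smul {a : ℂ} {b : nullSer W} {x : ℤ → Op W} (h : Exch a b x) {s t : Fin 3}
    (hst : s ≠ t) {Y : Dist3 W} (hY : ∀ g, Y (g - ex t) = Y g) :
    fac s t a • (fun g => rho3 s b Y g * x (g t)) =
      fac s t (-a) • rho3 s b fun g => Y g * x (g t) := by
  funext g
  rw [DoubleYangian.fac_smul, DoubleYangian.fac_smul]
  have h1 := congrFun (congrFun (h.zw_rho fun m => Y (g + m • ex s)) 0) (g t)
  have e1 : ∀ m : ℤ, rho b (fun m => Y (g + m • ex s)) m = rho3 s b Y (g + m • ex s) := fun m => by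
    rw [rho_apply, rho3_apply]
    congr 1; funext k
    rw [add_smul, natCast_zsmul, add_assoc]
  have e2 : ∀ g', rho3 s b Y (g' - ex t) = rho3 s b Y g' := fun g' => by
    rw [rho3_apply, rho3_apply]
    congr 1; funext k
    rw [sub_add_eq_add_sub, hY]
  have e3 : ∀ m n : ℤ, rhoZ b (zw (fun m => Y (g + m • ex s)) x) m n =
      rsum b fun k => Y (g + m • ex s + k • ex s) * x n := fun m n => by
    rw [rhoZ_apply]
    congr 1; funext k
    rw [zw, add_smul, natCast_zsmul, add_assoc]
  simp only [mulSub, hb_mul, zw, e1] at h1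
  simp only [e3] at h1
  simp only [zero_sub, neg_smul, one_smul, zero_smul, add_zero, ← sub_eq_add_neg] at h1
  simp only [rho3_apply, Pi.add_apply, Pi.sub_apply, Pi.smul_apply, ex_self, ex_ne hst.symm,
    smul_zero, sub_zero, add_zero] at h1 e2 ⊢
  rw [e2]
  refine h1.trans ?_
  congr 3
  funext k
  rw [sub_add_eq_add_sub, hY]

theorem fac_smul_mul {s t k : Fin 3} (hs : k ≠ s) (ht : k ≠ t) (c : ℂ) (D : Dist3 W)
    (y : ℤ → Op W) :
    fac s t c • (fun g => D g * y (g k)) = fun g => (fac s t c • D) g * y (g k) := by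
  funext g
  rw [fac_smul, fac_smul]
  simp [ex_ne hs, ex_ne ht, sub_mul]

theorem rho3_mul_right (k : Fin 3) (b : nullSer W) {Z : Dist3 W} (hZ : ∀ g, Z (g + ex k) = Z g)
    (y : ℤ → Op W) :
    rho3 k b (fun g => Z g * y (g k)) = fun g => Z g * rho b y (g k) := by
  have hZ' : ∀ (a : ℕ) g, Z (g + a • ex k) = Z g := fun a => by
    induction a with
    | zero => simp
    | succ a ih => intro g; rw [add_smul, one_smul, ← add_assoc, hZ, ih]
  funext g
  rw [rho3_apply, rho_apply, ← rsum_mul_left]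
  congr 1; funext a
  rw [hZ' a g]
  simp [ex_self]

/-- All three series are collected on the right of the word. The first has to cross the second and
third current, the second only the third; each crossing flips the sign of `ħ` in one linear factor.
-/
theorem word_relation {i j k : Fin 3} (hij : i ≠ j) (hik : i ≠ k) (hjk : j ≠ k)
    {b₁ b₂ b₃ : nullSer W} {y₁ y₂ y₃ : ℤ → Op W} {a₁₂ a₁₃ a₂₃ : ℂ} (h₁₂ : Exch a₁₂ b₁ y₂)
    (h₁₃ : Exch a₁₃ b₁ y₃) (h₂₃ : Exch a₂₃ b₂ y₃) :
    (fac i j a₁₂ * fac i k a₁₃ * fac j k a₂₃) •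
        word i j k (rho b₁ y₁) (rho b₂ y₂) (rho b₃ y₃) =
      (fac i j (-a₁₂) * fac i k (-a₁₃) * fac j k (-a₂₃)) •
        rho3 k b₃ (rho3 j b₂ (rho3 i b₁ (word i j k y₁ y₂ y₃))) := by
  set x₁ := rho b₁ y₁ with hx₁
  set x₂ := rho b₂ y₂ with hx₂
  set Y₁ : Dist3 W := fun g => y₁ (g i) with hY₁
  have r₁ : ∀ g, rho3 i b₁ Y₁ g = x₁ (g i) := fun g => by
    rw [rho3_apply, hx₁, rho_apply]
    congr 1; funext a
    simp [hY₁, ex_self]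
  have c₁ : word i j k x₁ x₂ (rho b₃ y₃) = rho3 k b₃ (word i j k x₁ x₂ y₃) :=
    (rho3_mul_right k b₃ (Z := fun g => x₁ (g i) * x₂ (g j))
      (fun g => by simp [ex_ne hik, ex_ne hjk]) y₃).symm
  set Z : Dist3 W := fun g => x₁ (g i) * x₂ (g j) with hZ
  have c₂ : Z = rho3 j b₂ fun g => x₁ (g i) * y₂ (g j) :=
    (rho3_mul_right j b₂ (Z := fun g => x₁ (g i)) (fun g => by simp [ex_ne hij]) y₂).symm
  set Y₁₂ : Dist3 W := fun g => y₁ (g i) * y₂ (g j) with hY₁₂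
  have c₃ : fac i j a₁₂ • Z = fac i j (-a₁₂) • rho3 j b₂ (rho3 i b₁ Y₁₂) := by
    have := h₁₂.fac_smul hij (Y := Y₁) fun g => by simp [hY₁, ex_ne hij]
    simp only [r₁] at this
    rw [c₂, ← map_smul, this, map_smul]
  have c₄ : fac i j a₁₂ • word i j k x₁ x₂ y₃ =
      fac i j (-a₁₂) • fun g => rho3 j b₂ (rho3 i b₁ Y₁₂) g * y₃ (g k) := by
    rw [fac_smul_mul hik.symm hjk.symm, ← c₃, ← fac_smul_mul hik.symm hjk.symm]
    rfl
  have inv : ∀ g, Y₁₂ (g - ex k) = Y₁₂ g := fun g => by simp [hY₁₂, ex_ne hik, ex_ne hjk]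
  have inv' : ∀ g, rho3 i b₁ Y₁₂ (g - ex k) = rho3 i b₁ Y₁₂ g := fun g => by
    rw [rho3_apply, rho3_apply]
    congr 1; funext a
    rw [sub_add_eq_add_sub, inv]
  have c₅ := h₂₃.fac_smul hjk inv'
  have c₆ := h₁₃.fac_smul hik inv
  rw [c₁, ← map_smul, ← map_smul]
  refine congrArg (rho3 k b₃) (smul_chain (rho3 j b₂) c₄ c₅ c₆)

end Words

end

/-! ### The Serre combination of the modified currents -/

section
section Serre

variable {W : Type*} [AddCommGroup W] [Module ℂ⟦X⟧ W] [TopFree W]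

theorem BNull.rho {a : ℤ → Op W} (ha : BNull a) (b : nullSer W) : BNull (rho b a) := fun v r => by
  obtain ⟨K, hK⟩ := b.2 v r
  choose N hN using fun k => ha (PowerSeries.coeff k (b : (Op W)⟦X⟧) v) r
  obtain ⟨M, hM⟩ := exists_lower_bound (fun k => N k - k) K
  refine ⟨M, fun n hn => rsum_mem fun k => ?_⟩
  by_cases hk : k ≤ K
  · have := hM k hk
    exact hN k _ (by omega)
  · exact map_mem_hsub (a (n + k)) (hK k (by omega))

theorem BNull.tsh {a : ℤ → Op W} (ha : BNull a) (κ : Op W) (c : ℂ) : BNull (Tsh κ c a) :=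
  fun v r => by
    obtain ⟨N, hN⟩ := ha v r
    refine ⟨N - r, fun n hn => ?_⟩
    rw [← fshift_eq]
    refine (uFin_fshift (ch_smul_mem c κ) a n).pFin.tsum_mem v r fun k => ?_
    refine zsmul_mem_hsub (M := W) _ ?_
    by_cases hk : k < r
    · exact map_mem_hsub ((ch c • κ) ^ k) (hN _ (by omega))
    · exact mem_hsub_hom.1 (hsub_anti (not_lt.1 hk) (pow_mem_hsub (ch_smul_mem c κ) k)) _

/-- The interchange of the first two variables. -/
def swapV (W : Type*) [AddCommGroup W] [Module ℂ⟦X⟧ W] : Dist3 W →ₗ[ℂ⟦X⟧] Dist3 W :=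
  LinearMap.funLeft ℂ⟦X⟧ (Op W) fun g s => g (Equiv.swap 0 1 s)

theorem swapV_apply (D : Dist3 W) (g : Fin 3 → ℤ) :
    swapV W D g = D fun s => g (Equiv.swap 0 1 s) := rfl

theorem ex_swap (s t : Fin 3) : ex (Equiv.swap 0 1 s) (Equiv.swap 0 1 t) = ex s t := by
  revert s t
  simp only [ex, Pi.single_apply]
  decide

theorem swapV_fac_smul (s t : Fin 3) (c : ℂ) (D : Dist3 W) :
    swapV W (fac s t c • D) = fac (Equiv.swap 0 1 s) (Equiv.swap 0 1 t) c • swapV W D := by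
  funext g
  rw [swapV_apply, fac_smul, fac_smul, swapV_apply, swapV_apply, swapV_apply]
  congr 3 <;>
  · funext a
    simp only [Pi.sub_apply, ex_swap]

theorem swapV_mem_lexNull {j k : Fin 3} {D : Dist3 W} (hD : D ∈ lexNull W j k) :
    swapV W D ∈ lexNull W (Equiv.swap 0 1 j) (Equiv.swap 0 1 k) := fun v r => by
  obtain ⟨⟨N, hN⟩, h2⟩ := hD v r
  refine ⟨⟨N, fun g hg => hN _ hg⟩, fun q => ?_⟩
  obtain ⟨M, hM⟩ := h2 q
  exact ⟨M, fun g hq hg => hM _ hq hg⟩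

theorem fac_smul_mid {s t : Fin 3} (hst : s ≠ t) (c : ℂ) {A B : Dist3 W}
    (hA : ∀ g, A (g - ex s) = A g ∧ A (g - ex t) = A g)
    (hB : ∀ g, B (g - ex s) = B g ∧ B (g - ex t) = B g) (D : ℤ → ℤ → Op W) :
    fac s t c • (fun g => A g * D (g s) (g t) * B g) =
      fun g => A g * mulSub (Gens.hb (Op W) c) D (g s) (g t) * B g := by
  funext g
  rw [fac_smul, (hA g).1, (hA g).2, (hB g).1, (hB g).2, mulSub, hb_mul]
  simp [ex_self, ex_ne hst, ex_ne hst.symm, mul_sub, sub_mul]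

theorem fac_smul_mid_eq {s t : Fin 3} (hst : s ≠ t) {c c' : ℂ} {A B : Dist3 W}
    (hA : ∀ g, A (g - ex s) = A g ∧ A (g - ex t) = A g)
    (hB : ∀ g, B (g - ex s) = B g ∧ B (g - ex t) = B g) {D D' : ℤ → ℤ → Op W}
    (h : mulSub (Gens.hb (Op W) c) D = mulSub (Gens.hb (Op W) c') D') :
    fac s t c • (fun g => A g * D (g s) (g t) * B g) =
      fac s t c' • fun g => A g * D' (g s) (g t) * B g := by
  rw [fac_smul_mid hst c hA hB, fac_smul_mid hst c' hA hB, h]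

theorem sc_neg (c : ℂ) : sc (-c) = -sc c := by
  rw [sc, sc, ch_neg, AddMonoidAlgebra.single_neg]

theorem sc_two : sc 2 = 2 * sc 1 := by
  rw [two_mul, sc, sc, ← AddMonoidAlgebra.single_add, ← ch_add]
  norm_num

/-- The distribution of one half of the Serre relation. -/
def serreHalf (a b : ℤ → Op W) : Dist3 W :=
  word 0 1 2 a a b - 2 • word 0 2 1 a b a + word 2 0 1 b a a

theorem serre_eq (a b : ℤ → Op W) (g : Fin 3 → ℤ) :
    serre a b (g 0) (g 1) (g 2) = (serreHalf a b + swapV W (serreHalf a b)) g := by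
  simp only [serre, serreHalf, word, Pi.add_apply, Pi.sub_apply, swapV_apply,
    Equiv.swap_apply_left, Equiv.swap_apply_right,
    Equiv.swap_apply_of_ne_of_ne (by decide : (2 : Fin 3) ≠ 0) (by decide : (2 : Fin 3) ≠ 1), two_mul,
    two_smul]

theorem serre_eq_zero_iff (a b : ℤ → Op W) :
    (∀ m₁ m₂ n, serre a b m₁ m₂ n = 0) ↔ serreHalf a b + swapV W (serreHalf a b) = 0 := by
  refine ⟨fun h => funext fun g => ?_, fun h m₁ m₂ n => ?_⟩
  · rw [← serre_eq, h, Pi.zero_apply]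
  · have := serre_eq a b ![m₁, m₂, n]
    rw [h] at this
    exact this

theorem Desc.mem {j k s t : Fin 3} (h : Desc j k s t) {D : Dist3 W} (hD : D ∈ lexNull W j k) :
    D ∈ lineNull W s t := lexNull_le_lineNull h hD

instance (j k s t : Fin 3) : Decidable (Desc j k s t) := by unfold Desc; infer_instance

theorem swapV_rho3 (s : Fin 3) (b : nullSer W) (D : Dist3 W) :
    swapV W (rho3 s b D) = rho3 (Equiv.swap 0 1 s) b (swapV W D) := by
  funext g
  rw [swapV_apply, rho3_apply, rho3_apply]
  congr 1; funext k
  rw [swapV_apply]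
  congr 1; funext a
  simp only [Pi.add_apply, Pi.smul_apply, ex_swap]

theorem smul_add_smul_eq_zero {Λ M : Type*} [CommRing Λ] [AddCommGroup M] [Module Λ M]
    {p q d d' : Λ} {P Q : Submodule Λ M} (iP : ∀ D ∈ P, p • D = 0 → D = 0)
    (iQ : ∀ D ∈ Q, q • D = 0 → D = 0) {E E' N N' : M} (hE : (p * q) • E = N)
    (hE' : (p * q) • E' = N') (hN : d • N + d' • N' = 0) (mE : E ∈ P ∧ E ∈ Q)
    (mE' : E' ∈ P ∧ E' ∈ Q) : d • E + d' • E' = 0 := by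
  refine iP _ (P.add_mem (P.smul_mem _ mE.1) (P.smul_mem _ mE'.1)) (iQ _ ?_ ?_)
  · exact Q.smul_mem _ (Q.add_mem (Q.smul_mem _ mE.2) (Q.smul_mem _ mE'.2))
  · rw [← hN, ← hE, ← hE']
    module

theorem ring_identities {Λ : Type*} [CommRing Λ] (a b c h : Λ) :
    (c - a - h = -((a - c) + h) ∧ c - b - h = -((b - c) + h)) ∧
    (c - a - -h = -((a - c) - h) ∧ c - b - -h = -((b - c) - h)) ∧
    (a - b - 2 * h = (a - c) - (b - c) - 2 * h ∧
      a - b - -(2 * h) = (a - c) - (b - c) + 2 * h) ∧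
    b - a - 2 * h = -((a - c) - (b - c) + 2 * h) := by
  refine ⟨⟨?_, ?_⟩, ⟨?_, ?_⟩, ⟨?_, ?_⟩, ?_⟩ <;> ring

theorem smul_neg_comm {Λ M : Type*} [CommRing Λ] [AddCommGroup M] [Module Λ M]
    {a b c a' b' c' : Λ} {N N' : M} (h : (a * b * -c) • N = (a' * b' * -c') • N') :
    (b * a * c) • N = (b' * a' * c') • N' := by
  linear_combination (norm := module) (-1 : Λ) • h

theorem smul_neg_neg {Λ M : Type*} [CommRing Λ] [AddCommGroup M] [Module Λ M]
    {a b c a' b' c' : Λ} {N N' : M} (h : (-a * -b * c) • N = (-a' * -b' * c') • N') :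
    (c * a * b) • N = (c' * a' * b') • N' := by
  linear_combination (norm := module) h

theorem mul_smul_of_smul_neg {Λ M : Type*} [CommRing Λ] [AddCommGroup M] [Module Λ M] {p q : Λ}
    {D E E' : M} (h : p • E' = D) (h' : -q • E = E') : (p * q) • -E = D := by
  linear_combination (norm := module) h + p • h'

/-- The common factors in the relations between words. -/
theorem fac_eqs : (fac 0 2 1 = (vr 0 - vr 2) - sc 1 ∧ fac 1 2 1 = (vr 1 - vr 2) - sc 1) ∧
    (fac 0 2 (-1) = (vr 0 - vr 2) + sc 1 ∧ fac 1 2 (-1) = (vr 1 - vr 2) + sc 1) ∧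
    (fac 2 0 1 = -((vr 0 - vr 2) + sc 1) ∧ fac 2 1 1 = -((vr 1 - vr 2) + sc 1)) ∧
    (fac 2 0 (-1) = -((vr 0 - vr 2) - sc 1) ∧ fac 2 1 (-1) = -((vr 1 - vr 2) - sc 1)) ∧
    (fac 0 1 2 = (vr 0 - vr 2) - (vr 1 - vr 2) - 2 * sc 1 ∧
    fac 0 1 (-2) = (vr 0 - vr 2) - (vr 1 - vr 2) + 2 * sc 1) ∧
    fac 1 0 2 = -((vr 0 - vr 2) - (vr 1 - vr 2) + 2 * sc 1) := by
  simp only [fac, sc_neg, sc_two]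
  exact ⟨⟨trivial, trivial⟩, ⟨sub_neg_eq_add _ _, sub_neg_eq_add _ _⟩, ring_identities _ _ _ _⟩

theorem swapV_sc_smul (c : ℂ) (D : Dist3 W) : swapV W (sc c • D) = sc c • swapV W D := by
  rw [sc, single_smul, single_smul]
  simp only [sub_zero]
  exact map_smul (swapV W) (ch c) D

variable {b b' : nullSer W} {y y' : ℤ → Op W}

/-- The three series multiplying a word. -/
def rho3All (b b' : nullSer W) : Dist3 W →ₗ[Lau] Dist3 W := rho3 0 b ∘ₗ rho3 1 b ∘ₗ rho3 2 b'

-- The combinations before symmetrization do not agree: they differ by `G = -2ħ(u - v - 2ħ)(E₁ +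
-- E₃)`, where `u = z₁ - w`, `v = z₂ - w` and `E₁`, `E₃` are quotients of the outer words. The
-- quadratic relation for `x` makes `G` antisymmetric in the first two variables, so the full Serre
-- combinations correspond.
set_option maxHeartbeats 1000000 in
theorem serreHalf_rho (h₁ : Exch 2 b y) (h₂ : Exch (-1) b y') (h₃ : Exch (-1) b' y)
    (hy : BNull y) (hy' : BNull y')
    (hbb : ∀ k l, Commute (PowerSeries.coeff k (b : (Op W)⟦X⟧)) (PowerSeries.coeff l (b : (Op W)⟦X⟧)))
    (hbb' : ∀ k l, Commute (PowerSeries.coeff k (b : (Op W)⟦X⟧))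
      (PowerSeries.coeff l (b' : (Op W)⟦X⟧)))
    (hx : mulSub (Gens.hb (Op W) 2) (zw (rho b y) (rho b y)) =
      mulSub (Gens.hb (Op W) (-2)) (wz (rho b y) (rho b y)))
    (hx' : mulSub (Gens.hb (Op W) (-1)) (zw (rho b y) (rho b' y')) =
      mulSub (Gens.hb (Op W) 1) (wz (rho b' y') (rho b y))) :
    ∃ G : Dist3 W, serreHalf (rho b y) (rho b' y') =
      rho3All b b' (serreHalf y y') + G ∧ G + swapV W G = 0 := by
  obtain ⟨⟨f02p, f12p⟩, ⟨f02m, f12m⟩, ⟨f20p, f21p⟩, ⟨f20m, f21m⟩, ⟨f01p, f01m⟩, f10p⟩ := fac_eqs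
  set u : Lau := vr 0 - vr 2 with hu
  set v : Lau := vr 1 - vr 2 with hv'
  set h : Lau := sc 1 with hh
  set x := rho b y with hxd
  set x' := rho b' y' with hxd'
  have nx : BNull x := hy.rho b
  have nx' : BNull x' := hy'.rho b'
  have c01 := fun D => rho3_comm (W := W) 0 1 hbb D
  have c02 := fun D => rho3_comm (W := W) 0 2 hbb' D
  have c12 := fun D => rho3_comm (W := W) 1 2 hbb' D
  have n2 : -(2 : ℂ) = -2 := rfl
  have n1 : -(-1 : ℂ) = 1 := neg_neg 1
  have mN₁ : word 0 1 2 x x x' ∈ lexNull W 1 2 := word_mem_lexNull _ _ _ _ nx nx'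
  have mN₂ : word 0 2 1 x x' x ∈ lexNull W 2 1 := word_mem_lexNull _ _ _ _ nx' nx
  have mN₃ : word 2 0 1 x' x x ∈ lexNull W 0 1 := word_mem_lexNull _ _ _ _ nx nx
  have mR : ∀ {j k : Fin 3} {D : Dist3 W}, D ∈ lexNull W j k → rho3All b b' D ∈ lexNull W j k :=
    fun hD => rho3_mem_lexNull 0 b (rho3_mem_lexNull 1 b (rho3_mem_lexNull 2 b' hD))
  have mM₁ : rho3All b b' (word 0 1 2 y y y') ∈ lexNull W 1 2 :=
    mR (word_mem_lexNull _ _ _ _ hy hy')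
  have mM₂ : rho3All b b' (word 0 2 1 y y' y) ∈ lexNull W 2 1 :=
    mR (word_mem_lexNull _ _ _ _ hy' hy)
  have mM₃ : rho3All b b' (word 2 0 1 y' y y) ∈ lexNull W 0 1 :=
    mR (word_mem_lexNull _ _ _ _ hy hy)
  have r₁ := word_relation (W := W) (i := 0) (j := 1) (k := 2) (by decide) (by decide) (by decide)
    (b₂ := b) (b₃ := b') (y₁ := y) h₁ h₂ h₂
  have r₂ := word_relation (W := W) (i := 0) (j := 2) (k := 1) (by decide) (by decide) (by decide)
    (b₂ := b') (b₃ := b) (y₁ := y) h₂ h₁ h₃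
  have r₃ := word_relation (W := W) (i := 2) (j := 0) (k := 1) (by decide) (by decide) (by decide)
    (b₂ := b) (b₃ := b) (y₁ := y') h₃ h₃ h₁
  rw [n1, f01p, f02m, f12m, f01m, f02p, f12p, ← c12, ← c02, ← c01] at r₁
  rw [n1, f01p, f02m, f21m, f01m, f02p, f21p, ← c02, ← c01] at r₂
  rw [n1, f20m, f21m, f01p, f20p, f21p, f01m, ← c01] at r₃
  -- Each linear factor is inverted in the direction that the word admits: `z - w` where `w` stands
  -- to the right of `z`, and `w - z` where it stands to the left. For the middle word this leaves a
  -- sign, absorbed by using `-J`.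
  obtain ⟨E', mE', hE'⟩ := exists_fac_smul_eq (by decide : Desc 1 2 0 2) 1 mN₁
  obtain ⟨E₁, mE₁, hE₁⟩ := exists_fac_smul_eq (by decide : Desc 1 2 1 2) 1 mE'
  obtain ⟨F', mF', hF'⟩ := exists_fac_smul_eq (by decide : Desc 0 1 2 0) 1 mN₃
  obtain ⟨E₃, mE₃, hE₃⟩ := exists_fac_smul_eq (by decide : Desc 0 1 2 1) 1 mF'
  obtain ⟨J', mJ', hJ'⟩ := exists_fac_smul_eq (by decide : Desc 2 1 0 2) 1
    ((lexNull W 2 1).smul_mem (u - v - 2 * h) mN₂)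
  obtain ⟨J, mJ, hJ⟩ := exists_fac_smul_eq (by decide : Desc 2 1 2 1) 1 mJ'
  rw [f02p] at hE' hJ'
  rw [f12p] at hE₁
  rw [f20p] at hF'
  rw [f21p] at hE₃ hJ
  have e₁ : ((u - h) * (v - h)) • E₁ = word 0 1 2 x x x' := by rw [mul_smul, hE₁, hE']
  have e₃ : ((u + h) * (v + h)) • E₃ = word 2 0 1 x' x x := by
    rw [← neg_mul_neg, mul_smul, hE₃, hF']
  -- Neighbouring words differ by exchanging `x'` with an adjacent `x`, to which the quadratic
  -- relation applies.
  have h₁₂ : (v + h) • word 0 1 2 x x x' = (v - h) • word 0 2 1 x x' x := by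
    have := fac_smul_mid_eq (W := W) (s := 1) (t := 2) (by decide) (A := fun g => x (g 0)) (B := 1)
      (fun g => by simp [ex]) (fun g => ⟨rfl, rfl⟩) hx'
    rw [f12m, f12p] at this
    simp only [zw, wz, Pi.one_apply, mul_one, ← mul_assoc] at this
    exact this
  have h₂₃ : (u + h) • word 0 2 1 x x' x = (u - h) • word 2 0 1 x' x x := by
    have := fac_smul_mid_eq (W := W) (s := 0) (t := 2) (by decide) (A := 1) (B := fun g => x (g 1))
      (fun g => ⟨rfl, rfl⟩) (fun g => by simp [ex]) hx'
    rw [f02m, f02p] at this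
    simp only [zw, wz, Pi.one_apply, one_mul] at this
    exact this
  have s₁ : (u - v - 2 * h) • word 0 1 2 x x x' = (u - v + 2 * h) • swapV W (word 0 1 2 x x x') := by
    have := fac_smul_mid_eq (W := W) (s := 0) (t := 1) (by decide) (A := 1) (B := fun g => x' (g 2))
      (fun g => ⟨rfl, rfl⟩) (fun g => by simp [ex]) hx
    rw [f01m, f01p] at this
    simp only [zw, wz, Pi.one_apply, one_mul] at this
    exact this
  have s₃ : (u - v - 2 * h) • word 2 0 1 x' x x = (u - v + 2 * h) • swapV W (word 2 0 1 x' x x) := by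
    have := fac_smul_mid_eq (W := W) (s := 0) (t := 1) (by decide) (A := fun g => x' (g 2)) (B := 1)
      (fun g => by simp [ex]) (fun g => ⟨rfl, rfl⟩) hx
    rw [f01m, f01p] at this
    simp only [zw, wz, Pi.one_apply, mul_one, ← mul_assoc] at this
    exact this
  have main := serre_comparison h u v
    (P₁ := lineNull W 0 2) (P₂ := lineNull W 1 2) (P₁' := lineNull W 2 0) (P₂' := lineNull W 2 1)
    (P := lineNull W 0 1)
    (fun D hD h0 => fac_smul_injOn hD (by rwa [f02p]))
    (fun D hD h0 => fac_smul_injOn hD (by rwa [f12p]))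
    (fun D hD h0 => fac_smul_injOn hD (c := 1) (by rw [f20p, neg_smul, h0, neg_zero]))
    (fun D hD h0 => fac_smul_injOn hD (c := 1) (by rw [f21p, neg_smul, h0, neg_zero]))
    (fun D hD h0 => fac_smul_injOn hD (by rwa [f01p]))
    (fun D hD h0 => fac_smul_injOn hD (by rwa [f01m]))
    r₁ (smul_neg_comm r₂) (smul_neg_neg r₃) h₁₂ h₂₃
    ⟨Desc.mem (by decide) mM₁, Desc.mem (by decide) mM₁, Desc.mem (by decide) mM₁⟩
    ⟨Desc.mem (by decide) mM₂, Desc.mem (by decide) mM₂, Desc.mem (by decide) mM₂⟩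
    ⟨Desc.mem (by decide) mM₃, Desc.mem (by decide) mM₃, Desc.mem (by decide) mM₃⟩
    ⟨Desc.mem (by decide) mE₁, Desc.mem (by decide) mE₁, Desc.mem (by decide) mE₁⟩
    ⟨Desc.mem (by decide) (neg_mem mJ), Desc.mem (by decide) (neg_mem mJ),
      Desc.mem (by decide) (neg_mem mJ)⟩
    ⟨Desc.mem (by decide) mE₃, Desc.mem (by decide) mE₃, Desc.mem (by decide) mE₃⟩
    (Desc.mem (by decide) mN₁) (Desc.mem (by decide) mN₂) (Desc.mem (by decide) mN₃)
    e₁ e₃ (mul_smul_of_smul_neg hJ' hJ)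
  have w₁ := congrArg (swapV W) hE'
  have w₁' := congrArg (swapV W) hE₁
  have w₃ := congrArg (swapV W) hF'
  have w₃' := congrArg (swapV W) hE₃
  rw [← f02p, swapV_fac_smul] at w₁
  rw [← f12p, swapV_fac_smul] at w₁'
  rw [← f20p, swapV_fac_smul] at w₃
  rw [← f21p, swapV_fac_smul] at w₃'
  change fac 1 2 1 • _ = _ at w₁
  change fac 0 2 1 • _ = _ at w₁'
  change fac 2 1 1 • _ = _ at w₃
  change fac 2 0 1 • _ = _ at w₃'
  rw [f12p] at w₁
  rw [f02p] at w₁'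
  rw [f21p] at w₃
  rw [f20p] at w₃'
  have sE₁ : swapV W E₁ ∈ lexNull W 0 2 := swapV_mem_lexNull mE₁
  have sE₃ : swapV W E₃ ∈ lexNull W 1 0 := swapV_mem_lexNull mE₃
  -- The quadratic relation `s₁` for the outer word is divided by `(u - h)(v - h)`, which is
  -- symmetric in `z₁`, `z₂`. Both `E₁` and its transpose lie where these factors are injective.
  have t₁ : (u - v - 2 * h) • E₁ + (-(u - v + 2 * h)) • swapV W E₁ = 0 := by
    refine smul_add_smul_eq_zero (P := lineNull W 0 2) (Q := lineNull W 1 2)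
      (fun D hD h0 => fac_smul_injOn hD (by rwa [f02p]))
      (fun D hD h0 => fac_smul_injOn hD (by rwa [f12p])) e₁
      (N' := swapV W (word 0 1 2 x x x')) ?_ ?_ ⟨Desc.mem (by decide) mE₁, Desc.mem (by decide) mE₁⟩
      ⟨Desc.mem (by decide) sE₁, Desc.mem (by decide) sE₁⟩
    · rw [mul_comm, mul_smul, w₁', w₁]
    · rw [s₁, neg_smul, add_neg_cancel]
  have t₃ : (u - v - 2 * h) • E₃ + (-(u - v + 2 * h)) • swapV W E₃ = 0 := by
    refine smul_add_smul_eq_zero (P := lineNull W 2 0) (Q := lineNull W 2 1)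
      (fun D hD h0 => fac_smul_injOn hD (c := 1) (by rw [f20p, neg_smul, h0, neg_zero]))
      (fun D hD h0 => fac_smul_injOn hD (c := 1) (by rw [f21p, neg_smul, h0, neg_zero])) e₃
      (N' := swapV W (word 2 0 1 x' x x)) ?_ ?_ ⟨Desc.mem (by decide) mE₃, Desc.mem (by decide) mE₃⟩
      ⟨Desc.mem (by decide) sE₃, Desc.mem (by decide) sE₃⟩
    · rw [mul_comm, ← neg_mul_neg, mul_smul, w₃', w₃]
    · rw [s₃, neg_smul, add_neg_cancel]
  refine ⟨-(2 • (h * (u - v - 2 * h)) • (E₁ + E₃)), ?_, ?_⟩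
  · rw [← sub_eq_add_neg]
    refine main.trans ?_
    rw [serreHalf, map_add, map_sub, map_nsmul]
    rfl
  -- Interchanging `z₁` and `z₂` sends `u - v - 2h` to `-(u - v + 2h)`, so the sum of `t₁` and `t₃`
  -- is the antisymmetry of `G`.
  · have key : swapV W ((h * (u - v - 2 * h)) • (E₁ + E₃)) =
        h • (-(u - v + 2 * h)) • swapV W (E₁ + E₃) := by
      rw [mul_smul, hh, swapV_sc_smul, ← hh, ← f01p, swapV_fac_smul, ← f10p]
      rfl
    have t := congrArg₂ (· + ·) t₁ t₃
    simp only [add_zero] at t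
    rw [add_add_add_comm, ← smul_add, ← smul_add, ← map_add] at t
    rw [map_neg, map_nsmul, key, ← neg_add, ← smul_add, mul_smul, ← smul_add, t, smul_zero,
      smul_zero, neg_zero]

end Serre

end

/-! ### Equivalence of the Serre relations for `X_i^±` and for `x_i^±` -/

section
section Serre

variable {W : Type*} [AddCommGroup W] [Module ℂ⟦X⟧ W] [TopFree W]

theorem rho3All_swapV {b b' : nullSer W}
    (hbb : ∀ k l, Commute (PowerSeries.coeff k (b : (Op W)⟦X⟧)) (PowerSeries.coeff l (b : (Op W)⟦X⟧)))
    (D : Dist3 W) : swapV W (rho3All b b' D) = rho3All b b' (swapV W D) := by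
  simp only [rho3All, LinearMap.comp_apply, swapV_rho3]
  exact rho3_comm 1 0 hbb _

theorem rho3All_injective {b b' p p' : nullSer W} (h : b * p = 1) (h' : b' * p' = 1) :
    Function.Injective (rho3All b b') :=
  (rho3_injective 0 h).comp ((rho3_injective 1 h).comp (rho3_injective 2 h'))

/-- The order-`2` Serre combination of three operators. -/
def serreOp (q x p : Op W) : Op W :=
  (x * p * q - 2 * (x * q * p) + q * x * p) + (p * x * q - 2 * (p * q * x) + q * p * x)

theorem serreOp_comm (q x p : Op W) : serreOp q x p = serreOp q p x := add_comm _ _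

/-- The Serre combination as a linear map of one of the operators which occur twice. -/
def serreLin (q p : Op W) : Op W →ₗ[ℂ⟦X⟧] Op W where
  toFun x := serreOp q x p
  map_add' x x' := by rw [serreOp, serreOp, serreOp]; noncomm_ring
  map_smul' c x := by
    simp only [serreOp, smul_mul_assoc, mul_smul_comm, ← smul_add, ← smul_sub, RingHom.id_apply]

/-- The Serre combination as a linear map of the operator which occurs once. -/
def serreLinOnce (x p : Op W) : Op W →ₗ[ℂ⟦X⟧] Op W where
  toFun q := serreOp q x p
  map_add' q q' := by rw [serreOp, serreOp, serreOp]; noncomm_ring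
  map_smul' c q := by
    simp only [serreOp, smul_mul_assoc, mul_smul_comm, ← smul_add, ← smul_sub, RingHom.id_apply]

theorem two_mul_left_comm (κ x : Op W) : 2 * (κ * x) = κ * (2 * x) := by
  rw [two_mul, two_mul, mul_add]

theorem serreLin_mul {κ p q : Op W} (hp : Commute κ p) (hq : Commute κ q) (x : Op W) :
    serreLin q p (κ * x) = κ * serreLin q p x := by
  change serreOp q (κ * x) p = κ * serreOp q x p
  simp only [serreOp, mul_add, mul_sub]
  simp only [mul_assoc, ← hp.left_comm, ← hq.left_comm, two_mul_left_comm]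

theorem serreLinOnce_mul {κ p q : Op W} (hp : Commute κ p) (hq : Commute κ q) (x : Op W) :
    serreLinOnce q p (κ * x) = κ * serreLinOnce q p x := by
  change serreOp (κ * x) q p = κ * serreOp x q p
  simp only [serreOp, mul_add, mul_sub]
  simp only [mul_assoc, ← hp.left_comm, ← hq.left_comm, two_mul_left_comm]

theorem map_Tsh_eq_zero {κ : Op W} {L : Op W →ₗ[ℂ⟦X⟧] Op W} (hL : ∀ x, L (κ * x) = κ * L x)
    (c : ℂ) {a : ℤ → Op W} (h : ∀ n, L (a n) = 0) (n : ℤ) : L (Tsh κ c a n) = 0 := by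
  have hk : ∀ (k : ℕ) n, L (((kL κ * derL (Op W)) ^ k) a n) = 0 := fun k => by
    induction k with
    | zero => exact h
    | succ k ih =>
      intro n
      rw [pow_succ']
      change L (κ * ((n + 1) • ((kL κ * derL (Op W)) ^ k) a (n + 1))) = 0
      rw [hL, map_zsmul, ih, smul_zero, mul_zero]
  rw [Tsh, ev_apply, hsum_apply, map_hsum]
  simp only [Pi.smul_apply, map_smul, hk, smul_zero, hsum_zero]

/-- The Serre combination is linear, also over `κ`, in each of its three arguments, so the currents
can be shifted one at a time. -/
theorem serre_Tsh {κ : Op W} {a b : ℤ → Op W} (ha : ∀ n, Commute κ (a n))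
    (hb : ∀ n, Commute κ (b n)) (c : ℂ) (h : ∀ m₁ m₂ n, serre a b m₁ m₂ n = 0) (m₁ m₂ n : ℤ) :
    serre (Tsh κ c a) (Tsh κ c b) m₁ m₂ n = 0 := by
  have ha' := commute_Tsh (Commute.refl _) c ha
  have h₁ : ∀ m₁ m₂ n, serreOp (b n) (Tsh κ c a m₁) (a m₂) = 0 := fun m₁ m₂ n =>
    map_Tsh_eq_zero (L := serreLin (b n) (a m₂)) (serreLin_mul (ha m₂) (hb n)) c
      (fun m => h m m₂ n) m₁
  have h₂ : ∀ m₁ m₂ n, serreOp (b n) (Tsh κ c a m₁) (Tsh κ c a m₂) = 0 := fun m₁ m₂ n =>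
    map_Tsh_eq_zero (L := serreLin (b n) (Tsh κ c a m₂)) (serreLin_mul (ha' m₂) (hb n)) c
      (fun m => (serreOp_comm _ _ _).trans (h₁ m₂ m n)) m₁
  exact map_Tsh_eq_zero (L := serreLinOnce (Tsh κ c a m₁) (Tsh κ c a m₂))
    (serreLinOnce_mul (ha' m₂) (ha' m₁)) c (fun n => h₂ m₁ m₂ n) n

end Serre

section Currents

open Gens

variable {I W : Type*} [AddCommGroup W] [Module ℂ⟦X⟧ W] [TopFree W] {g : Gens I (Op W)}
  {A : Matrix I I ℤ}

theorem Gens.IsGood.bNull_Xc (hg : g.IsGood) (s : ℤˣ) (i : I) : BNull (g.Xc s i) := fun v r => by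
  obtain ⟨N, hN⟩ := hg.nullX s i v r
  refine ⟨-N, fun n hn => ?_⟩
  have := hN (-n - 1).toNat (by omega)
  rwa [Int.toNat_of_nonneg (by omega)] at this

/-- For `s = -1`, symmetrizing removes the defect of `serreHalf_rho`, and the three series multiply
the whole Serre combination on the right; this operation is injective and commutes with the
interchange of the two variables. Shifting all variables by `κħ` leads back from `X^-(z - κħ)` to
`X^-(z)`. -/
theorem Gens.HRel.serre_iff (hH : HRel A g) (hg : g.IsGood) (hX : XRel A g) (s : ℤˣ) {i j : I}
    (hii : A i i = 2) (hij : A i j = -1) (hji : A j i = -1)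
    (hx : ∀ i j, mulSub (hb (Op W) (A i j)) (zw (g.xY s i) (g.xY s j)) =
      mulSub (hb (Op W) (-(A i j : ℂ))) (wz (g.xY s j) (g.xY s i))) :
    (∀ m₁ m₂ n, serre (g.xY s i) (g.xY s j) m₁ m₂ n = 0) ↔
      ∀ m₁ m₂ n, serre (g.Xc s i) (g.Xc s j) m₁ m₂ n = 0 := by
  rcases Int.units_eq_one_or s with rfl | rfl
  · rw [xY_one, xY_one]
  have h₁ := hg.exch (hX i i)
  have h₂ := hg.exch (hX i j)
  have h₃ := hg.exch (hX j i)
  have k₁ := hx i i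
  have k₂ := hx i j
  rw [hii] at h₁ k₁
  rw [hij] at h₂ k₂
  rw [hji] at h₃
  rw [hg.xY_neg, hg.xY_neg] at k₂ ⊢
  rw [hg.xY_neg] at k₁
  push_cast at h₁ h₂ h₃ k₁ k₂
  rw [neg_neg] at k₂
  have hbb := hH.commute_iH_iH hg (-1 / 2) (-1 / 2) i i
  obtain ⟨G, hG, hG'⟩ := serreHalf_rho h₁ h₂ h₃ ((hg.bNull_Xc (-1) i).tsh g.kappa (-1))
    ((hg.bNull_Xc (-1) j).tsh g.kappa (-1)) hbb (hH.commute_iH_iH hg (-1 / 2) (-1 / 2) i j) k₁ k₂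
  have inj := rho3All_injective (hg.iH_mul_pH (-1 / 2) i) (hg.iH_mul_pH (-1 / 2) j)
  have step : (∀ m₁ m₂ n, serre (g.Xs i) (g.Xs j) m₁ m₂ n = 0) ↔
      ∀ m₁ m₂ n, serre (g.Xc (-1) i) (g.Xc (-1) j) m₁ m₂ n = 0 := by
    refine ⟨fun h => ?_, serre_Tsh (hg.commute_Xc (-1) i) (hg.commute_Xc (-1) j) (-1)⟩
    have := serre_Tsh (hg.commute_Xs i) (hg.commute_Xs j) 1 h
    rwa [Xs, Xs, Tsh_apply_neg, Tsh_apply_neg] at this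
  rw [← step, serre_eq_zero_iff, serre_eq_zero_iff, hG, map_add, add_add_add_comm, hG', add_zero,
    rho3All_swapV hbb, ← map_add]
  exact ⟨fun h => inj (h.trans (map_zero _).symm), fun h => by rw [h, map_zero]⟩

end Currents

end

end DoubleYangian

end

/-! ### Assembling the equivalences -/

namespace DoubleYangian

open Gens

variable {I W : Type*} [DecidableEq I] [AddCommGroup W] [Module ℂ⟦X⟧ W]
  {g : Gens I (Op W)} {A : Matrix I I ℤ}

theorem IsSimplyLacedGCM.symm {I : Type*} {A : Matrix I I ℤ} (hA : IsSimplyLacedGCM A) (i j : I) :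
    A i j = A j i := by
  rcases eq_or_ne i j with rfl | hij
  · rfl
  · have h₁ := hA.simplyLaced hij
    have h₂ := hA.simplyLaced hij.symm
    have h₃ := hA.zero_symm i j
    have h₄ := hA.zero_symm j i
    omega

theorem relator_eq_zero_iff : (∀ x, g.Relator A x → x = 0) ↔
    (∀ s i j, g.dy1 s i j = 0) ∧ (∀ i j, g.dy2 (A i j) i j = 0) ∧
    (∀ s i j, g.dy3 (A i j) s i j = 0) ∧ (∀ s i j, g.dy4 (A j i) s i j = 0) ∧
    (∀ i j, g.dy5 i j = 0) ∧ (∀ s i j, g.dy6 (A i j) s i j = 0) ∧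
    (∀ s i j, A i j = 0 → g.dy7 s i j = 0) ∧
    ∀ s i j, A i j = -1 → ∀ m₁ m₂ n, serre (g.Xc s i) (g.Xc s j) m₁ m₂ n = 0 := by
  constructor
  · exact fun h => ⟨fun s i j => funext₂ fun m n => h _ (.dy1 s i j m n),
      fun i j => funext₂ fun m n => h _ (.dy2 i j m n),
      fun s i j => funext₂ fun m n => h _ (.dy3 s i j m n),
      fun s i j => funext₂ fun m n => h _ (.dy4 s i j m n),
      fun i j => funext₂ fun m n => h _ (.dy5 i j m n),
      fun s i j => funext₂ fun m n => h _ (.dy6 s i j m n),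
      fun s i j h0 => funext₂ fun m n => h _ (.dy7 s i j m n h0),
      fun s i j h0 m₁ m₂ n => h _ (.dy8 s i j m₁ m₂ n h0)⟩
  · rintro ⟨h1, h2, h3, h4, h5, h6, h7, h8⟩ x hx
    rcases hx with (⟨s, i, j, m, n⟩ | ⟨i, j, m, n⟩ | ⟨s, i, j, m, n⟩ | ⟨s, i, j, m, n⟩ |
      ⟨i, j, m, n⟩ | ⟨s, i, j, m, n⟩ | ⟨s, i, j, m, n, h⟩ | ⟨s, i, j, m₁, m₂, n, h⟩)
    · rw [h1]; rfl
    · rw [h2]; rfl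
    · rw [h3]; rfl
    · rw [h4]; rfl
    · rw [h5]; rfl
    · rw [h6]; rfl
    · rw [h7 s i j h]; rfl
    · exact h8 s i j h m₁ m₂ n

/-- The individual equivalences depend on one another: those for `[h, x]` need the relations among
the `H_i^±`, and the quadratic and Serre relations for `x^-` also need the exchange of `H^+` with
`X^-`. Both directions therefore establish the relations in this order. -/
theorem Gens.IsGood.relators_iff_currentRelations [TopFree W] (hg : g.IsGood) (hA : IsSimplyLacedGCM A) :
    (∀ x, g.Relator A x → x = 0) ↔ g.CurrentRelations A := by
  have hS := hA.symm
  rw [relator_eq_zero_iff]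
  constructor
  · rintro ⟨h1, h2, h3, h4, h5, h6, h7, h8⟩
    have hH := hg.hRel hS h1 h2
    have hX : XRel A g := fun i j => h3 (-1) i j
    have hx := fun s i j => (hH.x_x_iff_dy hg hS hX s i j).2 (h6 s i j)
    exact
      { h_h := (hg.h_h_iff_dy hS).2 ⟨h1, h2⟩
        h_x := fun s i j => (hH.h_x_iff_dy hg hS s i j).2 ⟨h3 s i j, h4 s i j⟩
        x_x := hx
        x_x_zero := fun s i j h0 => (hH.x_x_zero_iff_dy hg hS hX s h0).2 (h7 s i j h0)
        -- The rational factor comes from moving `H_j^+` across `X_i^+`, which involves `A j i`;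
        -- symmetry of `A` identifies it with `A i j`.
        x_x_pm := fun i j => (hg.x_x_pm_iff_dy (by rw [hS i j]; exact h3 1 j i)).2 (h5 i j)
        serre := fun s i j h0 => (hH.serre_iff hg hX s (hA.diag i) h0 (hS i j ▸ h0) (hx s)).2
          (h8 s i j h0) }
  · intro h
    -- The relation `[h, h]` for all pairs comes first: it provides `HRel`, under which `[h, x]` can
    -- be translated, and this in turn provides `XRel`.
    obtain ⟨h1, h2⟩ := (hg.h_h_iff_dy hS).1 h.h_h
    have hH := hg.hRel hS h1 h2
    have h34 := fun s i j => (hH.h_x_iff_dy hg hS s i j).1 (h.h_x s i j)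
    have hX : XRel A g := fun i j => (h34 (-1) i j).1
    exact ⟨h1, h2, fun s i j => (h34 s i j).1, fun s i j => (h34 s i j).2,
      fun i j => (hg.x_x_pm_iff_dy (by rw [hS i j]; exact (h34 1 j i).1)).1 (h.x_x_pm i j),
      fun s i j => (hH.x_x_iff_dy hg hS hX s i j).1 (h.x_x s i j),
      fun s i j h0 => (hH.x_x_zero_iff_dy hg hS hX s h0).1 (h.x_x_zero s i j h0),
      fun s i j h0 => (hH.serre_iff hg hX s (hA.diag i) h0 (hS i j ▸ h0) (h.x_x s)).1
        (h.serre s i j h0)⟩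

end DoubleYangian

open DoubleYangian in
theorem theorem5p6 {I : Type*} [DecidableEq I] (A : Matrix I I ℤ) (hA : IsSimplyLacedGCM A)
    {W : Type*} [AddCommGroup W] [Module ℂ⟦X⟧ W]
    (π : (Atilde I)⟦X⟧ →ₐ[ℂ⟦X⟧] Module.End ℂ⟦X⟧ W)
    (g : Gens I (Module.End ℂ⟦X⟧ W)) (hg : g = (Atilde.gens I).map π)
    (hW : IsRestricted g) :
    (∀ i, g.Cc i = fmul (g.expG (-1) i) (g.expG 1 i) ∧ IsField (g.Cc i)) ∧
      (IsRestrictedDYModule A g ↔ g.CurrentRelations A) := by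
  subst hg
  have := hW.1.topFree
  have hg := Gens.isGood_map π hW
  exact ⟨fun i => ⟨hg.Cc_eq_expG i, hg.isField_Cc i⟩,
    (isRestrictedDYModule_iff A π hW).trans (hg.relators_iff_currentRelations hA)⟩
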